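/- **Setting.** Everything is unitary: fusion categories are unitary fusion categories over $\mathbb C$, tensor functors are $\mathbb C$-linear $*$-functors with unitary constraints, and all structure isomorphisms (associators, braidings, isomorphisms of group actions, equivariant structures) are unitary. Let $\mathcal B$ be a unitary braided fusion category (for example a unitary modular category), and let $G$ be a finite group with a normal subgroup $N$ and a subgroup $H$ such that $G=N\rtimes H$. A *unitary $G$-crossed braided extension* of $\mathcal B$ is a unitary fusion category $\mathcal C=\bigoplus_{g\in G}\mathcal C_g$ with a faithful $G$-grading, a unitary action $X\mapsto {}^gX$ of $G$ by tensor autoequivalences with ${}^g\mathcal C_{g'}\subset\mathcal C_{gg'g^{-1}}$, and a coherent unitary $G$-braiding $c_{X,Y}\colon X\otimes Y\to {}^gY\otimes X$ ($X\in\mathcal C_g$), together with a unitary braided equivalence $\mathcal B\simeq\mathcal C_1$. Let $\underline{\underline{\mathrm{Pic}}}(\mathcal B)$ be the unitary Picard 3-group, whose objects are the invertible unitary $\mathcal B$-module categories, with product $\boxtimes_{\mathcal B}$. A tri-homomorphism $\rho\colon \underline{\underline G}\to\underline{\underline{\mathrm{Pic}}}(\mathcal B)$ consists of invertible module categories $\rho(g)$,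 equivalences $\rho(g)\boxtimes_{\mathcal B}\rho(h)\simeq\rho(gh)$ and $\mathcal B\simeq\rho(1)$ of $\mathcal B$-module categories, and associativity and unit isomorphisms satisfying the pentagon and triangle axioms. An extension $\mathcal C$ *corresponds to* $\rho$ if there are unitary equivalences $\rho(g)\simeq\mathcal C_g$ carrying the $\mathcal B$-action, the products, the associativity and the unit isomorphisms of $\rho$ to those given by the tensor product of $\mathcal C$ (where $\mathcal B$-linearity of $\otimes$ in the second variable is given by the $G$-braiding with objects of $\mathcal B$). The *gauging* of $\mathcal B$ by $G$ along $\rho$ is the equivariantization $\mathcal C^G$ of an extension $\mathcal C$ corresponding to $\rho$, with the braiding $X\otimes Y\xrightarrow{c}{}^gY\otimes X\xrightarrow{\tau_g\otimes\mathrm{id}}Y\otimes X$ for $(X,\sigma),(Y,\tau)\in\mathcal C^G$ on the components of $X$ of degree $g$. **Theorem.** Let $\rho\colon \underline{\underline G}\to\underline{\underline{\mathrm{Pic}}}(\mathcal B)$ be a tri-homomorphism and let $\mathcal C=\bigoplus_{g\in G}\mathcal C_g$ be a unitary $G$-crossed braided extension of $\mathcal B$ corresponding to $\rho$. Then: 1.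 $\mathcal C_N:=\bigoplus_{n\in N}\mathcal C_n$, with the induced structure, is a unitary fusion category and a unitary $N$-crossed braided extension of $\mathcal B$, and it corresponds to $\rho_1:=\rho|_N$. Its equivariantization $(\mathcal C_N)^N$, the gauging of $\mathcal B$ by $N$ along $\rho_1$, is a unitary braided fusion category. 2. The equivariantization $\mathcal C^N$ is a unitary fusion category, and it is a unitary $H$-crossed braided extension of $(\mathcal C_N)^N$, as follows. An element $h\in H$ acts by $(X,\varphi)\mapsto({}^hX,{}^h\varphi_{h^{-1}\bullet h})$ and $f\mapsto{}^hf$. The component of degree $h$ consists of the $(X,\varphi)$ with $X\in\bigoplus_{n\in N}\mathcal C_{hn}$. For $(X,\varphi)$ of degree $h$ and any $(Y,\varphi')$, the $H$-braiding is, on the components of $X$ of degree $hn$, the composition $X\otimes Y\xrightarrow{c}{}^{hn}Y\otimes X\xrightarrow{{}^h\varphi'_n\otimes\mathrm{id}}{}^hY\otimes X$. The embedding $(\mathcal C_N)^N\to\mathcal C^N$ is, up to unitary monoidal isomorphism, the inclusion $(X,\varphi)\mapsto(X,\varphi)$. 3. There is a tri-homomorphism $\rho_2\colon\underline{\underline H}\to\underline{\underline{\mathrm{Pic}}}\big((\mathcal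 C_N)^N\big)$ to which the $H$-crossed braided extension $\mathcal C^N$ of $(\mathcal C_N)^N$ corresponds. 4. The gauging $(\mathcal C^N)^H$ of $(\mathcal C_N)^N$ by $H$ along $\rho_2$ and the gauging $\mathcal C^G$ of $\mathcal B$ by $G$ along $\rho$ are unitary braided fusion categories, and they are equivalent: there is a unitary braided tensor equivalence $F\colon(\mathcal C^N)^H\to\mathcal C^G$ which, up to unitary monoidal isomorphism, sends $((X,\varphi),\psi)$ to $(X,\tau)$ with $\tau_{nh}=\varphi_n\circ{}^n\psi_h$ for $n\in N$, $h\in H$, and a morphism $f$ to $f$. -/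

import Mathlib

open CategoryTheory MonoidalCategory
open scoped MonoidalLeftAction
open Functor.LaxMonoidal Functor.OplaxMonoidal

universe w₁ w₂ w₃ v₁ v₂ v₃ u₁ u₂ u₃ t

namespace SeqGauging

/-! ### Unitary (C*-) categories and unitary fusion categories -/

/-- An involutive contravariant endofunctor `dag` which is the identity on objects. -/
class DaggerCategory (C : Type u₁) [Category.{v₁} C] where
  dag {X Y : C} (f : X ⟶ Y) : Y ⟶ X
  dag_dag {X Y : C} (f : X ⟶ Y) : dag (dag f) = f
  dag_id (X : C) : dag (𝟙 X) = 𝟙 X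
  dag_comp {X Y Z : C} (f : X ⟶ Y) (g : Y ⟶ Z) : dag (f ≫ g) = dag g ≫ dag f

open DaggerCategory

attribute [simp] DaggerCategory.dag_dag DaggerCategory.dag_id DaggerCategory.dag_comp

section

variable {C : Type u₁} [Category.{v₁} C] [DaggerCategory C]

/-- A morphism `f` is unitary if `f† f` and `f f†` are identities. -/
structure IsUnitary {X Y : C} (f : X ⟶ Y) : Prop where
  hom_dag : f ≫ dag f = 𝟙 X
  dag_hom : dag f ≫ f = 𝟙 Y

namespace IsUnitary

theorem id (X : C) : IsUnitary (𝟙 X) := ⟨by simp, by simp⟩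

theorem comp {X Y Z : C} {f : X ⟶ Y} {g : Y ⟶ Z} (hf : IsUnitary f) (hg : IsUnitary g) :
    IsUnitary (f ≫ g) := by
  refine ⟨?_, ?_⟩
  · rw [dag_comp, Category.assoc, ← Category.assoc g, hg.hom_dag, Category.id_comp, hf.hom_dag]
  · rw [dag_comp, Category.assoc, ← Category.assoc (dag f), hf.dag_hom, Category.id_comp,
      hg.dag_hom]

theorem isIso {X Y : C} {f : X ⟶ Y} (hf : IsUnitary f) : IsIso f :=
  ⟨dag f, hf.hom_dag, hf.dag_hom⟩

theorem dag_eq_inv {X Y : C} (e : X ≅ Y) (h : IsUnitary e.hom) : dag e.hom = e.inv := by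
  rw [← cancel_epi e.hom, h.hom_dag, e.hom_inv_id]

theorem inv {X Y : C} (e : X ≅ Y) (h : IsUnitary e.hom) : IsUnitary e.inv := by
  rw [← dag_eq_inv e h]
  exact ⟨by simpa using h.dag_hom, by simpa using h.hom_dag⟩

end IsUnitary

end

/-- A positive complex `*`-structure: `dag` is antilinear, every `f† f` is a positive element of an
endomorphism algebra, and `f† f = 0` implies `f = 0`. For categories with finite-dimensional
morphism spaces this is the same as a C*-structure. -/
class CStarCategory (C : Type u₁) [Category.{v₁} C] [Preadditive C] [Linear ℂ C]
    [DaggerCategory C] : Prop where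
  dag_add {X Y : C} (f g : X ⟶ Y) : dag (f + g) = dag f + dag g
  dag_smul {X Y : C} (c : ℂ) (f : X ⟶ Y) : dag (c • f) = starRingEnd ℂ c • dag f
  comp_dag_positive {X Y : C} (f : X ⟶ Y) : ∃ a : X ⟶ X, f ≫ dag f = a ≫ dag a
  eq_zero_of_comp_dag {X Y : C} (f : X ⟶ Y) : f ≫ dag f = 0 → f = 0

/-- The data exhibiting `X` as the direct sum of a finite family `Y`. -/
structure DirectSum {C : Type u₁} [Category.{v₁} C] [Preadditive C] {ι : Type} [Fintype ι]
    (Y : ι → C) (X : C) where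
  incl (i : ι) : Y i ⟶ X
  proj (i : ι) : X ⟶ Y i
  incl_proj_self (i : ι) : incl i ≫ proj i = 𝟙 (Y i)
  incl_proj_ne (i j : ι) : i ≠ j → incl i ≫ proj j = 0
  total : ∑ i, proj i ≫ incl i = 𝟙 X

/-- Finite semisimple `ℂ`-linear abelian categories. -/
class IsFiniteSemisimple (C : Type u₁) [Category.{v₁} C] [Preadditive C] [Linear ℂ C] :
    Prop where
  hasFiniteProducts : Limits.HasFiniteProducts C
  hasKernels : Limits.HasKernels C
  hasCokernels : Limits.HasCokernels C
  normalMono : IsNormalMonoCategory C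
  normalEpi : IsNormalEpiCategory C
  finite_hom (X Y : C) : Module.Finite ℂ (X ⟶ Y)
  semisimple (X : C) : ∃ (ι : Type) (_ : Fintype ι) (S : ι → C),
    (∀ i, Simple (S i)) ∧ Nonempty (DirectSum S X)
  finite_simples : ∃ (n : ℕ) (S : Fin n → C), ∀ X : C, Simple X → ∃ i, Nonempty (X ≅ S i)

/-- The tensor product is a `*`-functor and the constraints are unitary. -/
class UnitaryMonoidal (C : Type u₁) [Category.{v₁} C] [MonoidalCategory C]
    [DaggerCategory C] : Prop where
  dag_tensorHom {X Y X' Y' : C} (f : X ⟶ Y) (g : X' ⟶ Y') :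
    dag (f ⊗ₘ g) = dag f ⊗ₘ dag g
  associator_unitary (X Y Z : C) : IsUnitary (α_ X Y Z).hom
  leftUnitor_unitary (X : C) : IsUnitary (λ_ X).hom
  rightUnitor_unitary (X : C) : IsUnitary (ρ_ X).hom

/-- Unitary fusion categories (over `ℂ`). -/
class UnitaryFusionCategory (C : Type u₁) [Category.{v₁} C] [Preadditive C] [Linear ℂ C]
    [MonoidalCategory C] [DaggerCategory C] : Prop extends
    MonoidalPreadditive C, MonoidalLinear ℂ C, CStarCategory C, IsFiniteSemisimple C,
    UnitaryMonoidal C where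
  simple_unit : Simple (𝟙_ C)
  rigid (X : C) : Nonempty (HasLeftDual X) ∧ Nonempty (HasRightDual X)

/-- A braiding is unitary if all its components are. -/
class UnitaryBraided (C : Type u₁) [Category.{v₁} C] [MonoidalCategory C] [DaggerCategory C]
    [BraidedCategory C] : Prop where
  braiding_unitary (X Y : C) : IsUnitary (β_ X Y).hom

/-- `ℂ`-linear `*`-functors. -/
structure IsUnitaryFunctor {C : Type u₁} [Category.{v₁} C] [Preadditive C] [Linear ℂ C]
    [DaggerCategory C] {D : Type u₂} [Category.{v₂} D] [Preadditive D] [Linear ℂ D]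
    [DaggerCategory D] (F : C ⥤ D) : Prop where
  map_add {X Y : C} (f g : X ⟶ Y) : F.map (f + g) = F.map f + F.map g
  map_smul {X Y : C} (c : ℂ) (f : X ⟶ Y) : F.map (c • f) = c • F.map f
  map_dag {X Y : C} (f : X ⟶ Y) : F.map (dag f) = dag (F.map f)

/-- Unitary tensor functors: `ℂ`-linear `*`-functors with unitary monoidal constraints. -/
structure IsUnitaryTensorFunctor {C : Type u₁} [Category.{v₁} C] [Preadditive C] [Linear ℂ C]
    [MonoidalCategory C] [DaggerCategory C] {D : Type u₂} [Category.{v₂} D] [Preadditive D]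
    [Linear ℂ D] [MonoidalCategory D] [DaggerCategory D] (F : C ⥤ D) [F.Monoidal] : Prop
    extends IsUnitaryFunctor F where
  μ_unitary (X Y : C) : IsUnitary (μ F X Y)
  ε_unitary : IsUnitary (ε F)

/-! ### Full subcategories -/

section

variable {C : Type u₁} [Category.{v₁} C] [DaggerCategory C]

instance (P : ObjectProperty C) : DaggerCategory P.FullSubcategory where
  dag f := ObjectProperty.homMk (dag f.hom)
  dag_dag f := by ext; simp
  dag_id X := by ext; simp
  dag_comp f g := by ext; simp

@[simp] theorem full_dag_hom (P : ObjectProperty C) {X Y : P.FullSubcategory} (f : X ⟶ Y) :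
    (dag f).hom = dag f.hom := rfl

theorem isUnitary_full (P : ObjectProperty C) {X Y : P.FullSubcategory} {f : X ⟶ Y} :
    IsUnitary f ↔ IsUnitary f.hom := by
  constructor
  · intro h
    exact ⟨congrArg (fun k => k.hom) h.hom_dag, congrArg (fun k => k.hom) h.dag_hom⟩
  · intro h
    exact ⟨by ext; exact h.hom_dag, by ext; exact h.dag_hom⟩

instance (P : ObjectProperty C) [MonoidalCategory C] [UnitaryMonoidal C] [P.IsMonoidal] :
    UnitaryMonoidal P.FullSubcategory where
  dag_tensorHom f g := by
    ext; exact UnitaryMonoidal.dag_tensorHom f.hom g.hom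
  associator_unitary X Y Z := (isUnitary_full P).2 (UnitaryMonoidal.associator_unitary _ _ _)
  leftUnitor_unitary X := (isUnitary_full P).2 (UnitaryMonoidal.leftUnitor_unitary _)
  rightUnitor_unitary X := (isUnitary_full P).2 (UnitaryMonoidal.rightUnitor_unitary _)

theorem IsUnitary.tensor [MonoidalCategory C] [UnitaryMonoidal C] {X Y X' Y' : C} {f : X ⟶ Y}
    {g : X' ⟶ Y'} (hf : IsUnitary f) (hg : IsUnitary g) : IsUnitary (f ⊗ₘ g) := by
  constructor
  · rw [UnitaryMonoidal.dag_tensorHom, tensorHom_comp_tensorHom, hf.hom_dag, hg.hom_dag,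
      id_tensorHom_id]
  · rw [UnitaryMonoidal.dag_tensorHom, tensorHom_comp_tensorHom, hf.dag_hom, hg.dag_hom,
      id_tensorHom_id]

end

/-- The lift of a monoidal functor to a full monoidal subcategory. -/
@[reducible]
def liftMonoidal {C : Type u₁} [Category.{v₁} C] [MonoidalCategory C] {D : Type u₂}
    [Category.{v₂} D] [MonoidalCategory D] (P : ObjectProperty C) [P.IsMonoidal] (F : D ⥤ C)
    [F.Monoidal] (hF : ∀ X, P (F.obj X)) : (P.lift F hF).Monoidal :=
  Functor.CoreMonoidal.toMonoidal
    { εIso := P.isoMk (Functor.Monoidal.εIso F)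
      μIso X Y := P.isoMk (Functor.Monoidal.μIso F X Y)
      μIso_hom_natural_left f X := by ext; exact μ_natural_left F f X
      μIso_hom_natural_right X f := by ext; exact μ_natural_right F X f
      associativity X Y Z := by ext; exact Functor.LaxMonoidal.associativity F X Y Z
      left_unitality X := by ext; exact Functor.LaxMonoidal.left_unitality F X
      right_unitality X := by ext; exact Functor.LaxMonoidal.right_unitality F X }

/-- The restriction of a monoidal endofunctor to a stable full monoidal subcategory. -/
@[reducible]
def restrictMonoidal {C : Type u₁} [Category.{v₁} C] [MonoidalCategory C]
    (P : ObjectProperty C) [P.IsMonoidal] (F : C ⥤ C)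
    [F.Monoidal] (hF : ∀ X : P.FullSubcategory, P (F.obj X.obj)) :
    (P.lift (P.ι ⋙ F) hF).Monoidal :=
  Functor.CoreMonoidal.toMonoidal
    { εIso := P.isoMk (Functor.Monoidal.εIso F)
      μIso X Y := P.isoMk (Functor.Monoidal.μIso F X.obj Y.obj)
      μIso_hom_natural_left f X := by ext; exact μ_natural_left F f.hom X.obj
      μIso_hom_natural_right X f := by ext; exact μ_natural_right F X.obj f.hom
      associativity X Y Z := by
        ext; exact Functor.LaxMonoidal.associativity F X.obj Y.obj Z.obj
      left_unitality X := by ext; exact Functor.LaxMonoidal.left_unitality F X.obj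
      right_unitality X := by ext; exact Functor.LaxMonoidal.right_unitality F X.obj }

/-! ### Unitary actions of a group by tensor autoequivalences -/

/-- A unitary action of a group `G` on `C`, i.e. a monoidal functor from the discrete monoidal
category `G` to unitary tensor autoequivalences and unitary tensor isomorphisms. The isomorphisms
`mul` and `one` are indexed by equations in `G` in order to avoid transports. -/
structure UnitaryAction (G : Type t) [Group G] (C : Type u₁) [Category.{v₁} C] [Preadditive C]
    [Linear ℂ C] [MonoidalCategory C] [DaggerCategory C] where
  act : G → C ⥤ C
  [monoidal (g : G) : (act g).Monoidal]
  unitary (g : G) : IsUnitaryTensorFunctor (act g)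
  mul {g h k : G} (e : g * h = k) : act h ⋙ act g ≅ act k
  one {o : G} (e : o = 1) : 𝟭 C ≅ act o
  mul_monoidal {g h k : G} (e : g * h = k) : NatTrans.IsMonoidal (mul e).hom
  one_monoidal {o : G} (e : o = 1) : NatTrans.IsMonoidal (one e).hom
  mul_unitary {g h k : G} (e : g * h = k) (X : C) : IsUnitary ((mul e).hom.app X)
  one_unitary {o : G} (e : o = 1) (X : C) : IsUnitary ((one e).hom.app X)
  mul_mul {g h k gh hk ghk : G} (e₁ : g * h = gh) (e₂ : h * k = hk) (e₃ : gh * k = ghk)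
    (e₄ : g * hk = ghk) (X : C) :
    (act g).map ((mul e₂).hom.app X) ≫ (mul e₄).hom.app X =
      (mul e₁).hom.app ((act k).obj X) ≫ (mul e₃).hom.app X
  one_mul_left {o g : G} (e : o = 1) (e' : o * g = g) (X : C) :
    (one e).hom.app ((act g).obj X) ≫ (mul e').hom.app X = 𝟙 _
  mul_one_right {o g : G} (e : o = 1) (e' : g * o = g) (X : C) :
    (act g).map ((one e).hom.app X) ≫ (mul e').hom.app X = 𝟙 _

attribute [instance] UnitaryAction.monoidal

variable {G : Type t} [Group G] {C : Type u₁} [Category.{v₁} C] [Preadditive C]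
    [Linear ℂ C] [MonoidalCategory C] [DaggerCategory C]

/-- Restriction of an action along a group homomorphism. -/
abbrev UnitaryAction.comp (A : UnitaryAction G C) {K : Type w₁} [Group K] (f : K →* G) :
    UnitaryAction K C where
  act k := A.act (f k)
  unitary k := A.unitary (f k)
  mul e := A.mul (by rw [← map_mul, e])
  one e := A.one (by rw [e, map_one])
  mul_monoidal e := A.mul_monoidal _
  one_monoidal e := A.one_monoidal _
  mul_unitary e X := A.mul_unitary _ X
  one_unitary e X := A.one_unitary _ X
  mul_mul e₁ e₂ e₃ e₄ X := A.mul_mul _ _ _ _ X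
  one_mul_left e e' X := A.one_mul_left _ _ X
  mul_one_right e e' X := A.mul_one_right _ _ X

/-- Restriction of an action to a stable full monoidal subcategory. -/
def UnitaryAction.onFull (A : UnitaryAction G C) (P : ObjectProperty C) [P.IsMonoidal]
    (hP : ∀ g X, P X → P ((A.act g).obj X)) : UnitaryAction G P.FullSubcategory where
  act g := P.lift (P.ι ⋙ A.act g) (fun X => hP g _ X.property)
  monoidal g := restrictMonoidal P (A.act g) (fun X => hP g _ X.property)
  unitary g :=
    letI := restrictMonoidal P (A.act g) (fun X => hP g _ X.property)
    { map_add f f' := by ext; exact (A.unitary g).map_add f.hom f'.hom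
      map_smul c f := by ext; exact (A.unitary g).map_smul c f.hom
      map_dag f := by ext; exact (A.unitary g).map_dag f.hom
      μ_unitary X Y := (isUnitary_full P).2 ((A.unitary g).μ_unitary X.obj Y.obj)
      ε_unitary := (isUnitary_full P).2 (A.unitary g).ε_unitary }
  mul {g h k} e := NatIso.ofComponents (fun X => P.isoMk ((A.mul e).app X.obj)) (by
    intro X Y f; ext; exact (A.mul e).hom.naturality f.hom)
  one e := NatIso.ofComponents (fun X => P.isoMk ((A.one e).app X.obj)) (by
    intro X Y f; ext; exact (A.one e).hom.naturality f.hom)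
  mul_monoidal {g h k} e :=
    letI := fun g => restrictMonoidal P (A.act g) (fun X => hP g _ X.property)
    { unit := by ext; exact (A.mul_monoidal e).unit
      tensor X Y := by ext; exact (A.mul_monoidal e).tensor X.obj Y.obj }
  one_monoidal {o} e :=
    letI := fun g => restrictMonoidal P (A.act g) (fun X => hP g _ X.property)
    { unit := by ext; exact (A.one_monoidal e).unit
      tensor X Y := by ext; exact (A.one_monoidal e).tensor X.obj Y.obj }
  mul_unitary e X := (isUnitary_full P).2 (A.mul_unitary e X.obj)
  one_unitary e X := (isUnitary_full P).2 (A.one_unitary e X.obj)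
  mul_mul e₁ e₂ e₃ e₄ X := by ext; exact A.mul_mul e₁ e₂ e₃ e₄ X.obj
  one_mul_left e e' X := by ext; exact A.one_mul_left e e' X.obj
  mul_one_right e e' X := by ext; exact A.mul_one_right e e' X.obj


/-! ### Equivariantization -/

/-- Objects of the equivariantization: objects of `C` with compatible unitary isomorphisms
`str g : g(X) ⟶ X`. -/
structure Equivariant (A : UnitaryAction G C) where
  obj : C
  str (g : G) : (A.act g).obj obj ⟶ obj
  str_unitary (g : G) : IsUnitary (str g)
  str_mul {g h k : G} (e : g * h = k) :
    (A.mul e).hom.app obj ≫ str k = (A.act g).map (str h) ≫ str g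

namespace Equivariant

variable {A : UnitaryAction G C}

/-- Equivariant morphisms. -/
@[ext]
structure Hom (X Y : Equivariant A) where
  hom : X.obj ⟶ Y.obj
  comm (g : G) : (A.act g).map hom ≫ Y.str g = X.str g ≫ hom

instance : Category (Equivariant A) where
  Hom := Hom
  id X := ⟨𝟙 X.obj, by simp⟩
  comp f f' := ⟨f.hom ≫ f'.hom, fun g => by
    rw [Functor.map_comp, Category.assoc, f'.comm, ← Category.assoc, f.comm, Category.assoc]⟩

@[ext] theorem hom_ext {X Y : Equivariant A} {f f' : X ⟶ Y} (h : f.hom = f'.hom) : f = f' :=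
  Hom.ext h

@[simp] theorem id_hom (X : Equivariant A) : Hom.hom (𝟙 X) = 𝟙 X.obj := rfl
@[simp] theorem comp_hom {X Y Z : Equivariant A} (f : X ⟶ Y) (f' : Y ⟶ Z) :
    (f ≫ f').hom = f.hom ≫ f'.hom := rfl

/-- Isomorphisms of equivariant objects from isomorphisms of the underlying objects. -/
@[simps]
def isoMk {X Y : Equivariant A} (e : X.obj ≅ Y.obj)
    (h : ∀ g, (A.act g).map e.hom ≫ Y.str g = X.str g ≫ e.hom) : X ≅ Y where
  hom := ⟨e.hom, h⟩
  inv := ⟨e.inv, fun g => by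
    rw [← cancel_epi ((A.act g).map e.hom), ← Category.assoc, ← Functor.map_comp, e.hom_inv_id,
      ← Category.assoc, h]
    simp⟩

variable (A) in
/-- The forgetful functor from the equivariantization. -/
def forget : Equivariant A ⥤ C where
  obj X := X.obj
  map f := f.hom

@[simp] theorem forget_obj (X : Equivariant A) : (forget A).obj X = X.obj := rfl
@[simp] theorem forget_map {X Y : Equivariant A} (f : X ⟶ Y) : (forget A).map f = f.hom := rfl

instance : (forget A).Faithful where
  map_injective h := hom_ext h

theorem map_zero' (g : G) (X Y : C) : (A.act g).map (0 : X ⟶ Y) = 0 := by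
  simpa using (A.unitary g).map_smul 0 (0 : X ⟶ Y)

theorem map_neg' (g : G) {X Y : C} (f : X ⟶ Y) : (A.act g).map (-f) = -(A.act g).map f := by
  simpa using (A.unitary g).map_smul (-1) f

theorem map_sub' (g : G) {X Y : C} (f f' : X ⟶ Y) :
    (A.act g).map (f - f') = (A.act g).map f - (A.act g).map f' := by
  rw [sub_eq_add_neg, (A.unitary g).map_add, map_neg', sub_eq_add_neg]

section

variable (X Y : Equivariant A)

instance : Zero (X ⟶ Y) := ⟨⟨0, by simp [map_zero']⟩⟩
instance : Add (X ⟶ Y) := ⟨fun f f' => ⟨f.hom + f'.hom, fun g => by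
  rw [(A.unitary g).map_add, Preadditive.add_comp, Preadditive.comp_add, f.comm, f'.comm]⟩⟩
instance : Neg (X ⟶ Y) := ⟨fun f => ⟨-f.hom, fun g => by
  rw [map_neg', Preadditive.neg_comp, Preadditive.comp_neg, f.comm]⟩⟩
instance : Sub (X ⟶ Y) := ⟨fun f f' => ⟨f.hom - f'.hom, fun g => by
  rw [map_sub', Preadditive.sub_comp, Preadditive.comp_sub, f.comm, f'.comm]⟩⟩

theorem map_smul_of {R : Type} [SMul R ℂ] [∀ X Y : C, SMul R (X ⟶ Y)]
    [∀ X Y : C, IsScalarTower R ℂ (X ⟶ Y)] (r : R) (g : G) {X Y : C} (f : X ⟶ Y) :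
    (A.act g).map (r • f) = r • (A.act g).map f := by
  have h (X Y : C) (f : X ⟶ Y) : r • f = (r • (1 : ℂ)) • f := by simp
  rw [h, (A.unitary g).map_smul, ← h]

instance : SMul ℂ (X ⟶ Y) := ⟨fun c f => ⟨c • f.hom, fun g => by
  rw [(A.unitary g).map_smul, Linear.smul_comp, Linear.comp_smul, f.comm]⟩⟩
instance : SMul ℕ (X ⟶ Y) := ⟨fun n f => ⟨n • f.hom, fun g => by
  rw [map_smul_of, Preadditive.nsmul_comp, Preadditive.comp_nsmul, f.comm]⟩⟩
instance : SMul ℤ (X ⟶ Y) := ⟨fun n f => ⟨n • f.hom, fun g => by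
  rw [map_smul_of, Preadditive.zsmul_comp, Preadditive.comp_zsmul, f.comm]⟩⟩

theorem hom_injective : Function.Injective (fun f : X ⟶ Y => f.hom) := fun _ _ h => hom_ext h

instance : AddCommGroup (X ⟶ Y) :=
  (hom_injective X Y).addCommGroup _ rfl (fun _ _ => rfl) (fun _ => rfl) (fun _ _ => rfl)
    (fun _ _ => rfl) (fun _ _ => rfl)

instance : Module ℂ (X ⟶ Y) :=
  (hom_injective X Y).module ℂ ⟨⟨fun f => f.hom, rfl⟩, fun _ _ => rfl⟩ (fun _ _ => rfl)

end

instance : Preadditive (Equivariant A) where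
  add_comp _ _ _ f f' k := hom_ext (Preadditive.add_comp _ _ _ f.hom f'.hom k.hom)
  comp_add _ _ _ f k k' := hom_ext (Preadditive.comp_add _ _ _ f.hom k.hom k'.hom)

instance : Linear ℂ (Equivariant A) where
  smul_comp _ _ _ c f k := hom_ext (Linear.smul_comp _ _ _ c f.hom k.hom)
  comp_smul _ _ _ f c k := hom_ext (Linear.comp_smul _ _ _ f.hom c k.hom)

instance : DaggerCategory (Equivariant A) where
  dag {X Y} f := ⟨dag f.hom, fun g => by
    have h := congrArg dag (f.comm g)
    rw [dag_comp, dag_comp, ← (A.unitary g).map_dag] at h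
    have h' := congrArg (fun k => Y.str g ≫ k ≫ X.str g) h
    simp only [Category.assoc, (X.str_unitary g).dag_hom, Category.comp_id] at h'
    rw [← h', ← Category.assoc (Y.str g), (Y.str_unitary g).hom_dag, Category.id_comp]⟩
  dag_dag f := hom_ext (dag_dag f.hom)
  dag_id X := hom_ext (dag_id X.obj)
  dag_comp f f' := hom_ext (dag_comp f.hom f'.hom)

@[simp] theorem dag_hom' {X Y : Equivariant A} (f : X ⟶ Y) : (dag f).hom = dag f.hom := rfl

theorem isUnitary_iff {X Y : Equivariant A} {f : X ⟶ Y} : IsUnitary f ↔ IsUnitary f.hom :=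
  ⟨fun h => ⟨congrArg Hom.hom h.hom_dag, congrArg Hom.hom h.dag_hom⟩,
    fun h => ⟨hom_ext h.hom_dag, hom_ext h.dag_hom⟩⟩

end Equivariant

section

variable (A : UnitaryAction G C)

theorem UnitaryAction.δ_unitary (g : G) (X Y : C) : IsUnitary (δ (A.act g) X Y) :=
  IsUnitary.inv (Functor.Monoidal.μIso (A.act g) X Y) ((A.unitary g).μ_unitary X Y)

theorem UnitaryAction.η_unitary (g : G) : IsUnitary (η (A.act g)) :=
  IsUnitary.inv (Functor.Monoidal.εIso (A.act g)) (A.unitary g).ε_unitary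

theorem UnitaryAction.mul_tensor {g h k : G} (e : g * h = k) (X Y : C) :
    μ (A.act g) ((A.act h).obj X) ((A.act h).obj Y) ≫ (A.act g).map (μ (A.act h) X Y) ≫
      (A.mul e).hom.app (X ⊗ Y) =
    ((A.mul e).hom.app X ⊗ₘ (A.mul e).hom.app Y) ≫ μ (A.act k) X Y := by
  have := A.mul_monoidal e
  simpa using NatTrans.IsMonoidal.tensor (τ := (A.mul e).hom) X Y

theorem UnitaryAction.mul_tensor' {g h k : G} (e : g * h = k) (X Y : C) :
    (A.mul e).hom.app (X ⊗ Y) ≫ δ (A.act k) X Y =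
      (A.act g).map (δ (A.act h) X Y) ≫ δ (A.act g) _ _ ≫
        ((A.mul e).hom.app X ⊗ₘ (A.mul e).hom.app Y) := by
  have H := A.mul_tensor e X Y
  rw [← cancel_epi ((A.act g).map (μ (A.act h) X Y)), ← cancel_epi (μ (A.act g) _ _)]
  have H' := congrArg (fun q => q ≫ δ (A.act k) X Y) H
  simp only [Category.assoc] at H'
  rw [H', Functor.Monoidal.μ_δ, Category.comp_id,
    ← Category.assoc ((A.act g).map (μ (A.act h) X Y)), ← Functor.map_comp,
    Functor.Monoidal.μ_δ, CategoryTheory.Functor.map_id, Category.id_comp,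
    ← Category.assoc (μ (A.act g) _ _), Functor.Monoidal.μ_δ, Category.id_comp]

theorem UnitaryAction.mul_unit {g h k : G} (e : g * h = k) :
    ε (A.act g) ≫ (A.act g).map (ε (A.act h)) ≫ (A.mul e).hom.app (𝟙_ C) = ε (A.act k) := by
  have := A.mul_monoidal e
  simpa using NatTrans.IsMonoidal.unit (τ := (A.mul e).hom)

theorem UnitaryAction.mul_unit' {g h k : G} (e : g * h = k) :
    (A.mul e).hom.app (𝟙_ C) ≫ η (A.act k) = (A.act g).map (η (A.act h)) ≫ η (A.act g) := by
  have H := A.mul_unit e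
  rw [← cancel_epi ((A.act g).map (ε (A.act h))), ← cancel_epi (ε (A.act g)),
    (by simpa only [Category.assoc] using congrArg (fun q => q ≫ η (A.act k)) H :
      ε (A.act g) ≫ (A.act g).map (ε (A.act h)) ≫ (A.mul e).hom.app (𝟙_ C) ≫ η (A.act k) =
        ε (A.act k) ≫ η (A.act k)),
    Functor.Monoidal.ε_η, ← Category.assoc ((A.act g).map (ε (A.act h))), ← Functor.map_comp,
    Functor.Monoidal.ε_η, CategoryTheory.Functor.map_id, Category.id_comp, Functor.Monoidal.ε_η]

end

namespace Equivariant

variable {A : UnitaryAction G C} [UnitaryMonoidal C]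

/-- The tensor product `(X, f) ⊗ (Y, f') = (X ⊗ Y, (f_g ⊗ f'_g) ψ(g)⁻¹)` and the unit object of
the equivariantization. -/
instance : MonoidalCategoryStruct (Equivariant A) where
  tensorObj X Y :=
    { obj := X.obj ⊗ Y.obj
      str g := δ (A.act g) X.obj Y.obj ≫ (X.str g ⊗ₘ Y.str g)
      str_unitary g := (A.δ_unitary g _ _).comp ((X.str_unitary g).tensor (Y.str_unitary g))
      str_mul {g h k} e := by
        rw [← Category.assoc, A.mul_tensor' e, Category.assoc, Category.assoc,
          tensorHom_comp_tensorHom, X.str_mul e, Y.str_mul e, Functor.map_comp, Category.assoc,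
          ← δ_natural_assoc, tensorHom_comp_tensorHom] }
  tensorUnit :=
    { obj := 𝟙_ C
      str g := η (A.act g)
      str_unitary g := A.η_unitary g
      str_mul e := A.mul_unit' e }
  tensorHom f f' := ⟨f.hom ⊗ₘ f'.hom, fun g => by
    rw [← δ_natural_assoc, tensorHom_comp_tensorHom, f.comm, f'.comm, Category.assoc,
      tensorHom_comp_tensorHom]⟩
  whiskerLeft X _ _ f := ⟨X.obj ◁ f.hom, fun g => by
    rw [← id_tensorHom, ← δ_natural_assoc, tensorHom_comp_tensorHom, f.comm, Category.assoc,
      tensorHom_comp_tensorHom]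
    simp⟩
  whiskerRight f X := ⟨f.hom ▷ X.obj, fun g => by
    rw [← tensorHom_id, ← δ_natural_assoc, tensorHom_comp_tensorHom, f.comm, Category.assoc,
      tensorHom_comp_tensorHom]
    simp⟩
  associator X Y Z := isoMk (α_ X.obj Y.obj Z.obj) (fun g => by
    have h₁ : (X.str g ⊗ₘ δ (A.act g) Y.obj Z.obj ≫ (Y.str g ⊗ₘ Z.str g)) =
        _ ◁ δ (A.act g) Y.obj Z.obj ≫ (X.str g ⊗ₘ (Y.str g ⊗ₘ Z.str g)) := by
      rw [← id_tensorHom, tensorHom_comp_tensorHom, Category.id_comp]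
    have h₂ : (δ (A.act g) X.obj Y.obj ≫ (X.str g ⊗ₘ Y.str g) ⊗ₘ Z.str g) =
        δ (A.act g) X.obj Y.obj ▷ _ ≫ ((X.str g ⊗ₘ Y.str g) ⊗ₘ Z.str g) := by
      rw [← tensorHom_id, tensorHom_comp_tensorHom, Category.id_comp]
    dsimp only
    rw [h₁, h₂, Category.assoc, Category.assoc, associator_naturality]
    simpa only [Category.assoc] using congrArg (fun q => q ≫ (X.str g ⊗ₘ Y.str g ⊗ₘ Z.str g))
      (oplax_associativity (A.act g) X.obj Y.obj Z.obj).symm)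
  leftUnitor X := isoMk (λ_ X.obj) (fun g => by
    dsimp only
    rw [Functor.Monoidal.map_leftUnitor, Category.assoc, Category.assoc, Category.assoc,
      MonoidalCategory.tensorHom_def, Category.assoc, leftUnitor_naturality])
  rightUnitor X := isoMk (ρ_ X.obj) (fun g => by
    dsimp only
    rw [Functor.Monoidal.map_rightUnitor, Category.assoc, Category.assoc, Category.assoc,
      tensorHom_def', Category.assoc, rightUnitor_naturality])

section

variable {X Y Z W : Equivariant A} (f : X ⟶ Y) (f' : Z ⟶ W)

@[simp] theorem tensorObj_obj : (X ⊗ Y).obj = X.obj ⊗ Y.obj := rfl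
@[simp] theorem tensorObj_str (g : G) :
    (X ⊗ Y).str g = δ (A.act g) X.obj Y.obj ≫ (X.str g ⊗ₘ Y.str g) := rfl
@[simp] theorem tensorUnit_obj : (𝟙_ (Equivariant A)).obj = 𝟙_ C := rfl
@[simp] theorem tensorUnit_str (g : G) : (𝟙_ (Equivariant A)).str g = η (A.act g) := rfl
@[simp] theorem tensorHom_hom : (f ⊗ₘ f').hom = f.hom ⊗ₘ f'.hom := rfl
@[simp] theorem whiskerLeft_hom : (Z ◁ f).hom = Z.obj ◁ f.hom := rfl
@[simp] theorem whiskerRight_hom : (f ▷ Z).hom = f.hom ▷ Z.obj := rfl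
@[simp] theorem associator_hom : (α_ X Y Z).hom.hom = (α_ X.obj Y.obj Z.obj).hom := rfl
@[simp] theorem leftUnitor_hom : (λ_ X).hom.hom = (λ_ X.obj).hom := rfl
@[simp] theorem rightUnitor_hom : (ρ_ X).hom.hom = (ρ_ X.obj).hom := rfl

end

instance : MonoidalCategory (Equivariant A) :=
  Monoidal.induced (forget A)
    { μIso _ _ := Iso.refl _
      εIso := Iso.refl _
      whiskerLeft_eq _ _ _ _ := (Category.id_comp _).symm.trans (by simp)
      whiskerRight_eq _ _ := (Category.id_comp _).symm.trans (by simp)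
      tensorHom_eq _ _ := (Category.id_comp _).symm.trans (by simp)
      associator_eq _ _ _ := by simp
      leftUnitor_eq _ := by simp
      rightUnitor_eq _ := by simp }

instance : (forget A).Monoidal :=
  Functor.CoreMonoidal.toMonoidal
    { εIso := Iso.refl _
      μIso := fun _ _ ↦ Iso.refl _ }

end Equivariant

/-! ### The residual action on the equivariantization by a normal subgroup -/

section

variable (A : UnitaryAction G C)

/-- The isomorphism `a(g(X)) ≅ g(b(X))` for `a g = g b`. -/
def UnitaryAction.swap {a b g : G} (e : a * g = g * b) :
    A.act g ⋙ A.act a ≅ A.act b ⋙ A.act g :=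
  A.mul rfl ≪≫ (A.mul e.symm).symm

theorem UnitaryAction.swap_comp {a b g k : G} (e : a * g = g * b) (e' : a * g = k)
    (e'' : g * b = k) (X : C) :
    (A.swap e).hom.app X ≫ (A.mul e'').hom.app X = (A.mul e').hom.app X := by
  subst e'
  simp [UnitaryAction.swap]

theorem UnitaryAction.swap_mul {a b a' b' a'' b'' g : G} (e : a * g = g * b)
    (e' : a' * g = g * b') (ha : a * a' = a'') (hb : b * b' = b'') (e'' : a'' * g = g * b'')
    (X : C) :
    (A.mul ha).hom.app ((A.act g).obj X) ≫ (A.swap e'').hom.app X =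
      (A.act a).map ((A.swap e').hom.app X) ≫ (A.swap e).hom.app ((A.act b').obj X) ≫
        (A.act g).map ((A.mul hb).hom.app X) := by
  have k₁ : g * b'' = a'' * g := e''.symm
  have k₂ : g * b * b' = a'' * g := by rw [mul_assoc, hb, k₁]
  have k₃ : a * (a' * g) = a'' * g := by rw [← mul_assoc, ha]
  rw [← cancel_mono ((A.mul k₁).hom.app X)]
  simp only [Category.assoc]
  rw [A.swap_comp e'' rfl k₁, A.mul_mul rfl hb k₂ k₁, ← Category.assoc ((A.swap e).hom.app _),
    A.swap_comp e e rfl, ← A.mul_mul e e'.symm k₂ k₃, ← Category.assoc ((A.act a).map _),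
    ← Functor.map_comp, A.swap_comp e' rfl e'.symm, A.mul_mul ha rfl rfl k₃]

theorem UnitaryAction.swap_trans {a b c g h k : G} (e : a * g = g * b) (e' : b * h = h * c)
    (hk : g * h = k) (e'' : a * k = k * c) (X : C) :
    (A.act a).map ((A.mul hk).hom.app X) ≫ (A.swap e'').hom.app X =
      (A.swap e).hom.app ((A.act h).obj X) ≫ (A.act g).map ((A.swap e').hom.app X) ≫
        (A.mul hk).hom.app ((A.act c).obj X) := by
  have k₁ : k * c = a * k := e''.symm
  have k₂ : g * (h * c) = a * k := by rw [← mul_assoc, hk, k₁]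
  have k₃ : g * b * h = a * k := by rw [← e, mul_assoc, hk]
  rw [← cancel_mono ((A.mul k₁).hom.app X)]
  simp only [Category.assoc]
  rw [A.swap_comp e'' rfl k₁, ← A.mul_mul hk rfl k₁ k₂,
    ← Category.assoc ((A.act g).map _), ← Functor.map_comp, A.swap_comp e' e' rfl,
    A.mul_mul rfl e' k₃ k₂, ← Category.assoc ((A.swap e).hom.app _), A.swap_comp e e rfl,
    A.mul_mul e hk k₃ rfl]

theorem UnitaryAction.swap_one {a o : G} (ho : o = 1) (e : a * o = o * a) (X : C) :
    (A.act a).map ((A.one ho).hom.app X) ≫ (A.swap e).hom.app X =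
      (A.one ho).hom.app ((A.act a).obj X) := by
  have k₁ : o * a = a := by rw [ho, one_mul]
  have k₂ : a * o = a := by rw [ho, mul_one]
  rw [← cancel_mono ((A.mul k₁).hom.app X), Category.assoc, A.swap_comp e k₂ k₁,
    A.mul_one_right ho k₂, A.one_mul_left ho k₁]
  rfl

theorem UnitaryAction.swap_tensor {a b g : G} (e : a * g = g * b) (X Y : C) :
    (A.act a).map (δ (A.act g) X Y) ≫ δ (A.act a) _ _ ≫
        ((A.swap e).hom.app X ⊗ₘ (A.swap e).hom.app Y) =
      (A.swap e).hom.app (X ⊗ Y) ≫ (A.act g).map (δ (A.act b) X Y) ≫ δ (A.act g) _ _ := by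
  have h : IsIso ((A.mul e.symm).hom.app X ⊗ₘ (A.mul e.symm).hom.app Y) := inferInstance
  rw [← cancel_mono ((A.mul e.symm).hom.app X ⊗ₘ (A.mul e.symm).hom.app Y)]
  simp only [Category.assoc]
  rw [tensorHom_comp_tensorHom, A.swap_comp e rfl, A.swap_comp e rfl, ← A.mul_tensor',
    ← A.mul_tensor', ← Category.assoc, A.swap_comp e rfl]

theorem UnitaryAction.swap_unit {a b g : G} (e : a * g = g * b) :
    (A.act a).map (η (A.act g)) ≫ η (A.act a) =
      (A.swap e).hom.app (𝟙_ C) ≫ (A.act g).map (η (A.act b)) ≫ η (A.act g) := by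
  rw [← A.mul_unit' rfl, ← A.mul_unit' e.symm, ← Category.assoc, A.swap_comp e rfl]

theorem UnitaryAction.swap_unitary {a b g : G} (e : a * g = g * b) (X : C) :
    IsUnitary ((A.swap e).hom.app X) :=
  (A.mul_unitary rfl X).comp (IsUnitary.inv ((A.mul e.symm).app X) (A.mul_unitary _ X))

theorem UnitaryAction.map_unitary (g : G) {X Y : C} {f : X ⟶ Y} (hf : IsUnitary f) :
    IsUnitary ((A.act g).map f) := by
  constructor
  · rw [← (A.unitary g).map_dag, ← Functor.map_comp, hf.hom_dag, CategoryTheory.Functor.map_id]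
  · rw [← (A.unitary g).map_dag, ← Functor.map_comp, hf.dag_hom, CategoryTheory.Functor.map_id]

end

namespace Equivariant

variable {A : UnitaryAction G C} {N : Subgroup G}

/-- The isomorphism `n(X) ⟶ X` of an object of the `N`-equivariantization. -/
def strN (X : Equivariant (A.comp N.subtype)) (n : N) : (A.act (n : G)).obj X.obj ⟶ X.obj :=
  X.str n

theorem strN_mul (X : Equivariant (A.comp N.subtype)) {n m k : N} (e : (n : G) * m = k) :
    (A.mul e).hom.app X.obj ≫ X.strN k = (A.act n).map (X.strN m) ≫ X.strN n :=
  X.str_mul (g := n) (h := m) (k := k) (Subtype.ext e)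

theorem comm_strN {X Y : Equivariant (A.comp N.subtype)} (f : X ⟶ Y) (n : N) :
    (A.act n).map f.hom ≫ Y.strN n = X.strN n ≫ f.hom :=
  f.comm n

theorem strN_congr (X : Equivariant (A.comp N.subtype)) {g : G} {n m m' : N}
    (e : (n : G) * g = g * (m : G)) (e' : (n : G) * g = g * (m' : G)) :
    (A.swap e).hom.app X.obj ≫ (A.act g).map (X.strN m) =
      (A.swap e').hom.app X.obj ≫ (A.act g).map (X.strN m') := by
  obtain rfl : m = m' := Subtype.ext (mul_left_cancel (e.symm.trans e'))
  rfl

theorem tensor_strN [UnitaryMonoidal C] (X Y : Equivariant (A.comp N.subtype)) (n : N) :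
    (X ⊗ Y).strN n = δ (A.act n) X.obj Y.obj ≫ (X.strN n ⊗ₘ Y.strN n) := rfl

theorem unit_strN [UnitaryMonoidal C] (n : N) : (𝟙_ (Equivariant (A.comp N.subtype))).strN n = η (A.act n) := rfl

variable [hN : N.Normal]

/-- `g⁻¹ n g` as an element of the normal subgroup `N`. -/
def conj (g : G) (n : N) : N :=
  ⟨g⁻¹ * n * g, by simpa using hN.conj_mem n n.2 g⁻¹⟩

theorem conj_spec (g : G) (n : N) : (n : G) * g = g * (conj g n : N) := by
  simp [conj, mul_assoc]

/-- The action of `g` on objects of the `N`-equivariantization: `(X, φ) ↦ (g(X), ψ)` where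
`ψ_n : n(g(X)) ≅ g(g⁻¹ng(X)) ⟶ g(X)` is induced by `φ_{g⁻¹ng}`. -/
def residualObj (g : G) (X : Equivariant (A.comp N.subtype)) :
    Equivariant (A.comp N.subtype) where
  obj := (A.act g).obj X.obj
  str n := (A.swap (conj_spec g n)).hom.app X.obj ≫ (A.act g).map (X.strN (conj g n))
  str_unitary n := (A.swap_unitary _ _).comp (A.map_unitary g (X.str_unitary _))
  str_mul {n m k} e := by
    have e₁ : (n : G) * m = k := congrArg Subtype.val e
    have e₃ : ((conj g n : N) : G) * (conj g m : N) = (conj g k : N) := by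
      simp [conj, mul_assoc, ← e₁]
    have nat := (A.swap (conj_spec g n)).hom.naturality (X.strN (conj g m))
    simp only [Functor.comp_map] at nat
    change (A.mul e₁).hom.app _ ≫ (A.swap _).hom.app X.obj ≫ (A.act g).map _ =
      (A.act n).map ((A.swap _).hom.app X.obj ≫ (A.act g).map _) ≫
        (A.swap _).hom.app X.obj ≫ (A.act g).map _
    rw [← Category.assoc, A.swap_mul (conj_spec g n) (conj_spec g m) e₁ e₃ (conj_spec g k)]
    simp only [Category.assoc, Functor.map_comp]
    rw [← Category.assoc ((A.act n).map ((A.act g).map _)), nat, Category.assoc,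
      ← Functor.map_comp, ← Functor.map_comp, X.strN_mul e₃]

theorem residualObj_strN (g : G) (X : Equivariant (A.comp N.subtype)) (n : N) :
    (residualObj g X).strN n =
      (A.swap (conj_spec g n)).hom.app X.obj ≫ (A.act g).map (X.strN (conj g n)) := rfl

variable (A N) in
/-- The functor `(X, φ) ↦ (g(X), g(φ_{g⁻¹ • g}))` on the `N`-equivariantization. -/
@[simps]
def residualFunctor (g : G) :
    Equivariant (A.comp N.subtype) ⥤ Equivariant (A.comp N.subtype) where
  obj X := residualObj g X
  map {X Y} f := ⟨(A.act g).map f.hom, fun n => by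
    have nat := (A.swap (conj_spec g n)).hom.naturality f.hom
    simp only [Functor.comp_map] at nat
    change (A.act n).map ((A.act g).map f.hom) ≫ (A.swap _).hom.app Y.obj ≫ (A.act g).map _ =
      ((A.swap _).hom.app X.obj ≫ (A.act g).map _) ≫ (A.act g).map f.hom
    rw [← Category.assoc, nat, Category.assoc, ← Functor.map_comp, comm_strN, Functor.map_comp,
      Category.assoc]⟩
  map_id X := by ext; exact (A.act g).map_id X.obj
  map_comp f f' := by ext; exact (A.act g).map_comp f.hom f'.hom

section

variable [UnitaryMonoidal C]

instance residualMonoidal (g : G) : (residualFunctor A N g).Monoidal :=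
  Functor.CoreMonoidal.toMonoidal
    { εIso := (isoMk (X := residualObj g (𝟙_ (Equivariant (A.comp N.subtype))))
        (Y := 𝟙_ (Equivariant (A.comp N.subtype))) (Functor.Monoidal.εIso (A.act g)).symm
        (fun n => by
          change (A.act n).map (η (A.act g)) ≫ η (A.act n) =
            ((A.swap (conj_spec g n)).hom.app (𝟙_ C) ≫ (A.act g).map (η (A.act (conj g n : N)))) ≫
              η (A.act g)
          rw [Category.assoc, A.swap_unit (conj_spec g n)])).symm
      μIso X Y := (isoMk (X := residualObj g (X ⊗ Y)) (Y := residualObj g X ⊗ residualObj g Y)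
        (Functor.Monoidal.μIso (A.act g) X.obj Y.obj).symm (fun n => by
          change (A.act n).map (δ (A.act g) X.obj Y.obj) ≫ δ (A.act n) _ _ ≫
              (((A.swap (conj_spec g n)).hom.app X.obj ≫ (A.act g).map (X.strN (conj g n))) ⊗ₘ
                ((A.swap (conj_spec g n)).hom.app Y.obj ≫ (A.act g).map (Y.strN (conj g n)))) =
            ((A.swap (conj_spec g n)).hom.app (X.obj ⊗ Y.obj) ≫ (A.act g).map
              (δ (A.act (conj g n : N)) X.obj Y.obj ≫
                (X.strN (conj g n) ⊗ₘ Y.strN (conj g n)))) ≫ δ (A.act g) X.obj Y.obj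
          rw [← tensorHom_comp_tensorHom, Functor.map_comp, Category.assoc, Category.assoc,
            ← δ_natural]
          simpa only [Category.assoc] using congrArg
            (fun q => q ≫ ((A.act g).map (X.strN (conj g n)) ⊗ₘ
              (A.act g).map (Y.strN (conj g n)))) (A.swap_tensor (conj_spec g n) X.obj Y.obj))).symm
      μIso_hom_natural_left f X := by ext; exact μ_natural_left (A.act g) f.hom X.obj
      μIso_hom_natural_right X f := by ext; exact μ_natural_right (A.act g) X.obj f.hom
      associativity X Y Z := by
        ext; exact Functor.LaxMonoidal.associativity (A.act g) X.obj Y.obj Z.obj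
      left_unitality X := by ext; exact Functor.LaxMonoidal.left_unitality (A.act g) X.obj
      right_unitality X := by ext; exact Functor.LaxMonoidal.right_unitality (A.act g) X.obj }

variable (A N) in
/-- The residual action of `G` on the `N`-equivariantization, `N` a normal subgroup of `G`. -/
def residual : UnitaryAction G (Equivariant (A.comp N.subtype)) where
  act g := residualFunctor A N g
  unitary g :=
    { map_add f f' := hom_ext ((A.unitary g).map_add f.hom f'.hom)
      map_smul c f := hom_ext ((A.unitary g).map_smul c f.hom)
      map_dag f := hom_ext ((A.unitary g).map_dag f.hom)
      μ_unitary X Y := isUnitary_iff.2 ((A.unitary g).μ_unitary X.obj Y.obj)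
      ε_unitary := isUnitary_iff.2 (A.unitary g).ε_unitary }
  mul {g h k} e := NatIso.ofComponents (fun X => isoMk (X := residualObj g (residualObj h X))
      (Y := residualObj k X) ((A.mul e).app X.obj) (fun n => by
        have e₁ : ((conj g n : N) : G) * h = h * (conj k n : N) := by
          simp [conj, mul_assoc, ← e]
        have nat := (A.mul e).hom.naturality (X.strN (conj k n))
        simp only [Functor.comp_map] at nat
        change (A.act n).map ((A.mul e).hom.app X.obj) ≫ (A.swap (conj_spec k n)).hom.app X.obj ≫
            (A.act k).map (X.strN (conj k n)) =
          ((A.swap (conj_spec g n)).hom.app ((A.act h).obj X.obj) ≫ (A.act g).map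
            ((A.swap (conj_spec h (conj g n))).hom.app X.obj ≫ (A.act h).map _)) ≫
              (A.mul e).hom.app X.obj
        rw [X.strN_congr (conj_spec h (conj g n)) e₁, ← Category.assoc,
          A.swap_trans (conj_spec g n) e₁ e (conj_spec k n), Functor.map_comp]
        simp only [Category.assoc]
        rw [nat])) (fun f => hom_ext ((A.mul e).hom.naturality f.hom))
  one {o} e := NatIso.ofComponents (fun X => isoMk (Y := residualObj o X) ((A.one e).app X.obj)
      (fun n => by
        have e₁ : (n : G) * o = o * (n : G) := by simp [e]
        have nat := (A.one e).hom.naturality (X.strN n)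
        simp only [Functor.id_map] at nat
        change (A.act n).map ((A.one e).hom.app X.obj) ≫ (A.swap (conj_spec o n)).hom.app X.obj ≫
            (A.act o).map (X.strN (conj o n)) = X.strN n ≫ (A.one e).hom.app X.obj
        rw [X.strN_congr (conj_spec o n) e₁, ← Category.assoc, A.swap_one e e₁]
        exact nat.symm)) (fun f => hom_ext ((A.one e).hom.naturality f.hom))
  mul_monoidal e :=
    { unit := hom_ext ((Category.assoc _ _ _).trans (A.mul_unit e))
      tensor X Y := hom_ext ((Category.assoc _ _ _).trans (A.mul_tensor e X.obj Y.obj)) }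
  one_monoidal e :=
    { unit := hom_ext (A.one_monoidal e).unit
      tensor X Y := hom_ext ((A.one_monoidal e).tensor X.obj Y.obj) }
  mul_unitary e X := isUnitary_iff.2 (A.mul_unitary e X.obj)
  one_unitary e X := isUnitary_iff.2 (A.one_unitary e X.obj)
  mul_mul e₁ e₂ e₃ e₄ X := hom_ext (A.mul_mul e₁ e₂ e₃ e₄ X.obj)
  one_mul_left e e' X := hom_ext (A.one_mul_left e e' X.obj)
  mul_one_right e e' X := hom_ext (A.mul_one_right e e' X.obj)

end

end Equivariant

/-! ### Unitary `G`-crossed braided fusion categories -/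

/-- A faithful `G`-grading and a unitary `G`-braiding on a category with a unitary `G`-action.
Together with `UnitaryFusionCategory C` this is a unitary `G`-crossed braided fusion category.
`deg g` is the class of objects of the component of degree `g`. -/
structure CrossedBraiding (A : UnitaryAction G C) where
  deg : G → ObjectProperty C
  deg_of_iso {g : G} {X Y : C} (e : X ≅ Y) : deg g X → deg g Y
  deg_directSum {g : G} {ι : Type} [Fintype ι] {Y : ι → C} {X : C} (D : DirectSum Y X) :
    (∀ i, deg g (Y i)) → deg g X
  hom_eq_zero {g h : G} {X Y : C} : deg g X → deg h Y → g ≠ h → ∀ f : X ⟶ Y, f = 0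
  decomposition (X : C) : ∃ (ι : Type) (_ : Fintype ι) (d : ι → G) (Y : ι → C),
    (∀ i, deg (d i) (Y i)) ∧ Nonempty (DirectSum Y X)
  faithful (g : G) : ∃ X, deg g X ∧ ¬ Limits.IsZero X
  deg_unit : deg 1 (𝟙_ C)
  deg_tensor {g h : G} {X Y : C} : deg g X → deg h Y → deg (g * h) (X ⊗ Y)
  deg_act (g : G) {h : G} {X : C} : deg h X → deg (g * h * g⁻¹) ((A.act g).obj X)
  /-- The `G`-braiding `c_{X,Y} : X ⊗ Y ≅ g(Y) ⊗ X` for `X` of degree `g`. -/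
  braid {g : G} {X : C} (hX : deg g X) (Y : C) : X ⊗ Y ≅ (A.act g).obj Y ⊗ X
  braid_unitary {g : G} {X : C} (hX : deg g X) (Y : C) : IsUnitary (braid hX Y).hom
  braid_natural {g : G} {X X' : C} (hX : deg g X) (hX' : deg g X') {Y Y' : C} (f : X ⟶ X')
    (f' : Y ⟶ Y') :
    (f ⊗ₘ f') ≫ (braid hX' Y').hom = (braid hX Y).hom ≫ ((A.act g).map f' ⊗ₘ f)
  /-- `g(c_{X,Y}) = c_{g(X),g(Y)}`. -/
  braid_act (g : G) {h : G} {X : C} (hX : deg h X) (Y : C) :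
    μ (A.act g) X Y ≫ (A.act g).map (braid hX Y).hom ≫ δ (A.act g) _ X ≫
        (A.mul (k := g * h) rfl).hom.app Y ▷ (A.act g).obj X =
      (braid (deg_act g hX) ((A.act g).obj Y)).hom ≫
        (A.mul (k := g * h) (by group)).hom.app Y ▷ (A.act g).obj X
  braid_tensor_right {g : G} {X : C} (hX : deg g X) (Y Z : C) :
    (braid hX (Y ⊗ Z)).hom ≫ δ (A.act g) Y Z ▷ X =
      (α_ X Y Z).inv ≫ (braid hX Y).hom ▷ Z ≫ (α_ _ X Z).hom ≫
        (A.act g).obj Y ◁ (braid hX Z).hom ≫ (α_ _ _ X).inv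
  braid_tensor_left {g h : G} {X Y : C} (hX : deg g X) (hY : deg h Y) (Z : C) :
    (braid (deg_tensor hX hY) Z).hom =
      (α_ X Y Z).hom ≫ X ◁ (braid hY Z).hom ≫ (α_ X _ Y).inv ≫
        (braid hX ((A.act h).obj Z)).hom ▷ Y ≫ (α_ _ X Y).hom ≫
        (A.mul rfl).hom.app Z ▷ (X ⊗ Y)

namespace CrossedBraiding

variable {A : UnitaryAction G C} (K : CrossedBraiding A)

/-- The full subcategory `⨁_{g ∈ S} C_g`: finite direct sums of homogeneous objects with degrees
in `S`. -/
def sector (S : Set G) : ObjectProperty C := fun X =>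
  ∃ (ι : Type) (_ : Fintype ι) (d : ι → G) (Y : ι → C),
    (∀ i, d i ∈ S ∧ K.deg (d i) (Y i)) ∧ Nonempty (DirectSum Y X)

theorem sector_of_deg {S : Set G} {g : G} (hg : g ∈ S) {X : C} (hX : K.deg g X) :
    K.sector S X :=
  ⟨Unit, inferInstance, fun _ => g, fun _ => X, fun _ => ⟨hg, hX⟩,
    ⟨⟨fun _ => 𝟙 X, fun _ => 𝟙 X, fun _ => by simp, fun i j h => (h rfl).elim, by simp⟩⟩⟩

theorem sector_act (N : Subgroup G) (n : N) {X : C} (hX : K.sector (N : Set G) X) :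
    K.sector (N : Set G) ((A.act n).obj X) := by
  obtain ⟨ι, _, d, Y, h, ⟨D⟩⟩ := hX
  refine ⟨ι, inferInstance, fun i => n * d i * (n : G)⁻¹, fun i => (A.act n).obj (Y i),
    fun i => ⟨N.mul_mem (N.mul_mem n.2 (h i).1) (N.inv_mem n.2), K.deg_act _ (h i).2⟩,
    ⟨⟨fun i => (A.act n).map (D.incl i), fun i => (A.act n).map (D.proj i), fun i => ?_,
      fun i j hij => ?_, ?_⟩⟩⟩
  · rw [← Functor.map_comp, D.incl_proj_self, CategoryTheory.Functor.map_id]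
  · rw [← Functor.map_comp, D.incl_proj_ne i j hij, Equivariant.map_zero']
  · have : (A.act n).Additive := ⟨fun {_ _ f f'} => (A.unitary n).map_add f f'⟩
    simp only [← Functor.map_comp]
    rw [← Functor.map_sum, D.total, CategoryTheory.Functor.map_id]

instance [UnitaryFusionCategory C] (N : Subgroup G) : (K.sector (N : Set G)).IsMonoidal where
  prop_unit := K.sector_of_deg N.one_mem K.deg_unit
  prop_tensor X X' hX hX' := by
    obtain ⟨ι, _, d, Y, h, ⟨D⟩⟩ := hX
    obtain ⟨ι', _, d', Y', h', ⟨D'⟩⟩ := hX'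
    refine ⟨ι × ι', inferInstance, fun i => d i.1 * d' i.2, fun i => Y i.1 ⊗ Y' i.2,
      fun i => ⟨N.mul_mem (h i.1).1 (h' i.2).1, K.deg_tensor (h i.1).2 (h' i.2).2⟩,
      ⟨⟨fun i => D.incl i.1 ⊗ₘ D'.incl i.2, fun i => D.proj i.1 ⊗ₘ D'.proj i.2, fun i => ?_,
        fun i j hij => ?_, ?_⟩⟩⟩
    · rw [tensorHom_comp_tensorHom, D.incl_proj_self, D'.incl_proj_self, id_tensorHom_id]
    · rw [tensorHom_comp_tensorHom]
      by_cases h₁ : i.1 = j.1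
      · have h₂ : i.2 ≠ j.2 := fun h₂ => hij (Prod.ext h₁ h₂)
        rw [D'.incl_proj_ne _ _ h₂, MonoidalPreadditive.tensor_zero]
      · rw [D.incl_proj_ne _ _ h₁, MonoidalPreadditive.zero_tensor]
    · simp only [tensorHom_comp_tensorHom]
      rw [Fintype.sum_prod_type]
      simp only [← tensor_sum, ← sum_tensor, D.total, D'.total, id_tensorHom_id]

section Restrict

variable [UnitaryFusionCategory C] (N : Subgroup G)

/-- The category `⨁_{n ∈ N} C_n`. -/
abbrev Sub : Type _ := (K.sector (N : Set G)).FullSubcategory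

/-- The action of `N` on `⨁_{n ∈ N} C_n`. -/
abbrev subAction : UnitaryAction N (K.Sub N) :=
  (A.comp N.subtype).onFull (K.sector (N : Set G)) (fun n _ hX => K.sector_act N n hX)

/-- The `N`-crossed braided structure of `⨁_{n ∈ N} C_n` induced from the one of `C`. -/
def restrict : CrossedBraiding (K.subAction N) where
  deg n X := K.deg n X.obj
  deg_of_iso e h := K.deg_of_iso ((K.sector (N : Set G)).ι.mapIso e) h
  deg_directSum D h := K.deg_directSum
    { incl i := (D.incl i).hom
      proj i := (D.proj i).hom
      incl_proj_self i := congrArg (fun f => f.hom) (D.incl_proj_self i)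
      incl_proj_ne i j hij := congrArg (fun f => f.hom) (D.incl_proj_ne i j hij)
      total := by
        have := congrArg (K.sector (N : Set G)).ι.map D.total
        rw [Functor.map_sum] at this
        exact this } h
  hom_eq_zero hX hY h f := by
    ext; exact K.hom_eq_zero hX hY (fun h' => h (Subtype.ext h')) f.hom
  decomposition X := by
    obtain ⟨ι, _, d, Y, h, ⟨D⟩⟩ := X.property
    refine ⟨ι, inferInstance, fun i => ⟨d i, (h i).1⟩,
      fun i => ⟨Y i, K.sector_of_deg (h i).1 (h i).2⟩, fun i => (h i).2,
      ⟨⟨fun i => ObjectProperty.homMk (D.incl i), fun i => ObjectProperty.homMk (D.proj i),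
        fun i => ?_, fun i j hij => ?_, ?_⟩⟩⟩
    · ext; exact D.incl_proj_self i
    · ext; exact D.incl_proj_ne i j hij
    · apply (K.sector (N : Set G)).ι.map_injective
      rw [Functor.map_sum]
      exact D.total
  faithful n := by
    obtain ⟨X, hX, h0⟩ := K.faithful n
    refine ⟨⟨X, K.sector_of_deg n.2 hX⟩, hX, fun h => h0 ?_⟩
    rw [Limits.IsZero.iff_id_eq_zero] at h ⊢
    exact congrArg (fun f => f.hom) h
  deg_unit := K.deg_unit
  deg_tensor hX hY := K.deg_tensor hX hY
  deg_act n m X hX := K.deg_act n hX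
  braid {n X} hX Y := (K.sector (N : Set G)).isoMk (K.braid (g := n) hX Y.obj)
  braid_unitary hX Y := (isUnitary_full _).2 (K.braid_unitary hX Y.obj)
  braid_natural hX hX' Y Y' f f' := by ext; exact K.braid_natural hX hX' f.hom f'.hom
  braid_act n m X hX Y := by ext; exact K.braid_act n hX Y.obj
  braid_tensor_right hX Y Z := by ext; exact K.braid_tensor_right hX Y.obj Z.obj
  braid_tensor_left hX hY Z := by ext; exact K.braid_tensor_left hX hY Z.obj

end Restrict

end CrossedBraiding

/-! ### Extensions of a unitary braided fusion category -/

section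

variable {A : UnitaryAction G C} (K : CrossedBraiding A)
  (B : Type u₂) [Category.{v₂} B] [Preadditive B] [Linear ℂ B] [MonoidalCategory B]
  [DaggerCategory B] [BraidedCategory B]

/-- An identification, by a unitary braided equivalence, of `B` with the component of degree `1`
of a `G`-crossed braided category. -/
structure CrossedBraiding.Extension where
  ι : B ⥤ C
  [monoidal : ι.Monoidal]
  unitary : IsUnitaryTensorFunctor ι
  full : ι.Full
  faithful : ι.Faithful
  deg_one_iff (X : C) : K.deg 1 X ↔ ∃ b, Nonempty (ι.obj b ≅ X)
  deg_ι (b : B) : K.deg 1 (ι.obj b) := (deg_one_iff _).2 ⟨b, ⟨Iso.refl _⟩⟩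
  /-- `ι` is braided, where `1(Y) ⊗ X` is identified with `Y ⊗ X`. -/
  braided (a b : B) :
    μ ι a b ≫ ι.map (β_ a b).hom =
      (K.braid (deg_ι a) (ι.obj b)).hom ≫ (A.one rfl).inv.app (ι.obj b) ▷ ι.obj a ≫ μ ι b a

attribute [instance] CrossedBraiding.Extension.monoidal

variable {K B}

/-- The isomorphism `b ⊗ X ≅ X ⊗ b` given by the `G`-braiding with an object `b` of `B`. -/
def CrossedBraiding.Extension.exchange (E : K.Extension B) (b : B) (X : C) :
    E.ι.obj b ⊗ X ≅ X ⊗ E.ι.obj b :=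
  K.braid (E.deg_ι b) X ≪≫ whiskerRightIso ((A.one rfl).app X).symm (E.ι.obj b)

/-- The component `⨁_{n ∈ N} C_n` as an `N`-crossed extension of `B`. -/
def CrossedBraiding.Extension.restrict [UnitaryFusionCategory C] (E : K.Extension B)
    (N : Subgroup G) : (K.restrict N).Extension B where
  ι := (K.sector (N : Set G)).lift E.ι (fun b => K.sector_of_deg N.one_mem (E.deg_ι b))
  monoidal := liftMonoidal _ _ _
  unitary :=
    letI := liftMonoidal (K.sector (N : Set G)) E.ι
      (fun b => K.sector_of_deg N.one_mem (E.deg_ι b))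
    { map_add f f' := by ext; exact E.unitary.map_add f f'
      map_smul c f := by ext; exact E.unitary.map_smul c f
      map_dag f := by ext; exact E.unitary.map_dag f
      μ_unitary X Y := (isUnitary_full _).2 (E.unitary.μ_unitary X Y)
      ε_unitary := (isUnitary_full _).2 E.unitary.ε_unitary }
  full := ⟨fun f => by
    obtain ⟨k, hk⟩ := E.full.map_surjective f.hom
    exact ⟨k, by ext; exact hk⟩⟩
  faithful := ⟨fun h => E.faithful.map_injective (congrArg (fun f => f.hom) h)⟩
  deg_one_iff X := by
    refine (E.deg_one_iff X.obj).trans ⟨?_, ?_⟩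
    · rintro ⟨b, ⟨e⟩⟩
      exact ⟨b, ⟨(K.sector (N : Set G)).isoMk e⟩⟩
    · rintro ⟨b, ⟨e⟩⟩
      exact ⟨b, ⟨(K.sector (N : Set G)).ι.mapIso e⟩⟩
  deg_ι b := E.deg_ι b
  braided a b :=
    letI := liftMonoidal (K.sector (N : Set G)) E.ι
      (fun b => K.sector_of_deg N.one_mem (E.deg_ι b))
    by ext; exact E.braided a b

/-- The braiding of the `G`-equivariantization of a `G`-crossed braided category: on the component
`Z` of degree `g` of `X` it is `Z ⊗ Y ⟶ g(Y) ⊗ Z ⟶ Y ⊗ Z`, the `G`-braiding followed by the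
equivariant structure of `Y`. -/
def CrossedBraiding.IsGaugeBraiding (K : CrossedBraiding A) [UnitaryMonoidal C]
    [BraidedCategory (Equivariant A)] : Prop :=
  ∀ (X Y : Equivariant A) {g : G} {Z : C} (hZ : K.deg g Z) (i : Z ⟶ X.obj),
    i ▷ Y.obj ≫ (β_ X Y).hom.hom = (K.braid hZ Y.obj).hom ≫ Y.str g ▷ Z ≫ Y.obj ◁ i

/-- The `H`-crossed braided structure of the `N`-equivariantization, for the residual action: the
component of degree `h` consists of the objects of `⨁_{n ∈ N} C_{hn}`, and on the
component `Z` of degree `hn` of `X` the `H`-braiding is `Z ⊗ Y ⟶ (hn)(Y) ⊗ Z ⟶ h(Y) ⊗ Z`, the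
`G`-braiding followed by `h(φ_n)`. -/
structure CrossedBraiding.IsResidual [UnitaryMonoidal C] (K : CrossedBraiding A)
    {N : Subgroup G} [N.Normal] {H : Subgroup G}
    (L : CrossedBraiding ((Equivariant.residual A N).comp H.subtype)) : Prop where
  deg_iff (h : H) (X : Equivariant (A.comp N.subtype)) :
    L.deg h X ↔ K.sector {g | ∃ n : N, g = h * n} X.obj
  braid_eq {h : H} {X : Equivariant (A.comp N.subtype)} (hX : L.deg h X)
    (Y : Equivariant (A.comp N.subtype)) {n : N} {Z : C} (hZ : K.deg ((h : G) * n) Z)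
    (i : Z ⟶ X.obj) :
    i ▷ Y.obj ≫ (L.braid hX Y).hom.hom =
      (K.braid hZ Y.obj).hom ≫
        ((A.mul rfl).inv.app Y.obj ≫ (A.act h).map (Y.strN n)) ▷ Z ≫
        (A.act h).obj Y.obj ◁ i

end

/-! ### Module categories, relative tensor products and the Picard 3-group -/

section

/-- The action of `B` on `M` is bilinear, compatible with `†`, and has unitary constraints. -/
class IsUnitaryModule (B : Type u₂) [Category.{v₂} B] [Preadditive B] [Linear ℂ B]
    [MonoidalCategory B] [DaggerCategory B] (M : Type w₁) [Category.{w₂} M] [Preadditive M]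
    [Linear ℂ M] [DaggerCategory M] [MonoidalLeftAction B M] : Prop where
  add_left {a b : B} (f f' : a ⟶ b) (x : M) : (f + f') ⊵ₗ x = f ⊵ₗ x + f' ⊵ₗ x
  smul_left {a b : B} (c : ℂ) (f : a ⟶ b) (x : M) : (c • f) ⊵ₗ x = c • (f ⊵ₗ x)
  add_right (b : B) {x y : M} (f f' : x ⟶ y) : b ⊴ₗ (f + f') = b ⊴ₗ f + b ⊴ₗ f'
  smul_right (b : B) {x y : M} (c : ℂ) (f : x ⟶ y) : b ⊴ₗ (c • f) = c • (b ⊴ₗ f)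
  dag_actionHom {a b : B} {x y : M} (f : a ⟶ b) (k : x ⟶ y) :
    dag (f ⊙ₗₘ k) = dag f ⊙ₗₘ dag k
  assoc_unitary (a b : B) (x : M) : IsUnitary (αₗ a b x).hom
  unit_unitary (x : M) : IsUnitary (λₗ[B] x).hom

variable (B : Type u₂) [Category.{v₂} B] [Preadditive B] [Linear ℂ B] [MonoidalCategory B]
  [DaggerCategory B]

/-- Unitary (finite semisimple, left) `B`-module categories. -/
structure UModCat where
  carrier : Type w₁
  [category : Category.{w₂} carrier]
  [preadditive : Preadditive carrier]
  [linear : Linear ℂ carrier]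
  [dagger : DaggerCategory carrier]
  [cstar : CStarCategory carrier]
  [semisimple : IsFiniteSemisimple carrier]
  [action : MonoidalLeftAction B carrier]
  [unitary : IsUnitaryModule B carrier]

instance : CoeSort (UModCat.{w₁, w₂} B) (Type w₁) := ⟨UModCat.carrier⟩

attribute [instance] UModCat.category UModCat.preadditive UModCat.linear UModCat.dagger
  UModCat.cstar UModCat.semisimple UModCat.action UModCat.unitary

/-- `B` as a module category over itself. -/
def UModCat.self [UnitaryFusionCategory B] : UModCat.{u₂, v₂} B :=
  { carrier := B
    action := selfLeftAction B
    unitary :=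
      { add_left _ _ _ := MonoidalPreadditive.add_whiskerRight _ _
        smul_left _ _ _ := MonoidalLinear.smul_whiskerRight _ _ _
        add_right _ _ _ _ _ := MonoidalPreadditive.whiskerLeft_add _ _
        smul_right _ _ _ _ _ := MonoidalLinear.whiskerLeft_smul _ _ _
        dag_actionHom f k := UnitaryMonoidal.dag_tensorHom f k
        assoc_unitary a b x := UnitaryMonoidal.associator_unitary a b x
        unit_unitary x := UnitaryMonoidal.leftUnitor_unitary x } }

/-- The morphism `F(x, y) ⟶ F(x', y')` induced by a pair of morphisms. -/
abbrev biMap {X : Type u₁} [Category.{v₁} X] {Y : Type u₂} [Category.{v₂} Y] {Z : Type u₃}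
    [Category.{v₃} Z] (F : X ⥤ Y ⥤ Z) {x x' : X} {y y' : Y} (f : x ⟶ x') (k : y ⟶ y') :
    (F.obj x).obj y ⟶ (F.obj x').obj y' :=
  (F.map f).app y ≫ (F.obj x').map k

/-- `ℂ`-bilinear bifunctors. -/
structure IsBilinear {X : Type u₁} [Category.{v₁} X] [Preadditive X] [Linear ℂ X]
    {Y : Type u₂} [Category.{v₂} Y] [Preadditive Y] [Linear ℂ Y] {Z : Type u₃}
    [Category.{v₃} Z] [Preadditive Z] [Linear ℂ Z] (F : X ⥤ Y ⥤ Z) : Prop where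
  add_left {x x' : X} (f f' : x ⟶ x') (y : Y) :
    (F.map (f + f')).app y = (F.map f).app y + (F.map f').app y
  smul_left {x x' : X} (c : ℂ) (f : x ⟶ x') (y : Y) :
    (F.map (c • f)).app y = c • (F.map f).app y
  add_right (x : X) {y y' : Y} (k k' : y ⟶ y') :
    (F.obj x).map (k + k') = (F.obj x).map k + (F.obj x).map k'
  smul_right (x : X) {y y' : Y} (c : ℂ) (k : y ⟶ y') :
    (F.obj x).map (c • k) = c • (F.obj x).map k

variable {B} [BraidedCategory B]

/-- A `B`-balanced bilinear functor on `X × Y`, where `X` is a right module category through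
the braiding of `B`: `x ◁ b = b ⊙ x`, with `(x ◁ a) ◁ b = b ⊙ a ⊙ x ≅ (b ⊗ a) ⊙ x ≅ (a ⊗ b) ⊙ x`
`= x ◁ (a ⊗ b)`. -/
structure BalancedFunctor (X : UModCat.{u₁, v₁} B) (Y : UModCat.{u₃, v₃} B) (Z : Type w₁)
    [Category.{w₂} Z] [Preadditive Z] [Linear ℂ Z] where
  F : X ⥤ Y ⥤ Z
  bilinear : IsBilinear F
  balance (b : B) (x : X) (y : Y) : (F.obj (b ⊙ₗ x)).obj y ≅ (F.obj x).obj (b ⊙ₗ y)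
  balance_natural {b b' : B} {x x' : X} {y y' : Y} (f : b ⟶ b') (k : x ⟶ x') (l : y ⟶ y') :
    biMap F (f ⊙ₗₘ k) l ≫ (balance b' x' y').hom = (balance b x y).hom ≫ biMap F k (f ⊙ₗₘ l)
  balance_tensor (a b : B) (x : X) (y : Y) :
    (F.map ((αₗ b a x).inv ≫ (β_ b a).hom ⊵ₗ x)).app y ≫ (balance (a ⊗ b) x y).hom ≫
        (F.obj x).map (αₗ a b y).hom =
      (balance b (a ⊙ₗ x) y).hom ≫ (balance a x (b ⊙ₗ y)).hom
  balance_unit (x : X) (y : Y) :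
    (balance (𝟙_ B) x y).hom ≫ (F.obj x).map (λₗ y).hom = (F.map (λₗ x).hom).app y

/-- Unitary bilinear functors `X × Y ⥤ Z` of `B`-module categories, i.e. functors which are
unitary `B`-module functors in each variable, such that the two resulting isomorphisms
`(a ⊙ x) · (b ⊙ y) ≅ a ⊙ b ⊙ (x · y)` agree up to the braiding of `B`. They are the
`B`-balanced functors inducing `B`-module functors on relative tensor products. -/
structure ModuleBifunctor (X : UModCat.{u₁, v₁} B) (Y : UModCat.{u₃, v₃} B)
    (Z : UModCat.{w₁, w₂} B) where
  F : X ⥤ Y ⥤ Z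
  bilinear : IsBilinear F
  map_dag {x x' : X} {y y' : Y} (k : x ⟶ x') (l : y ⟶ y') :
    dag (biMap F k l) = biMap F (dag k) (dag l)
  left (b : B) (x : X) (y : Y) : (F.obj (b ⊙ₗ x)).obj y ≅ b ⊙ₗ (F.obj x).obj y
  right (b : B) (x : X) (y : Y) : (F.obj x).obj (b ⊙ₗ y) ≅ b ⊙ₗ (F.obj x).obj y
  left_unitary (b : B) (x : X) (y : Y) : IsUnitary (left b x y).hom
  right_unitary (b : B) (x : X) (y : Y) : IsUnitary (right b x y).hom
  left_natural {b b' : B} {x x' : X} {y y' : Y} (f : b ⟶ b') (k : x ⟶ x') (l : y ⟶ y') :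
    biMap F (f ⊙ₗₘ k) l ≫ (left b' x' y').hom = (left b x y).hom ≫ (f ⊙ₗₘ biMap F k l)
  right_natural {b b' : B} {x x' : X} {y y' : Y} (f : b ⟶ b') (k : x ⟶ x') (l : y ⟶ y') :
    biMap F k (f ⊙ₗₘ l) ≫ (right b' x' y').hom = (right b x y).hom ≫ (f ⊙ₗₘ biMap F k l)
  left_tensor (a b : B) (x : X) (y : Y) :
    (left (a ⊗ b) x y).hom ≫ (αₗ a b _).hom =
      (F.map (αₗ a b x).hom).app y ≫ (left a (b ⊙ₗ x) y).hom ≫ a ⊴ₗ (left b x y).hom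
  right_tensor (a b : B) (x : X) (y : Y) :
    (right (a ⊗ b) x y).hom ≫ (αₗ a b _).hom =
      (F.obj x).map (αₗ a b y).hom ≫ (right a x (b ⊙ₗ y)).hom ≫ a ⊴ₗ (right b x y).hom
  left_unit (x : X) (y : Y) :
    (left (𝟙_ B) x y).hom ≫ (λₗ _).hom = (F.map (λₗ x).hom).app y
  right_unit (x : X) (y : Y) :
    (right (𝟙_ B) x y).hom ≫ (λₗ _).hom = (F.obj x).map (λₗ y).hom
  hexagon (a b : B) (x : X) (y : Y) :
    (left a x (b ⊙ₗ y)).hom ≫ a ⊴ₗ (right b x y).hom =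
      (right b (a ⊙ₗ x) y).hom ≫ b ⊴ₗ (left a x y).hom ≫ (αₗ b a _).inv ≫
        (β_ b a).hom ⊵ₗ _ ≫ (αₗ a b _).hom

namespace ModuleBifunctor

variable {X : UModCat.{u₁, v₁} B} {Y : UModCat.{u₃, v₃} B} {Z : UModCat.{w₁, w₂} B}

/-- The value `x · y`. -/
abbrev on (Φ : ModuleBifunctor X Y Z) (x : X) (y : Y) : Z := (Φ.F.obj x).obj y

/-- The value on a pair of morphisms. -/
abbrev onMap (Φ : ModuleBifunctor X Y Z) {x x' : X} {y y' : Y} (k : x ⟶ x') (l : y ⟶ y') :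
    Φ.on x y ⟶ Φ.on x' y' := biMap Φ.F k l

/-- The balancing `(b ⊙ x) · y ≅ b ⊙ (x · y) ≅ x · (b ⊙ y)`. -/
def balance (Φ : ModuleBifunctor X Y Z) (b : B) (x : X) (y : Y) :
    Φ.on (b ⊙ₗ x) y ≅ Φ.on x (b ⊙ₗ y) :=
  Φ.left b x y ≪≫ (Φ.right b x y).symm

/-- `Φ` exhibits `Z` as the relative tensor product `X ⊠_B Y`, i.e. it induces an equivalence
`X ⊠_B Y ≌ Z`: composition with `Φ` is an equivalence from linear functors `Z ⥤ D` to
`B`-balanced functors `X × Y ⥤ D`, for all finite semisimple `ℂ`-linear categories `D`. -/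
structure IsRelativeTensorProduct (Φ : ModuleBifunctor X Y Z) : Prop where
  factor (D : Type w₁) [Category.{w₂} D] [Preadditive D] [Linear ℂ D] [IsFiniteSemisimple D]
    (Ψ : BalancedFunctor X Y D) :
    ∃ (T : Z ⥤ D) (_ : T.Additive) (_ : T.Linear ℂ)
      (θ : ∀ x y, T.obj (Φ.on x y) ≅ (Ψ.F.obj x).obj y),
      (∀ {x x' : X} {y y' : Y} (k : x ⟶ x') (l : y ⟶ y'),
        T.map (Φ.onMap k l) ≫ (θ x' y').hom = (θ x y).hom ≫ biMap Ψ.F k l) ∧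
      ∀ b x y, T.map (Φ.balance b x y).hom ≫ (θ x (b ⊙ₗ y)).hom =
        (θ (b ⊙ₗ x) y).hom ≫ (Ψ.balance b x y).hom
  existsUnique_natTrans (D : Type w₁) [Category.{w₂} D] [Preadditive D] [Linear ℂ D]
    [IsFiniteSemisimple D] (T T' : Z ⥤ D) [T.Additive] [T.Linear ℂ] [T'.Additive]
    [T'.Linear ℂ] (η : ∀ x y, T.obj (Φ.on x y) ⟶ T'.obj (Φ.on x y))
    (_ : ∀ {x x' : X} {y y' : Y} (k : x ⟶ x') (l : y ⟶ y'),
      T.map (Φ.onMap k l) ≫ η x' y' = η x y ≫ T'.map (Φ.onMap k l))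
    (_ : ∀ b x y, T.map (Φ.balance b x y).hom ≫ η x (b ⊙ₗ y) =
      η (b ⊙ₗ x) y ≫ T'.map (Φ.balance b x y).hom) :
    ∃! τ : T ⟶ T', ∀ x y, τ.app (Φ.on x y) = η x y

end ModuleBifunctor

/-- Invertible module categories: the objects of the Picard 3-group of `B`. -/
def UModCat.IsInvertible [UnitaryFusionCategory B] (M : UModCat.{w₁, w₂} B) : Prop :=
  ∃ (M' : UModCat.{w₁, w₂} B) (Φ : ModuleBifunctor M M' (UModCat.self B))
    (Ψ : ModuleBifunctor M' M (UModCat.self B)),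
    Φ.IsRelativeTensorProduct ∧ Ψ.IsRelativeTensorProduct

variable (G B) in
/-- Tri-homomorphisms from `G`, as a discrete 3-group, to the Picard 3-group of `B`: invertible
`B`-module categories `B_g`, equivalences `B_g ⊠_B B_h ≌ B_{gh}` of `B`-module categories, an
equivalence `B ≌ B_1`, `b ↦ b ⊙ u`, of `B`-module categories, and isomorphisms of `B`-module
functors for associativity and the two unit laws, subject to the pentagon and the triangle axiom.
As for actions, `mul`, `unit` etc. are indexed by equations in `G`. -/
structure TriHom [UnitaryFusionCategory B] where
  obj : G → UModCat.{w₁, w₂} B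
  invertible (g : G) : (obj g).IsInvertible
  mul {g h k : G} (e : g * h = k) : ModuleBifunctor (obj g) (obj h) (obj k)
  mul_equivalence {g h k : G} (e : g * h = k) : (mul e).IsRelativeTensorProduct
  unit {o : G} (e : o = 1) : obj o
  unit_equivalence {o : G} (e : o = 1) :
    ((MonoidalLeftAction.curriedAction B (obj o)).flip.obj (unit e)).IsEquivalence
  assoc {g h k gh hk ghk : G} (e₁ : g * h = gh) (e₂ : h * k = hk) (e₃ : gh * k = ghk)
    (e₄ : g * hk = ghk) (x : obj g) (y : obj h) (z : obj k) :
    (mul e₃).on ((mul e₁).on x y) z ≅ (mul e₄).on x ((mul e₂).on y z)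
  leftUnit {o g : G} (e : o = 1) (e' : o * g = g) (x : obj g) : (mul e').on (unit e) x ≅ x
  rightUnit {o g : G} (e : o = 1) (e' : g * o = g) (x : obj g) : (mul e').on x (unit e) ≅ x
  assoc_unitary {g h k gh hk ghk : G} (e₁ : g * h = gh) (e₂ : h * k = hk) (e₃ : gh * k = ghk)
    (e₄ : g * hk = ghk) (x : obj g) (y : obj h) (z : obj k) :
    IsUnitary (assoc e₁ e₂ e₃ e₄ x y z).hom
  leftUnit_unitary {o g : G} (e : o = 1) (e' : o * g = g) (x : obj g) :
    IsUnitary (leftUnit e e' x).hom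
  rightUnit_unitary {o g : G} (e : o = 1) (e' : g * o = g) (x : obj g) :
    IsUnitary (rightUnit e e' x).hom
  assoc_natural {g h k gh hk ghk : G} (e₁ : g * h = gh) (e₂ : h * k = hk) (e₃ : gh * k = ghk)
    (e₄ : g * hk = ghk) {x x' : obj g} {y y' : obj h} {z z' : obj k} (p : x ⟶ x')
    (q : y ⟶ y') (r : z ⟶ z') :
    (mul e₃).onMap ((mul e₁).onMap p q) r ≫ (assoc e₁ e₂ e₃ e₄ x' y' z').hom =
      (assoc e₁ e₂ e₃ e₄ x y z).hom ≫ (mul e₄).onMap p ((mul e₂).onMap q r)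
  leftUnit_natural {o g : G} (e : o = 1) (e' : o * g = g) {x x' : obj g} (p : x ⟶ x') :
    (mul e').onMap (𝟙 _) p ≫ (leftUnit e e' x').hom = (leftUnit e e' x).hom ≫ p
  rightUnit_natural {o g : G} (e : o = 1) (e' : g * o = g) {x x' : obj g} (p : x ⟶ x') :
    (mul e').onMap p (𝟙 _) ≫ (rightUnit e e' x').hom = (rightUnit e e' x).hom ≫ p
  assoc_left {g h k gh hk ghk : G} (e₁ : g * h = gh) (e₂ : h * k = hk) (e₃ : gh * k = ghk)
    (e₄ : g * hk = ghk) (b : B) (x : obj g) (y : obj h) (z : obj k) :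
    (assoc e₁ e₂ e₃ e₄ (b ⊙ₗ x) y z).hom ≫ ((mul e₄).left b x _).hom =
      (mul e₃).onMap ((mul e₁).left b x y).hom (𝟙 z) ≫ ((mul e₃).left b _ z).hom ≫
        b ⊴ₗ (assoc e₁ e₂ e₃ e₄ x y z).hom
  assoc_middle {g h k gh hk ghk : G} (e₁ : g * h = gh) (e₂ : h * k = hk) (e₃ : gh * k = ghk)
    (e₄ : g * hk = ghk) (b : B) (x : obj g) (y : obj h) (z : obj k) :
    (assoc e₁ e₂ e₃ e₄ x (b ⊙ₗ y) z).hom ≫ (mul e₄).onMap (𝟙 x) ((mul e₂).left b y z).hom ≫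
        ((mul e₄).right b x _).hom =
      (mul e₃).onMap ((mul e₁).right b x y).hom (𝟙 z) ≫ ((mul e₃).left b _ z).hom ≫
        b ⊴ₗ (assoc e₁ e₂ e₃ e₄ x y z).hom
  assoc_right {g h k gh hk ghk : G} (e₁ : g * h = gh) (e₂ : h * k = hk) (e₃ : gh * k = ghk)
    (e₄ : g * hk = ghk) (b : B) (x : obj g) (y : obj h) (z : obj k) :
    (assoc e₁ e₂ e₃ e₄ x y (b ⊙ₗ z)).hom ≫ (mul e₄).onMap (𝟙 x) ((mul e₂).right b y z).hom ≫
        ((mul e₄).right b x _).hom =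
      ((mul e₃).right b _ z).hom ≫ b ⊴ₗ (assoc e₁ e₂ e₃ e₄ x y z).hom
  leftUnit_module {o g : G} (e : o = 1) (e' : o * g = g) (b : B) (x : obj g) :
    (leftUnit e e' (b ⊙ₗ x)).hom =
      ((mul e').right b (unit e) x).hom ≫ b ⊴ₗ (leftUnit e e' x).hom
  rightUnit_module {o g : G} (e : o = 1) (e' : g * o = g) (b : B) (x : obj g) :
    (rightUnit e e' (b ⊙ₗ x)).hom =
      ((mul e').left b x (unit e)).hom ≫ b ⊴ₗ (rightUnit e e' x).hom
  pentagon {g h k l gh hk kl ghk hkl t : G} (e₁ : g * h = gh) (e₂ : h * k = hk)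
    (e₃ : k * l = kl) (e₄ : gh * k = ghk) (e₅ : g * hk = ghk) (e₆ : hk * l = hkl)
    (e₇ : h * kl = hkl) (e₈ : ghk * l = t) (e₉ : g * hkl = t) (e₁₀ : gh * kl = t)
    (x : obj g) (y : obj h) (z : obj k) (w : obj l) :
    (mul e₈).onMap (assoc e₁ e₂ e₄ e₅ x y z).hom (𝟙 w) ≫ (assoc e₅ e₆ e₈ e₉ x _ w).hom ≫
        (mul e₉).onMap (𝟙 x) (assoc e₂ e₃ e₆ e₇ y z w).hom =
      (assoc e₄ e₃ e₈ e₁₀ _ z w).hom ≫ (assoc e₁ e₇ e₁₀ e₉ x y _).hom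
  triangle {g o h k : G} (e : o = 1) (e₁ : g * o = g) (e₂ : o * h = h) (e₃ : g * h = k)
    (x : obj g) (y : obj h) :
    (assoc e₁ e₂ e₃ e₃ x (unit e) y).hom ≫ (mul e₃).onMap (𝟙 x) (leftUnit e e₂ y).hom =
      (mul e₃).onMap (rightUnit e e₁ x).hom (𝟙 y)

/-- Restriction of a tri-homomorphism along a group homomorphism. -/
def TriHom.comp [UnitaryFusionCategory B] (ρ : TriHom.{w₁, w₂} G B) {L : Type w₃} [Group L]
    (f : L →* G) : TriHom.{w₁, w₂} L B where
  obj g := ρ.obj (f g)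
  invertible g := ρ.invertible (f g)
  mul e := ρ.mul (by rw [← map_mul, e])
  mul_equivalence e := ρ.mul_equivalence _
  unit e := ρ.unit (by rw [e, map_one])
  unit_equivalence e := ρ.unit_equivalence _
  assoc e₁ e₂ e₃ e₄ := ρ.assoc _ _ _ _
  leftUnit e e' := ρ.leftUnit _ _
  rightUnit e e' := ρ.rightUnit _ _
  assoc_unitary e₁ e₂ e₃ e₄ := ρ.assoc_unitary _ _ _ _
  leftUnit_unitary e e' := ρ.leftUnit_unitary _ _
  rightUnit_unitary e e' := ρ.rightUnit_unitary _ _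
  assoc_natural e₁ e₂ e₃ e₄ _ _ _ _ _ _ := ρ.assoc_natural _ _ _ _
  leftUnit_natural e e' _ _ := ρ.leftUnit_natural _ _
  rightUnit_natural e e' _ _ := ρ.rightUnit_natural _ _
  assoc_left e₁ e₂ e₃ e₄ := ρ.assoc_left _ _ _ _
  assoc_middle e₁ e₂ e₃ e₄ := ρ.assoc_middle _ _ _ _
  assoc_right e₁ e₂ e₃ e₄ := ρ.assoc_right _ _ _ _
  leftUnit_module e e' := ρ.leftUnit_module _ _
  rightUnit_module e e' := ρ.rightUnit_module _ _
  pentagon e₁ e₂ e₃ e₄ e₅ e₆ e₇ e₈ e₉ e₁₀ := ρ.pentagon _ _ _ _ _ _ _ _ _ _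
  triangle e e₁ e₂ e₃ := ρ.triangle _ _ _ _

/-- The `G`-crossed braided extension `C` of `B` corresponds to the tri-homomorphism `ρ`: there are
unitary equivalences of the `ρ(g)` with the components `C_g`, which carry the action of
`B`, the bifunctors `ρ(g) × ρ(h) ⥤ ρ(gh)`, and the associativity and unit isomorphisms of `ρ` to the
ones given by the tensor product of `C`. In the second variable, `B`-linearity of the tensor product
of `C` is given by the `G`-braiding with objects of `B`. -/
structure CrossedBraiding.Extension.Realization [UnitaryFusionCategory B]
    {A : UnitaryAction G C} {K : CrossedBraiding A} (E : K.Extension B)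
    (ρ : TriHom.{w₁, w₂} G B) where
  J (g : G) : ρ.obj g ⥤ C
  unitary (g : G) : IsUnitaryFunctor (J g)
  full (g : G) : (J g).Full
  faithful (g : G) : (J g).Faithful
  deg_iff (g : G) (X : C) : K.deg g X ↔ ∃ x, Nonempty ((J g).obj x ≅ X)
  act {g : G} (b : B) (x : ρ.obj g) : (J g).obj (b ⊙ₗ x) ≅ E.ι.obj b ⊗ (J g).obj x
  mul {g h k : G} (e : g * h = k) (x : ρ.obj g) (y : ρ.obj h) :
    (J k).obj ((ρ.mul e).on x y) ≅ (J g).obj x ⊗ (J h).obj y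
  unit {o : G} (e : o = 1) : (J o).obj (ρ.unit e) ≅ 𝟙_ C
  act_unitary {g : G} (b : B) (x : ρ.obj g) : IsUnitary (act b x).hom
  mul_unitary {g h k : G} (e : g * h = k) (x : ρ.obj g) (y : ρ.obj h) :
    IsUnitary (mul e x y).hom
  unit_unitary {o : G} (e : o = 1) : IsUnitary (unit e).hom
  act_natural {g : G} {b b' : B} {x x' : ρ.obj g} (f : b ⟶ b') (p : x ⟶ x') :
    (J g).map (f ⊙ₗₘ p) ≫ (act b' x').hom = (act b x).hom ≫ (E.ι.map f ⊗ₘ (J g).map p)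
  act_tensor {g : G} (a b : B) (x : ρ.obj g) :
    (act (a ⊗ b) x).hom ≫ δ E.ι a b ▷ (J g).obj x ≫ (α_ _ _ _).hom =
      (J g).map (αₗ a b x).hom ≫ (act a (b ⊙ₗ x)).hom ≫ E.ι.obj a ◁ (act b x).hom
  act_unit {g : G} (x : ρ.obj g) :
    (act (𝟙_ B) x).hom ≫ η E.ι ▷ (J g).obj x ≫ (λ_ _).hom = (J g).map (λₗ x).hom
  mul_natural {g h k : G} (e : g * h = k) {x x' : ρ.obj g} {y y' : ρ.obj h} (p : x ⟶ x')
    (q : y ⟶ y') :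
    (J k).map ((ρ.mul e).onMap p q) ≫ (mul e x' y').hom =
      (mul e x y).hom ≫ ((J g).map p ⊗ₘ (J h).map q)
  mul_left {g h k : G} (e : g * h = k) (b : B) (x : ρ.obj g) (y : ρ.obj h) :
    (J k).map ((ρ.mul e).left b x y).hom ≫ (act b _).hom ≫ E.ι.obj b ◁ (mul e x y).hom =
      (mul e (b ⊙ₗ x) y).hom ≫ (act b x).hom ▷ (J h).obj y ≫ (α_ _ _ _).hom
  mul_right {g h k : G} (e : g * h = k) (b : B) (x : ρ.obj g) (y : ρ.obj h) :
    (J k).map ((ρ.mul e).right b x y).hom ≫ (act b _).hom ≫ E.ι.obj b ◁ (mul e x y).hom =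
      (mul e x (b ⊙ₗ y)).hom ≫ (J g).obj x ◁ (act b y).hom ≫ (α_ _ _ _).inv ≫
        (E.exchange b ((J g).obj x)).inv ▷ (J h).obj y ≫ (α_ _ _ _).hom
  mul_assoc {g h k gh hk ghk : G} (e₁ : g * h = gh) (e₂ : h * k = hk) (e₃ : gh * k = ghk)
    (e₄ : g * hk = ghk) (x : ρ.obj g) (y : ρ.obj h) (z : ρ.obj k) :
    (J ghk).map (ρ.assoc e₁ e₂ e₃ e₄ x y z).hom ≫ (mul e₄ x _).hom ≫
        (J g).obj x ◁ (mul e₂ y z).hom =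
      (mul e₃ _ z).hom ≫ (mul e₁ x y).hom ▷ (J k).obj z ≫ (α_ _ _ _).hom
  mul_unit_left {o g : G} (e : o = 1) (e' : o * g = g) (x : ρ.obj g) :
    (J g).map (ρ.leftUnit e e' x).hom =
      (mul e' (ρ.unit e) x).hom ≫ (unit e).hom ▷ (J g).obj x ≫ (λ_ _).hom
  mul_unit_right {o g : G} (e : o = 1) (e' : g * o = g) (x : ρ.obj g) :
    (J g).map (ρ.rightUnit e e' x).hom =
      (mul e' x (ρ.unit e)).hom ≫ (J g).obj x ◁ (unit e).hom ≫ (ρ_ _).hom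

end

end SeqGauging

open SeqGauging

set_option linter.unusedSectionVars false

namespace SeqGauging

open DaggerCategory

/-! Every category in the theorem consists of objects of `C` with extra data, so each claim is
reduced to an identity in `C`, usually one that can be tested on homogeneous components. Four
mechanisms carry the proof.

Unitary fusion structure. A positive definite dagger with finite-dimensional morphism spaces already
admits square roots (`exists_sqrt`), hence polar decompositions (`exists_isometry_of_mono`). A
category which moreover has a zero object, orthogonal sums and split projections
(`OrthogonallyComplete`) is therefore C*, has kernels and cokernels, and is semisimple. This
property is inherited by sums of components and by equivariantizations. Finiteness of the set of
simple objects comes from the induced objects `⨁ g(Y)`; rigidity comes from transporting the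
equivariant structure to a dual and averaging it to a unitary one (`exists_unitarization`).

Braidings. If the degrees of `X` lie in `S`, a family `t_g : g(Y) ⟶ W` for `g ∈ S` determines a
morphism `X ⊗ Y ⟶ W ⊗ X`, namely the `G`-braiding followed by `t_g` in degree `g` (`halfBraid`).
Naturality, both hexagons and compatibility with the action become identities between the `t_g`.
Taking for `t_g` the equivariant structure of `Y` gives the braiding of an equivariantization;
taking `t_{hn} = h(φ_n)` (`cosetMap`) gives the `H`-braiding of the `N`-equivariantization. For `h =
1` the two agree, which makes the gauging by `N` the trivial component.

Tri-homomorphisms. The components of any extension form a tri-homomorphism which the extension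
realizes by identities (`triHom`, `triHomRealization`). The point to prove is that `C_g × C_h ⥤
C_{gh}` is a relative tensor product. By rigidity, `Hom(x ⊗ y, x' ⊗ y') ≅ Hom(x, x' ⊗ (y' ⊗ y*))`,
and `y' ⊗ y*` has degree `1`, so it comes from some `b` in `B`. Hence a morphism between products is
given by `x ⟶ b ⊙ x'`, the balancing, and a universal `b ⊙ y ⟶ y'`, and any other balanced functor
knows what to do with these (`IsGenerating`, `mulBifunctor_isGenerating`).

Equivariantization in stages. For an object `((X, φ), ψ)` the cocycle law of `τ_{nh} = φ_n ∘ n(ψ_h)`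
holds because `ψ_h` is `N`-equivariant: this moves `φ` past `ψ` at the price of a conjugation,
exactly as in the multiplication of `N ⋊ H` (`strNH_mul`). Restricting `τ` to `N` and to `H` is the
inverse construction. The equivalence is braided since, in degree `hn`, both braidings are the
`G`-braiding followed by `ψ_h ∘ h(φ_n) = τ_{hn}` (`merge_braiding`). -/

/-! ### Positive dagger categories -/

/-- Linear dagger categories with finite-dimensional morphism spaces and an antilinear, positive
definite dagger. -/
class PositiveDagger (C : Type u₁) [Category.{v₁} C] [Preadditive C] [Linear ℂ C]
    [DaggerCategory C] : Prop where
  dag_add' {X Y : C} (f g : X ⟶ Y) : dag (f + g) = dag f + dag g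
  dag_smul' {X Y : C} (c : ℂ) (f : X ⟶ Y) : dag (c • f) = starRingEnd ℂ c • dag f
  -- The form with two summands is what excludes negative eigenvalues of `f ≫ dag f` in
  -- `exists_sqrt`; with `k = 0` it is ordinary definiteness.
  definite {X Y Z : C} (f : X ⟶ Y) (k : X ⟶ Z) : f ≫ dag f + k ≫ dag k = 0 → f = 0
  finite_hom' (X Y : C) : Module.Finite ℂ (X ⟶ Y)

/-- Positive dagger categories with a zero object, orthogonal direct sums and splittings of
projections by isometries. -/
class OrthogonallyComplete (C : Type u₁) [Category.{v₁} C] [Preadditive C] [Linear ℂ C]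
    [DaggerCategory C] : Prop extends PositiveDagger C where
  exists_zero : ∃ Z : C, 𝟙 Z = 0
  exists_sum (X Y : C) : ∃ (Z : C) (i : X ⟶ Z) (j : Y ⟶ Z), i ≫ dag i = 𝟙 X ∧ j ≫ dag j = 𝟙 Y ∧
    i ≫ dag j = 0 ∧ dag i ≫ i + dag j ≫ j = 𝟙 Z
  exists_splitting {X : C} (p : X ⟶ X) : dag p = p → p ≫ p = p →
    ∃ (Y : C) (v : Y ⟶ X), v ≫ dag v = 𝟙 Y ∧ dag v ≫ v = p

section

variable {C : Type u₁} [Category.{v₁} C] [Preadditive C] [Linear ℂ C] [DaggerCategory C]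

section

variable [PositiveDagger C]

attribute [simp] PositiveDagger.dag_add' PositiveDagger.dag_smul'

instance (X Y : C) : Module.Finite ℂ (X ⟶ Y) := PositiveDagger.finite_hom' X Y

@[simp] theorem dag_zero (X Y : C) : dag (0 : X ⟶ Y) = 0 := by
  simpa using PositiveDagger.dag_smul' 0 (0 : X ⟶ Y)

@[simp] theorem dag_neg {X Y : C} (f : X ⟶ Y) : dag (-f) = -dag f := by
  simpa using PositiveDagger.dag_smul' (-1) f

@[simp] theorem dag_sub {X Y : C} (f g : X ⟶ Y) : dag (f - g) = dag f - dag g := by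
  rw [sub_eq_add_neg, PositiveDagger.dag_add', dag_neg, sub_eq_add_neg]

@[simp] theorem dag_sum {ι : Type*} (s : Finset ι) {X Y : C} (f : ι → (X ⟶ Y)) :
    dag (∑ i ∈ s, f i) = ∑ i ∈ s, dag (f i) :=
  map_sum (AddMonoidHom.mk' (fun f : X ⟶ Y => dag f) PositiveDagger.dag_add') f s

theorem eq_zero_of_comp_dag' {X Y : C} (f : X ⟶ Y) (h : f ≫ dag f = 0) : f = 0 :=
  PositiveDagger.definite f (0 : X ⟶ Y) (by simp [h])

theorem eq_zero_of_dag_comp {X Y : C} (f : X ⟶ Y) (h : dag f ≫ f = 0) : f = 0 := by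
  have := eq_zero_of_comp_dag' (dag f) (by simpa using h)
  rw [← dag_dag f, this, dag_zero]

theorem dag_comp_dag {X Y : C} (f : X ⟶ Y) : dag (f ≫ dag f) = f ≫ dag f := by
  rw [dag_comp, dag_dag]

theorem dag_injective {X Y : C} {f g : X ⟶ Y} (h : dag f = dag g) : f = g := by
  rw [← dag_dag f, h, dag_dag]

/-- The projection onto the kernel of a morphism. -/
theorem exists_kernel_projection {X Y : C} (f : X ⟶ Y) :
    ∃ q c : X ⟶ X, dag q = q ∧ q ≫ q = q ∧ q ≫ f = 0 ∧ 𝟙 X - q = f ≫ dag f ≫ c := by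
  let b : X ⟶ X := f ≫ dag f
  have hb : dag b = b := by simp [b]
  let l : (X ⟶ X) →ₗ[ℂ] (X ⟶ X) := Linear.leftComp ℂ X b
  have hl (a) : l a = b ≫ a := rfl
  -- Since `b` is self-adjoint, `l` and its square have the same kernel, so `l` is bijective on its
  -- finite-dimensional range. This yields `c` with `b ≫ b ≫ c = b`, and `𝟙 X - b ≫ c` is the
  -- projection.
  have hk (a) (h : l (l a) = 0) : l a = 0 := by
    rw [hl, hl] at h
    rw [hl]
    apply eq_zero_of_dag_comp
    rw [dag_comp, hb, Category.assoc, h, Limits.comp_zero]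
  let r : LinearMap.range l →ₗ[ℂ] LinearMap.range l := l.restrict (fun a _ => ⟨a, rfl⟩)
  have hr : Function.Injective r := by
    rw [← LinearMap.ker_eq_bot, LinearMap.ker_eq_bot']
    rintro ⟨_, a, rfl⟩ h
    exact Subtype.ext (hk a (congrArg Subtype.val h))
  obtain ⟨⟨_, c, rfl⟩, hc⟩ := LinearMap.injective_iff_surjective.1 hr ⟨l (𝟙 X), 𝟙 X, rfl⟩
  have hc' : l (l c) = l (𝟙 X) := congrArg Subtype.val hc
  have hbq : b ≫ (𝟙 X - b ≫ c) = 0 := by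
    have : l (𝟙 X - l c) = 0 := by rw [map_sub, hc', sub_self]
    exact this
  obtain ⟨q, hq⟩ : ∃ q, q = 𝟙 X - b ≫ c := ⟨_, rfl⟩
  rw [← hq] at hbq
  have hqb : dag q ≫ b = 0 := by
    rw [← hb, ← dag_comp, hbq, dag_zero]
  have hqq : dag q ≫ q = dag q := by
    conv_lhs => rw [hq]
    rw [Preadditive.comp_sub, ← Category.assoc (dag _), ← hq, hqb]
    simp
  have hq' : dag q = q := by
    have := congrArg dag hqq
    rw [dag_comp, dag_dag, hqq] at this
    exact this
  refine ⟨q, c, hq', by rw [hq'] at hqq; exact hqq, ?_, by rw [hq]; simp [b]⟩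
  apply eq_zero_of_comp_dag'
  rw [hq'] at hqb
  simp only [b] at hqb
  rw [dag_comp, Category.assoc, ← Category.assoc f, ← Category.assoc, hqb, Limits.zero_comp]

open Polynomial in
theorem dag_aeval {X : C} (b : End X) (hb : dag (b : X ⟶ X) = b) (p : ℂ[X]) :
    dag (aeval b p : X ⟶ X) = (aeval b (p.map (starRingEnd ℂ)) : End X) := by
  have hpow (n : ℕ) : dag (b ^ n : End X) = (b ^ n : End X) := by
    induction n with
    | zero => exact dag_id X
    | succ n ih =>
      conv_lhs => rw [pow_succ]
      rw [End.mul_def, dag_comp, ih, hb, ← End.mul_def, ← pow_succ']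
  induction p using Polynomial.induction_on' with
  | add p q hp hq =>
    rw [Polynomial.map_add, map_add, map_add, ← hp, ← hq]
    exact PositiveDagger.dag_add' _ _
  | monomial n c =>
    rw [map_monomial, aeval_monomial, aeval_monomial, ← Algebra.smul_def, ← Algebra.smul_def]
    refine (PositiveDagger.dag_smul' c (b ^ n : End X)).trans ?_
    rw [hpow]

open Polynomial in
/-- Positive endomorphisms have self-adjoint square roots. -/
theorem exists_sqrt {X Y : C} (f : X ⟶ Y) : ∃ s : X ⟶ X, dag s = s ∧ s ≫ s = f ≫ dag f := by
  classical
  let b : End X := f ≫ dag f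
  have hb : dag (b : X ⟶ X) = b := by simp [b]
  have hfin : Module.Finite ℂ (End X) := inferInstanceAs (Module.Finite ℂ (X ⟶ X))
  have hint : IsIntegral ℂ b := Algebra.IsIntegral.isIntegral b
  set m := minpoly ℂ b with hm
  have hm0 : m ≠ 0 := minpoly.ne_zero hint
  -- The cofactor of a root has smaller degree than the minimal polynomial, so its value at `b` is
  -- nonzero; that value serves as an eigenvector.
  have hroot (l : ℂ) (hl : l ∈ m.roots) : ∃ q : ℂ[X],
      m = (Polynomial.X - Polynomial.C l) * q ∧ aeval b q ≠ 0 := by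
    obtain ⟨q, hq⟩ := dvd_iff_isRoot.2 (isRoot_of_mem_roots hl)
    refine ⟨q, hq, fun h => ?_⟩
    have hq0 : q ≠ 0 := by rintro rfl; exact hm0 (by rw [hq, mul_zero])
    have := minpoly.degree_le_of_ne_zero ℂ b hq0 h
    rw [← hm, hq, degree_mul, degree_X_sub_C, degree_eq_natDegree hq0] at this
    norm_cast at this
    omega
  have hcoe (l : ℂ) (q : ℂ[X]) : aeval b ((Polynomial.X - Polynomial.C l) * q) = b * aeval b q - l
      • aeval b q := by
    rw [map_mul, map_sub, aeval_X, aeval_C, sub_mul, Algebra.smul_def]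
  -- For the eigenvector `c` one has `(c ≫ f) ≫ dag (c ≫ f) = l • (c ≫ dag c)`. Comparison with the
  -- adjoint makes `l` real. If `l` were negative, moving the right side over would give a vanishing
  -- sum of two squares, hence `c = 0`.
  have hreal (l : ℂ) (hl : l ∈ m.roots) : ∃ x : ℝ, 0 ≤ x ∧ l = x := by
    obtain ⟨q, hq, hne⟩ := hroot l hl
    have h0 : b * aeval b q - l • aeval b q = 0 := by
      rw [← hcoe, ← hq]; exact minpoly.aeval ℂ b
    obtain ⟨c, hc⟩ : ∃ c : X ⟶ X, c = (aeval b q : End X) := ⟨_, rfl⟩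
    have hcb : c ≫ f ≫ dag f = l • c := by
      have h1 : b * aeval b q = l • aeval b q := sub_eq_zero.1 h0
      rw [End.mul_def] at h1
      rw [hc]
      exact h1
    have hc0 : c ≠ 0 := by rw [hc]; exact hne
    have hcc : c ≫ dag c ≠ 0 := fun h => hc0 (eq_zero_of_comp_dag' c h)
    have h1 : (c ≫ f) ≫ dag (c ≫ f) = l • (c ≫ dag c) := by
      rw [dag_comp, ← Linear.smul_comp, ← hcb]; simp
    have h2 : starRingEnd ℂ l = l := by
      have h3 := congrArg dag h1
      rw [PositiveDagger.dag_smul', dag_comp_dag, dag_comp_dag, h1] at h3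
      exact (smul_left_injective ℂ hcc h3).symm
    obtain ⟨x, rfl⟩ := Complex.conj_eq_iff_real.1 h2
    refine ⟨x, ?_, rfl⟩
    by_contra! hx
    apply hc0
    have h4 : ((Real.sqrt (-x) : ℂ) • c) = 0 := by
      refine PositiveDagger.definite _ (c ≫ f) ?_
      rw [h1, PositiveDagger.dag_smul', Linear.smul_comp, Linear.comp_smul, smul_smul,
        Complex.conj_ofReal, ← Complex.ofReal_mul, Real.mul_self_sqrt (by linarith), ← add_smul]
      simp
    rcases smul_eq_zero.1 h4 with h5 | h5
    · rw [Complex.ofReal_eq_zero, Real.sqrt_eq_zero'] at h5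
      linarith
    · exact h5
  -- A double root `x` would give `c ≫ d ≫ d = 0` with `d = b - x` self-adjoint and `c ≫ d ≠ 0` by
  -- minimality, but definiteness forces `c ≫ d = 0`.
  have hnodup : m.roots.Nodup := by
    rw [Multiset.nodup_iff_count_le_one]
    intro l
    by_contra! hl
    rw [count_roots] at hl
    have hl' : l ∈ m.roots := by
      rw [← Multiset.count_pos, count_roots]; omega
    obtain ⟨q, hq⟩ := (le_rootMultiplicity_iff hm0).1 hl
    have hq1 : m = (Polynomial.X - Polynomial.C l) * ((Polynomial.X - Polynomial.C l) * q) :=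
        by rw [hq]; ring
    have hq0 : q ≠ 0 := by rintro rfl; exact hm0 (by rw [hq, mul_zero])
    have hne : aeval b ((Polynomial.X - Polynomial.C l) * q) ≠ 0 := by
      intro h
      have hq2 : (Polynomial.X - Polynomial.C l) * q ≠ 0 := mul_ne_zero (X_sub_C_ne_zero l) hq0
      have := minpoly.degree_le_of_ne_zero ℂ b hq2 h
      rw [← hm, hq1, degree_mul (q := (Polynomial.X - Polynomial.C l) * q), degree_X_sub_C,
        degree_eq_natDegree hq2] at this
      norm_cast at this
      omega
    apply hne
    obtain ⟨x, -, rfl⟩ := hreal l hl'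
    obtain ⟨d, hd⟩ : ∃ d : X ⟶ X, d = (f ≫ dag f) - (x : ℂ) • 𝟙 X := ⟨_, rfl⟩
    have hd' : dag d = d := by
      rw [hd, dag_sub, PositiveDagger.dag_smul', dag_id, Complex.conj_ofReal, dag_comp_dag]
    obtain ⟨c, hc⟩ : ∃ c : X ⟶ X, c = (aeval b q : End X) := ⟨_, rfl⟩
    have h1 : (aeval b ((Polynomial.X - Polynomial.C (x : ℂ)) * q) : End X) = c ≫ d := by
      rw [hcoe, End.mul_def, hd, hc, Preadditive.comp_sub, Linear.comp_smul, Category.comp_id]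
    have h2 : c ≫ d ≫ d = 0 := by
      have h3 : aeval b m = 0 := minpoly.aeval ℂ b
      rw [hq1, hcoe, h1, End.mul_def] at h3
      rw [← Category.assoc]
      conv_lhs => arg 2; rw [hd]
      rw [Preadditive.comp_sub, Linear.comp_smul, Category.comp_id]
      exact h3
    rw [h1]
    apply eq_zero_of_comp_dag'
    rw [dag_comp, hd', Category.assoc, ← Category.assoc d, ← Category.assoc, h2,
      Limits.zero_comp]
  have hdvd (p : ℂ[X]) (hp : ∀ l ∈ m.roots, p.eval l = 0) : aeval b p = 0 := by
    by_cases hp0 : p = 0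
    · simp [hp0]
    have h1 : m ∣ p := by
      rw [(IsAlgClosed.splits m).eq_prod_roots_of_monic (minpoly.monic hint),
        Multiset.prod_X_sub_C_dvd_iff_le_roots hp0, Multiset.le_iff_subset hnodup]
      intro l hl
      exact (mem_roots hp0).2 (hp l hl)
    obtain ⟨q, rfl⟩ := h1
    rw [map_mul, hm, minpoly.aeval, zero_mul]
  -- The roots are simple, real and nonnegative, so polynomial identities in `b` need only be
  -- checked there, and interpolating the square root at the roots is enough.
  let p : ℂ[X] := Lagrange.interpolate m.roots.toFinset id
    (fun l => ((Real.sqrt l.re : ℝ) : ℂ))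
  have hp (l : ℂ) (hl : l ∈ m.roots) : p.eval l = (Real.sqrt l.re : ℝ) :=
    Lagrange.eval_interpolate_at_node (v := id) _ Function.injective_id.injOn
      (Multiset.mem_toFinset.2 hl)
  refine ⟨(aeval b p : End X), ?_, ?_⟩
  · rw [dag_aeval b hb, ← sub_eq_zero]
    refine (map_sub (aeval b) (p.map (starRingEnd ℂ)) p).symm.trans (hdvd _ ?_)
    intro l hl
    have h1 := hp l hl
    obtain ⟨x, hx, rfl⟩ := hreal l hl
    have h2 : (p.map (starRingEnd ℂ)).eval (x : ℂ) = starRingEnd ℂ (p.eval (x : ℂ)) := by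
      have := eval_map_apply (starRingEnd ℂ) (p := p) (x : ℂ)
      rwa [Complex.conj_ofReal] at this
    rw [eval_sub, h2, h1, Complex.conj_ofReal, sub_self]
  · have h1 : aeval b (p * p - Polynomial.X) = 0 := by
      apply hdvd
      intro l hl
      have h1 := hp l hl
      obtain ⟨x, hx, rfl⟩ := hreal l hl
      rw [eval_sub, eval_mul, h1, eval_X, Complex.ofReal_re, ← Complex.ofReal_mul,
        Real.mul_self_sqrt hx, sub_self]
    rw [map_sub, map_mul, aeval_X, sub_eq_zero] at h1
    exact h1

/-- A monomorphism becomes an isometry after composition with a self-adjoint automorphism. -/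
theorem exists_isometry_of_mono {X Y : C} (f : X ⟶ Y) [Mono f] :
    ∃ t : X ≅ X, (t.hom ≫ f) ≫ dag (t.hom ≫ f) = 𝟙 X := by
  obtain ⟨q, c, hq, hqq, hqf, hc⟩ := exists_kernel_projection f
  obtain rfl : q = 0 := by rw [← cancel_mono f, hqf, Limits.zero_comp]
  -- Polar decomposition: because the kernel projection vanishes, `s` is invertible with inverse `s
  -- ≫ c`, and this inverse followed by `f` is an isometry.
  obtain ⟨s, hs, hss⟩ := exists_sqrt f
  rw [sub_zero, ← Category.assoc, ← hss, Category.assoc] at hc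
  have hc' : (dag c ≫ s) ≫ s = 𝟙 X := by
    have := congrArg dag hc
    rw [dag_id, dag_comp, dag_comp, hs] at this
    exact this.symm
  have hcc : dag c ≫ s = s ≫ c := by
    rw [← Category.comp_id (dag c ≫ s), hc, ← Category.assoc, hc', Category.id_comp]
  have h1 : (s ≫ c) ≫ s = 𝟙 X := by rw [← hcc, hc']
  refine ⟨⟨s ≫ c, s, h1, hc.symm⟩, ?_⟩
  dsimp only
  have h2 : dag (s ≫ c) = s ≫ c := by rw [dag_comp, hs, hcc]
  rw [dag_comp, h2, Category.assoc, ← Category.assoc f, ← hss, Category.assoc s s, ← hc,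
    Category.comp_id, h1]

/-- Isomorphic objects are unitarily isomorphic. -/
theorem exists_unitary_of_iso {X Y : C} (e : X ≅ Y) : ∃ u : X ≅ Y, IsUnitary u.hom := by
  obtain ⟨t, ht⟩ := exists_isometry_of_mono e.hom
  refine ⟨t ≪≫ e, ht, ?_⟩
  have : dag (t.hom ≫ e.hom) = e.inv ≫ t.inv := by
    rw [← cancel_epi (t.hom ≫ e.hom), ht]; simp
  rw [Iso.trans_hom, this]; simp

theorem exists_retraction_of_mono {X Y : C} (f : X ⟶ Y) [Mono f] : ∃ r : Y ⟶ X, f ≫ r = 𝟙 X := by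
  obtain ⟨q, c, hq, hqq, hqf, hc⟩ := exists_kernel_projection f
  obtain rfl : q = 0 := by rw [← cancel_mono f, hqf, Limits.zero_comp]
  exact ⟨dag f ≫ c, by rw [← hc, sub_zero]⟩

theorem mono_dag {X Y : C} (f : X ⟶ Y) [Epi f] : Mono (dag f) :=
  ⟨fun g h e => dag_injective (by
    rw [← cancel_epi f, ← dag_dag f, ← dag_comp, ← dag_comp, e])⟩

theorem exists_section_of_epi {X Y : C} (f : X ⟶ Y) [Epi f] : ∃ s : Y ⟶ X, s ≫ f = 𝟙 Y := by
  have := mono_dag f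
  obtain ⟨r, hr⟩ := exists_retraction_of_mono (dag f)
  exact ⟨dag r, by rw [← dag_id, ← hr, dag_comp, dag_dag]⟩

end

end

/-! ### Orthogonal direct sums -/

/-- The data exhibiting `X` as the orthogonal direct sum of a finite family `Y`. -/
structure OrthoSum {C : Type u₁} [Category.{v₁} C] [Preadditive C] [DaggerCategory C]
    {ι : Type t} [Fintype ι] (Y : ι → C) (X : C) where
  incl (i : ι) : Y i ⟶ X
  incl_dag_self (i : ι) : incl i ≫ dag (incl i) = 𝟙 (Y i)
  incl_dag_ne (i j : ι) : i ≠ j → incl i ≫ dag (incl j) = 0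
  total : ∑ i, dag (incl i) ≫ incl i = 𝟙 X

attribute [simp] OrthoSum.incl_dag_self

section

variable {C : Type u₁} [Category.{v₁} C] [Preadditive C] [Linear ℂ C] [DaggerCategory C]

namespace OrthoSum

/-- The direct sum underlying an orthogonal direct sum. -/
def toDirectSum {ι : Type} [Fintype ι] {Y : ι → C} {X : C} (D : OrthoSum Y X) :
    DirectSum Y X where
  incl := D.incl
  proj i := dag (D.incl i)
  incl_proj_self := D.incl_dag_self
  incl_proj_ne := D.incl_dag_ne
  total := D.total

theorem hom_ext {ι : Type t} [Fintype ι] {Y : ι → C} {X Z : C} (D : OrthoSum Y X) {f g : X ⟶ Z}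
    (h : ∀ i, D.incl i ≫ f = D.incl i ≫ g) : f = g := by
  rw [← Category.id_comp f, ← Category.id_comp g, ← D.total, Preadditive.sum_comp,
    Preadditive.sum_comp]
  exact Finset.sum_congr rfl fun i _ => by rw [Category.assoc, h, Category.assoc]

theorem incl_comp_sum {ι : Type t} [Fintype ι] {Y : ι → C} {X Z : C} (D : OrthoSum Y X)
    (f : ∀ i, Y i ⟶ Z) (i : ι) : D.incl i ≫ ∑ j, dag (D.incl j) ≫ f j = f i := by
  rw [Preadditive.comp_sum, Finset.sum_eq_single i, ← Category.assoc, D.incl_dag_self,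
    Category.id_comp]
  · intro j _ hj
    rw [← Category.assoc, D.incl_dag_ne i j hj.symm, Limits.zero_comp]
  · simp

/-- Reindexing. -/
def reindex {ι : Type t} [Fintype ι] {κ : Type w₁} [Fintype κ] (e : κ ≃ ι) {Y : ι → C} {X : C}
    (D : OrthoSum Y X) : OrthoSum (fun k => Y (e k)) X where
  incl k := D.incl (e k)
  incl_dag_self _ := D.incl_dag_self _
  incl_dag_ne _ _ h := D.incl_dag_ne _ _ (fun h' => h (e.injective h'))
  total := (e.sum_comp fun i => dag (D.incl i) ≫ D.incl i).trans D.total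

end OrthoSum

theorem DirectSum.hom_ext {ι : Type} [Fintype ι] {Y : ι → C} {X Z : C} (D : DirectSum Y X)
    {f g : X ⟶ Z} (h : ∀ i, D.incl i ≫ f = D.incl i ≫ g) : f = g := by
  rw [← Category.id_comp f, ← Category.id_comp g, ← D.total, Preadditive.sum_comp,
    Preadditive.sum_comp]
  exact Finset.sum_congr rfl fun i _ => by rw [Category.assoc, h, Category.assoc]

theorem DirectSum.hom_ext' {ι : Type} [Fintype ι] {Y : ι → C} {X Z : C} (D : DirectSum Y X)
    {f g : Z ⟶ X} (h : ∀ i, f ≫ D.proj i = g ≫ D.proj i) : f = g := by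
  rw [← Category.comp_id f, ← Category.comp_id g, ← D.total, Preadditive.comp_sum,
    Preadditive.comp_sum]
  exact Finset.sum_congr rfl fun i _ => by rw [← Category.assoc, h, Category.assoc]

/-! ### Finite semisimplicity of orthogonally complete categories -/

section

variable [OrthogonallyComplete C]

theorem exists_orthoSum {ι : Type t} [Fintype ι] (Y : ι → C) :
    ∃ X, Nonempty (OrthoSum Y X) := by
  revert Y
  suffices h : ∀ (ι : Type t) [Finite ι] (_ : Fintype ι) (Y : ι → C), ∃ X,
      Nonempty (OrthoSum Y X) by
    exact h ι _
  intro ι _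
  induction ι using Finite.induction_empty_option with
  | @of_equiv α β e ih =>
    intro _ Y
    let hα : Fintype α := Fintype.ofEquiv β e.symm
    obtain ⟨X, ⟨D⟩⟩ := ih hα (fun a => Y (e a))
    refine ⟨X, ⟨?_⟩⟩
    have := D.reindex e.symm
    simpa only [Equiv.apply_symm_apply] using this
  | h_empty =>
    intro _ Y
    obtain ⟨Z, hZ⟩ := OrthogonallyComplete.exists_zero (C := C)
    exact ⟨Z, ⟨⟨fun i => i.elim, fun i => i.elim, fun i => i.elim, by rw [hZ]; simp⟩⟩⟩
  | @h_option α _ ih =>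
    intro hF Y
    obtain rfl : hF = instFintypeOption := Subsingleton.elim _ _
    obtain ⟨X, ⟨D⟩⟩ := ih inferInstance (fun a => Y (some a))
    obtain ⟨Z, i, j, hi, hj, hij, h⟩ := OrthogonallyComplete.exists_sum X (Y none)
    have hji : j ≫ dag i = 0 := by
      have := congrArg dag hij
      simpa using this
    refine ⟨Z, ⟨⟨fun a => a.casesOn j fun a => D.incl a ≫ i, ?_, ?_, ?_⟩⟩⟩
    · rintro (_ | a)
      · exact hj
      · dsimp only
        rw [dag_comp, Category.assoc, ← Category.assoc i, hi, Category.id_comp, D.incl_dag_self]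
    · rintro (_ | a) (_ | b) hab
      · exact (hab rfl).elim
      · dsimp only
        rw [dag_comp, ← Category.assoc, hji, Limits.zero_comp]
      · dsimp only
        rw [Category.assoc, hij, Limits.comp_zero]
      · dsimp only
        rw [dag_comp, Category.assoc, ← Category.assoc i, hi, Category.id_comp,
          D.incl_dag_ne _ _ (fun h => hab (congrArg _ h))]
    · rw [Fintype.sum_option, add_comm, ← h]
      congr 1
      dsimp only
      simp only [dag_comp, Category.assoc]
      rw [← Preadditive.comp_sum]
      simp only [← Category.assoc (dag _) _ i]
      rw [← Preadditive.sum_comp, D.total, Category.id_comp]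

/-- Splitting the kernel projection `q` gives the isometry. Since `𝟙 X - q` factors through `f` on
the left, a morphism killed by `f` is fixed by `q`. -/
theorem exists_kernel {X Y : C} (f : X ⟶ Y) :
    ∃ (K : C) (v : K ⟶ X), v ≫ dag v = 𝟙 K ∧ v ≫ f = 0 ∧
      ∀ {Z : C} (k : Z ⟶ X), k ≫ f = 0 → k ≫ dag v ≫ v = k := by
  obtain ⟨q, c, hq, hqq, hqf, hc⟩ := exists_kernel_projection f
  obtain ⟨K, v, hv, hv'⟩ := OrthogonallyComplete.exists_splitting q hq hqq
  refine ⟨K, v, hv, ?_, fun k hk => ?_⟩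
  · rw [← Category.id_comp v, ← hv, Category.assoc, Category.assoc, ← Category.assoc (dag v), hv',
      hqf, Limits.comp_zero]
  · have : k ≫ (𝟙 X - q) = 0 := by rw [hc, ← Category.assoc, hk, Limits.zero_comp]
    rw [Preadditive.comp_sub, Category.comp_id, sub_eq_zero] at this
    rw [hv', ← this]

theorem hasKernels_of_orthogonallyComplete : Limits.HasKernels C where
  has_limit {X Y} f := by
    obtain ⟨K, v, hv, hvf, h⟩ := exists_kernel f
    refine Limits.HasLimit.mk ⟨Limits.KernelFork.ofι v hvf, Limits.KernelFork.IsLimit.ofι v hvf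
      (fun k _ => k ≫ dag v) (fun k hk => by rw [Category.assoc, h k hk]) (fun k _ m hm => ?_)⟩
    rw [← hm, Category.assoc, hv, Category.comp_id]

/-- The adjoint of a kernel of `dag f` is a cokernel of `f`. -/
theorem hasCokernels_of_orthogonallyComplete : Limits.HasCokernels C where
  has_colimit {X Y} f := by
    obtain ⟨K, v, hv, hvf, h⟩ := exists_kernel (dag f)
    have hfv : f ≫ dag v = 0 := dag_injective (by simpa using hvf)
    refine Limits.HasColimit.mk ⟨Limits.CokernelCofork.ofπ (dag v) hfv,
      Limits.CokernelCofork.IsColimit.ofπ (dag v) hfv (fun k _ => v ≫ k) (fun k hk => ?_)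
      (fun k _ m hm => ?_)⟩
    · apply dag_injective
      rw [dag_comp, dag_comp, dag_dag, Category.assoc]
      exact h _ (by rw [← dag_comp, hk, dag_zero])
    · rw [← hm, ← Category.assoc, hv, Category.id_comp]

theorem hasFiniteProducts_of_orthogonallyComplete : Limits.HasFiniteProducts C := by
  have h₁ : Limits.HasBinaryBiproducts C := ⟨fun X Y => by
    obtain ⟨Z, i, j, hi, hj, hij, h⟩ := OrthogonallyComplete.exists_sum X Y
    have hji : j ≫ dag i = 0 := by
      have := congrArg dag hij
      simpa using this
    exact Limits.hasBinaryBiproduct_of_total ⟨Z, dag i, dag j, i, j, hi, hij, hji, hj⟩ h⟩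
  have h₂ : Limits.HasTerminal C := by
    obtain ⟨Z, hZ⟩ := OrthogonallyComplete.exists_zero (C := C)
    exact ((Limits.IsZero.iff_id_eq_zero Z).2 hZ).isTerminal.hasTerminal
  exact hasFiniteProducts_of_has_binary_and_terminal

/-- A monomorphism has a retraction `r`, so it is the kernel of `𝟙 Y - r ≫ f`. -/
theorem isNormalMonoCategory_of_positiveDagger : IsNormalMonoCategory C where
  normalMonoOfMono {X Y} f _ := by
    obtain ⟨r, hr⟩ := exists_retraction_of_mono f
    have hw : f ≫ (𝟙 Y - r ≫ f) = 0 := by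
      rw [Preadditive.comp_sub, ← Category.assoc, hr, Category.id_comp, Category.comp_id, sub_self]
    refine ⟨⟨Y, 𝟙 Y - r ≫ f, hw, Limits.KernelFork.IsLimit.ofι f hw (fun k _ => k ≫ r)
      (fun k hk => ?_) (fun k _ m hm => ?_)⟩⟩
    · rw [Preadditive.comp_sub, Category.comp_id, sub_eq_zero] at hk
      rw [Category.assoc, ← hk]
    · rw [← hm, Category.assoc, hr, Category.comp_id]

theorem isNormalEpiCategory_of_positiveDagger : IsNormalEpiCategory C where
  normalEpiOfEpi {X Y} f _ := by
    obtain ⟨s, hs⟩ := exists_section_of_epi f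
    have hw : (𝟙 X - f ≫ s) ≫ f = 0 := by
      rw [Preadditive.sub_comp, Category.assoc, hs, Category.id_comp, Category.comp_id, sub_self]
    refine ⟨⟨X, 𝟙 X - f ≫ s, hw, Limits.CokernelCofork.IsColimit.ofπ f hw (fun k _ => s ≫ k)
      (fun k hk => ?_) (fun k _ m hm => ?_)⟩⟩
    · rw [Preadditive.sub_comp, Category.id_comp, sub_eq_zero] at hk
      rw [← Category.assoc, ← hk]
    · rw [← hm, ← Category.assoc, hs, Category.id_comp]

/-- Conjugation by `v` embeds `End Y` in `End X`, and its image contains the identity only if `dag v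
≫ v = 𝟙 X`. This is the descent for `exists_orthoSum_simple`. -/
theorem finrank_end_lt {X Y : C} (v : Y ⟶ X) (hv : v ≫ dag v = 𝟙 Y) (hv' : dag v ≫ v ≠ 𝟙 X) :
    Module.finrank ℂ (Y ⟶ Y) < Module.finrank ℂ (X ⟶ X) := by
  let l : (Y ⟶ Y) →ₗ[ℂ] (X ⟶ X) :=
    (Linear.rightComp ℂ X v).comp (Linear.leftComp ℂ Y (dag v))
  have hl (a) : l a = dag v ≫ a ≫ v := by simp [l]
  have hinj : Function.Injective l := by
    intro a a' h
    rw [hl, hl] at h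
    have h' := congrArg (fun k => v ≫ k ≫ dag v) h
    simp only [Category.assoc, hv, Category.comp_id] at h'
    simpa only [← Category.assoc, hv, Category.id_comp] using h'
  rw [← LinearMap.finrank_range_of_inj hinj]
  apply Submodule.finrank_lt
  intro htop
  obtain ⟨a, ha⟩ : 𝟙 X ∈ LinearMap.range l := by rw [htop]; trivial
  rw [hl] at ha
  apply hv'
  have : (dag v ≫ v) ≫ 𝟙 X = 𝟙 X := by
    rw [← ha, Category.assoc, ← Category.assoc v, hv, Category.id_comp]
  rwa [Category.comp_id] at this

/-- Induction on the dimension of `End X`. A nontrivial projection cuts `X` into two orthogonal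
pieces with smaller endomorphism algebras. If there is none, `X` is zero or simple: for a nonzero
monomorphism `f` into `X`, the kernel projection of `dag f` cannot be the identity, hence is zero,
and this provides a section of `f`. -/
theorem exists_orthoSum_simple (X : C) : ∃ (ι : Type) (_ : Fintype ι) (S : ι → C),
    (∀ i, Simple (S i)) ∧ Nonempty (OrthoSum S X) := by
  induction h : Module.finrank ℂ (X ⟶ X) using Nat.strong_induction_on generalizing X with
  | _ n ih =>
    subst h
    by_cases h0 : 𝟙 X = 0
    · exact ⟨Empty, inferInstance, Empty.elim, fun i => i.elim,
        ⟨⟨fun i => i.elim, fun i => i.elim, fun i => i.elim, by simp [h0]⟩⟩⟩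
    by_cases hp : ∃ p : X ⟶ X, dag p = p ∧ p ≫ p = p ∧ p ≠ 0 ∧ p ≠ 𝟙 X
    · obtain ⟨p, hp, hpp, hp0, hp1⟩ := hp
      obtain ⟨Y, v, hv, hv'⟩ := OrthogonallyComplete.exists_splitting p hp hpp
      obtain ⟨Z, w, hw, hw'⟩ := OrthogonallyComplete.exists_splitting (𝟙 X - p) (by simp [hp])
        (by simp [hpp])
      obtain ⟨ι, _, S, hS, ⟨D⟩⟩ := ih _ (finrank_end_lt v hv (hv'.trans_ne hp1)) Y rfl
      obtain ⟨κ, _, T, hT, ⟨D'⟩⟩ := ih _ (finrank_end_lt w hw (hw'.trans_ne (by simpa using hp0)))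
        Z rfl
      have hvw : v ≫ dag w = 0 := by
        have h1 : v ≫ p = v := by rw [← hv', ← Category.assoc, hv, Category.id_comp]
        have h2 : v ≫ (𝟙 X - p) = 0 := by rw [Preadditive.comp_sub, h1, Category.comp_id, sub_self]
        rw [← hw'] at h2
        rw [← Category.comp_id (dag w), ← hw, ← Category.assoc, ← Category.assoc,
          Category.assoc v, h2, Limits.zero_comp]
      have hwv : w ≫ dag v = 0 := by
        have := congrArg dag hvw
        simpa using this
      refine ⟨ι ⊕ κ, inferInstance, Sum.elim S T, by rintro (i | i) <;> simp [hS, hT], ⟨⟨?_, ?_,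
          ?_, ?_⟩⟩⟩
      · exact fun i => i.casesOn (fun i => D.incl i ≫ v) (fun i => D'.incl i ≫ w)
      · rintro (i | i)
        · change (D.incl i ≫ v) ≫ dag (D.incl i ≫ v) = 𝟙 (S i)
          rw [dag_comp, Category.assoc, ← Category.assoc v, hv, Category.id_comp, D.incl_dag_self]
        · change (D'.incl i ≫ w) ≫ dag (D'.incl i ≫ w) = 𝟙 (T i)
          rw [dag_comp, Category.assoc, ← Category.assoc w, hw, Category.id_comp, D'.incl_dag_self]
      · rintro (i | i) (j | j) hij
        · change (D.incl i ≫ v) ≫ dag (D.incl j ≫ v) = 0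
          rw [dag_comp, Category.assoc, ← Category.assoc v, hv, Category.id_comp,
            D.incl_dag_ne _ _ fun h => hij (congrArg _ h)]
        · change (D.incl i ≫ v) ≫ dag (D'.incl j ≫ w) = 0
          rw [dag_comp, Category.assoc, ← Category.assoc v, hvw, Limits.zero_comp,
            Limits.comp_zero]
        · change (D'.incl i ≫ w) ≫ dag (D.incl j ≫ v) = 0
          rw [dag_comp, Category.assoc, ← Category.assoc w, hwv, Limits.zero_comp,
            Limits.comp_zero]
        · change (D'.incl i ≫ w) ≫ dag (D'.incl j ≫ w) = 0
          rw [dag_comp, Category.assoc, ← Category.assoc w, hw, Category.id_comp,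
            D'.incl_dag_ne _ _ fun h => hij (congrArg _ h)]
      · rw [Fintype.sum_sum_type]
        change ∑ a, dag (D.incl a ≫ v) ≫ D.incl a ≫ v +
          ∑ a, dag (D'.incl a ≫ w) ≫ D'.incl a ≫ w = 𝟙 X
        simp only [dag_comp, Category.assoc]
        rw [← Preadditive.comp_sum, ← Preadditive.comp_sum]
        simp only [← Category.assoc (dag _) _ v, ← Category.assoc (dag _) _ w]
        rw [← Preadditive.sum_comp, D.total, ← Preadditive.sum_comp, D'.total, Category.id_comp,
          Category.id_comp, hv', hw', add_sub_cancel]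
    · push Not at hp
      refine ⟨Unit, inferInstance, fun _ => X, fun _ => ⟨fun {Y} (f : Y ⟶ X) hf => ⟨?_, ?_⟩⟩,
        ⟨⟨fun _ => 𝟙 X, by simp, fun i j h => (h rfl).elim, by simp⟩⟩⟩
      · rintro hi rfl
        apply h0
        rw [← IsIso.inv_hom_id (0 : Y ⟶ X), Limits.comp_zero]
      · intro hf0
        obtain ⟨q, c, hq, hqq, hqf, hc⟩ := exists_kernel_projection (dag f)
        change 𝟙 X - q = _ at hc
        rw [dag_dag] at hc
        by_cases hq0 : q = 0
        · rw [hq0, sub_zero] at hc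
          have hc' := congrArg dag hc
          rw [dag_id, dag_comp, dag_comp, dag_dag] at hc'
          have : IsSplitEpi f := ⟨⟨⟨_, hc'.symm⟩⟩⟩
          exact isIso_of_mono_of_isSplitEpi f
        · exfalso
          rw [hp q hq hqq hq0, Category.id_comp] at hqf
          apply hf0
          rw [← dag_dag f, hqf, dag_zero]

theorem cStarCategory_of_positiveDagger : CStarCategory C where
  dag_add := PositiveDagger.dag_add'
  dag_smul := PositiveDagger.dag_smul'
  comp_dag_positive f := by
    obtain ⟨s, hs, hss⟩ := exists_sqrt f
    exact ⟨s, by rw [hs, hss]⟩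
  eq_zero_of_comp_dag := eq_zero_of_comp_dag'

/-- An orthogonally complete category is finite semisimple if its simple objects are detected by
finitely many objects. -/
theorem isFiniteSemisimple_of_detecting {κ : Type t} [Finite κ] (W : κ → C)
    (hW : ∀ X : C, Simple X → ∃ (k : κ) (f : X ⟶ W k), f ≠ 0) : IsFiniteSemisimple C where
  hasFiniteProducts := hasFiniteProducts_of_orthogonallyComplete
  hasKernels := hasKernels_of_orthogonallyComplete
  hasCokernels := hasCokernels_of_orthogonallyComplete
  normalMono := isNormalMonoCategory_of_positiveDagger
  normalEpi := isNormalEpiCategory_of_positiveDagger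
  finite_hom := PositiveDagger.finite_hom'
  semisimple X := by
    obtain ⟨ι, _, S, hS, ⟨D⟩⟩ := exists_orthoSum_simple X
    exact ⟨ι, _, S, hS, ⟨D.toDirectSum⟩⟩
  finite_simples := by
    have := hasKernels_of_orthogonallyComplete (C := C)
    have hd := fun k => exists_orthoSum_simple (W k)
    choose ι _ S hS D using hd
    -- A simple object with a nonzero morphism to some `W k` has a nonzero component into one of its
    -- simple summands, so by Schur's lemma these summands exhaust the isomorphism classes.
    obtain ⟨n, ⟨e⟩⟩ := Finite.exists_equiv_fin (Σ k, ι k)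
    refine ⟨n, fun i => S (e.symm i).1 (e.symm i).2, fun X hX => ?_⟩
    obtain ⟨k, f, hf⟩ := hW X hX
    have : ∃ i, f ≫ dag ((D k).some.incl i) ≠ 0 := by
      by_contra! h
      apply hf
      rw [← Category.comp_id f, ← (D k).some.total, Preadditive.comp_sum]
      exact Finset.sum_eq_zero fun i _ => by rw [← Category.assoc, h, Limits.zero_comp]
    obtain ⟨i, hi⟩ := this
    have := hS k i
    have := isIso_of_hom_simple hi
    exact ⟨e ⟨k, i⟩, ⟨asIso (f ≫ dag ((D k).some.incl i)) ≪≫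
      eqToIso (by dsimp only; rw [e.symm_apply_apply])⟩⟩

end

/-! ### Unitary fusion categories are orthogonally complete -/

section

variable [CStarCategory C] [IsFiniteSemisimple C]

/-- By Schur's lemma the element `a` with `f ≫ dag f = a ≫ dag a` is a scalar, so `f ≫ dag f` is a
nonnegative real multiple of the identity, and two such multiples cancel only if both vanish. -/
theorem CStarCategory.definite_of_simple {S Y Z : C} [Simple S] (f : S ⟶ Y) (k : S ⟶ Z)
    (h : f ≫ dag f + k ≫ dag k = 0) : f = 0 := by
  have := IsFiniteSemisimple.hasKernels (C := C)
  have := IsFiniteSemisimple.finite_hom S S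
  have key {Y : C} (f : S ⟶ Y) : ∃ x : ℝ, 0 ≤ x ∧ f ≫ dag f = (x : ℂ) • 𝟙 S := by
    obtain ⟨a, ha⟩ := CStarCategory.comp_dag_positive f
    obtain ⟨c, rfl⟩ := endomorphism_simple_eq_smul_id ℂ a
    refine ⟨Complex.normSq c, Complex.normSq_nonneg c, ?_⟩
    rw [ha, CStarCategory.dag_smul, dag_id, Linear.smul_comp, Linear.comp_smul, smul_smul,
      Category.comp_id, Complex.mul_conj]
  obtain ⟨x, hx, hf⟩ := key f
  obtain ⟨y, hy, hk⟩ := key k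
  rw [hf, hk, ← add_smul, smul_eq_zero_iff_left (id_nonzero S), ← Complex.ofReal_add,
    Complex.ofReal_eq_zero] at h
  apply CStarCategory.eq_zero_of_comp_dag
  rw [hf, (by linarith : x = 0)]
  simp

/-- Definiteness can be tested after restriction along the inclusions of simple summands, which need
not be orthogonal. -/
instance : PositiveDagger C where
  dag_add' := CStarCategory.dag_add
  dag_smul' := CStarCategory.dag_smul
  finite_hom' := IsFiniteSemisimple.finite_hom
  definite {X Y Z} f k h := by
    obtain ⟨ι, _, S, hS, ⟨D⟩⟩ := IsFiniteSemisimple.semisimple X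
    refine D.hom_ext fun i => ?_
    have := hS i
    rw [Limits.comp_zero]
    apply CStarCategory.definite_of_simple (D.incl i ≫ f) (D.incl i ≫ k)
    have h' := congrArg (fun q => D.incl i ≫ q ≫ dag (D.incl i)) h
    simpa using h'

/-- The inclusion of the kernel of `𝟙 X - p` is made isometric by polar decomposition. The
projections `dag v ≫ v` and `p` then have the same image, and taking adjoints shows that they agree.
-/
theorem exists_splitting_of_hasKernels [Limits.HasKernels C] {X : C} (p : X ⟶ X) (hp : dag p = p)
    (hpp : p ≫ p = p) : ∃ (Y : C) (v : Y ⟶ X), v ≫ dag v = 𝟙 Y ∧ dag v ≫ v = p := by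
  have hz : p ≫ (𝟙 X - p) = 0 := by simp [hpp]
  let i := Limits.kernel.ι (𝟙 X - p)
  let r := Limits.kernel.lift (𝟙 X - p) p hz
  have hri : r ≫ i = p := Limits.kernel.lift_ι _ _ _
  have hip : i ≫ p = i := by
    have : i ≫ (𝟙 X - p) = 0 := Limits.kernel.condition _
    rw [Preadditive.comp_sub, Category.comp_id, sub_eq_zero] at this
    exact this.symm
  obtain ⟨s, hs⟩ := exists_isometry_of_mono i
  obtain ⟨v, hv⟩ : ∃ v, v = s.hom ≫ i := ⟨_, rfl⟩
  rw [← hv] at hs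
  refine ⟨_, v, hs, ?_⟩
  have h1 : (dag v ≫ v) ≫ p = dag v ≫ v := by rw [hv, Category.assoc, Category.assoc, hip]
  have h2 : p ≫ dag v ≫ v = p := by
    have : p = r ≫ s.inv ≫ v := by rw [hv, s.inv_hom_id_assoc, hri]
    calc p ≫ dag v ≫ v = (r ≫ s.inv ≫ v) ≫ dag v ≫ v := by rw [← this]
      _ = r ≫ s.inv ≫ (v ≫ dag v) ≫ v := by simp only [Category.assoc]
      _ = p := by rw [hs, Category.id_comp, ← this]
  have h3 := congrArg dag h2
  rw [dag_comp, dag_comp, dag_dag, hp, h1] at h3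
  exact h3

/-- A biproduct need not be orthogonal. As in Gram–Schmidt, the inclusion of `X` is made isometric,
its orthogonal complement is split off, and the resulting isomorphism of `Y` with the complement is
replaced by a unitary one. -/
instance : OrthogonallyComplete C where
  exists_zero := by
    have := IsFiniteSemisimple.hasFiniteProducts (C := C)
    exact ⟨⊤_ C, Limits.terminal.hom_ext _ _⟩
  exists_sum X Y := by
    have := IsFiniteSemisimple.hasFiniteProducts (C := C)
    have := IsFiniteSemisimple.hasKernels (C := C)
    have := Limits.HasBinaryBiproducts.of_hasBinaryProducts (C := C)
    obtain ⟨s, hs⟩ := exists_isometry_of_mono (Limits.biprod.inl : X ⟶ X ⊞ Y)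
    obtain ⟨v, hv⟩ : ∃ v, v = s.hom ≫ (Limits.biprod.inl : X ⟶ X ⊞ Y) := ⟨_, rfl⟩
    rw [← hv] at hs
    have hvv : (dag v ≫ v) ≫ dag v ≫ v = dag v ≫ v := by
      rw [Category.assoc, ← Category.assoc v, hs, Category.id_comp]
    obtain ⟨K, w, hw, hw'⟩ := exists_splitting_of_hasKernels (𝟙 _ - dag v ≫ v) (by simp)
      (by simp [-Category.assoc, hvv])
    have hwv : w ≫ dag v = 0 := by
      have h : w ≫ (𝟙 _ - dag v ≫ v) = w := by rw [← hw', ← Category.assoc, hw, Category.id_comp]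
      rw [Preadditive.comp_sub, Category.comp_id, sub_eq_self] at h
      rw [← Category.comp_id (dag v), ← hs, ← Category.assoc, ← Category.assoc,
        Category.assoc w, h, Limits.zero_comp]
    have hvw : v ≫ dag w = 0 := by
      have := congrArg dag hwv
      simpa using this
    have hiw : Limits.biprod.inl ≫ dag w = 0 := by
      rw [← cancel_epi s.hom, ← Category.assoc, ← hv, hvw, Limits.comp_zero]
    have hvs : v ≫ Limits.biprod.snd = 0 := by rw [hv]; simp
    let e : Y ≅ K :=
      { hom := Limits.biprod.inr ≫ dag w
        inv := w ≫ Limits.biprod.snd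
        hom_inv_id := by
          rw [Category.assoc, ← Category.assoc (dag w), hw', Preadditive.sub_comp,
            Preadditive.comp_sub, Category.assoc (dag v), hvs]
          simp
        inv_hom_id := by
          have h : Limits.biprod.snd ≫ Limits.biprod.inr =
              𝟙 (X ⊞ Y) - Limits.biprod.fst ≫ Limits.biprod.inl := by
            rw [← Limits.biprod.total, add_sub_cancel_left]
          rw [Category.assoc, ← Category.assoc Limits.biprod.snd, h, Preadditive.sub_comp,
            Category.assoc Limits.biprod.fst, hiw]
          simp [hw] }
    obtain ⟨u, hu⟩ := exists_unitary_of_iso e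
    refine ⟨X ⊞ Y, v, u.hom ≫ w, hs, ?_, ?_, ?_⟩
    · rw [dag_comp, Category.assoc, ← Category.assoc w, hw, Category.id_comp, hu.hom_dag]
    · rw [dag_comp, ← Category.assoc, hvw, Limits.zero_comp]
    · rw [dag_comp, Category.assoc, ← Category.assoc _ u.hom, hu.dag_hom, Category.id_comp, hw',
        add_sub_cancel]
  exists_splitting p hp hpp := by
    have := IsFiniteSemisimple.hasKernels (C := C)
    exact exists_splitting_of_hasKernels p hp hpp

end

end

section

variable {C : Type u₁} [Category.{v₁} C] [Preadditive C] [Linear ℂ C] [DaggerCategory C]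

/-! ### Full subcategories closed under direct sums and retracts -/

/-- Classes of objects closed under finite direct sums and retracts. -/
structure IsSummandClosed (P : ObjectProperty C) : Prop where
  of_directSum {ι : Type} [Fintype ι] {Y : ι → C} {X : C} (D : DirectSum Y X) :
    (∀ i, P (Y i)) → P X
  of_retract {X Y : C} (i : Y ⟶ X) (r : X ⟶ Y) : i ≫ r = 𝟙 Y → P X → P Y

theorem positiveDagger_full [PositiveDagger C] (P : ObjectProperty C) :
    PositiveDagger P.FullSubcategory where
  dag_add' f g := by ext; exact PositiveDagger.dag_add' f.hom g.hom
  dag_smul' c f := by ext; exact PositiveDagger.dag_smul' c f.hom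
  definite f k h := by ext; exact PositiveDagger.definite f.hom k.hom (congrArg (fun f => f.hom) h)
  finite_hom' X Y := by
    let l : (X ⟶ Y) →ₗ[ℂ] (X.obj ⟶ Y.obj) :=
      { toFun f := f.hom
        map_add' _ _ := rfl
        map_smul' _ _ := rfl }
    exact Module.Finite.of_injective l fun f g h => by ext; exact h

theorem IsSummandClosed.exists_zero [OrthogonallyComplete C] {P : ObjectProperty C}
    (hP : IsSummandClosed P) : ∃ Z : C, P Z ∧ 𝟙 Z = 0 := by
  obtain ⟨Z, hZ⟩ := OrthogonallyComplete.exists_zero (C := C)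
  exact ⟨Z, hP.of_directSum (ι := Empty) (Y := Empty.elim)
    ⟨fun i => i.elim, fun i => i.elim, fun i => i.elim, fun i => i.elim, by rw [hZ]; simp⟩
    fun i => i.elim, hZ⟩

theorem IsSummandClosed.orthogonallyComplete [OrthogonallyComplete C] {P : ObjectProperty C}
    (hP : IsSummandClosed P) : OrthogonallyComplete P.FullSubcategory :=
  { positiveDagger_full P with
    exists_zero := by
      obtain ⟨Z, hZ, h⟩ := hP.exists_zero
      exact ⟨⟨Z, hZ⟩, by ext; exact h⟩
    exists_sum X Y := by
      obtain ⟨Z, i, j, hi, hj, hij, h⟩ := OrthogonallyComplete.exists_sum X.obj Y.obj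
      have hji : j ≫ dag i = 0 := by
        have := congrArg dag hij
        simpa using this
      have hZ : P Z := by
        refine hP.of_directSum (ι := Bool) (Y := fun b => bif b then X.obj else Y.obj)
          ⟨fun b => b.casesOn j i, fun b => b.casesOn (dag j) (dag i), ?_, ?_, ?_⟩ ?_
        · rintro (_ | _)
          · exact hj
          · exact hi
        · rintro (_ | _) (_ | _) hb
          · exact (hb rfl).elim
          · exact hji
          · exact hij
          · exact (hb rfl).elim
        · rw [Fintype.sum_bool]
          exact h
        · rintro (_ | _)
          · exact Y.property
          · exact X.property
      refine ⟨⟨Z, hZ⟩, ObjectProperty.homMk i, ObjectProperty.homMk j, ?_, ?_, ?_, ?_⟩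
      · ext; exact hi
      · ext; exact hj
      · ext; exact hij
      · ext; exact h
    exists_splitting {X} p hp hpp := by
      obtain ⟨Y, v, hv, hv'⟩ := OrthogonallyComplete.exists_splitting p.hom
        (congrArg (fun f => f.hom) hp) (congrArg (fun f => f.hom) hpp)
      refine ⟨⟨Y, hP.of_retract v (dag v) hv X.property⟩, ObjectProperty.homMk v, ?_, ?_⟩
      · ext; exact hv
      · ext; exact hv' }

theorem IsSummandClosed.of_iso {P : ObjectProperty C} (hP : IsSummandClosed P) {X Y : C}
    (e : X ≅ Y) (hX : P X) : P Y :=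
  hP.of_retract e.inv e.hom e.inv_hom_id hX

/-- A simple object of the subcategory has, in the ambient category, a simple summand which again
satisfies `P`. So the simple objects of `C` that satisfy `P` detect all simple objects of the
subcategory. -/
theorem IsSummandClosed.isFiniteSemisimple [CStarCategory C] [IsFiniteSemisimple C]
    {P : ObjectProperty C} (hP : IsSummandClosed P) : IsFiniteSemisimple P.FullSubcategory := by
  classical
  have := hP.orthogonallyComplete
  obtain ⟨n, S, hS⟩ := IsFiniteSemisimple.finite_simples (C := C)
  obtain ⟨Z, hZ, -⟩ := hP.exists_zero
  refine isFiniteSemisimple_of_detecting (κ := Fin n)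
    -- Representatives outside `P` are replaced by a zero object; they are never used.
    (fun k => if h : P (S k) then ⟨S k, h⟩ else ⟨Z, hZ⟩) fun X hX => ?_
  obtain ⟨ι, _, T, hT, ⟨D⟩⟩ := exists_orthoSum_simple X.obj
  have : ∃ i, D.incl i ≠ 0 := by
    by_contra! h
    apply id_nonzero X
    ext
    refine D.hom_ext fun i => ?_
    rw [h, Limits.zero_comp, Limits.zero_comp]
  obtain ⟨i, hi⟩ := this
  obtain ⟨k, ⟨e⟩⟩ := hS (T i) (hT i)
  have hk : P (S k) := hP.of_iso e (hP.of_retract _ _ (D.incl_dag_self i) X.property)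
  refine ⟨k, ObjectProperty.homMk (dag (D.incl i) ≫ e.hom) ≫ eqToHom (by rw [dif_pos hk]), ?_⟩
  intro h
  apply hi
  have h' := (cancel_mono _).1 (h.trans Limits.zero_comp.symm)
  have h'' : dag (D.incl i) ≫ e.hom = 0 := congrArg (fun f => f.hom) h'
  rw [← dag_dag (D.incl i), (cancel_mono e.hom).1 (h''.trans Limits.zero_comp.symm), dag_zero]

theorem IsSummandClosed.cStarCategory [CStarCategory C] [IsFiniteSemisimple C]
    {P : ObjectProperty C} (hP : IsSummandClosed P) : CStarCategory P.FullSubcategory :=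
  have := hP.orthogonallyComplete
  cStarCategory_of_positiveDagger

/-- A nonzero monomorphism `f` into `X` has a retraction `r`, and `r ≫ f` is a nonzero scalar, so
rescaling `r` gives a section of `f`. -/
theorem OrthogonallyComplete.simple_of_end [OrthogonallyComplete C] {X : C} (h0 : 𝟙 X ≠ 0)
    (h : ∀ f : X ⟶ X, ∃ c : ℂ, f = c • 𝟙 X) : Simple X where
  mono_isIso_iff_nonzero {Y} f _ := by
    constructor
    · rintro hi rfl
      apply h0
      rw [← IsIso.inv_hom_id (0 : Y ⟶ X), Limits.comp_zero]
    · intro hf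
      obtain ⟨r, hr⟩ := exists_retraction_of_mono f
      obtain ⟨c, hc⟩ := h (r ≫ f)
      have hc0 : c ≠ 0 := by
        rintro rfl
        apply hf
        rw [← Category.id_comp f, ← hr, Category.assoc, hc, zero_smul, Limits.comp_zero]
      have : IsSplitEpi f := ⟨⟨⟨c⁻¹ • r, by
        rw [Linear.smul_comp, hc, smul_smul, inv_mul_cancel₀ hc0, one_smul]⟩⟩⟩
      exact isIso_of_mono_of_isSplitEpi f

theorem exists_smul_id_of_simple [CStarCategory C] [IsFiniteSemisimple C] {X : C} [Simple X]
    (f : X ⟶ X) : ∃ c : ℂ, f = c • 𝟙 X := by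
  have := IsFiniteSemisimple.hasKernels (C := C)
  obtain ⟨c, hc⟩ := endomorphism_simple_eq_smul_id ℂ f
  exact ⟨c, hc.symm⟩

/-! ### Unitary functors and orthogonal sums -/

/-- The image of an orthogonal direct sum under a unitary functor. -/
def OrthoSum.map {D : Type u₂} [Category.{v₂} D] [Preadditive D] [Linear ℂ D] [DaggerCategory D]
    {F : C ⥤ D} (hF : IsUnitaryFunctor F) {ι : Type t} [Fintype ι] {Y : ι → C} {X : C}
    (S : OrthoSum Y X) : OrthoSum (fun i => F.obj (Y i)) (F.obj X) where
  incl i := F.map (S.incl i)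
  incl_dag_self i := by
    rw [← hF.map_dag, ← F.map_comp, S.incl_dag_self, F.map_id]
  incl_dag_ne i j h := by
    rw [← hF.map_dag, ← F.map_comp, S.incl_dag_ne i j h]
    simpa using hF.map_smul 0 (0 : Y i ⟶ Y j)
  total := by
    have : F.Additive := ⟨fun {_ _ f f'} => hF.map_add f f'⟩
    simp only [← hF.map_dag, ← F.map_comp]
    rw [← F.map_sum, S.total, F.map_id]

/-- Morphisms of orthogonal direct sums which permute the summands by unitary isomorphisms are
unitary. -/
theorem OrthoSum.isUnitary [PositiveDagger C] {ι : Type t} [Fintype ι] {Y Y' : ι → C} {X X' : C}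
    (S : OrthoSum Y X) (S' : OrthoSum Y' X') (e : ι ≃ ι) {f : X ⟶ X'}
    (u : ∀ i, Y i ⟶ Y' (e i)) (hu : ∀ i, IsUnitary (u i))
    (hf : ∀ i, S.incl i ≫ f = u i ≫ S'.incl (e i)) : IsUnitary f := by
  have hf' (i) : S'.incl (e i) ≫ dag f = dag (u i) ≫ S.incl i := by
    have hd : dag f = ∑ i, dag (S'.incl (e i)) ≫ dag (u i) ≫ S.incl i := by
      apply dag_injective
      rw [dag_dag, dag_sum]
      refine S.hom_ext fun i => ?_
      simp only [dag_comp, dag_dag, Category.assoc]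
      rw [hf, S.incl_comp_sum (fun i => u i ≫ S'.incl (e i))]
    rw [hd]
    exact (S'.reindex e).incl_comp_sum (fun i => dag (u i) ≫ S.incl i) i
  constructor
  · refine S.hom_ext fun i => ?_
    rw [← Category.assoc, hf, Category.assoc, hf', ← Category.assoc, (hu i).hom_dag,
      Category.id_comp, Category.comp_id]
  · refine (S'.reindex e).hom_ext fun i => ?_
    change S'.incl (e i) ≫ _ = S'.incl (e i) ≫ _
    rw [← Category.assoc, hf', Category.assoc, hf, ← Category.assoc, (hu i).dag_hom,
      Category.id_comp, Category.comp_id]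

theorem IsUnitaryFunctor.map_unitary {D : Type u₂} [Category.{v₂} D] [Preadditive D] [Linear ℂ D]
    [DaggerCategory D] {F : C ⥤ D} (hF : IsUnitaryFunctor F) {X Y : C} {f : X ⟶ Y}
    (hf : IsUnitary f) : IsUnitary (F.map f) :=
  ⟨by rw [← hF.map_dag, ← F.map_comp, hf.hom_dag, F.map_id],
    by rw [← hF.map_dag, ← F.map_comp, hf.dag_hom, F.map_id]⟩

theorem IsUnitary.dag {X Y : C} {f : X ⟶ Y} (hf : IsUnitary f) : IsUnitary (dag f) :=
  ⟨by rw [dag_dag, hf.dag_hom], by rw [dag_dag, hf.hom_dag]⟩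

/-- The isomorphism given by a unitary morphism. -/
def IsUnitary.iso {X Y : C} {f : X ⟶ Y} (hf : IsUnitary f) : X ≅ Y :=
  ⟨f, DaggerCategory.dag f, hf.hom_dag, hf.dag_hom⟩

end

/-! ### Equivariantizations are orthogonally complete -/

section

variable {G : Type t} [Group G] {C : Type u₁} [Category.{v₁} C] [Preadditive C]
    [Linear ℂ C] [MonoidalCategory C] [DaggerCategory C] {A : UnitaryAction G C}

namespace Equivariant

theorem map_str_comp {X : Equivariant A} {g h k : G} (e : g * h = k) :
    dag ((A.act g).map (X.str h)) ≫ (A.mul e).hom.app X.obj = X.str g ≫ dag (X.str k) := by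
  have h1 := X.str_mul e
  have h2 := congrArg (fun q => dag ((A.act g).map (X.str h)) ≫ q ≫ dag (X.str k)) h1
  simp only [Category.assoc, (X.str_unitary k).hom_dag, Category.comp_id] at h2
  rw [h2, ← Category.assoc, (A.map_unitary g (X.str_unitary h)).dag_hom, Category.id_comp]

/-- Unitality is not part of the definition of an equivariant object. The cocycle law for the pair
`(o, o)`, after cancelling the invertible `str o`, gives the claim under the functor `act o`, and
naturality of `one` removes that functor. -/
theorem str_one (X : Equivariant A) {o : G} (e : o = 1) :
    (A.one e).hom.app X.obj ≫ X.str o = 𝟙 X.obj := by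
  have h1 := X.str_mul (g := o) (h := o) (k := o) (by rw [e, one_mul])
  have h2 := A.mul_one_right (g := o) e (by rw [e, one_mul]) X.obj
  have h3 := congrArg (fun q => (A.act o).map ((A.one e).hom.app X.obj) ≫ q) h1
  simp only [← Category.assoc] at h3
  rw [h2, Category.id_comp, ← Functor.map_comp] at h3
  have h4 : (A.act o).map ((A.one e).hom.app X.obj ≫ X.str o) = 𝟙 _ := by
    have := (X.str_unitary o).isIso
    rw [← cancel_mono (X.str o), ← h3, Category.id_comp]
  have h5 := (A.one e).hom.naturality ((A.one e).hom.app X.obj ≫ X.str o)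
  rw [h4, Category.comp_id, Functor.id_map] at h5
  rw [← cancel_mono ((A.one e).hom.app X.obj)]
  exact h5.trans (Category.id_comp _).symm

instance [PositiveDagger C] : PositiveDagger (Equivariant A) where
  dag_add' f g := hom_ext (PositiveDagger.dag_add' f.hom g.hom)
  dag_smul' c f := hom_ext (PositiveDagger.dag_smul' c f.hom)
  definite f k h := hom_ext (PositiveDagger.definite f.hom k.hom (congrArg Hom.hom h))
  finite_hom' X Y := by
    let l : (X ⟶ Y) →ₗ[ℂ] (X.obj ⟶ Y.obj) :=
      { toFun f := f.hom
        map_add' _ _ := rfl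
        map_smul' _ _ := rfl }
    exact Module.Finite.of_injective l fun f g h => hom_ext h

/-- The equivariant structure of a summand. -/
theorem exists_summand (X : Equivariant A) {Y : C} (v : Y ⟶ X.obj) (hv : v ≫ dag v = 𝟙 Y)
    (hp : ∀ g, (A.act g).map (dag v ≫ v) ≫ X.str g = X.str g ≫ dag v ≫ v) :
    ∃ (Z : Equivariant A) (e : Z.obj = Y) (w : Z ⟶ X), w.hom = eqToHom e ≫ v := by
  have hgv (g : G) : (A.act g).map v ≫ dag ((A.act g).map v) = 𝟙 _ := by
    rw [← (A.unitary g).map_dag, ← Functor.map_comp, hv, CategoryTheory.Functor.map_id]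
  have hp' (g : G) : (A.act g).map v ≫ X.str g ≫ dag v ≫ v = (A.act g).map v ≫ X.str g := by
    rw [← hp, ← Category.assoc, ← Functor.map_comp, ← Category.assoc v, hv, Category.id_comp]
  refine ⟨⟨Y, fun g => (A.act g).map v ≫ X.str g ≫ dag v, fun g => ⟨?_, ?_⟩, fun {g h k} e => ?_⟩,
    rfl, ⟨v, fun g => ?_⟩, by simp⟩
  · calc _ = ((A.act g).map v ≫ X.str g ≫ dag v ≫ v) ≫ dag (X.str g) ≫
          dag ((A.act g).map v) := by simp only [dag_comp, dag_dag, Category.assoc]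
      _ = _ := by rw [hp', Category.assoc, ← Category.assoc (X.str g), (X.str_unitary g).hom_dag,
          Category.id_comp, hgv]
  · have h1 : dag ((A.act g).map v) ≫ (A.act g).map v = (A.act g).map (dag v ≫ v) := by
      rw [← (A.unitary g).map_dag, ← Functor.map_comp]
    simp only [dag_comp, dag_dag, Category.assoc]
    rw [← Category.assoc _ _ (X.str g ≫ _), h1, ← Category.assoc _ (X.str g), hp,
      ← Category.assoc (dag (X.str g)), ← Category.assoc (dag (X.str g)),
      (X.str_unitary g).dag_hom, Category.id_comp, Category.assoc, hv, Category.comp_id, hv]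
  · have nat := (A.mul e).hom.naturality v
    simp only [Functor.comp_map] at nat
    simp only [Functor.map_comp]
    rw [← Category.assoc, ← nat, Category.assoc, ← Category.assoc _ (X.str k), X.str_mul e]
    have h1 : (A.act g).map (dag v) ≫ (A.act g).map v ≫ X.str g ≫ dag v = X.str g ≫ dag v := by
      rw [← Category.assoc, ← Functor.map_comp, ← Category.assoc, hp]
      simp only [Category.assoc]
      rw [hv, Category.comp_id]
    simp only [Category.assoc]
    rw [h1]
  · simp only [Category.assoc]
    exact (hp' g).symm

/-- All three constructions take place in `C`. An orthogonal sum carries the block-diagonal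
structure `s`, which is determined by its restrictions to the two translated summands. A projection
in the equivariantization commutes with the structure, so its splitting inherits one by
`exists_summand`. -/
instance [OrthogonallyComplete C] : OrthogonallyComplete (Equivariant A) where
  exists_zero := by
    obtain ⟨Z, hZ⟩ := OrthogonallyComplete.exists_zero (C := C)
    have hz (X : C) (f : X ⟶ Z) : f = 0 := by rw [← Category.comp_id f, hZ, Limits.comp_zero]
    have hgz (g : G) : 𝟙 ((A.act g).obj Z) = 0 := by
      rw [← CategoryTheory.Functor.map_id, hZ, map_zero']
    have hz' (g : G) (Y : C) (f : (A.act g).obj Z ⟶ Y) : f = 0 := by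
      rw [← Category.id_comp f, hgz, Limits.zero_comp]
    exact ⟨⟨Z, fun g => 0, fun g => ⟨by rw [hgz, Limits.zero_comp], by rw [hZ, Limits.comp_zero]⟩,
      fun e => (hz _ _).trans (hz _ _).symm⟩, hom_ext hZ⟩
  exists_sum X Y := by
    obtain ⟨Z, i, j, hi, hj, hij, h⟩ := OrthogonallyComplete.exists_sum X.obj Y.obj
    have hji : j ≫ dag i = 0 := by
      have := congrArg dag hij
      simpa using this
    have ai (g : G) : (A.act g).map i ≫ dag ((A.act g).map i) = 𝟙 _ := by
      rw [← (A.unitary g).map_dag, ← Functor.map_comp, hi, CategoryTheory.Functor.map_id]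
    have aj (g : G) : (A.act g).map j ≫ dag ((A.act g).map j) = 𝟙 _ := by
      rw [← (A.unitary g).map_dag, ← Functor.map_comp, hj, CategoryTheory.Functor.map_id]
    have aij (g : G) : (A.act g).map i ≫ dag ((A.act g).map j) = 0 := by
      rw [← (A.unitary g).map_dag, ← Functor.map_comp, hij, map_zero']
    have aji (g : G) : (A.act g).map j ≫ dag ((A.act g).map i) = 0 := by
      rw [← (A.unitary g).map_dag, ← Functor.map_comp, hji, map_zero']
    have at' (g : G) : dag ((A.act g).map i) ≫ (A.act g).map i +
        dag ((A.act g).map j) ≫ (A.act g).map j = 𝟙 _ := by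
      rw [← (A.unitary g).map_dag, ← (A.unitary g).map_dag, ← Functor.map_comp,
        ← Functor.map_comp, ← (A.unitary g).map_add, h, CategoryTheory.Functor.map_id]
    have ext₂ (g : G) {W : C} {f f' : (A.act g).obj Z ⟶ W}
        (h₁ : (A.act g).map i ≫ f = (A.act g).map i ≫ f')
        (h₂ : (A.act g).map j ≫ f = (A.act g).map j ≫ f') : f = f' := by
      rw [← Category.id_comp f, ← Category.id_comp f', ← at' g]
      simp only [Preadditive.add_comp, Category.assoc, h₁, h₂]
    obtain ⟨s, hs⟩ : ∃ s : ∀ g, (A.act g).obj Z ⟶ Z, s = fun g =>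
      dag ((A.act g).map i) ≫ X.str g ≫ i + dag ((A.act g).map j) ≫ Y.str g ≫ j := ⟨_, rfl⟩
    have si (g : G) : (A.act g).map i ≫ s g = X.str g ≫ i := by
      rw [hs]
      dsimp only
      rw [Preadditive.comp_add, ← Category.assoc, ai, Category.id_comp, ← Category.assoc _ _
        (Y.str g ≫ j), aij, Limits.zero_comp, add_zero]
    have sj (g : G) : (A.act g).map j ≫ s g = Y.str g ≫ j := by
      rw [hs]
      dsimp only
      rw [Preadditive.comp_add, ← Category.assoc, aji, Limits.zero_comp, zero_add,
        ← Category.assoc _ _ (Y.str g ≫ j), aj, Category.id_comp]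
    refine ⟨⟨Z, s, fun g => ⟨?_, ?_⟩, fun {g k l} e => ?_⟩, ⟨i, si⟩, ⟨j, sj⟩, hom_ext hi,
        hom_ext hj,
      hom_ext hij, hom_ext h⟩
    · have hd : dag (s g) = dag i ≫ dag (X.str g) ≫ (A.act g).map i +
          dag j ≫ dag (Y.str g) ≫ (A.act g).map j := by
        rw [hs]; simp
      apply ext₂ g
      · rw [← Category.assoc, si, hd, Category.assoc, Preadditive.comp_add, ← Category.assoc i, hi,
          ← Category.assoc i, hij]
        simp only [Category.id_comp, Limits.zero_comp, add_zero]
        rw [← Category.assoc, (X.str_unitary g).hom_dag, Category.id_comp, Category.comp_id]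
      · rw [← Category.assoc, sj, hd, Category.assoc, Preadditive.comp_add, ← Category.assoc j, hji,
          ← Category.assoc j, hj]
        simp only [Category.id_comp, Limits.zero_comp, zero_add]
        rw [← Category.assoc, (Y.str_unitary g).hom_dag, Category.id_comp, Category.comp_id]
    · have hd : dag (s g) = dag i ≫ dag (X.str g) ≫ (A.act g).map i +
          dag j ≫ dag (Y.str g) ≫ (A.act g).map j := by
        rw [hs]; simp
      rw [hd, Preadditive.add_comp, Category.assoc, Category.assoc, Category.assoc, Category.assoc,
        si, sj, ← Category.assoc _ _ i, (X.str_unitary g).dag_hom, ← Category.assoc _ _ j,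
        (Y.str_unitary g).dag_hom, Category.id_comp, Category.id_comp, h]
    · have ni := (A.mul e).hom.naturality i
      have nj := (A.mul e).hom.naturality j
      simp only [Functor.comp_map] at ni nj
      have ext₃ {W : C} {f f' : (A.act g).obj ((A.act k).obj Z) ⟶ W}
          (h₁ : (A.act g).map ((A.act k).map i) ≫ f = (A.act g).map ((A.act k).map i) ≫ f')
          (h₂ : (A.act g).map ((A.act k).map j) ≫ f = (A.act g).map ((A.act k).map j) ≫ f') :
          f = f' := by
        have := (A.unitary g).map_add (dag ((A.act k).map i) ≫ (A.act k).map i)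
          (dag ((A.act k).map j) ≫ (A.act k).map j)
        rw [at', CategoryTheory.Functor.map_id] at this
        rw [← Category.id_comp f, ← Category.id_comp f', this]
        simp only [Preadditive.add_comp, Functor.map_comp, Category.assoc, h₁, h₂]
      apply ext₃
      · rw [← Category.assoc, ni, Category.assoc, si, ← Category.assoc _ _ (s g),
          ← Functor.map_comp, si, Functor.map_comp, Category.assoc, si, ← Category.assoc,
          X.str_mul e, Category.assoc]
      · rw [← Category.assoc, nj, Category.assoc, sj, ← Category.assoc _ _ (s g),
          ← Functor.map_comp, sj, Functor.map_comp, Category.assoc, sj, ← Category.assoc,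
          Y.str_mul e, Category.assoc]
  exists_splitting {X} p hp hpp := by
    obtain ⟨Y, v, hv, hv'⟩ := OrthogonallyComplete.exists_splitting p.hom
      (congrArg Hom.hom hp) (congrArg Hom.hom hpp)
    obtain ⟨Z, rfl, w, hw⟩ := exists_summand X v hv (fun g => by rw [hv']; exact p.comm g)
    rw [eqToHom_refl, Category.id_comp] at hw
    exact ⟨Z, w, hom_ext (by simp [hw, hv]), hom_ext (by simp [hw, hv'])⟩

/-! ### Induction -/

/-- The induced object `⨁_g g(Y)`. -/
theorem exists_induced [OrthogonallyComplete C] [Fintype G] (Y : C) :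
    ∃ (I : Equivariant A) (D : OrthoSum (fun g : G => (A.act g).obj Y) I.obj),
      ∀ {g h k : G} (e : g * h = k), (A.act g).map (D.incl h) ≫ I.str g =
        (A.mul e).hom.app Y ≫ D.incl k := by
  obtain ⟨X, ⟨D⟩⟩ := exists_orthoSum (fun g : G => (A.act g).obj Y)
  let Dg := fun g => D.map (A.unitary g).toIsUnitaryFunctor
  obtain ⟨s, hs⟩ : ∃ s : ∀ g, (A.act g).obj X ⟶ X, ∀ {g h k : G} (e : g * h = k),
      (A.act g).map (D.incl h) ≫ s g = (A.mul e).hom.app Y ≫ D.incl k := by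
    refine ⟨fun g => ∑ h, dag ((A.act g).map (D.incl h)) ≫
      (A.mul (rfl : g * h = g * h)).hom.app Y ≫ D.incl (g * h), ?_⟩
    rintro g h k rfl
    exact (Dg g).incl_comp_sum (fun h => (A.mul (rfl : g * h = g * h)).hom.app Y ≫
      D.incl (g * h)) h
  refine ⟨⟨X, s, fun g => ?_, fun {g h k} e => ?_⟩, D, hs⟩
  -- `s g` permutes the summands by `h ↦ g * h`, through the unitary isomorphisms `g(h(Y)) ≅ gh(Y)`.
  · exact (Dg g).isUnitary D (Equiv.mulLeft g) (fun h => (A.mul rfl).hom.app Y)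
      (fun h => A.mul_unitary _ _) (fun h => hs rfl)
  · refine ((Dg h).map (A.unitary g).toIsUnitaryFunctor).hom_ext fun l => ?_
    change (A.act g).map ((A.act h).map (D.incl l)) ≫ _ =
      (A.act g).map ((A.act h).map (D.incl l)) ≫ _
    have nat := (A.mul e).hom.naturality (D.incl l)
    simp only [Functor.comp_map] at nat
    rw [← Category.assoc, nat, Category.assoc, hs rfl, ← Category.assoc _ _ (s g),
      ← Functor.map_comp, hs rfl, Functor.map_comp, Category.assoc,
      hs (k := k * l) (by rw [← e, mul_assoc]), ← Category.assoc, ← Category.assoc,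
      A.mul_mul e rfl rfl (by rw [← e, mul_assoc])]

/-- Frobenius reciprocity: a nonzero `f : X ⟶ S k` in `C` induces a nonzero equivariant morphism
from `X` to the object induced from `S k`, whose component at `h` is `h(f)` preceded by the inverse
of the structure of `X`. So the objects induced from the finitely many simple objects of `C` detect
all simple objects. -/
theorem isFiniteSemisimple [CStarCategory C] [IsFiniteSemisimple C] [Finite G] :
    IsFiniteSemisimple (Equivariant A) := by
  have := Fintype.ofFinite G
  obtain ⟨n, S, hS⟩ := IsFiniteSemisimple.finite_simples (C := C)
  choose I D hD using fun k => exists_induced (A := A) (S k)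
  refine isFiniteSemisimple_of_detecting I fun X hX => ?_
  obtain ⟨ι, _, T, hT, ⟨E⟩⟩ := exists_orthoSum_simple X.obj
  have : ∃ i, E.incl i ≠ 0 := by
    by_contra! h
    apply id_nonzero X
    ext
    refine E.hom_ext fun i => ?_
    rw [h, Limits.zero_comp, Limits.zero_comp]
  obtain ⟨i, hi⟩ := this
  obtain ⟨k, ⟨e⟩⟩ := hS (T i) (hT i)
  obtain ⟨f, hf⟩ : ∃ f : X.obj ⟶ S k, f = dag (E.incl i) ≫ e.hom := ⟨_, rfl⟩
  have hf0 : f ≠ 0 := by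
    intro h
    apply hi
    rw [← dag_dag (E.incl i), (cancel_mono e.hom).1 ((hf.symm.trans h).trans Limits.zero_comp.symm),
      dag_zero]
  refine ⟨k, ⟨∑ h, dag (X.str h) ≫ (A.act h).map f ≫ (D k).incl h, fun g => ?_⟩, fun h => ?_⟩
  · have : (A.act g).Additive := ⟨fun {_ _ f f'} => (A.unitary g).map_add f f'⟩
    rw [Functor.map_sum, Preadditive.sum_comp, Preadditive.comp_sum,
      ← Equiv.sum_comp (Equiv.mulLeft g) (fun h => X.str g ≫ dag (X.str h) ≫ (A.act h).map f ≫
        (D k).incl h)]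
    refine Finset.sum_congr rfl fun h _ => ?_
    have nat := (A.mul (rfl : g * h = g * h)).hom.naturality f
    simp only [Functor.comp_map] at nat
    rw [Functor.map_comp, Functor.map_comp, Category.assoc, Category.assoc, hD k rfl,
      ← Category.assoc _ _ ((D k).incl _), nat, (A.unitary g).map_dag, Category.assoc,
      ← Category.assoc (dag _), map_str_comp]
    simp only [Category.assoc]
    rfl
  -- The component at `1` recovers `f` up to isomorphism, so the induced morphism cannot vanish.
  · have h' : ∑ h, dag (X.str h) ≫ (A.act h).map f ≫ (D k).incl h = 0 := congrArg Hom.hom h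
    have h'' := congrArg (fun q => q ≫ dag ((D k).incl 1)) h'
    rw [Preadditive.sum_comp, Finset.sum_eq_single 1, Limits.zero_comp, Category.assoc,
      Category.assoc, (D k).incl_dag_self, Category.comp_id] at h''
    · have := (X.str_unitary 1).dag.isIso
      have h3 : (A.act 1).map f = 0 := (cancel_epi _).1 (h''.trans Limits.comp_zero.symm)
      have nat := (A.one rfl).hom.naturality f
      rw [h3, Limits.comp_zero, Functor.id_map] at nat
      exact hf0 ((cancel_mono _).1 (nat.trans Limits.zero_comp.symm))
    · intro g _ hg
      rw [Category.assoc, Category.assoc, (D k).incl_dag_ne g 1 hg, Limits.comp_zero,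
        Limits.comp_zero]
    · simp

end Equivariant

end

/-! ### Rigidity of equivariantizations -/

section

variable {C : Type u₁} [Category.{v₁} C] [MonoidalCategory C]

/-- By duality, morphisms into the dual `Y` are determined by pairing them with `X`. The uniqueness
arguments for structures on duals and for degrees of duals rest on this. -/
theorem evaluation_injective {X Y : C} (p : ExactPairing X Y) {W : C} {a a' : W ⟶ Y}
    (h : a ▷ X ≫ p.evaluation' = a' ▷ X ≫ p.evaluation') : a = a' := by
  let _ : HasRightDual X := ⟨Y⟩
  have h1 := tensorRightHomEquiv_whiskerRight_comp_evaluation (X := X) a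
  have h2 := tensorRightHomEquiv_whiskerRight_comp_evaluation (X := X) a'
  rw [← cancel_mono (λ_ Y).inv]
  exact h1.symm.trans ((congrArg _ h).trans h2)

theorem exists_evaluation {X Y : C} (p : ExactPairing X Y) {W : C} (f : W ⊗ X ⟶ 𝟙_ C) :
    ∃ a : W ⟶ Y, a ▷ X ≫ p.evaluation' = f := by
  let _ : HasRightDual X := ⟨Y⟩
  refine ⟨tensorRightHomEquiv W X Y (𝟙_ C) f ≫ (λ_ Y).hom,
    (tensorRightHomEquiv W X Y (𝟙_ C)).injective ?_⟩
  exact (tensorRightHomEquiv_whiskerRight_comp_evaluation (X := X) _).trans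
    ((Category.assoc _ _ _).trans ((congrArg _ (λ_ Y).hom_inv_id).trans (Category.comp_id _)))

/-- The same uniqueness for morphisms into `Z ⊗ Y`, as needed for statements about the coevaluation.
-/
theorem evaluation_whisker_injective {X Y : C} (p : ExactPairing X Y) {W Z : C} {a a' : W ⟶ Z ⊗ Y}
    (h : a ▷ X ≫ (α_ _ _ _).hom ≫ Z ◁ p.evaluation' =
      a' ▷ X ≫ (α_ _ _ _).hom ≫ Z ◁ p.evaluation') : a = a' := by
  apply (tensorRightHomEquiv W X Y Z).symm.injective
  have := congrArg (fun q => q ≫ (ρ_ Z).hom) h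
  simpa [tensorRightHomEquiv, ExactPairing.evaluation] using this

/-- Duals from the dagger. -/
@[reducible]
def exactPairingDag [DaggerCategory C] [UnitaryMonoidal C] {X Y : C} (p : ExactPairing X Y) :
    ExactPairing Y X where
  coevaluation' := dag p.evaluation'
  evaluation' := dag p.coevaluation'
  coevaluation_evaluation' := by
    have h := congrArg dag p.evaluation_coevaluation'
    simp only [dag_comp, ← id_tensorHom, ← tensorHom_id, UnitaryMonoidal.dag_tensorHom,
      dag_id] at h
    rw [IsUnitary.dag_eq_inv _ (UnitaryMonoidal.associator_unitary X Y X),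
      IsUnitary.dag_eq_inv _ (UnitaryMonoidal.leftUnitor_unitary X),
      ← IsUnitary.dag_eq_inv _ (UnitaryMonoidal.rightUnitor_unitary X), dag_dag] at h
    simpa using h
  evaluation_coevaluation' := by
    have h := congrArg dag p.coevaluation_evaluation'
    simp only [dag_comp, ← id_tensorHom, ← tensorHom_id, UnitaryMonoidal.dag_tensorHom,
      dag_id] at h
    rw [← IsUnitary.dag_eq_inv _ (UnitaryMonoidal.associator_unitary Y X Y),
      IsUnitary.dag_eq_inv _ (UnitaryMonoidal.rightUnitor_unitary Y),
      ← IsUnitary.dag_eq_inv _ (UnitaryMonoidal.leftUnitor_unitary Y), dag_dag, dag_dag] at h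
    simpa using h

end

section

variable {G : Type t} [Group G] {C : Type u₁} [Category.{v₁} C] [Preadditive C]
    [Linear ℂ C] [MonoidalCategory C] [DaggerCategory C] {A : UnitaryAction G C}

theorem UnitaryAction.one_tensor (A : UnitaryAction G C) {o : G} (e : o = 1) (X Y : C) :
    (A.one e).hom.app (X ⊗ Y) = ((A.one e).hom.app X ⊗ₘ (A.one e).hom.app Y) ≫ μ (A.act o) X Y := by
  have := A.one_monoidal e
  simpa using NatTrans.IsMonoidal.tensor (τ := (A.one e).hom) X Y

theorem UnitaryAction.one_unit (A : UnitaryAction G C) {o : G} (e : o = 1) :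
    (A.one e).hom.app (𝟙_ C) = ε (A.act o) := by
  have := A.one_monoidal e
  simpa using NatTrans.IsMonoidal.unit (τ := (A.one e).hom)

namespace Equivariant

/-- Compact group actions can be unitarized. -/
theorem exists_unitarization [OrthogonallyComplete C] [Fintype G] {Y : C}
    (τ : ∀ g, (A.act g).obj Y ⟶ Y) (hτ : ∀ {g h k : G} (e : g * h = k),
      (A.mul e).hom.app Y ≫ τ k = (A.act g).map (τ h) ≫ τ g)
    (hτ₁ : ∀ {o : G} (e : o = 1), (A.one e).hom.app Y ≫ τ o = 𝟙 Y) :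
    ∃ (X : Equivariant A) (w : Y ≅ X.obj), ∀ g, (A.act g).map w.hom ≫ X.str g = τ g ≫ w.hom := by
  obtain ⟨Z, ⟨D⟩⟩ := exists_orthoSum (fun g : G => (A.act g).obj Y)
  -- `f` maps `Y` to `⨁ g(Y)` by the adjoints of the `τ g`, so that `f ≫ dag f` is the averaged form
  -- `∑ dag (τ g) ≫ τ g`. Its component at `1` is invertible by unitality, so `f` is a monomorphism.
  obtain ⟨f, hf⟩ : ∃ f : Y ⟶ Z, f = ∑ g, dag (τ g) ≫ D.incl g := ⟨_, rfl⟩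
  have hfi (g : G) : f ≫ dag (D.incl g) = dag (τ g) := by
    apply dag_injective
    rw [dag_comp, dag_dag, dag_dag, hf, dag_sum]
    simp only [dag_comp, dag_dag]
    exact D.incl_comp_sum τ g
  have hff : f ≫ dag f = ∑ g, dag (τ g) ≫ τ g := by
    conv_lhs => arg 1; rw [hf]
    rw [Preadditive.sum_comp]
    refine Finset.sum_congr rfl fun g _ => ?_
    rw [Category.assoc, ← dag_dag (D.incl g), ← dag_comp, hfi, dag_dag]
  have hmono : Mono f := by
    have h1 : f ≫ dag (D.incl 1) ≫ dag ((A.one rfl).hom.app Y) = 𝟙 Y := by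
      rw [← Category.assoc, hfi, ← dag_comp, hτ₁ rfl]
      exact dag_id Y
    have h2 : f ≫ (dag (D.incl 1) ≫ dag ((A.one rfl).hom.app Y)) = 𝟙 Y := h1
    have : Mono (f ≫ (dag (D.incl 1) ≫ dag ((A.one rfl).hom.app Y))) := h2 ▸ inferInstance
    exact mono_of_mono f (dag (D.incl 1) ≫ dag ((A.one rfl).hom.app Y))
  obtain ⟨t, ht⟩ := exists_isometry_of_mono f
  -- The inverse of the automorphism from the polar decomposition of `f` is a square root of the
  -- averaged form.
  have hP : t.inv ≫ dag t.inv = f ≫ dag f := by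
    have h1 : dag t.hom ≫ dag t.inv = 𝟙 Y := by rw [← dag_comp, t.inv_hom_id, dag_id]
    calc t.inv ≫ dag t.inv = t.inv ≫ ((t.hom ≫ f) ≫ dag (t.hom ≫ f)) ≫ dag t.inv := by
          rw [ht, Category.id_comp]
      _ = (t.inv ≫ t.hom) ≫ f ≫ dag f ≫ dag t.hom ≫ dag t.inv := by
          simp only [dag_comp, Category.assoc]
      _ = f ≫ dag f := by rw [h1, t.inv_hom_id, Category.id_comp, Category.comp_id]
  -- The averaged form is invariant: the cocycle law turns translation by `h` into a permutation of
  -- the summands by left multiplication.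
  have hinv (h : G) : dag (τ h) ≫ (A.act h).map (f ≫ dag f) ≫ τ h = f ≫ dag f := by
    have : (A.act h).Additive := ⟨fun {_ _ f f'} => (A.unitary h).map_add f f'⟩
    rw [hff, Functor.map_sum, Preadditive.sum_comp, Preadditive.comp_sum, eq_comm,
      ← Equiv.sum_comp (Equiv.mulLeft h) (fun g => dag (τ g) ≫ τ g)]
    refine Finset.sum_congr rfl fun g _ => ?_
    have h1 := hτ (rfl : h * g = h * g)
    have h2 := congrArg dag h1
    rw [dag_comp, dag_comp, ← (A.unitary h).map_dag] at h2
    rw [Functor.map_comp, Category.assoc, ← h1, ← Category.assoc (dag (τ h)), ← h2, Category.assoc,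
      ← Category.assoc _ _ (τ (h * g)), (A.mul_unitary rfl Y).dag_hom, Category.id_comp]
    rfl
  -- Conjugation by `w` carries the invariant form to the identity, so the conjugated structure `s`
  -- preserves the standard form.
  obtain ⟨w, hwh, hwi⟩ : ∃ w : Y ≅ Y, w.hom = dag t.hom ∧ w.inv = dag t.inv :=
    ⟨⟨dag t.hom, dag t.inv, by rw [← dag_comp, t.inv_hom_id, dag_id],
      by rw [← dag_comp, t.hom_inv_id, dag_id]⟩, rfl, rfl⟩
  obtain ⟨s, hs⟩ : ∃ s : ∀ g, (A.act g).obj Y ⟶ Y, s = fun g =>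
    (A.act g).map w.inv ≫ τ g ≫ w.hom := ⟨_, rfl⟩
  have hws (g : G) : (A.act g).map w.hom ≫ s g = τ g ≫ w.hom := by
    rw [hs]
    dsimp only
    rw [← Category.assoc, ← Functor.map_comp, w.hom_inv_id, CategoryTheory.Functor.map_id,
      Category.id_comp]
  have hsm {g h k : G} (e : g * h = k) : (A.mul e).hom.app Y ≫ s k = (A.act g).map (s h) ≫ s g := by
    have nat := (A.mul e).hom.naturality w.hom
    simp only [Functor.comp_map] at nat
    rw [← cancel_epi ((A.act g).map ((A.act h).map w.hom)), ← Category.assoc, nat, Category.assoc,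
      hws, ← Category.assoc, hτ e, ← Category.assoc, ← Functor.map_comp, hws, Functor.map_comp,
      Category.assoc, Category.assoc, hws]
  have hs₁ {o : G} (e : o = 1) : (A.one e).hom.app Y ≫ s o = 𝟙 Y := by
    have nat := (A.one e).hom.naturality w.hom
    rw [Functor.id_map] at nat
    rw [← cancel_epi w.hom, ← Category.assoc]
    refine (congrArg (fun q => q ≫ s o) nat).trans ?_
    rw [Category.assoc, hws, ← Category.assoc]
    refine (congrArg (fun q => q ≫ w.hom) (hτ₁ e)).trans ?_
    rw [Category.comp_id]
    exact Category.id_comp _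
  have hco (g : G) : dag (s g) ≫ s g = 𝟙 Y := by
    have h1 : dag (s g) = t.hom ≫ dag (τ g) ≫ (A.act g).map t.inv := by
      rw [hs]
      simp [hwh, hwi, (A.unitary g).map_dag]
    have h2 : s g = (A.act g).map (dag t.inv) ≫ τ g ≫ dag t.hom := by rw [hs, ← hwi, ← hwh]
    have h3 : dag t.inv ≫ dag t.hom = 𝟙 Y := by rw [← dag_comp, t.hom_inv_id, dag_id]
    calc dag (s g) ≫ s g = t.hom ≫ (dag (τ g) ≫ (A.act g).map (t.inv ≫ dag t.inv) ≫ τ g) ≫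
          dag t.hom := by
            rw [h1, h2]; simp only [Category.assoc, Functor.map_comp]
      _ = t.hom ≫ (t.inv ≫ dag t.inv) ≫ dag t.hom := by rw [hP, hinv]
      _ = 𝟙 Y := by rw [Category.assoc, h3, Category.comp_id, t.hom_inv_id]
  refine ⟨⟨Y, s, fun g => ?_, hsm⟩, w, hws⟩
  -- So far only one of the two unitarity equations is known for `s g`. Its composite with the
  -- translate of `s g⁻¹` is the unitary `u`, and this gives `s g` an inverse on the other side as
  -- well.
  obtain ⟨a, ha⟩ : ∃ a, a = (A.act g).map (s g⁻¹) := ⟨_, rfl⟩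
  have haa : dag a ≫ a = 𝟙 _ := by
    rw [ha, ← (A.unitary g).map_dag, ← Functor.map_comp, hco, CategoryTheory.Functor.map_id]
  obtain ⟨u, hu⟩ : ∃ u, u = (A.mul (mul_inv_cancel g)).hom.app Y ≫ s 1 := ⟨_, rfl⟩
  have hau : a ≫ s g = u := by rw [ha, ← hsm (mul_inv_cancel g), hu]
  have hs1 : IsUnitary (s 1) := by
    have h1 : s 1 = dag ((A.one rfl).hom.app Y) := by
      have := (A.one_unitary (rfl : (1 : G) = 1) Y).isIso
      rw [← cancel_epi ((A.one rfl).hom.app Y), (A.one_unitary rfl Y).hom_dag]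
      exact hs₁ rfl
    rw [h1]
    exact (A.one_unitary rfl Y).dag
  have huu : IsUnitary u := by rw [hu]; exact (A.mul_unitary _ Y).comp hs1
  have hsau : s g ≫ dag u ≫ a = 𝟙 _ := by
    calc s g ≫ dag u ≫ a = (dag a ≫ a) ≫ s g ≫ dag u ≫ a := by rw [haa, Category.id_comp]
      _ = dag a ≫ (a ≫ s g) ≫ dag u ≫ a := by simp only [Category.assoc]
      _ = 𝟙 _ := by rw [hau, ← Category.assoc u, huu.hom_dag, Category.id_comp, haa]
  refine ⟨?_, hco g⟩
  have hd : dag (s g) = dag u ≫ a := by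
    calc dag (s g) = dag (s g) ≫ s g ≫ dag u ≫ a := by rw [hsau, Category.comp_id]
      _ = dag u ≫ a := by rw [← Category.assoc, hco, Category.id_comp]
  rw [hd, hsau]

section Dual

variable (X : Equivariant A) {Y : C} (p : ExactPairing X.obj Y)

/-- The structure on the dual is forced by invariance of the evaluation. It can be solved for
because the structure of `X` is invertible and every morphism `W ⊗ X ⟶ 𝟙_ C` comes from a morphism
`W ⟶ Y`. -/
theorem exists_dual_structure (g : G) : ∃ τ : (A.act g).obj Y ⟶ Y,
    (τ ⊗ₘ X.str g) ≫ p.evaluation' =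
      μ (A.act g) Y X.obj ≫ (A.act g).map p.evaluation' ≫ η (A.act g) := by
  obtain ⟨τ, hτ⟩ := exists_evaluation p (_ ◁ dag (X.str g) ≫ μ (A.act g) Y X.obj ≫
    (A.act g).map p.evaluation' ≫ η (A.act g))
  refine ⟨τ, ?_⟩
  rw [tensorHom_def', Category.assoc, hτ, ← Category.assoc, ← MonoidalCategory.whiskerLeft_comp,
    (X.str_unitary g).hom_dag, MonoidalCategory.whiskerLeft_id, Category.id_comp]

variable {X p} {τ : ∀ g, (A.act g).obj Y ⟶ Y}
  (hτ : ∀ g, (τ g ⊗ₘ X.str g) ≫ p.evaluation' =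
    μ (A.act g) Y X.obj ≫ (A.act g).map p.evaluation' ≫ η (A.act g))

include hτ

/-- By uniqueness it suffices to pair both sides with the structure of `X`; both then become the
evaluation translated first by `h` and then by `g`. -/
theorem dual_structure_mul {g h k : G} (e : g * h = k) :
    (A.mul e).hom.app Y ≫ τ k = (A.act g).map (τ h) ≫ τ g := by
  have hiso : IsIso ((A.mul e).hom.app X.obj) := inferInstance
  apply evaluation_injective p
  have := (X.str_unitary k).isIso
  rw [← cancel_epi (_ ◁ ((A.mul e).hom.app X.obj ≫ X.str k))]
  simp only [← Category.assoc]
  rw [← tensorHom_def', ← tensorHom_def']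
  have l : ((A.mul e).hom.app Y ≫ τ k ⊗ₘ (A.mul e).hom.app X.obj ≫ X.str k) ≫ p.evaluation' =
      μ (A.act g) _ _ ≫ (A.act g).map (μ (A.act h) Y X.obj ≫ (A.act h).map p.evaluation' ≫
        η (A.act h)) ≫ η (A.act g) := by
    have nat := (A.mul e).hom.naturality p.evaluation'
    simp only [Functor.comp_map] at nat
    rw [← tensorHom_comp_tensorHom, Category.assoc, hτ, ← Category.assoc, ← A.mul_tensor e,
      Category.assoc, Category.assoc, ← Category.assoc _ _ (η (A.act k)), ← nat, Category.assoc,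
      A.mul_unit' e]
    simp only [Functor.map_comp, Category.assoc]
  have r : ((A.act g).map (τ h) ≫ τ g ⊗ₘ (A.act g).map (X.str h) ≫ X.str g) ≫ p.evaluation' =
      μ (A.act g) _ _ ≫ (A.act g).map (μ (A.act h) Y X.obj ≫ (A.act h).map p.evaluation' ≫
        η (A.act h)) ≫ η (A.act g) := by
    rw [← tensorHom_comp_tensorHom, Category.assoc, hτ, μ_natural_assoc, ← Functor.map_comp_assoc,
      hτ]
  rw [X.str_mul e] at l ⊢
  exact l.trans r.symm

theorem dual_structure_one {o : G} (e : o = 1) : (A.one e).hom.app Y ≫ τ o = 𝟙 Y := by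
  apply evaluation_injective p
  have nat := (A.one e).hom.naturality p.evaluation'
  rw [Functor.id_map] at nat
  have h : ((A.one e).hom.app Y ≫ τ o ⊗ₘ (A.one e).hom.app X.obj ≫ X.str o) ≫ p.evaluation' =
      p.evaluation' := by
    rw [← tensorHom_comp_tensorHom, Category.assoc, hτ, ← Category.assoc, ← A.one_tensor e,
      ← Category.assoc]
    refine (congrArg (fun q => q ≫ η (A.act o)) nat.symm).trans ?_
    rw [A.one_unit e, Category.assoc, Functor.Monoidal.ε_η]
    exact Category.comp_id _
  rw [X.str_one e] at h
  refine (congrArg (fun q => q ≫ p.evaluation') (tensorHom_id _ _).symm).trans (h.trans ?_)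
  exact ((congrArg (fun q => q ≫ p.evaluation') (MonoidalCategory.id_whiskerRight _ _)).trans
    (Category.id_comp _)).symm

/-- Invariance of the coevaluation follows from that of the evaluation: after pairing with `X`, the
zigzag identity, applied once inside `act g` and once outside, reduces both sides to the structure
of `X`. -/
theorem dual_structure_coevaluation (g : G) :
    (A.act g).map p.coevaluation' ≫ δ (A.act g) X.obj Y ≫ (X.str g ⊗ₘ τ g) =
      η (A.act g) ≫ p.coevaluation' := by
  apply evaluation_whisker_injective p
  have := (X.str_unitary g).isIso
  rw [← cancel_epi (_ ◁ X.str g)]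
  have key : (A.act g).map p.coevaluation' ▷ (A.act g).obj X.obj ≫
      δ (A.act g) X.obj Y ▷ (A.act g).obj X.obj ≫ (α_ _ _ _).hom ≫
      (A.act g).obj X.obj ◁ (μ (A.act g) Y X.obj ≫ (A.act g).map p.evaluation' ≫ η (A.act g)) =
      η (A.act g) ▷ (A.act g).obj X.obj ≫ (λ_ _).hom ≫ (ρ_ _).inv := by
    rw [← cancel_epi (δ (A.act g) (𝟙_ C) X.obj), δ_natural_left_assoc,
      Functor.OplaxMonoidal.associativity_assoc, ← MonoidalCategory.whiskerLeft_comp]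
    simp only [Functor.Monoidal.δ_μ_assoc]
    rw [MonoidalCategory.whiskerLeft_comp, δ_natural_right_assoc, ← Functor.map_comp_assoc,
      ← Functor.map_comp_assoc, Category.assoc, p.evaluation_coevaluation', Functor.map_comp_assoc,
      ← oplax_right_unitality, Functor.Monoidal.map_leftUnitor]
    simp only [Category.assoc]
  have l : (A.act g).obj (𝟙_ C) ◁ X.str g ≫
      ((A.act g).map p.coevaluation' ≫ δ (A.act g) X.obj Y ≫ (X.str g ⊗ₘ τ g)) ▷ X.obj ≫
        (α_ _ _ _).hom ≫ X.obj ◁ p.evaluation' =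
      ((A.act g).map p.coevaluation' ▷ (A.act g).obj X.obj ≫
      δ (A.act g) X.obj Y ▷ (A.act g).obj X.obj ≫ (α_ _ _ _).hom ≫
      (A.act g).obj X.obj ◁ (μ (A.act g) Y X.obj ≫ (A.act g).map p.evaluation' ≫ η (A.act g))) ≫
        X.str g ▷ 𝟙_ C := by
    rw [← hτ]
    calc _ = ((A.act g).map p.coevaluation' ≫ δ (A.act g) X.obj Y) ▷ _ ≫
          ((X.str g ⊗ₘ τ g) ⊗ₘ X.str g) ≫ (α_ _ _ _).hom ≫ X.obj ◁ p.evaluation' := by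
          rw [← Category.assoc ((A.act g).map _), ← Category.assoc, ← tensorHom_def',
            ← Category.assoc _ _ (_ ≫ _), ← tensorHom_id, tensorHom_comp_tensorHom,
            Category.id_comp]
      _ = _ := by
          rw [associator_naturality_assoc, ← id_tensorHom, tensorHom_comp_tensorHom,
            Category.comp_id, ← Category.id_comp (X.str g), ← Category.comp_id ((τ g ⊗ₘ _) ≫ _),
            ← tensorHom_comp_tensorHom, Category.comp_id]
          simp
  rw [l, key, comp_whiskerRight]
  simp only [Category.assoc]
  rw [p.evaluation_coevaluation', whisker_exchange_assoc]
  simp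

end Dual

variable [UnitaryMonoidal C]

/-- The structure forced on the given dual need not be unitary, since the pairing is arbitrary. It
is unitarized and the pairing is transported along the comparison isomorphism `w`. -/
theorem exists_exactPairing [OrthogonallyComplete C] [Fintype G] (X : Equivariant A) {Y : C}
    (p : ExactPairing X.obj Y) : ∃ Z : Equivariant A, Nonempty (ExactPairing X Z) := by
  choose τ hτ using X.exists_dual_structure p
  obtain ⟨Z, w, hw⟩ := exists_unitarization τ (dual_structure_mul hτ) (dual_structure_one hτ)
  have hw' (g : G) : (A.act g).map w.inv ≫ τ g = Z.str g ≫ w.inv := by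
    rw [← cancel_mono w.hom, Category.assoc, ← hw, ← Category.assoc, ← Functor.map_comp,
      w.inv_hom_id, CategoryTheory.Functor.map_id, Category.id_comp, Category.assoc, w.inv_hom_id,
      Category.comp_id]
  let q : ExactPairing X.obj Z.obj := exactPairingCongrRight (Y' := Y) w.symm
  have qe : q.evaluation' = w.inv ▷ X.obj ≫ p.evaluation' := rfl
  have qc : q.coevaluation' = p.coevaluation' ≫ X.obj ◁ w.hom := rfl
  let _ : ExactPairing ((forget A).obj X) ((forget A).obj Z) := q
  refine ⟨Z, ⟨ExactPairing.ofFaithful (forget A) (X := X) (Y := Z)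
    (⟨q.evaluation', fun g => ?_⟩ : Z ⊗ X ⟶ 𝟙_ _) (⟨q.coevaluation', fun g => ?_⟩ : 𝟙_ _ ⟶ X ⊗ Z)
    ?_ ?_⟩⟩
  · change (A.act g).map q.evaluation' ≫ η (A.act g) =
      (δ (A.act g) _ _ ≫ (Z.str g ⊗ₘ X.str g)) ≫ q.evaluation'
    rw [qe, tensorHom_def', Category.assoc, Category.assoc, ← comp_whiskerRight_assoc, ← hw',
        comp_whiskerRight, Category.assoc, whisker_exchange_assoc,
      ← tensorHom_def'_assoc, hτ, δ_natural_left_assoc, Functor.Monoidal.δ_μ_assoc,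
      Functor.map_comp, Category.assoc]
  · change (A.act g).map q.coevaluation' ≫ (δ (A.act g) _ _ ≫ (X.str g ⊗ₘ Z.str g)) =
      η (A.act g) ≫ q.coevaluation'
    rw [qc, Functor.map_comp, Category.assoc, ← δ_natural_right_assoc, ← Category.assoc (η _),
      ← dual_structure_coevaluation hτ, Category.assoc, Category.assoc,
      MonoidalCategory.tensorHom_def, MonoidalCategory.tensorHom_def,
      Category.assoc, whisker_exchange_assoc, ← MonoidalCategory.whiskerLeft_comp, hw,
      MonoidalCategory.whiskerLeft_comp]
  · change q.evaluation' = 𝟙 _ ≫ q.evaluation' ≫ 𝟙 _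
    simp
  · change q.coevaluation' = 𝟙 _ ≫ q.coevaluation' ≫ 𝟙 _
    simp

theorem unitaryMonoidal : UnitaryMonoidal (Equivariant A) where
  dag_tensorHom f g := hom_ext (UnitaryMonoidal.dag_tensorHom f.hom g.hom)
  associator_unitary _ _ _ := isUnitary_iff.2 (UnitaryMonoidal.associator_unitary ..)
  leftUnitor_unitary _ := isUnitary_iff.2 (UnitaryMonoidal.leftUnitor_unitary ..)
  rightUnitor_unitary _ := isUnitary_iff.2 (UnitaryMonoidal.rightUnitor_unitary ..)

end Equivariant

/-- The equivariantization of a unitary fusion category by a finite group is a unitary fusion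
category. -/
theorem Equivariant.unitaryFusionCategory [UnitaryFusionCategory C] [Finite G] :
    UnitaryFusionCategory (Equivariant A) :=
  have := Fintype.ofFinite G
  have hss : IsFiniteSemisimple (Equivariant A) := Equivariant.isFiniteSemisimple
  have hcs : CStarCategory (Equivariant A) := cStarCategory_of_positiveDagger
  { hss, hcs, unitaryMonoidal with
    whiskerLeft_zero := hom_ext (MonoidalPreadditive.whiskerLeft_zero ..)
    zero_whiskerRight := hom_ext (MonoidalPreadditive.zero_whiskerRight ..)
    whiskerLeft_add _ _ := hom_ext (MonoidalPreadditive.whiskerLeft_add ..)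
    add_whiskerRight _ _ := hom_ext (MonoidalPreadditive.add_whiskerRight ..)
    whiskerLeft_smul _ _ _ _ _ := hom_ext (MonoidalLinear.whiskerLeft_smul ..)
    smul_whiskerRight _ _ _ _ _ := hom_ext (MonoidalLinear.smul_whiskerRight ..)
    simple_unit := by
      have : Simple (𝟙_ C) := UnitaryFusionCategory.simple_unit
      refine OrthogonallyComplete.simple_of_end
        (fun h => id_nonzero (𝟙_ C) (congrArg Hom.hom h)) fun f => ?_
      obtain ⟨c, hc⟩ := exists_smul_id_of_simple f.hom
      exact ⟨c, hom_ext hc⟩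
    rigid X := by
      obtain ⟨-, ⟨D⟩⟩ := UnitaryFusionCategory.rigid X.obj
      obtain ⟨Z, ⟨p⟩⟩ := X.exists_exactPairing D.exact
      have := unitaryMonoidal (A := A)
      exact ⟨⟨@HasLeftDual.mk _ _ _ _ Z (exactPairingDag p)⟩, ⟨@HasRightDual.mk _ _ _ _ Z p⟩⟩ }

end

/-! ### Sectors of a graded category -/

section

variable {G : Type t} [Group G] {C : Type u₁} [Category.{v₁} C] [Preadditive C]
    [Linear ℂ C] [MonoidalCategory C] [DaggerCategory C]

instance UnitaryAction.additive (A : UnitaryAction G C) (g : G) : (A.act g).Additive :=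
  ⟨fun {_ _ f f'} => (A.unitary g).map_add f f'⟩

namespace CrossedBraiding

variable {A : UnitaryAction G C} (K : CrossedBraiding A)

/-- In a homogeneous decomposition of `X` the summands with degree outside `S` have zero inclusion
and can be dropped. In this form, closure under sums and retracts is immediate. -/
theorem sector_iff {S : Set G} {X : C} :
    K.sector S X ↔ ∀ g ∉ S, ∀ Z, K.deg g Z → ∀ f : Z ⟶ X, f = 0 := by
  classical
  constructor
  · rintro ⟨ι, _, d, Y, hd, ⟨D⟩⟩ g hg Z hZ f
    refine D.hom_ext' fun i => ?_
    rw [Limits.zero_comp]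
    exact K.hom_eq_zero hZ (hd i).2 (fun h => hg (h ▸ (hd i).1)) _
  · intro h
    obtain ⟨ι, _, d, Y, hd, ⟨D⟩⟩ := K.decomposition X
    refine ⟨{i // d i ∈ S}, inferInstance, fun i => d i, fun i => Y i, fun i => ⟨i.2, hd i⟩,
      ⟨⟨fun i => D.incl i, fun i => D.proj i, fun i => D.incl_proj_self i,
        fun i j hij => D.incl_proj_ne i j (fun h => hij (Subtype.ext h)), ?_⟩⟩⟩
    rw [← D.total, ← Finset.sum_subtype (Finset.univ.filter fun i => d i ∈ S) (by simp)
      (fun i => D.proj i ≫ D.incl i), Finset.sum_filter]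
    · refine Finset.sum_congr rfl fun i _ => ?_
      split_ifs with hi
      · rfl
      · rw [h _ hi _ (hd i) (D.incl i), Limits.comp_zero]

theorem sector_mono {S S' : Set G} (h : S ⊆ S') {X : C} (hX : K.sector S X) : K.sector S' X :=
  K.sector_iff.2 fun g hg => K.sector_iff.1 hX g (fun h' => hg (h h'))

theorem sector_univ (X : C) : K.sector Set.univ X :=
  K.sector_iff.2 fun _ hg => (hg trivial).elim

theorem sector_isSummandClosed (S : Set G) : IsSummandClosed (K.sector S) where
  of_directSum D h := K.sector_iff.2 fun g hg Z hZ f => D.hom_ext' fun i => by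
    rw [Limits.zero_comp]
    exact K.sector_iff.1 (h i) g hg Z hZ _
  of_retract i r hir hX := K.sector_iff.2 fun g hg Z hZ f => by
    rw [← Category.comp_id f, ← hir, ← Category.assoc, K.sector_iff.1 hX g hg Z hZ (f ≫ i),
      Limits.zero_comp]

theorem deg_iff_sector {g : G} {X : C} : K.deg g X ↔ K.sector {g} X := by
  refine ⟨K.sector_of_deg (Set.mem_singleton g), ?_⟩
  rintro ⟨ι, _, d, Y, hd, ⟨D⟩⟩
  exact K.deg_directSum D fun i => (hd i).1 ▸ (hd i).2

theorem deg_isSummandClosed (g : G) : IsSummandClosed (K.deg g) := by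
  have h : K.deg g = K.sector {g} := by
    ext X
    exact K.deg_iff_sector
  rw [h]
  exact K.sector_isSummandClosed {g}

/-- The testing principle for identities on homogeneous components. The additive functor `F` allows
the object to be tested in place, inside tensor products and under the group action. -/
theorem sector_hom_ext {S : Set G} {X : C} (hX : K.sector S X) {D : Type u₂} [Category.{v₂} D]
    [Preadditive D] (F : C ⥤ D) [F.Additive] {W : D} {f f' : F.obj X ⟶ W}
    (h : ∀ g ∈ S, ∀ Z, K.deg g Z → ∀ i : Z ⟶ X, F.map i ≫ f = F.map i ≫ f') : f = f' := by
  obtain ⟨ι, _, d, Y, hd, ⟨D⟩⟩ := hX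
  rw [← Category.id_comp f, ← Category.id_comp f', ← F.map_id, ← D.total, F.map_sum,
    Preadditive.sum_comp, Preadditive.sum_comp]
  refine Finset.sum_congr rfl fun i _ => ?_
  rw [F.map_comp, Category.assoc, Category.assoc, h _ (hd i).1 _ (hd i).2]

theorem sector_hom_eq_zero {S : Set G} {X Y : C} (hX : K.sector S X) {g : G} (hY : K.deg g Y)
    (hg : g ∉ S) (f : X ⟶ Y) : f = 0 := by
  refine K.sector_hom_ext hX (𝟭 C) fun h hh Z hZ i => ?_
  rw [K.hom_eq_zero hZ hY (fun e => hg (e ▸ hh)) ((𝟭 C).map i ≫ f)]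
  exact Limits.comp_zero.symm

/-- Some projection to a homogeneous summand is nonzero, hence a monomorphism out of the simple `X`;
it also has a section, so it is an isomorphism. -/
theorem exists_deg_of_simple [Limits.HasKernels C] {S : Set G} {X : C} (hX : K.sector S X)
    [Simple X] : ∃ g ∈ S, K.deg g X := by
  obtain ⟨ι, _, d, Y, hd, ⟨D⟩⟩ := hX
  obtain ⟨i, hi⟩ : ∃ i, D.proj i ≠ 0 := by
    by_contra! h
    apply id_nonzero X
    rw [← D.total]
    exact Finset.sum_eq_zero fun i _ => by rw [h, Limits.zero_comp]
  have := mono_of_nonzero_from_simple hi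
  have h2 : D.proj i ≫ D.incl i = 𝟙 X := by
    rw [← cancel_mono (D.proj i), Category.assoc, D.incl_proj_self, Category.comp_id,
      Category.id_comp]
  exact ⟨d i, (hd i).1, K.deg_of_iso ⟨D.incl i, D.proj i, D.incl_proj_self i, h2⟩ (hd i).2⟩

theorem sector_tensor [MonoidalPreadditive C] {S S' S'' : Set G}
    (h : ∀ g ∈ S, ∀ g' ∈ S', g * g' ∈ S'') {X Y : C} (hX : K.sector S X) (hY : K.sector S' Y) :
    K.sector S'' (X ⊗ Y) := by
  refine K.sector_iff.2 fun g hg Z hZ f => ?_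
  obtain ⟨ι, _, d, X', hd, ⟨D⟩⟩ := hX
  obtain ⟨κ, _, d', Y', hd', ⟨D'⟩⟩ := hY
  rw [← Category.comp_id f, ← id_tensorHom_id, ← D.total, ← D'.total]
  simp only [tensor_sum, sum_tensor, Preadditive.comp_sum]
  refine Finset.sum_eq_zero fun i _ => Finset.sum_eq_zero fun j _ => ?_
  rw [← tensorHom_comp_tensorHom, ← Category.assoc, K.hom_eq_zero hZ
    (K.deg_tensor (hd j).2 (hd' i).2) (fun e => hg (e ▸ h _ (hd j).1 _ (hd' i).1)) (f ≫ _),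
    Limits.zero_comp]

theorem sector_act' {S S' : Set G} (a : G) (h : ∀ g ∈ S, a * g * a⁻¹ ∈ S') {X : C}
    (hX : K.sector S X) : K.sector S' ((A.act a).obj X) := by
  refine K.sector_iff.2 fun g hg Z hZ f => ?_
  obtain ⟨ι, _, d, X', hd, ⟨D⟩⟩ := hX
  rw [← Category.comp_id f, ← (A.act a).map_id, ← D.total, Functor.map_sum, Preadditive.comp_sum]
  refine Finset.sum_eq_zero fun i _ => ?_
  rw [Functor.map_comp, ← Category.assoc, K.hom_eq_zero hZ (K.deg_act a (hd i).2)
    (fun e => hg (e ▸ h _ (hd i).1)) (f ≫ _), Limits.zero_comp]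

/-- By duality, a morphism to `Y` from an object of degree `g` is a morphism to the unit from an
object with degrees in `g S`, and this set contains `1` only if `g ∈ S⁻¹`. -/
theorem sector_dual [MonoidalPreadditive C] {S : Set G} {X Y : C} (p : ExactPairing X Y)
    (hX : K.sector S X) : K.sector S⁻¹ Y := by
  refine K.sector_iff.2 fun g hg Z hZ f => evaluation_injective p ?_
  have h := K.sector_tensor (S := {g}) (S'' := {k | g⁻¹ * k ∈ S})
    (by rintro _ rfl g' hg'; simpa using hg') (K.deg_iff_sector.1 hZ) hX
  have h1 : (1 : G) ∉ {k | g⁻¹ * k ∈ S} := by simpa using hg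
  rw [K.sector_hom_eq_zero h K.deg_unit h1 (f ▷ X ≫ p.evaluation'),
    K.sector_hom_eq_zero h K.deg_unit h1 ((0 : Z ⟶ Y) ▷ X ≫ p.evaluation')]

theorem deg_dual [MonoidalPreadditive C] {g : G} {X Y : C} (p : ExactPairing X Y)
    (hX : K.deg g X) : K.deg g⁻¹ Y := by
  rw [deg_iff_sector] at hX ⊢
  simpa using K.sector_dual p hX

/-- The category `⨁_{n ∈ N} C_n` is a unitary fusion category. -/
theorem sub_unitaryFusionCategory [UnitaryFusionCategory C] (N : Subgroup G) :
    UnitaryFusionCategory (K.Sub N) :=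
  have hss : IsFiniteSemisimple (K.Sub N) := (K.sector_isSummandClosed N).isFiniteSemisimple
  have hcs : CStarCategory (K.Sub N) := (K.sector_isSummandClosed N).cStarCategory
  { hss, hcs, (inferInstance : MonoidalPreadditive (K.Sub N)),
    (inferInstance : MonoidalLinear ℂ (K.Sub N)), (inferInstance : UnitaryMonoidal (K.Sub N)) with
    simple_unit := by
      have : Simple (𝟙_ C) := UnitaryFusionCategory.simple_unit
      refine OrthogonallyComplete.simple_of_end
        (fun h => id_nonzero (𝟙_ C) (congrArg (fun f => f.hom) h)) fun f => ?_
      obtain ⟨c, hc⟩ := exists_smul_id_of_simple f.hom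
      exact ⟨c, by ext; exact hc⟩
    rigid X := by
      obtain ⟨-, ⟨D⟩⟩ := UnitaryFusionCategory.rigid X.obj
      have hD : K.sector (N : Set G) D.rightDual := by
        have := K.sector_dual D.exact X.property
        simpa using this
      let Y : K.Sub N := ⟨D.rightDual, hD⟩
      have : ExactPairing ((K.sector (N : Set G)).ι.obj X) ((K.sector (N : Set G)).ι.obj Y) :=
        D.exact
      let p : ExactPairing X Y := ExactPairing.ofFullyFaithful (K.sector (N : Set G)).ι X Y
      exact ⟨⟨@HasLeftDual.mk _ _ _ _ Y (exactPairingDag p)⟩, ⟨@HasRightDual.mk _ _ _ _ Y p⟩⟩ }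

end CrossedBraiding

end

/-! ### Half braidings -/

section

variable {G : Type t} [Group G] {C : Type u₁} [Category.{v₁} C] [Preadditive C]
    [Linear ℂ C] [MonoidalCategory C] [DaggerCategory C]

namespace CrossedBraiding

variable {A : UnitaryAction G C} (K : CrossedBraiding A)

theorem braid_natural_left {g : G} {X X' : C} (hX : K.deg g X) (hX' : K.deg g X') (Y : C)
    (f : X ⟶ X') :
    f ▷ Y ≫ (K.braid hX' Y).hom = (K.braid hX Y).hom ≫ (A.act g).obj Y ◁ f := by
  simpa using K.braid_natural hX hX' f (𝟙 Y)

theorem braid_natural_right {g : G} {X : C} (hX : K.deg g X) {Y Y' : C} (f : Y ⟶ Y') :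
    X ◁ f ≫ (K.braid hX Y').hom = (K.braid hX Y).hom ≫ (A.act g).map f ▷ X := by
  simpa using K.braid_natural hX hX (𝟙 X) f

variable [MonoidalPreadditive C]

/-- The sum over a homogeneous decomposition of `X` works for every homogeneous `Z ⟶ X`: the
components of such a morphism in other degrees vanish, and in its own degree the `G`-braiding is
natural. -/
theorem exists_halfBraid {S : Set G} {X : C} (hX : K.sector S X) {Y W : C}
    (t : ∀ g ∈ S, (A.act g).obj Y ⟶ W) :
    ∃ b : X ⊗ Y ⟶ W ⊗ X, ∀ {g : G} (hg : g ∈ S) {Z : C} (hZ : K.deg g Z) (i : Z ⟶ X),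
      i ▷ Y ≫ b = (K.braid hZ Y).hom ≫ t g hg ▷ Z ≫ W ◁ i := by
  obtain ⟨ι, _, d, X', hd, ⟨D⟩⟩ := hX
  refine ⟨∑ k, D.proj k ▷ Y ≫ (K.braid (hd k).2 Y).hom ≫ t _ (hd k).1 ▷ X' k ≫ W ◁ D.incl k,
    fun {g} hg Z hZ i => ?_⟩
  have h (k : ι) : (i ≫ D.proj k) ▷ Y ≫ (K.braid (hd k).2 Y).hom ≫ t _ (hd k).1 ▷ X' k =
      (K.braid hZ Y).hom ≫ t g hg ▷ Z ≫ W ◁ (i ≫ D.proj k) := by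
    by_cases e : g = d k
    · subst e
      rw [← Category.assoc, K.braid_natural_left hZ, Category.assoc, whisker_exchange]
    · rw [K.hom_eq_zero hZ (hd k).2 e (i ≫ D.proj k)]
      simp
  have hi : i = ∑ k, (i ≫ D.proj k) ≫ D.incl k := by
    simp only [Category.assoc]
    rw [← Preadditive.comp_sum, D.total, Category.comp_id]
  conv_rhs => rw [hi]
  rw [whiskerLeft_sum, Preadditive.comp_sum, Preadditive.comp_sum, Preadditive.comp_sum]
  refine Finset.sum_congr rfl fun k _ => ?_
  have h' := congrArg (fun q => q ≫ W ◁ D.incl k) (h k)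
  simpa using h'

/-- The morphism `X ⊗ Y ⟶ W ⊗ X` which on the components of `X` of degree `g ∈ S` is the
`G`-braiding followed by `t g : g(Y) ⟶ W`. -/
noncomputable def halfBraid {S : Set G} {X : C} (hX : K.sector S X) {Y W : C}
    (t : ∀ g ∈ S, (A.act g).obj Y ⟶ W) : X ⊗ Y ⟶ W ⊗ X :=
  (K.exists_halfBraid hX t).choose

theorem whiskerRight_halfBraid {S : Set G} {X : C} (hX : K.sector S X) {Y W : C}
    (t : ∀ g ∈ S, (A.act g).obj Y ⟶ W) {g : G} (hg : g ∈ S) {Z : C} (hZ : K.deg g Z)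
    (i : Z ⟶ X) :
    i ▷ Y ≫ K.halfBraid hX t = (K.braid hZ Y).hom ≫ t g hg ▷ Z ≫ W ◁ i :=
  (K.exists_halfBraid hX t).choose_spec hg hZ i

theorem halfBraid_natural_left {S : Set G} {X X' : C} (hX : K.sector S X) (hX' : K.sector S X')
    {Y W : C} (t : ∀ g ∈ S, (A.act g).obj Y ⟶ W) (f : X ⟶ X') :
    f ▷ Y ≫ K.halfBraid hX' t = K.halfBraid hX t ≫ W ◁ f := by
  refine K.sector_hom_ext hX (tensorRight Y) fun g hg Z hZ i => ?_
  change i ▷ Y ≫ f ▷ Y ≫ _ = i ▷ Y ≫ _ ≫ _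
  rw [← comp_whiskerRight_assoc, K.whiskerRight_halfBraid hX' t hg hZ, ← Category.assoc (i ▷ Y),
    K.whiskerRight_halfBraid hX t hg hZ]
  simp

/-- Naturality in `Y` holds whenever the families are intertwined by `f` and `s`. For equivariant
structures and `f = s` this intertwining is equivariance of `f`. -/
theorem halfBraid_natural_right {S : Set G} {X : C} (hX : K.sector S X) {Y Y' W W' : C}
    (t : ∀ g ∈ S, (A.act g).obj Y ⟶ W) (t' : ∀ g ∈ S, (A.act g).obj Y' ⟶ W') (f : Y ⟶ Y')
    (s : W ⟶ W') (h : ∀ g hg, (A.act g).map f ≫ t' g hg = t g hg ≫ s) :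
    X ◁ f ≫ K.halfBraid hX t' = K.halfBraid hX t ≫ s ▷ X := by
  refine K.sector_hom_ext hX (tensorRight Y) fun g hg Z hZ i => ?_
  change i ▷ Y ≫ _ ≫ _ = i ▷ Y ≫ _ ≫ _
  rw [← whisker_exchange_assoc, K.whiskerRight_halfBraid hX t' hg hZ, ← Category.assoc (i ▷ Y),
    K.whiskerRight_halfBraid hX t hg hZ, ← Category.assoc, K.braid_natural_right, Category.assoc,
    ← comp_whiskerRight_assoc, h]
  simp [whisker_exchange]

/-- The hypothesis is the formula for the structure of a tensor product of equivariant objects; the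
rest is the hexagon of the `G`-braiding. -/
theorem halfBraid_tensor_right {S : Set G} {X : C} (hX : K.sector S X) {Y Z W V : C}
    (t : ∀ g ∈ S, (A.act g).obj Y ⟶ W) (s : ∀ g ∈ S, (A.act g).obj Z ⟶ V)
    (r : ∀ g ∈ S, (A.act g).obj (Y ⊗ Z) ⟶ W ⊗ V)
    (h : ∀ g hg, r g hg = δ (A.act g) Y Z ≫ (t g hg ⊗ₘ s g hg)) :
    K.halfBraid hX r = (α_ X Y Z).inv ≫ K.halfBraid hX t ▷ Z ≫ (α_ _ X Z).hom ≫
      W ◁ K.halfBraid hX s ≫ (α_ _ _ X).inv := by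
  refine K.sector_hom_ext hX (tensorRight (Y ⊗ Z)) fun g hg P hP i => ?_
  change i ▷ (Y ⊗ Z) ≫ _ = i ▷ (Y ⊗ Z) ≫ _
  have h0 := K.braid_tensor_right hP Y Z
  rw [K.whiskerRight_halfBraid hX r hg hP, h, comp_whiskerRight, Category.assoc,
    reassoc_of% h0, associator_inv_naturality_left_assoc,
    ← comp_whiskerRight_assoc, K.whiskerRight_halfBraid hX t hg hP]
  have h1 : W ◁ i ▷ Z ≫ W ◁ K.halfBraid hX s = W ◁ ((K.braid hP Z).hom ≫ s g hg ▷ P ≫ V ◁ i) := by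
    rw [← MonoidalCategory.whiskerLeft_comp, K.whiskerRight_halfBraid hX s hg hP]
  simp only [comp_whiskerRight, Category.assoc]
  rw [associator_naturality_middle_assoc, reassoc_of% h1]
  simp only [MonoidalCategory.whiskerLeft_comp, Category.assoc]
  rw [associator_naturality_left_assoc, ← whisker_exchange_assoc]
  simp [MonoidalCategory.tensorHom_def]

/-- The hypothesis is a cocycle law for the families. It is what matches the isomorphism `g(g'(Z)) ≅
gg'(Z)` occurring in the other hexagon of the `G`-braiding. -/
theorem halfBraid_tensor_left {S S' S'' : Set G} {X Y : C} (hX : K.sector S X)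
    (hY : K.sector S' Y) (hXY : K.sector S'' (X ⊗ Y)) {Z W V : C}
    (s : ∀ g ∈ S', (A.act g).obj Z ⟶ W) (t : ∀ g ∈ S, (A.act g).obj W ⟶ V)
    (r : ∀ g ∈ S'', (A.act g).obj Z ⟶ V)
    (h : ∀ g (hg : g ∈ S) g' (hg' : g' ∈ S'), ∃ hgg' : g * g' ∈ S'',
      (A.mul rfl).hom.app Z ≫ r (g * g') hgg' = (A.act g).map (s g' hg') ≫ t g hg) :
    K.halfBraid hXY r = (α_ X Y Z).hom ≫ X ◁ K.halfBraid hY s ≫ (α_ X _ Y).inv ≫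
      K.halfBraid hX t ▷ Y ≫ (α_ _ X Y).hom := by
  refine K.sector_hom_ext hX (tensorRight Y ⋙ tensorRight Z) fun g hg P hP i => ?_
  -- With `X` already replaced by its homogeneous component `P`, the second factor is tested in
  -- turn.
  refine K.sector_hom_ext hY (tensorLeft P ⋙ tensorRight Z) fun g' hg' Q hQ j => ?_
  change (P ◁ j) ▷ Z ≫ (i ▷ Y) ▷ Z ≫ _ = (P ◁ j) ▷ Z ≫ (i ▷ Y) ▷ Z ≫ _
  obtain ⟨hgg', e⟩ := h g hg g' hg'
  rw [← comp_whiskerRight_assoc, K.whiskerRight_halfBraid hXY r hgg' (K.deg_tensor hP hQ),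
    K.braid_tensor_left hP hQ]
  have h1 : P ◁ j ▷ Z ≫ P ◁ K.halfBraid hY s =
      P ◁ ((K.braid hQ Z).hom ≫ s g' hg' ▷ Q ≫ W ◁ j) := by
    rw [← MonoidalCategory.whiskerLeft_comp, K.whiskerRight_halfBraid hY s hg' hQ]
  have h2 : i ▷ W ▷ Y ≫ K.halfBraid hX t ▷ Y = ((K.braid hP W).hom ≫ t g hg ▷ P ≫ V ◁ i) ▷ Y := by
    rw [← comp_whiskerRight, K.whiskerRight_halfBraid hX t hg hP]
  have h3 := congrArg (fun q => q ▷ (P ⊗ Q)) e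
  simp only [comp_whiskerRight] at h3
  have h4 : P ◁ s g' hg' ▷ Q ≫ (α_ P W Q).inv ≫ (K.braid hP W).hom ▷ Q =
      (α_ P _ Q).inv ≫ (K.braid hP _).hom ▷ Q ≫ (A.act g).map (s g' hg') ▷ P ▷ Q := by
    rw [associator_inv_naturality_middle_assoc, ← comp_whiskerRight, K.braid_natural_right,
      comp_whiskerRight]
  simp only [Category.assoc]
  rw [reassoc_of% h3, associator_naturality_left_assoc, ← whisker_exchange_assoc,
    associator_inv_naturality_left_assoc, reassoc_of% h2, associator_naturality_middle_assoc,
    reassoc_of% h1]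
  simp only [MonoidalCategory.whiskerLeft_comp, comp_whiskerRight, Category.assoc]
  rw [associator_inv_naturality_right_assoc, whisker_exchange_assoc (K.braid hP W).hom j,
    reassoc_of% h4]
  simp only [Category.assoc, MonoidalCategory.whisker_assoc,
    MonoidalCategory.tensor_whiskerLeft]
  rw [← associator_inv_naturality_left_assoc, Iso.inv_hom_id_assoc, whisker_exchange_assoc]
  simp

/-- Translation by `a` sends degree `g` to `a * g * a⁻¹`, and `braid_act` says that it preserves the
`G`-braiding. So only the family has to be translated, using `aga⁻¹(a(Y)) ≅ a(g(Y))`. -/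
theorem halfBraid_act (a : G) {S S' : Set G} {X : C} (hX : K.sector S X)
    (haX : K.sector S' ((A.act a).obj X)) {Y W : C} (t : ∀ g ∈ S, (A.act g).obj Y ⟶ W)
    (t' : ∀ g ∈ S', (A.act g).obj ((A.act a).obj Y) ⟶ (A.act a).obj W)
    (h : ∀ g (hg : g ∈ S), ∃ hg' : a * g * a⁻¹ ∈ S', t' (a * g * a⁻¹) hg' =
      (A.mul (k := a * g) (by group)).hom.app Y ≫ (A.mul (k := a * g) rfl).inv.app Y ≫
        (A.act a).map (t g hg)) :
    μ (A.act a) X Y ≫ (A.act a).map (K.halfBraid hX t) ≫ δ (A.act a) W X =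
      K.halfBraid haX t' := by
  refine K.sector_hom_ext hX (A.act a ⋙ tensorRight _) fun g hg Z hZ i => ?_
  change (A.act a).map i ▷ _ ≫ _ = (A.act a).map i ▷ _ ≫ _
  obtain ⟨hg', e⟩ := h g hg
  rw [K.whiskerRight_halfBraid haX t' hg' (K.deg_act a hZ), μ_natural_left_assoc,
    ← Functor.map_comp_assoc, K.whiskerRight_halfBraid hX t hg hZ, e]
  have h1 := K.braid_act a hZ Y
  have h2 : μ (A.act a) Z Y ≫ (A.act a).map (K.braid hZ Y).hom ≫ δ (A.act a) _ Z =
      (K.braid (K.deg_act a hZ) ((A.act a).obj Y)).hom ≫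
        ((A.mul (k := a * g) (by group)).hom.app Y ≫ (A.mul (k := a * g) rfl).inv.app Y) ▷ _ := by
    rw [← cancel_mono ((A.mul (k := a * g) rfl).hom.app Y ▷ (A.act a).obj Z)]
    simp only [Category.assoc]
    rw [h1, ← comp_whiskerRight, Category.assoc, Iso.inv_hom_id_app, Category.comp_id]
  simp only [Functor.map_comp, Category.assoc]
  rw [← δ_natural_right, ← δ_natural_left_assoc, reassoc_of% h2]
  simp

end CrossedBraiding

end

/-! ### Unitarity of half braidings -/

section

variable {G : Type t} [Group G] {C : Type u₁} [Category.{v₁} C] [Preadditive C]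
    [Linear ℂ C] [MonoidalCategory C] [DaggerCategory C] [UnitaryFusionCategory C]

theorem isUnitaryFunctor_tensorRight (Y : C) : IsUnitaryFunctor (tensorRight Y) where
  map_add f f' := MonoidalPreadditive.add_whiskerRight f f'
  map_smul c f := MonoidalLinear.smul_whiskerRight c f Y
  map_dag f := by
    have := UnitaryMonoidal.dag_tensorHom f (𝟙 Y)
    simpa using this.symm

theorem isUnitaryFunctor_tensorLeft (Y : C) : IsUnitaryFunctor (tensorLeft Y) where
  map_add f f' := MonoidalPreadditive.whiskerLeft_add f f'
  map_smul c f := MonoidalLinear.whiskerLeft_smul Y c f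
  map_dag f := by
    have := UnitaryMonoidal.dag_tensorHom (𝟙 Y) f
    simpa using this.symm

/-- An orthogonal decomposition into simple objects is automatically homogeneous, and on it the half
braiding is an orthogonal sum of unitaries. -/
theorem CrossedBraiding.halfBraid_unitary {A : UnitaryAction G C} (K : CrossedBraiding A)
    {S : Set G} {X : C} (hX : K.sector S X) {Y W : C} (t : ∀ g ∈ S, (A.act g).obj Y ⟶ W)
    (ht : ∀ g hg, IsUnitary (t g hg)) : IsUnitary (K.halfBraid hX t) := by
  have := IsFiniteSemisimple.hasKernels (C := C)
  obtain ⟨ι, _, T, hT, ⟨D⟩⟩ := exists_orthoSum_simple X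
  have hT' (i : ι) : ∃ g ∈ S, K.deg g (T i) :=
    have := hT i
    K.exists_deg_of_simple ((K.sector_isSummandClosed S).of_retract _ _ (D.incl_dag_self i) hX)
  choose d hd hd' using hT'
  refine (D.map (isUnitaryFunctor_tensorRight Y)).isUnitary
    (D.map (isUnitaryFunctor_tensorLeft W)) (Equiv.refl ι)
    (fun i => (K.braid (hd' i) Y).hom ≫ t _ (hd i) ▷ T i)
    (fun i => (K.braid_unitary _ _).comp ?_) fun i => ?_
  · exact (isUnitaryFunctor_tensorRight _).map_unitary (ht _ _)
  · refine (K.whiskerRight_halfBraid hX t (hd i) (hd' i) (D.incl i)).trans ?_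
    exact (Category.assoc _ _ _).symm

end

/-! ### The braiding of the equivariantization -/

section

variable {G : Type t} [Group G] {C : Type u₁} [Category.{v₁} C] [Preadditive C]
    [Linear ℂ C] [MonoidalCategory C] [DaggerCategory C] [UnitaryFusionCategory C]
    {A : UnitaryAction G C} (K : CrossedBraiding A)

namespace CrossedBraiding

/-- The braiding of the equivariantization. -/
noncomputable def gaugeBraidingHom (X Y : Equivariant A) : X ⊗ Y ⟶ Y ⊗ X :=
  ⟨K.halfBraid (K.sector_univ X.obj) (fun g _ => Y.str g), fun a => by
    -- `t'` is the family of the half braiding translated by `a`. By the cocycle law it is the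
    -- structure of `Y` conjugated by `Y.str a`, so naturality along `Y.str a` and `X.str a` leads
    -- back to the original half braiding.
    let t' : ∀ g ∈ Set.univ, (A.act g).obj ((A.act a).obj Y.obj) ⟶ (A.act a).obj Y.obj :=
      fun g _ => (A.act g).map (Y.str a) ≫ Y.str g ≫ dag (Y.str a)
    have h1 := K.halfBraid_act a (K.sector_univ X.obj) (K.sector_univ _) (fun g _ => Y.str g) t'
      (fun g _ => ⟨trivial, by
        have e1 := Y.str_mul (g := a * g * a⁻¹) (h := a) (k := a * g) (by group)
        have e2 := Y.str_mul (g := a) (h := g) (k := a * g) rfl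
        dsimp only [t']
        rw [← Category.assoc, ← e1, Category.assoc, ← cancel_epi
            ((A.mul (g := a * g * a⁻¹) (h := a) (k := a * g) (by group)).inv.app Y.obj),
          Iso.inv_hom_id_app_assoc, Iso.inv_hom_id_app_assoc,
          ← cancel_epi ((A.mul (k := a * g) rfl).hom.app Y.obj), Iso.hom_inv_id_app_assoc,
          ← Category.assoc, e2, Category.assoc, (Y.str_unitary a).hom_dag, Category.comp_id]⟩)
    have h2 := K.halfBraid_natural_right (K.sector_univ ((A.act a).obj X.obj)) t'
      (fun g _ => Y.str g) (Y.str a) (Y.str a) (fun g _ => by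
        dsimp only [t']
        rw [Category.assoc, Category.assoc, (Y.str_unitary a).dag_hom, Category.comp_id])
    have h3 := K.halfBraid_natural_left (K.sector_univ ((A.act a).obj X.obj))
      (K.sector_univ X.obj) (fun g _ => Y.str g) (X.str a)
    change (A.act a).map _ ≫ δ (A.act a) _ _ ≫ (Y.str a ⊗ₘ X.str a) =
      (δ (A.act a) _ _ ≫ (X.str a ⊗ₘ Y.str a)) ≫ _
    rw [← cancel_epi (μ (A.act a) X.obj Y.obj), Category.assoc, Functor.Monoidal.μ_δ_assoc,
      tensorHom_def' (X.str a), Category.assoc, h3, reassoc_of% h2, ← h1,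
      MonoidalCategory.tensorHom_def (Y.str a)]
    simp only [Category.assoc]⟩

theorem gaugeBraidingHom_unitary (X Y : Equivariant A) : IsUnitary (K.gaugeBraidingHom X Y) :=
  Equivariant.isUnitary_iff.2 (K.halfBraid_unitary (K.sector_univ X.obj) _ fun g _ => Y.str_unitary
  g)

/-- The braided structure of the equivariantization of a crossed braided category. -/
@[reducible]
noncomputable def gaugeBraiding : BraidedCategory (Equivariant A) where
  braiding X Y := (K.gaugeBraidingHom_unitary X Y).iso
  braiding_naturality_right X Y Z f := Equivariant.hom_ext
    (K.halfBraid_natural_right (K.sector_univ X.obj) (fun g _ => Y.str g) (fun g _ => Z.str g)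
      f.hom f.hom fun g _ => f.comm g)
  braiding_naturality_left {X Y} f Z := Equivariant.hom_ext
    (K.halfBraid_natural_left (K.sector_univ X.obj) (K.sector_univ Y.obj) (fun g _ => Z.str g)
      f.hom)
  hexagon_forward X Y Z := Equivariant.hom_ext (by
    change (α_ X.obj Y.obj Z.obj).hom ≫
      K.halfBraid (K.sector_univ X.obj) (fun g _ => (Y ⊗ Z).str g) ≫ (α_ _ _ _).hom = _
    rw [K.halfBraid_tensor_right (K.sector_univ X.obj) (fun g _ => Y.str g) (fun g _ => Z.str g)
      (fun g _ => (Y ⊗ Z).str g) fun g _ => rfl]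
    simp only [Category.assoc, Iso.inv_hom_id, Category.comp_id, Iso.hom_inv_id_assoc]
    rfl)
  hexagon_reverse X Y Z := Equivariant.hom_ext (by
    change (α_ X.obj Y.obj Z.obj).inv ≫
      K.halfBraid (K.sector_univ (X.obj ⊗ Y.obj)) (fun g _ => Z.str g) ≫ (α_ _ _ _).inv = _
    rw [K.halfBraid_tensor_left (K.sector_univ X.obj) (K.sector_univ Y.obj)
      (K.sector_univ (X.obj ⊗ Y.obj)) (fun g _ => Z.str g) (fun g _ => Z.str g)
      (fun g _ => Z.str g) fun g _ g' _ => ⟨trivial, Z.str_mul rfl⟩]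
    simp only [Category.assoc, Iso.hom_inv_id, Category.comp_id, Iso.inv_hom_id_assoc]
    rfl)

theorem gaugeBraiding_unitary :
    letI := K.gaugeBraiding
    UnitaryBraided (Equivariant A) :=
  letI := K.gaugeBraiding
  ⟨fun X Y => K.gaugeBraidingHom_unitary X Y⟩

theorem isGaugeBraiding_gaugeBraiding :
    letI := K.gaugeBraiding
    K.IsGaugeBraiding :=
  letI := K.gaugeBraiding
  fun X Y _ _ hZ i => K.whiskerRight_halfBraid (K.sector_univ X.obj) (fun g _ => Y.str g)
    trivial hZ i

end CrossedBraiding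

end

/-! ### Comparison maps along cosets -/

section

variable {G : Type t} [Group G] {C : Type u₁} [Category.{v₁} C] [Preadditive C]
    [Linear ℂ C] [MonoidalCategory C] [DaggerCategory C]
    {A : UnitaryAction G C} {N : Subgroup G}

namespace Equivariant

/-- The isomorphism `k(Y) ≅ g(n(Y)) ⟶ g(Y)` for `k = g n` and an `N`-equivariant object `Y`. -/
def cosetMap (Y : Equivariant (A.comp N.subtype)) {g k : G} {n : N} (e : g * n = k) :
    (A.act k).obj Y.obj ⟶ (A.act g).obj Y.obj :=
  (A.mul e).inv.app Y.obj ≫ (A.act g).map (Y.strN n)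

theorem cosetMap_unitary (Y : Equivariant (A.comp N.subtype)) {g k : G} {n : N}
    (e : g * n = k) : IsUnitary (Y.cosetMap e) :=
  (IsUnitary.inv ((A.mul e).app Y.obj) (A.mul_unitary e Y.obj)).comp
    (A.map_unitary g (Y.str_unitary n))

theorem mul_cosetMap (Y : Equivariant (A.comp N.subtype)) {g k : G} {n : N} (e : g * n = k) :
    (A.mul e).hom.app Y.obj ≫ Y.cosetMap e = (A.act g).map (Y.strN n) := by
  rw [cosetMap, Iso.hom_inv_id_app_assoc]

theorem cosetMap_congr (Y : Equivariant (A.comp N.subtype)) {g k : G} {n n' : N}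
    (e : g * n = k) (e' : g * n' = k) : Y.cosetMap e = Y.cosetMap e' := by
  obtain rfl : n = n' := Subtype.ext (mul_left_cancel (e.trans e'.symm))
  rfl

theorem cosetMap_natural {Y Y' : Equivariant (A.comp N.subtype)} (f : Y ⟶ Y') {g k : G} {n : N}
    (e : g * n = k) :
    (A.act k).map f.hom ≫ Y'.cosetMap e = Y.cosetMap e ≫ (A.act g).map f.hom := by
  have nat := (A.mul e).hom.naturality f.hom
  simp only [Functor.comp_map] at nat
  rw [← cancel_epi ((A.mul e).hom.app Y.obj), ← Category.assoc, ← nat, Category.assoc,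
    mul_cosetMap, ← Category.assoc, mul_cosetMap, ← Functor.map_comp, ← Functor.map_comp,
    comm_strN]

theorem map_cosetMap (Y : Equivariant (A.comp N.subtype)) {a g k ag ak : G} {n : N}
    (e : g * n = k) (e₁ : a * g = ag) (e₂ : a * k = ak) (e₃ : ag * n = ak) :
    (A.act a).map (Y.cosetMap e) ≫ (A.mul e₁).hom.app Y.obj =
      (A.mul e₂).hom.app Y.obj ≫ Y.cosetMap e₃ := by
  have nat := (A.mul e₁).hom.naturality (Y.strN n)
  simp only [Functor.comp_map] at nat
  rw [← cancel_epi ((A.act a).map ((A.mul e).hom.app Y.obj)), ← Functor.map_comp_assoc,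
    mul_cosetMap, nat, ← Category.assoc, A.mul_mul e₁ e e₃ e₂, Category.assoc, mul_cosetMap]

/-- Coset maps compose along a left coset of `N`; this is the cocycle law of `Y` translated by `g`.
-/
theorem cosetMap_comp (Y : Equivariant (A.comp N.subtype)) {g k l : G} {n m nm : N}
    (e : g * n = k) (e' : k * m = l) (e'' : g * nm = l) :
    Y.cosetMap e' ≫ Y.cosetMap e = Y.cosetMap e'' := by
  have h : (n : G) * m = nm := by
    rw [← mul_right_inj g, ← mul_assoc, e, e', e'']
  have nat := (A.mul e).hom.naturality (Y.strN m)
  simp only [Functor.comp_map] at nat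
  have h1 := A.mul_mul e h e' e'' Y.obj
  rw [← cancel_epi ((A.mul e').hom.app Y.obj), ← Category.assoc, mul_cosetMap,
    ← cancel_epi ((A.mul e).hom.app _), ← Category.assoc, ← nat, Category.assoc, mul_cosetMap,
    ← Functor.map_comp, ← strN_mul Y h, ← Category.assoc, ← h1, Category.assoc, mul_cosetMap,
    Functor.map_comp]

variable [hN : N.Normal]

/-- The structure on `g(X)` is itself a coset map, so verifications for the residual action become
identities between coset maps. -/
theorem residualObj_strN' (X : Equivariant (A.comp N.subtype)) {g k : G} {n m : N}
    (e : (n : G) * g = k) (e' : g * m = k) :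
    (residualObj g X).strN n = (A.mul e).hom.app X.obj ≫ X.cosetMap e' := by
  obtain rfl : m = conj g n :=
    Subtype.ext (mul_left_cancel (e'.trans (e.symm.trans (conj_spec g n))))
  have h1 := A.swap_comp (conj_spec g n) e e' X.obj
  rw [residualObj_strN, ← h1, Category.assoc, mul_cosetMap]

/-- A coset map of `a(X)` is one of `X` after right multiplication by `a`, where `n` is replaced by
`m = a⁻¹ * n * a`. -/
theorem cosetMap_residualObj (X : Equivariant (A.comp N.subtype)) {a g k ag ak : G} {n m : N}
    (e : g * n = k) (e₁ : g * a = ag) (e₂ : k * a = ak) (e₃ : ag * m = ak) :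
    (residualObj a X).cosetMap e ≫ (A.mul e₁).hom.app X.obj =
      (A.mul e₂).hom.app X.obj ≫ X.cosetMap e₃ := by
  have h : a * m = n * a := by
    rw [← mul_right_inj g, ← mul_assoc, e₁, e₃, ← mul_assoc, e, e₂]
  have h' : g * (n * a) = ak := by rw [← mul_assoc, e, e₂]
  have h1 : (A.act g).map ((residualObj a X).strN n) ≫ (A.mul e₁).hom.app X.obj =
      (A.act g).map ((A.mul rfl).hom.app X.obj) ≫ (A.mul h').hom.app X.obj ≫ X.cosetMap e₃ := by
    rw [residualObj_strN' X rfl h]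
    refine (congrArg (fun q => q ≫ (A.mul e₁).hom.app X.obj) ((A.act g).map_comp _ _)).trans ?_
    refine (Category.assoc _ _ _).trans ?_
    exact congrArg (fun q => (A.act g).map ((A.mul rfl).hom.app X.obj) ≫ q)
      (map_cosetMap X h e₁ h' e₃)
  rw [← Category.assoc, A.mul_mul e rfl e₂ h', Category.assoc] at h1
  refine (Category.assoc _ _ _).trans ((congrArg (fun q => (A.mul e).inv.app _ ≫ q) h1).trans ?_)
  exact Iso.inv_hom_id_app_assoc _ _ _

theorem cosetMap_tensor [UnitaryMonoidal C] (Y Z : Equivariant (A.comp N.subtype)) {g k : G}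
    {n : N} (e : g * n = k) :
    (Y ⊗ Z).cosetMap e ≫ δ (A.act g) Y.obj Z.obj =
      δ (A.act k) Y.obj Z.obj ≫ (Y.cosetMap e ⊗ₘ Z.cosetMap e) := by
  rw [← cancel_epi ((A.mul e).hom.app (Y ⊗ Z).obj), ← Category.assoc, mul_cosetMap, tensor_strN,
    Functor.map_comp, Category.assoc, ← δ_natural]
  change _ = (A.mul e).hom.app (Y.obj ⊗ Z.obj) ≫ _ ≫ _
  rw [← Category.assoc (NatTrans.app _ _), A.mul_tensor' e, Category.assoc, Category.assoc,
    tensorHom_comp_tensorHom, mul_cosetMap, mul_cosetMap]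

end Equivariant

end

/-! ### Spectral projections of the grading -/

section

variable {G : Type t} [Group G] {C : Type u₁} [Category.{v₁} C] [Preadditive C]
    [Linear ℂ C] [MonoidalCategory C] [DaggerCategory C] {A : UnitaryAction G C}
    (K : CrossedBraiding A)

namespace CrossedBraiding

/-- The simple summands of an orthogonal decomposition are homogeneous. The sum of the projections
onto those with degree in `S` is self-adjoint because the decomposition is orthogonal. -/
theorem exists_sectorProj [CStarCategory C] [IsFiniteSemisimple C] (S : Set G) (X : C) :
    ∃ p : X ⟶ X, dag p = p ∧ (∀ g ∈ S, ∀ Z, K.deg g Z → ∀ i : Z ⟶ X, i ≫ p = i) ∧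
      ∀ g ∉ S, ∀ Z, K.deg g Z → ∀ i : Z ⟶ X, i ≫ p = 0 := by
  classical
  have := IsFiniteSemisimple.hasKernels (C := C)
  obtain ⟨ι, _, T, hT, ⟨D⟩⟩ := exists_orthoSum_simple X
  have hT' (i : ι) : ∃ g, K.deg g (T i) := by
    have := hT i
    obtain ⟨g, -, hg⟩ := K.exists_deg_of_simple (K.sector_univ (T i))
    exact ⟨g, hg⟩
  choose d hd using hT'
  refine ⟨∑ i, if d i ∈ S then dag (D.incl i) ≫ D.incl i else 0, ?_, fun g hg Z hZ i => ?_,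
    fun g hg Z hZ i => ?_⟩
  · rw [dag_sum]
    refine Finset.sum_congr rfl fun i _ => ?_
    split_ifs <;> simp
  · conv_rhs => rw [← Category.comp_id i, ← D.total]
    rw [Preadditive.comp_sum, Preadditive.comp_sum]
    refine Finset.sum_congr rfl fun j _ => ?_
    split_ifs with hj
    · rfl
    · rw [← Category.assoc, K.hom_eq_zero hZ (hd j) (fun e => hj (e ▸ hg)) (i ≫ _),
        Limits.zero_comp, Limits.comp_zero]
  · rw [Preadditive.comp_sum]
    refine Finset.sum_eq_zero fun j _ => ?_
    split_ifs with hj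
    · rw [← Category.assoc, K.hom_eq_zero hZ (hd j) (fun e => hg (e ▸ hj)) (i ≫ _),
        Limits.zero_comp]
    · exact Limits.comp_zero

variable [CStarCategory C] [IsFiniteSemisimple C]

/-- The orthogonal projection onto the part of an object with degrees in `S`. -/
noncomputable def sectorProj (S : Set G) (X : C) : X ⟶ X := (K.exists_sectorProj S X).choose

theorem dag_sectorProj (S : Set G) (X : C) : dag (K.sectorProj S X) = K.sectorProj S X :=
  (K.exists_sectorProj S X).choose_spec.1

theorem comp_sectorProj_of_mem {S : Set G} {X : C} {g : G} (hg : g ∈ S) {Z : C} (hZ : K.deg g Z)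
    (i : Z ⟶ X) : i ≫ K.sectorProj S X = i :=
  (K.exists_sectorProj S X).choose_spec.2.1 g hg Z hZ i

theorem comp_sectorProj_of_notMem {S : Set G} {X : C} {g : G} (hg : g ∉ S) {Z : C}
    (hZ : K.deg g Z) (i : Z ⟶ X) : i ≫ K.sectorProj S X = 0 :=
  (K.exists_sectorProj S X).choose_spec.2.2 g hg Z hZ i

theorem sectorProj_natural (S : Set G) {X Y : C} (f : X ⟶ Y) :
    f ≫ K.sectorProj S Y = K.sectorProj S X ≫ f := by
  refine K.sector_hom_ext (K.sector_univ X) (𝟭 C) fun g _ Z hZ i => ?_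
  change i ≫ f ≫ _ = i ≫ _ ≫ _
  by_cases hg : g ∈ S
  · rw [← Category.assoc, K.comp_sectorProj_of_mem hg hZ, ← Category.assoc i,
      K.comp_sectorProj_of_mem hg hZ]
  · rw [← Category.assoc, K.comp_sectorProj_of_notMem hg hZ, ← Category.assoc i,
      K.comp_sectorProj_of_notMem hg hZ, Limits.zero_comp]

theorem sectorProj_idem (S : Set G) (X : C) :
    K.sectorProj S X ≫ K.sectorProj S X = K.sectorProj S X := by
  refine K.sector_hom_ext (K.sector_univ X) (𝟭 C) fun g _ Z hZ i => ?_
  change i ≫ _ ≫ _ = i ≫ _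
  by_cases hg : g ∈ S
  · rw [← Category.assoc, K.comp_sectorProj_of_mem hg hZ]
  · rw [K.comp_sectorProj_of_notMem hg hZ, ← Category.assoc, K.comp_sectorProj_of_notMem hg hZ]

theorem map_sectorProj {S S' : Set G} (a : G) (h : ∀ g, a * g * a⁻¹ ∈ S' ↔ g ∈ S) (X : C) :
    (A.act a).map (K.sectorProj S X) = K.sectorProj S' ((A.act a).obj X) := by
  refine K.sector_hom_ext (K.sector_univ X) (A.act a) fun g _ Z hZ i => ?_
  by_cases hg : g ∈ S
  · rw [← Functor.map_comp, K.comp_sectorProj_of_mem hg hZ,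
      K.comp_sectorProj_of_mem ((h g).2 hg) (K.deg_act a hZ)]
  · rw [← Functor.map_comp, K.comp_sectorProj_of_notMem hg hZ,
      K.comp_sectorProj_of_notMem (fun h' => hg ((h g).1 h')) (K.deg_act a hZ), Functor.map_zero]

theorem sector_of_comp_sectorProj {S : Set G} {X Y : C} (v : Y ⟶ X) (hv : v ≫ dag v = 𝟙 Y)
    (h : v ≫ K.sectorProj S X = v) : K.sector S Y :=
  K.sector_iff.2 fun g hg Z hZ f => by
    have h1 : f ≫ v = 0 := by
      rw [← h, ← Category.assoc, K.comp_sectorProj_of_notMem hg hZ]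
    rw [← Category.comp_id f, ← hv, ← Category.assoc, h1, Limits.zero_comp]

theorem halfBraid_comp [MonoidalPreadditive C] {S : Set G} {X : C} (hX : K.sector S X)
    {Y W W' : C} (t : ∀ g ∈ S, (A.act g).obj Y ⟶ W) (s : W ⟶ W') :
    K.halfBraid hX (fun g hg => t g hg ≫ s) = K.halfBraid hX t ≫ s ▷ X := by
  have := K.halfBraid_natural_right hX t (fun g hg => t g hg ≫ s) (𝟙 Y) s (fun g hg => by simp)
  rwa [MonoidalCategory.whiskerLeft_id, Category.id_comp] at this

end CrossedBraiding

end

/-! ### The crossed braided structure of an equivariantization by a normal subgroup -/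

section

variable {G : Type t} [Group G] {C : Type u₁} [Category.{v₁} C] [Preadditive C]
    [Linear ℂ C] [MonoidalCategory C] [DaggerCategory C] [UnitaryFusionCategory C]
    {A : UnitaryAction G C} (K : CrossedBraiding A) (N H : Subgroup G) [hN : N.Normal]

open Equivariant

/-- The left coset `h N`. -/
abbrev coset (h : G) : Set G := {g | ∃ n : N, g = h * n}

namespace CrossedBraiding

variable {N} in
theorem mem_coset {h g : G} (hg : g ∈ coset N h) : ∃ n : N, h * n = g :=
  ⟨hg.choose, hg.choose_spec.symm⟩

/-- The underlying morphism of the residual half braiding. -/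
noncomputable def residualBraid {h : G} {X : C} (hX : K.sector (coset N h) X)
    (Y : Equivariant (A.comp N.subtype)) : X ⊗ Y.obj ⟶ (A.act h).obj Y.obj ⊗ X :=
  K.halfBraid hX fun _ hg => Y.cosetMap (mem_coset hg).choose_spec

variable {N} in
-- Normality makes `h N` stable under conjugation by `N`, so the part of an `N`-equivariant object
-- with degrees in `h N` is again `N`-equivariant. The witness comes from `n * (h * m) * n⁻¹ = h *
-- ((h⁻¹ * n * h) * m * n⁻¹)`.
theorem conj_mem_coset {n g h : G} (hn : n ∈ N) :
    (n * g * n⁻¹ ∈ coset N h) ↔ g ∈ coset N h := by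
  constructor
  · rintro ⟨m, hm⟩
    refine ⟨⟨h⁻¹ * n⁻¹ * h * m * n, ?_⟩, ?_⟩
    · refine N.mul_mem (N.mul_mem ?_ m.2) hn
      simpa using hN.conj_mem _ (N.inv_mem hn) h⁻¹
    · rw [← mul_left_inj n⁻¹, ← mul_right_inj n, ← mul_assoc, hm]
      group
  · rintro ⟨m, rfl⟩
    refine ⟨⟨h⁻¹ * n * h * m * n⁻¹, ?_⟩, ?_⟩
    · refine N.mul_mem (N.mul_mem ?_ m.2) (N.inv_mem hn)
      simpa using hN.conj_mem _ hn h⁻¹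
    · group

/-- The argument is that of `gaugeBraidingHom` with coset maps in place of the structure of `Y`. The
required identity of families holds because both sides are composites of coset maps in the coset `h
N`, using `n * h = h * (h⁻¹ * n * h)`. -/
theorem residualBraid_comm {h : G} {X : Equivariant (A.comp N.subtype)}
    (hX : K.sector (coset N h) X.obj) (Y : Equivariant (A.comp N.subtype)) (n : N) :
    (A.act n).map (K.residualBraid N hX Y) ≫ δ (A.act n) _ _ ≫
        ((residualObj h Y).strN n ⊗ₘ X.strN n) =
      (δ (A.act n) _ _ ≫ (X.strN n ⊗ₘ Y.strN n)) ≫ K.residualBraid N hX Y := by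
  have hu : IsUnitary ((residualObj h Y).strN n) := (residualObj h Y).str_unitary n
  obtain ⟨s, hs⟩ : ∃ s : (A.act n).obj ((A.act h).obj Y.obj) ⟶ (A.act h).obj Y.obj,
    s = (residualObj h Y).strN n := ⟨_, rfl⟩
  have hsu : IsUnitary s := hs ▸ hu
  have hnX : K.sector (coset N h) ((A.act n).obj X.obj) :=
    K.sector_act' n (fun g hg => (conj_mem_coset n.2).2 hg) hX
  let t' : ∀ g ∈ coset N h, (A.act g).obj ((A.act n).obj Y.obj) ⟶
      (A.act n).obj ((A.act h).obj Y.obj) :=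
    fun g hg => (A.act g).map (Y.strN n) ≫ Y.cosetMap (mem_coset hg).choose_spec ≫ dag s
  have h1 := K.halfBraid_act n hX hnX (fun _ hg => Y.cosetMap (mem_coset hg).choose_spec) t'
    (fun g hg => ⟨(conj_mem_coset n.2).2 hg, by
      obtain ⟨m, hm⟩ := mem_coset hg
      have hg' := (conj_mem_coset n.2).2 hg
      obtain ⟨m', hm'⟩ := mem_coset hg'
      have e1 : n * g * (n : G)⁻¹ * n = n * g := by group
      have e2 : h * (m' * n : N) = n * g := by
        rw [Subgroup.coe_mul, ← mul_assoc, hm', e1]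
      have e3 : h * (conj h n : N) = n * h := (conj_spec h n).symm
      have e4 : (n * h : G) * m = n * g := by rw [mul_assoc, hm]
      dsimp only [t']
      rw [Y.cosetMap_congr _ hm', Y.cosetMap_congr _ hm, ← Y.mul_cosetMap e1, Category.assoc,
        ← cancel_epi ((A.mul e1).inv.app Y.obj), Iso.inv_hom_id_app_assoc,
        Iso.inv_hom_id_app_assoc, ← cancel_epi ((A.mul (k := n * g) rfl).hom.app Y.obj),
        Iso.hom_inv_id_app_assoc, ← Category.assoc (Y.cosetMap e1), Y.cosetMap_comp hm' e1 e2]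
      have := hsu.isIso
      rw [← cancel_mono s, Category.assoc, Category.assoc, hsu.dag_hom, Category.comp_id, hs,
        residualObj_strN' Y rfl e3, ← Category.assoc ((A.act _).map _)]
      refine Eq.trans ?_ (congrArg (fun q => q ≫ Y.cosetMap e3)
        (map_cosetMap Y hm rfl rfl e4)).symm
      rw [Category.assoc, Y.cosetMap_comp e3 e4 e2]⟩)
  have h2 := K.halfBraid_natural_right hnX t'
    (fun _ hg => Y.cosetMap (mem_coset hg).choose_spec) (Y.strN n) s (fun g _ => by
      dsimp only [t']
      rw [Category.assoc, Category.assoc, hsu.dag_hom, Category.comp_id])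
  have h3 := K.halfBraid_natural_left hnX hX
    (fun _ hg => Y.cosetMap (mem_coset hg).choose_spec) (X.strN n)
  have key : (A.act n).map (K.residualBraid N hX Y) ≫ δ (A.act n) _ _ ≫ (s ⊗ₘ X.strN n) =
      (δ (A.act n) _ _ ≫ (X.strN n ⊗ₘ Y.strN n)) ≫ K.residualBraid N hX Y := by
    rw [← cancel_epi (μ (A.act n) X.obj Y.obj), Category.assoc, Functor.Monoidal.μ_δ_assoc,
      tensorHom_def' (X.strN n), Category.assoc, residualBraid, h3, reassoc_of% h2, ← h1,
      MonoidalCategory.tensorHom_def s]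
    simp only [Category.assoc]
  rw [← hs]
  exact key

/-- The residual half braiding as a morphism of equivariant objects. -/
noncomputable def residualBraidHom {h : G} {X : Equivariant (A.comp N.subtype)}
    (hX : K.sector (coset N h) X.obj) (Y : Equivariant (A.comp N.subtype)) :
    X ⊗ Y ⟶ (residualFunctor A N h).obj Y ⊗ X :=
  ⟨K.residualBraid N hX Y, fun n => K.residualBraid_comm N hX Y n⟩

theorem residualBraidHom_unitary {h : G} {X : Equivariant (A.comp N.subtype)}
    (hX : K.sector (coset N h) X.obj) (Y : Equivariant (A.comp N.subtype)) :
    IsUnitary (K.residualBraidHom N hX Y) :=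
  isUnitary_iff.2 (K.halfBraid_unitary hX _ fun _ _ => Y.cosetMap_unitary _)

/-- Translation of the half braiding by `a` is governed by `halfBraid_act`; the coset maps of `a(Y)`
are compared with those of `Y` by `cosetMap_residualObj`. Degree `h * n` goes to `b * (a * n *
a⁻¹)`, which stays in the coset of `b`. -/
theorem residualBraid_act {a b h ah : G} (e : a * h * a⁻¹ = b) (e₁ : a * h = ah)
    (e₂ : b * a = ah) {X : C} (hX : K.sector (coset N h) X)
    (haX : K.sector (coset N b) ((A.act a).obj X)) (Y : Equivariant (A.comp N.subtype)) :
    μ (A.act a) X Y.obj ≫ (A.act a).map (K.residualBraid N hX Y) ≫ δ (A.act a) _ X ≫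
        (A.mul e₁).hom.app Y.obj ▷ (A.act a).obj X =
      K.residualBraid N haX (residualObj a Y) ≫ (A.mul e₂).hom.app Y.obj ▷ (A.act a).obj X := by
  obtain ⟨c, hc⟩ : ∃ c : ∀ g ∈ coset N b, (A.act g).obj ((A.act a).obj Y.obj) ⟶
      (A.act b).obj ((A.act a).obj Y.obj),
      c = fun _ hg => (residualObj a Y).cosetMap (mem_coset hg).choose_spec := ⟨_, rfl⟩
  have hc' {g l : G} (hg : g ∈ coset N b) (k₁ : g * a = l) {n : N} (k₂ : ah * n = l) :
      c g hg ≫ (A.mul e₂).hom.app Y.obj = (A.mul k₁).hom.app Y.obj ≫ Y.cosetMap k₂ := by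
    rw [hc]
    exact cosetMap_residualObj Y _ e₂ k₁ k₂
  suffices h : μ (A.act a) X Y.obj ≫ (A.act a).map (K.residualBraid N hX Y) ≫ δ (A.act a) _ X ≫
      (A.mul e₁).hom.app Y.obj ▷ (A.act a).obj X =
        K.halfBraid haX c ≫ (A.mul e₂).hom.app Y.obj ▷ (A.act a).obj X from
    h.trans (by rw [hc]; rfl)
  have h1 := K.halfBraid_act a hX haX (fun _ hg => Y.cosetMap (mem_coset hg).choose_spec)
    (fun g hg => c g hg ≫ (A.mul e₂).hom.app Y.obj ≫ (A.mul e₁).inv.app Y.obj) (fun g hg => by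
      obtain ⟨n, hn⟩ := mem_coset hg
      have hb : b * (⟨a * n * a⁻¹, hN.conj_mem n n.2 a⟩ : N) = a * g * a⁻¹ := by
        rw [← e, ← hn]
        simp [mul_assoc]
      have k₁ : a * g * a⁻¹ * a = a * g := by group
      have k₂ : ah * n = a * g := by rw [← e₁, mul_assoc, hn]
      refine ⟨⟨_, hb.symm⟩, ?_⟩
      rw [Y.cosetMap_congr _ hn, reassoc_of% hc' ⟨_, hb.symm⟩ k₁ k₂,
        ← cancel_mono ((A.mul e₁).hom.app Y.obj)]
      simp only [Category.assoc]
      rw [map_cosetMap Y hn e₁ rfl k₂, Iso.inv_hom_id_app, Iso.inv_hom_id_app_assoc]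
      exact congrArg (fun q => (A.mul k₁).hom.app Y.obj ≫ q) (Category.comp_id _))
  rw [K.halfBraid_comp haX c] at h1
  have h3 := congrArg (fun q => q ≫ (A.mul e₁).hom.app Y.obj ▷ (A.act a).obj X) h1
  simp only [Category.assoc] at h3
  refine h3.trans ?_
  rw [← comp_whiskerRight, Category.assoc, Iso.inv_hom_id_app]
  exact congrArg (fun q => K.halfBraid haX c ≫ q ▷ (A.act a).obj X) (Category.comp_id _)

/-- The cocycle law needed by `halfBraid_tensor_left` is a composition of coset maps, along `(g * n)
* (h * n') = g * h * ((h⁻¹ * n * h) * n')`. -/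
theorem residualBraid_tensor_left {g h gh : G} (e : g * h = gh) {X Y : C}
    (hX : K.sector (coset N g) X) (hY : K.sector (coset N h) Y)
    (hXY : K.sector (coset N gh) (X ⊗ Y)) (Z : Equivariant (A.comp N.subtype)) :
    K.residualBraid N hXY Z = (α_ X Y Z.obj).hom ≫ X ◁ K.residualBraid N hY Z ≫ (α_ X _ Y).inv ≫
      K.residualBraid N hX (residualObj h Z) ▷ Y ≫ (α_ _ X Y).hom ≫
        (A.mul e).hom.app Z.obj ▷ (X ⊗ Y) := by
  obtain ⟨c, hc⟩ : ∃ c : ∀ k ∈ coset N g, (A.act k).obj ((A.act h).obj Z.obj) ⟶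
      (A.act g).obj ((A.act h).obj Z.obj),
      c = fun _ hg => (residualObj h Z).cosetMap (mem_coset hg).choose_spec := ⟨_, rfl⟩
  have hc' {k l : G} (hk : k ∈ coset N g) (k₁ : k * h = l) {n : N} (k₂ : gh * n = l) :
      c k hk ≫ (A.mul e).hom.app Z.obj = (A.mul k₁).hom.app Z.obj ≫ Z.cosetMap k₂ := by
    rw [hc]
    exact cosetMap_residualObj Z _ e k₁ k₂
  suffices h : K.residualBraid N hXY Z =
      (α_ X Y Z.obj).hom ≫ X ◁ K.residualBraid N hY Z ≫ (α_ X _ Y).inv ≫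
        K.halfBraid hX c ▷ Y ≫ (α_ _ X Y).hom ≫ (A.mul e).hom.app Z.obj ▷ (X ⊗ Y) from
    h.trans (by rw [hc]; rfl)
  have h1 := K.halfBraid_tensor_left hX hY hXY
    (fun _ hg => Z.cosetMap (mem_coset hg).choose_spec)
    (fun k hk => c k hk ≫ (A.mul e).hom.app Z.obj)
    (fun _ hg => Z.cosetMap (mem_coset hg).choose_spec) (fun k hk k' hk' => by
      obtain ⟨n, hn⟩ := mem_coset hk
      obtain ⟨n', hn'⟩ := mem_coset hk'
      have k₁ : gh * (conj h n : N) = k * h := by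
        rw [← e, mul_assoc, ← conj_spec, ← mul_assoc, hn]
      have k₂ : k * h * n' = k * k' := by rw [mul_assoc, hn']
      have k₃ : gh * (conj h n * n' : N) = k * k' := by
        rw [Subgroup.coe_mul, ← mul_assoc, k₁, k₂]
      refine ⟨⟨_, k₃.symm⟩, ?_⟩
      rw [Z.cosetMap_congr _ k₃, Z.cosetMap_congr _ hn', hc' hk rfl k₁, ← Category.assoc,
        map_cosetMap Z hn' rfl rfl k₂, Category.assoc, Z.cosetMap_comp k₁ k₂ k₃])
  refine h1.trans ?_
  rw [K.halfBraid_comp hX c, comp_whiskerRight, Category.assoc, associator_naturality_left]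
  rfl

theorem coset_tensor {g h : G} {X Y : C} (hX : K.sector (coset N g) X)
    (hY : K.sector (coset N h) Y) : K.sector (coset N (g * h)) (X ⊗ Y) :=
  K.sector_tensor (by
    rintro _ ⟨n, rfl⟩ _ ⟨n', rfl⟩
    exact ⟨Equivariant.conj h n * n', by simp [Equivariant.conj, mul_assoc]⟩) hX hY

theorem coset_act (a : G) {h : G} {X : C} (hX : K.sector (coset N h) X) :
    K.sector (coset N (a * h * a⁻¹)) ((A.act a).obj X) :=
  K.sector_act' a (by
    rintro _ ⟨n, rfl⟩
    exact ⟨⟨a * n * a⁻¹, hN.conj_mem n n.2 a⟩, by simp [mul_assoc]⟩) hX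

/-- Since `h N` is stable under conjugation by `N`, the projection onto the degrees in `h N`
commutes with the equivariant structure, and it splits in the equivariantization. -/
theorem exists_residual_summand (h : G) (X : Equivariant (A.comp N.subtype)) :
    ∃ (Y : Equivariant (A.comp N.subtype)) (v : Y ⟶ X), v ≫ dag v = 𝟙 Y ∧
      (dag v ≫ v).hom = K.sectorProj (coset N h) X.obj ∧
      K.sector (coset N h) Y.obj := by
  let p : X ⟶ X := ⟨K.sectorProj (coset N h) X.obj, fun n => by
    change (A.act n).map _ ≫ _ = _
    rw [K.map_sectorProj n fun g => conj_mem_coset n.2]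
    exact (K.sectorProj_natural _ (X.strN n)).symm⟩
  obtain ⟨Y, v, hv, hp⟩ := OrthogonallyComplete.exists_splitting p
    (hom_ext (K.dag_sectorProj _ _)) (hom_ext (K.sectorProj_idem _ _))
  refine ⟨Y, v, hv, congrArg Hom.hom hp, K.sector_of_comp_sectorProj v.hom (congrArg Hom.hom hv) ?_⟩
  have : v ≫ p = v := by rw [← hp, ← Category.assoc, hv, Category.id_comp]
  exact congrArg Hom.hom this

variable {N H} (hNH : N.IsComplement' H) [Finite G]

include hNH in
theorem coset_eq {h h' : H} {g : G} (hg : g ∈ coset N h)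
    (hg' : g ∈ coset N h') : h = h' := by
  obtain ⟨n, rfl⟩ := hg
  obtain ⟨n', e⟩ := hg'
  have h1 := (Subgroup.IsComplement'.symm hNH).1 (a₁ := (h, n)) (a₂ := (h', n')) e
  exact congrArg Prod.fst h1

include hNH in
theorem exists_coset (g : G) : ∃ h : H, g ∈ coset N h := by
  obtain ⟨⟨h, n⟩, e⟩ := (Subgroup.IsComplement'.symm hNH).2 g
  exact ⟨h, n, e.symm⟩

include hNH in
-- The cosets `h N` with `h ∈ H` partition `G`, so the corresponding projections are mutually
-- orthogonal and add up to the identity.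
theorem residual_decomposition (X : Equivariant (A.comp N.subtype)) :
    ∃ (ι : Type) (_ : Fintype ι) (d : ι → H) (Y : ι → Equivariant (A.comp N.subtype)),
      (∀ i, K.sector (coset N (d i)) (Y i).obj) ∧ Nonempty (DirectSum Y X) := by
  classical
  choose Y v hv hp hY using fun h : H => K.exists_residual_summand N h X
  -- The index set of a decomposition has to live in `Type`, so `H` is replaced by `Fin (Nat.card
  -- H)`.
  let e := (Finite.equivFin H).symm
  refine ⟨Fin (Nat.card H), inferInstance, fun i => e i, fun i => Y (e i), fun i => hY _,
    ⟨⟨fun i => v (e i), fun i => dag (v (e i)), fun i => hv _, fun i j hij => hom_ext ?_,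
      hom_ext ?_⟩⟩⟩
  · refine K.sector_hom_ext (hY (e i)) (𝟭 C) fun g hg Z hZ k => ?_
    rw [K.sector_iff.1 (hY (e j)) g
      (fun hg' => hij (e.injective (coset_eq hNH hg hg'))) Z hZ ((𝟭 C).map k ≫ _)]
    exact Limits.comp_zero.symm
  · refine K.sector_hom_ext (K.sector_univ X.obj) (𝟭 C) fun g _ Z hZ k => ?_
    have h1 : (∑ i, dag (v (e i)) ≫ v (e i)).hom =
        ∑ i, K.sectorProj (coset N (e i)) X.obj := by
      have : (Equivariant.forget (A.comp N.subtype)).Additive := ⟨rfl⟩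
      refine ((Equivariant.forget (A.comp N.subtype)).map_sum _ _).trans ?_
      exact Finset.sum_congr rfl fun i _ => hp (e i)
    rw [h1]
    change k ≫ _ = k ≫ 𝟙 _
    obtain ⟨h, hg⟩ := exists_coset hNH g
    rw [Preadditive.comp_sum, Finset.sum_eq_single (e.symm h), Category.comp_id,
      K.comp_sectorProj_of_mem (by simpa using hg) hZ]
    · intro i _ hi
      refine K.comp_sectorProj_of_notMem (fun hg' => hi ?_) hZ k
      rw [coset_eq hNH hg hg', e.symm_apply_apply]
    · simp

/-- Inducing a nonzero object `Z` of degree `h` from the trivial group to `N` gives summands of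
degree `n * h * n⁻¹ ∈ h N`, and the summand at `n = 1` is a copy of `Z`. -/
theorem residual_faithful (h : G) : ∃ X : Equivariant (A.comp N.subtype),
    K.sector (coset N h) X.obj ∧ ¬ Limits.IsZero X := by
  obtain ⟨Z, hZ, h0⟩ := K.faithful h
  have := Fintype.ofFinite N
  obtain ⟨I, D, -⟩ := exists_induced (A := A.comp N.subtype) Z
  refine ⟨I, K.sector_iff.2 fun g hg W hW f => ?_, fun hI => h0 ?_⟩
  · rw [← Category.comp_id f, ← D.total, Preadditive.comp_sum]
    refine Finset.sum_eq_zero fun n _ => ?_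
    have h1 : K.deg (n * h * (n : G)⁻¹) ((A.act n).obj Z) := K.deg_act n hZ
    rw [← Category.assoc]
    have h2 : f ≫ dag (D.incl n) = 0 := K.hom_eq_zero hW h1 (fun e => hg (e ▸ by
      rw [conj_mem_coset n.2]
      exact ⟨1, by simp⟩)) _
    rw [h2, Limits.zero_comp]
  · rw [Limits.IsZero.iff_id_eq_zero] at hI ⊢
    have h1 : 𝟙 I.obj = 0 := congrArg Hom.hom hI
    have h2 : 𝟙 ((A.act (1 : N)).obj Z) = 0 := by
      refine (D.incl_dag_self 1).symm.trans ?_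
      rw [← Category.comp_id (D.incl 1), h1, Limits.comp_zero, Limits.zero_comp]
      rfl
    have e : ((1 : N) : G) = 1 := rfl
    have h3 := congrArg (fun q => (A.one e).hom.app Z ≫ q ≫ (A.one e).inv.app Z) h2
    rw [Limits.zero_comp, Limits.comp_zero] at h3
    rw [← h3]
    exact ((congrArg (fun q => (A.one e).hom.app Z ≫ q) (Category.id_comp _)).trans
      (Iso.hom_inv_id_app _ _)).symm

/-- The crossed braided structure of the equivariantization by a normal subgroup. -/
noncomputable def residualCrossed :
    CrossedBraiding ((residual A N).comp H.subtype) where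
  deg h X := K.sector (coset N h) X.obj
  deg_of_iso e hX := (K.sector_isSummandClosed _).of_iso ((Equivariant.forget _).mapIso e) hX
  deg_directSum {h ι _ Y X} D hX := (K.sector_isSummandClosed _).of_directSum
    (Y := fun i => (_ : Equivariant (A.comp N.subtype)).obj)
    { incl i := (D.incl i).hom
      proj i := (D.proj i).hom
      incl_proj_self i := congrArg Hom.hom (D.incl_proj_self i)
      incl_proj_ne i j hij := congrArg Hom.hom (D.incl_proj_ne i j hij)
      total := by
        have : (Equivariant.forget (A.comp N.subtype)).Additive := ⟨rfl⟩
        exact ((Equivariant.forget (A.comp N.subtype)).map_sum _ _).symm.trans (congrArg Hom.hom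
            D.total) } hX
  hom_eq_zero {h h'} X Y hX hY e f := hom_ext (by
    refine K.sector_hom_ext hX (𝟭 C) fun g hg Z hZ i => ?_
    rw [K.sector_iff.1 hY g (fun hg' => e (coset_eq hNH hg hg')) Z hZ ((𝟭 C).map i ≫ f.hom)]
    exact Limits.comp_zero.symm)
  decomposition X := K.residual_decomposition hNH X
  faithful h := K.residual_faithful h
  deg_unit := K.sector_of_deg (S := coset N ((1 : H) : G)) ⟨1, by simp⟩ K.deg_unit
  deg_tensor hX hY := K.coset_tensor N hX hY
  deg_act a _ _ hX := K.coset_act N a hX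
  braid hX Y := (K.residualBraidHom_unitary N hX Y).iso
  braid_unitary hX Y := K.residualBraidHom_unitary N hX Y
  braid_natural {h X X'} hX hX' Y Y' f f' := hom_ext (by
    change (f.hom ⊗ₘ f'.hom) ≫ K.residualBraid N hX' Y' =
      K.residualBraid N hX Y ≫ ((A.act h).map f'.hom ⊗ₘ f.hom)
    rw [tensorHom_def', Category.assoc, residualBraid, K.halfBraid_natural_left hX hX',
      ← Category.assoc, K.halfBraid_natural_right hX _ _ f'.hom ((A.act h).map f'.hom)
        (fun g hg => cosetMap_natural f' _), Category.assoc, ← MonoidalCategory.tensorHom_def]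
    rfl)
  braid_act a h X hX Y := hom_ext (K.residualBraid_act N (by simp) _ _ hX (K.coset_act N a hX) Y)
  braid_tensor_right {h X} hX Y Z := hom_ext (by
    change K.residualBraid N hX (Y ⊗ Z) ≫ δ (A.act h) Y.obj Z.obj ▷ X.obj = (α_ _ _ _).inv ≫
      K.residualBraid N hX Y ▷ Z.obj ≫ (α_ _ _ _).hom ≫
        (A.act h).obj Y.obj ◁ K.residualBraid N hX Z ≫ (α_ _ _ _).inv
    rw [residualBraid, residualBraid, residualBraid]
    refine Eq.trans ?_ (K.halfBraid_tensor_right hX _ _ (fun g hg =>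
      (Y ⊗ Z).cosetMap (mem_coset hg).choose_spec ≫ δ (A.act h) Y.obj Z.obj)
      fun g hg => cosetMap_tensor Y Z _)
    have := K.halfBraid_natural_right hX (fun g hg => (Y ⊗ Z).cosetMap (mem_coset hg).choose_spec)
      (fun g hg => (Y ⊗ Z).cosetMap (mem_coset hg).choose_spec ≫ δ (A.act h) Y.obj Z.obj) (𝟙 _)
      (δ (A.act h) Y.obj Z.obj) (fun g hg => by simp)
    rw [MonoidalCategory.whiskerLeft_id, Category.id_comp] at this
    exact this.symm)
  braid_tensor_left hX hY Z := hom_ext (K.residualBraid_tensor_left N _ hX hY (K.coset_tensor N hX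
      hY) Z)

theorem residualCrossed_isResidual : IsResidual K (K.residualCrossed hNH) where
  deg_iff h X := Iff.rfl
  braid_eq {h X} hX Y n Z hZ i := by
    refine (K.whiskerRight_halfBraid hX _ ⟨n, rfl⟩ hZ i).trans ?_
    rw [Y.cosetMap_congr _ (rfl : (h : G) * n = h * n)]
    rfl

end CrossedBraiding

end

/-! ### The gauging by the normal subgroup as the trivial component -/

section

variable {G : Type t} [Group G] {C : Type u₁} [Category.{v₁} C] [Preadditive C]
    [Linear ℂ C] [MonoidalCategory C] [DaggerCategory C] [UnitaryFusionCategory C]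
    {A : UnitaryAction G C} (K : CrossedBraiding A) (N : Subgroup G)

open Equivariant

namespace CrossedBraiding

/-- The inclusion of the equivariantization of `⨁_{n ∈ N} C_n` in the one of `C`. -/
def subEquivariantι : Equivariant (K.subAction N) ⥤ Equivariant (A.comp N.subtype) where
  obj X :=
    { obj := X.obj.obj
      str n := (X.str n).hom
      str_unitary n := (isUnitary_full _).1 (X.str_unitary n)
      str_mul e := congrArg (fun f => f.hom) (X.str_mul e) }
  map f := ⟨f.hom.hom, fun n => congrArg (fun f => f.hom) (f.comm n)⟩

instance : (K.subEquivariantι N).Monoidal :=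
  Functor.CoreMonoidal.toMonoidal
    { εIso := isoMk (Iso.refl (𝟙_ C)) (fun n =>
        (congrArg (fun q => q ≫ η (A.act n)) ((A.act n).map_id _)).trans
          ((Category.id_comp _).trans (Category.comp_id _).symm))
      μIso X Y := isoMk (Iso.refl (X.obj.obj ⊗ Y.obj.obj)) (fun n =>
        (congrArg (fun q => q ≫ δ (A.act n) X.obj.obj Y.obj.obj ≫ ((X.str n).hom ⊗ₘ (Y.str n).hom))
          ((A.act n).map_id _)).trans ((Category.id_comp _).trans (Category.comp_id _).symm))
      μIso_hom_natural_left f X := hom_ext ((Category.comp_id _).trans (Category.id_comp _).symm)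
      μIso_hom_natural_right X f := hom_ext ((Category.comp_id _).trans (Category.id_comp _).symm)
      associativity X Y Z := hom_ext (by
        change 𝟙 _ ▷ _ ≫ 𝟙 _ ≫ (α_ X.obj.obj Y.obj.obj Z.obj.obj).hom =
          (α_ X.obj.obj Y.obj.obj Z.obj.obj).hom ≫ _ ◁ 𝟙 _ ≫ 𝟙 _
        simp)
      left_unitality X := hom_ext (by
        change (λ_ X.obj.obj).hom = 𝟙 _ ▷ _ ≫ 𝟙 _ ≫ (λ_ X.obj.obj).hom
        simp)
      right_unitality X := hom_ext (by
        change (ρ_ X.obj.obj).hom = _ ◁ 𝟙 _ ≫ 𝟙 _ ≫ (ρ_ X.obj.obj).hom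
        simp) }

theorem isUnitaryTensorFunctor_subEquivariantι :
    IsUnitaryTensorFunctor (K.subEquivariantι N) where
  map_add _ _ := rfl
  map_smul _ _ := rfl
  map_dag _ := rfl
  μ_unitary X Y := isUnitary_iff.2 (IsUnitary.id (X.obj.obj ⊗ Y.obj.obj))
  ε_unitary := isUnitary_iff.2 (IsUnitary.id (𝟙_ C))

/-- For the trivial coset the coset map is the equivariant structure itself. Hence the residual
`H`-braiding in degree `1` is the gauge braiding of `⨁ C_n`. -/
theorem cosetMap_one {N : Subgroup G} (Y : Equivariant (A.comp N.subtype)) {o : G} {n : N}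
    (e : o * n = n) (ho : o = 1) : Y.cosetMap e ≫ (A.one ho).inv.app Y.obj = Y.strN n := by
  have nat := (A.one ho).hom.naturality (Y.strN n)
  rw [Functor.id_map] at nat
  have h := A.one_mul_left ho e Y.obj
  rw [← cancel_mono ((A.one ho).hom.app Y.obj)]
  refine Eq.trans ?_ nat.symm
  rw [Category.assoc, Iso.inv_hom_id_app]
  refine (Category.comp_id _).trans ?_
  rw [← cancel_epi ((A.mul e).hom.app Y.obj), mul_cosetMap, ← cancel_epi ((A.one ho).hom.app _),
    ← Category.assoc _ _ (_ ≫ _)]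
  refine Eq.trans ?_ (congrArg (fun q => q ≫ _) h.symm)
  exact (Category.id_comp _).symm

variable {N} {H : Subgroup G} [hN : N.Normal] (hNH : N.IsComplement' H) [Finite G]

/-- On a component of degree `g ∈ N` both sides are the `G`-braiding followed by the structure of
`Y` at `g`. This is what makes the embedding of the gauging by `N` braided. -/
theorem restrict_halfBraid_hom (X Y : Equivariant (K.subAction N)) {o : G} (ho : o = 1)
    (hX : K.sector (coset N o) X.obj.obj) :
    ((K.restrict N).halfBraid ((K.restrict N).sector_univ X.obj) (fun n _ => Y.str n)).hom =
      K.residualBraid N hX ((K.subEquivariantι N).obj Y) ≫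
        (A.one ho).inv.app Y.obj.obj ▷ X.obj.obj := by
  refine K.sector_hom_ext X.obj.property (tensorRight Y.obj.obj) fun g hg Z hZ i => ?_
  have h1 := congrArg (fun f => f.hom) ((K.restrict N).whiskerRight_halfBraid
    ((K.restrict N).sector_univ X.obj) (fun n _ => Y.str n) (g := ⟨g, hg⟩) trivial
    (Z := ⟨Z, K.sector_of_deg hg hZ⟩) hZ (ObjectProperty.homMk i))
  have hgo : g ∈ coset N o := ⟨⟨g, hg⟩, by simp [ho]⟩
  have h2 := K.whiskerRight_halfBraid hX
    (fun _ hg => ((K.subEquivariantι N).obj Y).cosetMap (mem_coset hg).choose_spec) hgo hZ i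
  refine h1.trans (Eq.trans ?_ ((congrArg (fun q => q ≫ (A.one ho).inv.app Y.obj.obj ▷ X.obj.obj)
    h2.symm).trans (Category.assoc _ _ _)))
  obtain ⟨c, hc⟩ : ∃ c : (A.act g).obj Y.obj.obj ⟶ (A.act o).obj Y.obj.obj,
    c = ((K.subEquivariantι N).obj Y).cosetMap (mem_coset hgo).choose_spec := ⟨_, rfl⟩
  have h3 : c ≫ (A.one ho).inv.app Y.obj.obj = (Y.str ⟨g, hg⟩).hom := by
    rw [hc, cosetMap_congr _ _ (by simp [ho] : o * (⟨g, hg⟩ : N) = g)]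
    exact cosetMap_one ((K.subEquivariantι N).obj Y) _ ho
  suffices h : (K.braid hZ Y.obj.obj).hom ≫ (Y.str ⟨g, hg⟩).hom ▷ Z ≫ Y.obj.obj ◁ i =
      ((K.braid hZ Y.obj.obj).hom ≫ c ▷ Z ≫ (A.act o).obj Y.obj.obj ◁ i) ≫
        (A.one ho).inv.app Y.obj.obj ▷ X.obj.obj from h.trans (by rw [hc]; rfl)
  rw [Category.assoc, Category.assoc, whisker_exchange]
  refine Eq.trans ?_ (congrArg (fun q => (K.braid hZ Y.obj.obj).hom ≫ q)
    (comp_whiskerRight_assoc c ((A.one ho).inv.app Y.obj.obj) Z (Y.obj.obj ◁ i)))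
  exact congrArg (fun q => (K.braid hZ Y.obj.obj).hom ≫ q ▷ Z ≫ Y.obj.obj ◁ i) h3.symm

theorem sector_coset_one {o : G} (ho : o = 1) (X : Equivariant (K.subAction N)) :
    K.sector (coset N o) X.obj.obj :=
  K.sector_mono (S' := coset N o) (fun g hg => ⟨⟨g, hg⟩, by simp [ho]⟩) X.obj.property

/-- The gauging by `N` as the trivial component of the equivariantization by `N`. -/
@[reducible]
noncomputable def residualExtension [UnitaryFusionCategory (K.Sub N)] :
    letI := (K.restrict N).gaugeBraiding
    (K.residualCrossed hNH).Extension (Equivariant (K.subAction N)) :=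
  letI := (K.restrict N).gaugeBraiding
  { ι := K.subEquivariantι N
    unitary := K.isUnitaryTensorFunctor_subEquivariantι N
    full := ⟨fun f => ⟨⟨ObjectProperty.homMk f.hom, fun n => by ext; exact f.comm n⟩, rfl⟩⟩
    faithful := ⟨fun h => hom_ext (by ext; exact congrArg Hom.hom h)⟩
    deg_one_iff X := by
      have hS : coset N ((1 : H) : G) = (N : Set G) := by
        ext g
        simp
      change K.sector (coset N ((1 : H) : G)) X.obj ↔ _
      rw [hS]
      constructor
      · intro hX
        exact ⟨⟨⟨X.obj, hX⟩, fun n => ObjectProperty.homMk (X.str n),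
          fun n => (isUnitary_full _).2 (X.str_unitary n), fun e => by ext; exact X.str_mul e⟩,
          ⟨isoMk (Iso.refl _) fun n => (congrArg (fun q => q ≫ X.str n) ((A.act n).map_id _)).trans
            ((Category.id_comp _).trans (Category.comp_id _).symm)⟩⟩
      · rintro ⟨b, ⟨e⟩⟩
        exact (K.sector_isSummandClosed _).of_iso ((Equivariant.forget _).mapIso e)
          b.obj.property
    deg_ι b := K.sector_coset_one rfl b
    braided a b := hom_ext ((Category.id_comp _).trans ((K.restrict_halfBraid_hom a b rfl
      (K.sector_coset_one rfl a)).trans (congrArg (fun q => K.residualBraid N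
        (K.sector_coset_one rfl a) ((K.subEquivariantι N).obj b) ≫ q)
          (Category.comp_id ((A.one rfl).inv.app b.obj.obj ▷ a.obj.obj)).symm))) }

/-- The comparison of the forgetful functors. -/
def subEquivariantιForget :
    K.subEquivariantι N ⋙ Equivariant.forget (A.comp N.subtype) ≅
      Equivariant.forget (K.subAction N) ⋙ (K.sector (N : Set G)).ι :=
  NatIso.ofComponents (fun X => Iso.refl X.obj.obj)
    (fun _ => (Category.comp_id _).trans (Category.id_comp _).symm)

theorem subEquivariantιForget_isMonoidal :
    NatTrans.IsMonoidal (subEquivariantιForget K (N := N)).hom where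
  unit := by
    change (𝟙 (𝟙_ C) ≫ 𝟙 (𝟙_ C)) ≫ 𝟙 (𝟙_ C) = 𝟙 (𝟙_ C) ≫ 𝟙 (𝟙_ C)
    simp
  tensor X Y := by
    change (𝟙 (X.obj.obj ⊗ Y.obj.obj) ≫ 𝟙 (X.obj.obj ⊗ Y.obj.obj)) ≫ 𝟙 (X.obj.obj ⊗ Y.obj.obj) =
      (𝟙 X.obj.obj ⊗ₘ 𝟙 Y.obj.obj) ≫ 𝟙 (X.obj.obj ⊗ Y.obj.obj) ≫ 𝟙 (X.obj.obj ⊗ Y.obj.obj)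
    simp

end CrossedBraiding

end

/-! ### Restriction of realizations -/

section

variable {G : Type t} [Group G] {C : Type u₁} [Category.{v₁} C] [Preadditive C]
    [Linear ℂ C] [MonoidalCategory C] [DaggerCategory C] [UnitaryFusionCategory C]
    {A : UnitaryAction G C} {K : CrossedBraiding A}
    {B : Type u₂} [Category.{v₂} B] [Preadditive B] [Linear ℂ B] [MonoidalCategory B]
    [DaggerCategory B] [BraidedCategory B] [UnitaryFusionCategory B]

/-- The restriction to a subgroup of an extension corresponding to `ρ` corresponds to the
restriction of `ρ`. -/
def CrossedBraiding.Extension.Realization.restrict {E : K.Extension B}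
    {ρ : TriHom.{w₁, w₂} G B} (R : E.Realization ρ) (N : Subgroup G) :
    (E.restrict N).Realization (ρ.comp N.subtype) where
  J n := (K.sector (N : Set G)).lift (R.J n) (fun x =>
    K.sector_of_deg n.2 ((R.deg_iff n _).2 ⟨x, ⟨Iso.refl _⟩⟩))
  unitary n :=
    { map_add f f' := by ext; exact (R.unitary n).map_add f f'
      map_smul c f := by ext; exact (R.unitary n).map_smul c f
      map_dag f := by ext; exact (R.unitary n).map_dag f }
  full n := ⟨fun f => by
    obtain ⟨k, hk⟩ := (R.full n).map_surjective f.hom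
    exact ⟨k, by ext; exact hk⟩⟩
  faithful n := ⟨fun h => (R.faithful n).map_injective (congrArg (fun f => f.hom) h)⟩
  deg_iff n X := by
    refine (R.deg_iff n X.obj).trans ⟨?_, ?_⟩
    · rintro ⟨x, ⟨e⟩⟩
      exact ⟨x, ⟨(K.sector (N : Set G)).isoMk e⟩⟩
    · rintro ⟨x, ⟨e⟩⟩
      exact ⟨x, ⟨(K.sector (N : Set G)).ι.mapIso e⟩⟩
  act b x := (K.sector (N : Set G)).isoMk (R.act b x)
  mul e x y := (K.sector (N : Set G)).isoMk (R.mul (congrArg Subtype.val e) x y)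
  unit e := (K.sector (N : Set G)).isoMk (R.unit (congrArg Subtype.val e))
  act_unitary b x := (isUnitary_full _).2 (R.act_unitary b x)
  mul_unitary e x y := (isUnitary_full _).2 (R.mul_unitary _ x y)
  unit_unitary e := (isUnitary_full _).2 (R.unit_unitary _)
  act_natural f p := by ext; exact R.act_natural f p
  act_tensor a b x := by ext; exact R.act_tensor a b x
  act_unit x := by ext; exact R.act_unit x
  mul_natural e _ _ _ _ p q := by ext; exact R.mul_natural _ p q
  mul_left e b x y := by ext; exact R.mul_left _ b x y
  mul_right e b x y := by ext; exact R.mul_right _ b x y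
  mul_assoc e₁ e₂ e₃ e₄ x y z := by ext; exact R.mul_assoc _ _ _ _ x y z
  mul_unit_left e e' x := by ext; exact R.mul_unit_left _ _ x
  mul_unit_right e e' x := by ext; exact R.mul_unit_right _ _ x

end

/-! ### Relative tensor products -/

section

/-- A functor on `Z` from a functor on the full image of a family `O` of objects of which all
objects of `Z` are retracts. -/
theorem exists_functor_of_retract {Z : Type u₁} [Category.{v₁} Z] [Preadditive Z] [Linear ℂ Z]
    {D : Type u₂} [Category.{v₂} D] [Preadditive D] [Linear ℂ D] [IsIdempotentComplete D]
    {ι : Type*} (O : ι → Z)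
    (hO : ∀ z, ∃ (s : ι) (i : z ⟶ O s) (p : O s ⟶ z), i ≫ p = 𝟙 z) (W : ι → D)
    (m : ∀ {s t : ι}, (O s ⟶ O t) → (W s ⟶ W t)) (hid : ∀ s, m (𝟙 (O s)) = 𝟙 (W s))
    (hcomp : ∀ {r s t : ι} (f : O r ⟶ O s) (g : O s ⟶ O t), m (f ≫ g) = m f ≫ m g)
    (hadd : ∀ {s t : ι} (f g : O s ⟶ O t), m (f + g) = m f + m g)
    (hsmul : ∀ {s t : ι} (c : ℂ) (f : O s ⟶ O t), m (c • f) = c • m f) :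
    ∃ (T : Z ⥤ D) (_ : T.Additive) (_ : T.Linear ℂ) (θ : ∀ s, T.obj (O s) ≅ W s),
      ∀ {s t : ι} (f : O s ⟶ O t), T.map f ≫ (θ t).hom = (θ s).hom ≫ m f := by
  choose s i p hip using hO
  have hidem (z : Z) : m (p z ≫ i z) ≫ m (p z ≫ i z) = m (p z ≫ i z) := by
    rw [← hcomp, Category.assoc, reassoc_of% (hip z)]
  -- An object `z` is sent to the image of the idempotent `m (p z ≫ i z)`.
  choose V j q hjq hqj using fun z => IsIdempotentComplete.idempotents_split _ _ (hidem z)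
  have hm {z : Z} {t : ι} (f : z ⟶ O t) : m (p z ≫ i z) ≫ m (p z ≫ f) = m (p z ≫ f) := by
    rw [← hcomp, Category.assoc, reassoc_of% (hip z)]
  have hj {z : Z} : j z ≫ m (p z ≫ i z) = j z := by rw [← hqj, reassoc_of% (hjq z)]
  have hq {z : Z} : m (p z ≫ i z) ≫ q z = q z :=
      by rw [← hqj, Category.assoc, hjq, Category.comp_id]
  let T : Z ⥤ D :=
    { obj := V
      map {z z'} f := j z ≫ m (p z ≫ f ≫ i z') ≫ q z'
      map_id z := by rw [Category.id_comp, hq, hjq]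
      map_comp {z z' z''} f g := by
        simp only [Category.assoc]
        rw [reassoc_of% (hqj z'), ← Category.assoc (m (p z' ≫ i z')), hm, ← Category.assoc (m _),
          ← hcomp]
        simp only [Category.assoc]
        rw [reassoc_of% (hip z')] }
  refine ⟨T, ⟨fun {_ _ f g} => ?_⟩, ⟨fun f c => ?_⟩, fun t =>
    ⟨j (O t) ≫ m (p (O t)), m (i (O t)) ≫ q (O t), ?_, ?_⟩, fun {r t} f => ?_⟩
  · change j _ ≫ m (p _ ≫ (f + g) ≫ i _) ≫ q _ = _
    rw [Preadditive.add_comp, Preadditive.comp_add, hadd, Preadditive.add_comp,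
      Preadditive.comp_add]
  · change j _ ≫ m (p _ ≫ (c • f) ≫ i _) ≫ q _ = _
    rw [Linear.smul_comp, Linear.comp_smul, hsmul, Linear.smul_comp, Linear.comp_smul]
  · rw [Category.assoc, ← Category.assoc (m _), ← hcomp, hq, hjq]
  · rw [Category.assoc, reassoc_of% (hqj (O t)), ← Category.assoc, ← hcomp,
      reassoc_of% (hip (O t)), ← hcomp, hip, hid]
  · change (j _ ≫ m (p _ ≫ f ≫ i _) ≫ q _) ≫ j _ ≫ m (p _) = (j _ ≫ m (p _)) ≫ m f
    simp only [Category.assoc]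
    rw [reassoc_of% (hqj (O t)), ← hcomp, ← hcomp, ← hcomp]
    simp only [Category.assoc]
    rw [reassoc_of% (hip (O t)), hip, Category.comp_id]

theorem IsFiniteSemisimple.isIdempotentComplete (D : Type u₁) [Category.{v₁} D] [Preadditive D]
    [Linear ℂ D] [h : IsFiniteSemisimple D] : IsIdempotentComplete D := by
  rw [Idempotents.isIdempotentComplete_iff_idempotents_have_kernels]
  intro X p _
  have := h.hasKernels
  infer_instance

variable {B : Type u₂} [Category.{v₂} B] [Preadditive B] [Linear ℂ B] [MonoidalCategory B]
  [DaggerCategory B] [BraidedCategory B]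

namespace BalancedFunctor

variable {X : UModCat.{u₁, v₁} B} {Y : UModCat.{u₃, v₃} B} {Z : Type w₁}
    [Category.{w₂} Z] [Preadditive Z] [Linear ℂ Z] (Ψ : BalancedFunctor X Y Z)

/-- The value on a pair of morphisms. -/
def onHom {x x' : X} {y y' : Y} (k : x ⟶ x') (l : y ⟶ y') :
    (Ψ.F.obj x).obj y ⟶ (Ψ.F.obj x').obj y' :=
  (Ψ.F.map k).app y ≫ (Ψ.F.obj x').map l

theorem onHom_comp {x x' x'' : X} {y y' y'' : Y} (f : x ⟶ x') (f' : x' ⟶ x'') (k : y ⟶ y')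
    (k' : y' ⟶ y'') : Ψ.onHom (f ≫ f') (k ≫ k') = Ψ.onHom f k ≫ Ψ.onHom f' k' := by
  simp [onHom]

theorem onHom_comp_left {x x' x'' : X} (f : x ⟶ x') (f' : x' ⟶ x'') (y : Y) :
    Ψ.onHom (f ≫ f') (𝟙 y) = Ψ.onHom f (𝟙 y) ≫ Ψ.onHom f' (𝟙 y) := by
  rw [← onHom_comp, Category.comp_id]

theorem onHom_comp_right (x : X) {y y' y'' : Y} (k : y ⟶ y') (k' : y' ⟶ y'') :
    Ψ.onHom (𝟙 x) (k ≫ k') = Ψ.onHom (𝟙 x) k ≫ Ψ.onHom (𝟙 x) k' := by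
  rw [← onHom_comp, Category.comp_id]

theorem onHom_exchange {x x' : X} {y y' : Y} (k : x ⟶ x') (l : y ⟶ y') :
    Ψ.onHom (𝟙 x) l ≫ Ψ.onHom k (𝟙 y') = Ψ.onHom k (𝟙 y) ≫ Ψ.onHom (𝟙 x') l := by
  simp only [← onHom_comp, Category.comp_id, Category.id_comp]

theorem onHom_id (x : X) (y : Y) : Ψ.onHom (𝟙 x) (𝟙 y) = 𝟙 _ := by
  simp [onHom]

theorem onHom_balance {b b' : B} {x x' : X} {y y' : Y} (f : b ⟶ b') (k : x ⟶ x') (l : y ⟶ y') :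
    Ψ.onHom (f ⊙ₗₘ k) l ≫ (Ψ.balance b' x' y').hom =
      (Ψ.balance b x y).hom ≫ Ψ.onHom k (f ⊙ₗₘ l) :=
  Ψ.balance_natural f k l

/-- The morphism `x · y ⟶ x' · y'` given by `u : x ⟶ b ⊙ x'` and `v : b ⊙ y ⟶ y'`. -/
def pair {x x' : X} {y y' : Y} {b : B} (u : x ⟶ b ⊙ₗ x') (v : b ⊙ₗ y ⟶ y') :
    (Ψ.F.obj x).obj y ⟶ (Ψ.F.obj x').obj y' :=
  Ψ.onHom u (𝟙 y) ≫ (Ψ.balance b x' y).hom ≫ Ψ.onHom (𝟙 x') v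

/-- The coend relation: naturality of the balancing moves `w` from the right factor to the left one.
-/
theorem pair_whisker {x x' : X} {y y' : Y} {b b' : B} (u : x ⟶ b ⊙ₗ x') (w : b ⟶ b')
    (v : b' ⊙ₗ y ⟶ y') : Ψ.pair u (w ⊵ₗ y ≫ v) = Ψ.pair (u ≫ w ⊵ₗ x') v := by
  have h := Ψ.onHom_balance w (𝟙 x') (𝟙 y)
  simp only [MonoidalLeftAction.actionHom_id] at h
  rw [pair, pair, onHom_comp_left, onHom_comp_right, Category.assoc, reassoc_of% h]

/-- Ordinary morphisms are the pairs with `b` the unit object. -/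
theorem onHom_eq_pair {x x' : X} {y y' : Y} (k : x ⟶ x') (l : y ⟶ y') :
    Ψ.onHom k l = Ψ.pair (k ≫ (λₗ[B] x').inv) ((λₗ[B] y).hom ≫ l) := by
  have h : (Ψ.balance (𝟙_ B) x' y).hom ≫ Ψ.onHom (𝟙 x') (λₗ[B] y).hom =
      Ψ.onHom (λₗ[B] x').hom (𝟙 y) := by
    simpa [onHom] using Ψ.balance_unit x' y
  rw [pair, onHom_comp_right, reassoc_of% h, ← onHom_comp, ← onHom_comp]
  simp

theorem balance_eq_pair (b : B) (x : X) (y : Y) :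
    (Ψ.balance b x y).hom = Ψ.pair (𝟙 (b ⊙ₗ x)) (𝟙 (b ⊙ₗ y)) := by
  rw [pair, onHom_id, onHom_id, Category.id_comp, Category.comp_id]

/-- Pairs are closed under composition, and the data of the composite depend only on `X`, `Y` and
`B`, so any other balanced functor composes pairs in the same way. The braiding appears because the
right action on `X` is defined through it. -/
theorem pair_comp_pair {x x' x'' : X} {y y' y'' : Y} {a b : B} (u : x ⟶ b ⊙ₗ x')
    (v : b ⊙ₗ y ⟶ y') (u' : x' ⟶ a ⊙ₗ x'') (v' : a ⊙ₗ y' ⟶ y'') :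
    Ψ.pair u v ≫ Ψ.pair u' v' =
      Ψ.pair (u ≫ b ⊴ₗ u' ≫ (αₗ b a x'').inv ≫ (β_ b a).hom ⊵ₗ x'')
        ((αₗ a b y).hom ≫ a ⊴ₗ v ≫ v') := by
  have h1 := Ψ.onHom_balance (𝟙 b) u' (𝟙 y)
  have h2 := Ψ.onHom_balance (𝟙 a) (𝟙 x'') v
  simp only [MonoidalLeftAction.id_actionHom] at h1 h2
  rw [MonoidalLeftAction.actionHomRight_id] at h1 h2
  have h3 : Ψ.onHom ((αₗ b a x'').inv ≫ (β_ b a).hom ⊵ₗ x'') (𝟙 y) ≫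
      (Ψ.balance (a ⊗ b) x'' y).hom ≫ Ψ.onHom (𝟙 x'') (αₗ a b y).hom =
        (Ψ.balance b (a ⊙ₗ x'') y).hom ≫ (Ψ.balance a x'' (b ⊙ₗ y)).hom :=
    (by simp [onHom] : _ = _).trans (Ψ.balance_tensor a b x'' y)
  simp only [pair]
  rw [onHom_comp_left _ u, onHom_comp_left _ (b ⊴ₗ u'), onHom_comp_right, onHom_comp_right]
  simp only [Category.assoc]
  rw [reassoc_of% h3, ← reassoc_of% h2, reassoc_of% h1, reassoc_of% (Ψ.onHom_exchange u' v)]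

theorem pair_add {x x' : X} {y y' : Y} {b : B} (u u' : x ⟶ b ⊙ₗ x') (v : b ⊙ₗ y ⟶ y') :
    Ψ.pair (u + u') v = Ψ.pair u v + Ψ.pair u' v := by
  simp [pair, onHom, Ψ.bilinear.add_left]

theorem pair_smul {x x' : X} {y y' : Y} {b : B} (c : ℂ) (u : x ⟶ b ⊙ₗ x') (v : b ⊙ₗ y ⟶ y') :
    Ψ.pair (c • u) v = c • Ψ.pair u v := by
  simp [pair, onHom, Ψ.bilinear.smul_left]

/-- A criterion for a balanced functor to be a relative tensor product: morphisms between its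
values are given by pairs in a unique way. -/
structure IsGenerating : Prop where
  exists_universal (y y' : Y) : ∃ (b : B) (ev : b ⊙ₗ y ⟶ y'),
    (∀ (b' : B) (v : b' ⊙ₗ y ⟶ y'), ∃ w : b' ⟶ b, v = w ⊵ₗ y ≫ ev) ∧
      ∀ x x' : X, Function.Bijective (fun u : x ⟶ b ⊙ₗ x' => Ψ.pair u ev)
  exists_retract (z : Z) : ∃ (x : X) (y : Y) (i : z ⟶ (Ψ.F.obj x).obj y)
    (p : (Ψ.F.obj x).obj y ⟶ z), i ≫ p = 𝟙 z

namespace IsGenerating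

variable {Ψ} (hΨ : Ψ.IsGenerating)

include hΨ

theorem exists_pair {x x' : X} {y y' : Y} (f : (Ψ.F.obj x).obj y ⟶ (Ψ.F.obj x').obj y') :
    ∃ (b : B) (u : x ⟶ b ⊙ₗ x') (v : b ⊙ₗ y ⟶ y'), f = Ψ.pair u v := by
  obtain ⟨b, ev, -, h⟩ := hΨ.exists_universal y y'
  obtain ⟨u, hu⟩ := (h x x').2 f
  exact ⟨b, u, ev, hu.symm⟩

variable {D : Type t} [Category.{w₃} D] [Preadditive D] [Linear ℂ D]

/-- Another balanced functor defines a functor on the full image of a generating one. -/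
theorem exists_transport (Θ : BalancedFunctor X Y D) :
    ∃ m : ∀ {s t : X × Y}, ((Ψ.F.obj s.1).obj s.2 ⟶ (Ψ.F.obj t.1).obj t.2) →
        ((Θ.F.obj s.1).obj s.2 ⟶ (Θ.F.obj t.1).obj t.2),
      (∀ {x x' : X} {y y' : Y} {b : B} (u : x ⟶ b ⊙ₗ x') (v : b ⊙ₗ y ⟶ y'),
        m (s := (x, y)) (t := (x', y')) (Ψ.pair u v) = Θ.pair u v) ∧
      (∀ {s t : X × Y} (f g : (Ψ.F.obj s.1).obj s.2 ⟶ (Ψ.F.obj t.1).obj t.2),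
        m (f + g) = m f + m g) ∧
      ∀ {s t : X × Y} (c : ℂ) (f : (Ψ.F.obj s.1).obj s.2 ⟶ (Ψ.F.obj t.1).obj t.2),
        m (c • f) = c • m f := by
  choose b ev hev hbij using hΨ.exists_universal
  choose u hu using fun (s t : X × Y) (f : (Ψ.F.obj s.1).obj s.2 ⟶ (Ψ.F.obj t.1).obj t.2) =>
    (hbij s.2 t.2 s.1 t.1).2 f
  dsimp only at hu
  refine ⟨fun {s t} f => Θ.pair (u s t f) (ev s.2 t.2), fun {x x' y y' a} p q => ?_,
    fun {s t} f g => ?_, fun {s t} c f => ?_⟩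
  -- The value is independent of the presentation: an arbitrary pair is first rewritten, by the same
  -- move in `Ψ` and in `Θ`, as a pair with the universal `ev`.
  · obtain ⟨w, rfl⟩ := hev y y' a q
    have h : u (x, y) (x', y') (Ψ.pair p (w ⊵ₗ y ≫ ev y y')) = p ≫ w ⊵ₗ x' :=
      (hbij y y' x x').1 ((hu (x, y) (x', y') _).trans (Ψ.pair_whisker p w _))
    dsimp only
    rw [h, pair_whisker]
  · dsimp only
    rw [← pair_add, (hbij s.2 t.2 s.1 t.1).1 ((hu s t _).trans
      ((congrArg₂ (· + ·) (hu s t f) (hu s t g)).symm.trans (Ψ.pair_add _ _ _).symm))]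
  · dsimp only
    rw [← pair_smul, (hbij s.2 t.2 s.1 t.1).1 ((hu s t _).trans
      ((congrArg (c • ·) (hu s t f)).symm.trans (Ψ.pair_smul c _ _).symm))]

/-- By `pair_comp_pair` the transported maps form a functor on the full subcategory of the objects
`x · y`; it extends to all of `Z` because idempotents split in `D`. -/
theorem factor [IsFiniteSemisimple D] (Θ : BalancedFunctor X Y D) :
    ∃ (T : Z ⥤ D) (_ : T.Additive) (_ : T.Linear ℂ)
      (θ : ∀ x y, T.obj ((Ψ.F.obj x).obj y) ≅ (Θ.F.obj x).obj y),
      ∀ {x x' : X} {y y' : Y} {b : B} (u : x ⟶ b ⊙ₗ x') (v : b ⊙ₗ y ⟶ y'),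
        T.map (Ψ.pair u v) ≫ (θ x' y').hom = (θ x y).hom ≫ Θ.pair u v := by
  have := IsFiniteSemisimple.isIdempotentComplete D
  obtain ⟨m, hm, hadd, hsmul⟩ := hΨ.exists_transport Θ
  obtain ⟨T, hT, hT', θ, hθ⟩ := exists_functor_of_retract
    (fun s : X × Y => (Ψ.F.obj s.1).obj s.2)
    (fun z => by
      obtain ⟨x, y, i, p, h⟩ := hΨ.exists_retract z
      exact ⟨(x, y), i, p, h⟩)
    (fun s : X × Y => (Θ.F.obj s.1).obj s.2) m
    (fun s => by
      rw [← Ψ.onHom_id, ← Θ.onHom_id, onHom_eq_pair, onHom_eq_pair]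
      exact hm _ _)
    (fun {r s t} f g => by
      obtain ⟨a, p, q, rfl⟩ := hΨ.exists_pair f
      obtain ⟨b, p', q', rfl⟩ := hΨ.exists_pair g
      rw [pair_comp_pair]
      exact (hm _ _).trans ((Θ.pair_comp_pair _ _ _ _).symm.trans
        (congrArg₂ (· ≫ ·) (hm p q).symm (hm p' q').symm)))
    hadd hsmul
  exact ⟨T, hT, hT', fun x y => θ (x, y), fun {x x' y y' b} u v =>
    (hθ (s := (x, y)) (t := (x', y')) (Ψ.pair u v)).trans (congrArg (_ ≫ ·) (hm u v))⟩

/-- Every morphism between products is built from bifunctor values and a balancing, so the two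
hypotheses give naturality on products. The component at a retract of a product is then forced. -/
theorem existsUnique_natTrans (T T' : Z ⥤ D)
    (η : ∀ x y, T.obj ((Ψ.F.obj x).obj y) ⟶ T'.obj ((Ψ.F.obj x).obj y))
    (hη : ∀ {x x' : X} {y y' : Y} (k : x ⟶ x') (l : y ⟶ y'),
      T.map (Ψ.onHom k l) ≫ η x' y' = η x y ≫ T'.map (Ψ.onHom k l))
    (hη' : ∀ b x y, T.map (Ψ.balance b x y).hom ≫ η x (b ⊙ₗ y) =
      η (b ⊙ₗ x) y ≫ T'.map (Ψ.balance b x y).hom) :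
    ∃! τ : T ⟶ T', ∀ x y, τ.app ((Ψ.F.obj x).obj y) = η x y := by
  have nat {x x' : X} {y y' : Y} (f : (Ψ.F.obj x).obj y ⟶ (Ψ.F.obj x').obj y') :
      T.map f ≫ η x' y' = η x y ≫ T'.map f := by
    obtain ⟨b, u, v, rfl⟩ := hΨ.exists_pair f
    simp only [pair, Functor.map_comp, Category.assoc]
    rw [hη, reassoc_of% hη', reassoc_of% hη]
  choose x y i p hip using hΨ.exists_retract
  have key {z z' : Z} (f : z ⟶ z') {a : X} {c : Y} (j : z' ⟶ (Ψ.F.obj a).obj c) :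
      (T.map (i z) ≫ η (x z) (y z) ≫ T'.map (p z)) ≫ T'.map (f ≫ j) =
        T.map (f ≫ j) ≫ η a c := by
    rw [Category.assoc, Category.assoc, ← Functor.map_comp, ← nat, ← Category.assoc,
      ← Functor.map_comp, reassoc_of% (hip z)]
  refine ⟨⟨fun z => T.map (i z) ≫ η (x z) (y z) ≫ T'.map (p z), fun z z' f => ?_⟩,
    fun a c => ?_, fun τ hτ => ?_⟩
  · have h := congrArg (· ≫ T'.map (p z')) (key f (i z'))
    simp only [Category.assoc, Functor.map_comp] at h
    rw [← h, ← Functor.map_comp T' (i z'), hip, CategoryTheory.Functor.map_id, Category.comp_id]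
    simp only [Category.assoc]
  · have := key (𝟙 _) (𝟙 ((Ψ.F.obj a).obj c))
    simpa using this
  · ext z
    rw [← Category.comp_id (τ.app z), ← CategoryTheory.Functor.map_id T', ← hip z,
        Functor.map_comp, ← Category.assoc,
      ← τ.naturality, Category.assoc, hτ]

end IsGenerating

end BalancedFunctor

namespace ModuleBifunctor

variable {X : UModCat.{u₁, v₁} B} {Y : UModCat.{u₃, v₃} B} {Z : UModCat.{w₁, w₂} B}
  (Φ : ModuleBifunctor X Y Z)

/-- The underlying balanced functor. -/
def toBalanced : BalancedFunctor X Y Z where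
  F := Φ.F
  bilinear := Φ.bilinear
  balance := Φ.balance
  balance_natural {b b' x x' y y'} f k l := by
    have h1 := Φ.left_natural f k l
    have h2 := Φ.right_natural f k l
    simp only [balance, Iso.trans_hom, Iso.symm_hom]
    rw [← Category.assoc, h1, Category.assoc, Category.assoc]
    refine congrArg (_ ≫ ·) ?_
    rw [Iso.comp_inv_eq, Category.assoc, h2, Iso.inv_hom_id_assoc]
  balance_tensor a b x y := by
    -- Moving `a` and `b` out of opposite factors in the two possible orders differs by the
    -- braiding, by the hexagon of `Φ`; this is the twist in the right action of `a ⊗ b`.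
    have h1 := Φ.left_natural (β_ b a).hom (𝟙 x) (𝟙 y)
    have h2 := Φ.right_tensor a b x y
    have h3 := Φ.left_tensor b a x y
    have h4 := Φ.hexagon a b x y
    rw [biMap, biMap, CategoryTheory.Functor.map_id, CategoryTheory.Functor.map_id,
      CategoryTheory.Functor.map_id, NatTrans.id_app, Category.comp_id, Category.comp_id,
      MonoidalLeftAction.actionHom_id, MonoidalLeftAction.actionHom_id] at h1
    rw [← cancel_mono (Φ.right a x (b ⊙ₗ y)).hom, ← cancel_mono (a ⊴ₗ (Φ.right b x y).hom)]
    simp only [balance, Iso.trans_hom, Iso.symm_hom, Category.assoc, Iso.inv_hom_id_assoc]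
    rw [← h2, h4, Iso.inv_hom_id_assoc, Iso.inv_hom_id_assoc, Functor.map_comp, NatTrans.comp_app,
      Category.assoc, reassoc_of% h1, ← cancel_epi ((Φ.F.map (αₗ b a x).hom).app y),
      ← reassoc_of% h3, Iso.hom_inv_id_assoc, ← Category.assoc ((Φ.F.map _).app y),
      ← NatTrans.comp_app, ← Functor.map_comp, Iso.hom_inv_id, CategoryTheory.Functor.map_id,
      NatTrans.id_app, Category.id_comp]
  balance_unit x y := by
    have h1 := Φ.left_unit x y
    have h2 := Φ.right_unit x y
    simp only [balance, Iso.trans_hom, Iso.symm_hom, Category.assoc]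
    rw [← h2, Iso.inv_hom_id_assoc, h1]

theorem isRelativeTensorProduct (h : Φ.toBalanced.IsGenerating) : Φ.IsRelativeTensorProduct where
  factor D _ _ _ _ Ψ := by
    obtain ⟨T, hT, hT', θ, hθ⟩ := h.factor Ψ
    refine ⟨T, hT, hT', θ, fun {x x' y y'} k l => ?_, fun b x y => ?_⟩
    · have := hθ (k ≫ (λₗ[B] x').inv) ((λₗ[B] y).hom ≫ l)
      rw [← BalancedFunctor.onHom_eq_pair, ← BalancedFunctor.onHom_eq_pair] at this
      exact this
    · have := hθ (𝟙 (b ⊙ₗ x)) (𝟙 (b ⊙ₗ y))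
      rw [← BalancedFunctor.balance_eq_pair, ← BalancedFunctor.balance_eq_pair] at this
      exact this
  existsUnique_natTrans D _ _ _ _ T T' _ _ _ _ η hη hη' :=
    h.existsUnique_natTrans T T' η hη hη'

end ModuleBifunctor

end

/-! ### The exchange isomorphisms of an extension -/

section

variable {G : Type t} [Group G] {C : Type u₁} [Category.{v₁} C] [Preadditive C]
    [Linear ℂ C] [MonoidalCategory C] [DaggerCategory C]
    {A : UnitaryAction G C} {K : CrossedBraiding A}
    {B : Type u₂} [Category.{v₂} B] [Preadditive B] [Linear ℂ B] [MonoidalCategory B]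
    [DaggerCategory B] [BraidedCategory B]

namespace CrossedBraiding.Extension

variable (E : K.Extension B)

theorem exchange_hom (b : B) (X : C) :
    (E.exchange b X).hom = (K.braid (E.deg_ι b) X).hom ≫ (A.one rfl).inv.app X ▷ E.ι.obj b := rfl

theorem exchange_unitary [UnitaryMonoidal C] (b : B) (X : C) :
    IsUnitary (E.exchange b X).hom :=
  (K.braid_unitary _ _).comp (by
    have h := (IsUnitary.inv ((A.one rfl).app X) (A.one_unitary rfl X)).tensor
      (IsUnitary.id (E.ι.obj b))
    rw [tensorHom_id] at h
    exact h)

theorem exchange_natural {b b' : B} {X X' : C} (f : b ⟶ b') (k : X ⟶ X') :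
    (E.ι.map f ⊗ₘ k) ≫ (E.exchange b' X').hom =
      (E.exchange b X).hom ≫ (k ⊗ₘ E.ι.map f) := by
  have nat := (A.one (o := 1) rfl).inv.naturality k
  rw [Functor.id_map] at nat
  rw [exchange_hom, exchange_hom, ← Category.assoc, K.braid_natural (E.deg_ι b) (E.deg_ι b'),
    Category.assoc, Category.assoc, ← tensorHom_id, ← tensorHom_id, tensorHom_comp_tensorHom,
    nat]
  refine congrArg (_ ≫ ·) ?_
  refine Eq.trans ?_ (tensorHom_comp_tensorHom _ _ _ _).symm
  rw [Category.comp_id, Category.id_comp]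

theorem exchange_natural_left {b b' : B} (f : b ⟶ b') (X : C) :
    E.ι.map f ▷ X ≫ (E.exchange b' X).hom = (E.exchange b X).hom ≫ X ◁ E.ι.map f := by
  simpa using E.exchange_natural f (𝟙 X)

theorem exchange_natural_right (b : B) {X X' : C} (k : X ⟶ X') :
    E.ι.obj b ◁ k ≫ (E.exchange b X').hom = (E.exchange b X).hom ≫ k ▷ E.ι.obj b := by
  simpa using E.exchange_natural (𝟙 b) k

/-- The hexagon of the `G`-braiding in degree `1`, with the identification `1(X) ≅ X` removed by its
monoidality. -/
theorem exchange_tensor_right (b : B) (X Y : C) :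
    (E.exchange b (X ⊗ Y)).hom = (α_ _ X Y).inv ≫ (E.exchange b X).hom ▷ Y ≫ (α_ X _ Y).hom ≫
      X ◁ (E.exchange b Y).hom ≫ (α_ X Y _).inv := by
  have aux {b X Y X' Y' : C} (p : b ⊗ X ⟶ X' ⊗ b) (q : b ⊗ Y ⟶ Y' ⊗ b) (i : X' ⟶ X)
      (j : Y' ⟶ Y) : ((α_ b X Y).inv ≫ p ▷ Y ≫ (α_ _ _ _).hom ≫ X' ◁ q ≫ (α_ _ _ _).inv) ≫
        (i ⊗ₘ j) ▷ b = (α_ b X Y).inv ≫ (p ≫ i ▷ b) ▷ Y ≫ (α_ _ _ _).hom ≫ X ◁ (q ≫ j ▷ b) ≫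
          (α_ _ _ _).inv := by
    simp only [comp_whiskerRight, Category.assoc]
    rw [associator_naturality_left_assoc, MonoidalCategory.whiskerLeft_comp, Category.assoc,
        ← whisker_exchange_assoc,
      MonoidalCategory.tensorHom_def]
    monoidal
  have h1 := K.braid_tensor_right (E.deg_ι b) X Y
  have h2 : (A.one (o := 1) rfl).inv.app (X ⊗ Y) = δ (A.act 1) X Y ≫
      ((A.one rfl).inv.app X ⊗ₘ (A.one rfl).inv.app Y) := by
    have h3 := A.one_tensor (o := 1) rfl X Y
    rw [← cancel_epi ((A.one (o := 1) rfl).hom.app (X ⊗ Y)), Iso.hom_inv_id_app, h3,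
      Category.assoc, Functor.Monoidal.μ_δ_assoc]
    refine Eq.trans ?_ (tensorHom_comp_tensorHom _ _ _ _).symm
    rw [Iso.hom_inv_id_app, Iso.hom_inv_id_app]
    exact (id_tensorHom_id X Y).symm
  rw [exchange_hom, h2, comp_whiskerRight, reassoc_of% h1]
  refine Eq.trans ?_ (aux _ _ _ _)
  simp only [Category.assoc]
  rfl

theorem exchange_tensor_left (a b : B) (X : C) :
    δ E.ι a b ▷ X ≫ (α_ _ _ X).hom ≫ E.ι.obj a ◁ (E.exchange b X).hom ≫ (α_ _ X _).inv ≫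
        (E.exchange a X).hom ▷ E.ι.obj b ≫ (α_ X _ _).hom =
      (E.exchange (a ⊗ b) X).hom ≫ X ◁ δ E.ι a b := by
  have aux {a b X X' : C} (p : b ⊗ X ⟶ X' ⊗ b) (i : X' ⟶ X) (e : a ⊗ X ⟶ X ⊗ a)
      (e' : a ⊗ X' ⟶ X' ⊗ a) (h : a ◁ i ≫ e = e' ≫ i ▷ a) :
      (α_ a b X).hom ≫ a ◁ (p ≫ i ▷ b) ≫ (α_ _ _ _).inv ≫ e ▷ b ≫ (α_ _ _ _).hom =
        ((α_ a b X).hom ≫ a ◁ p ≫ (α_ _ _ _).inv ≫ e' ▷ b ≫ (α_ _ _ _).hom) ≫ i ▷ (a ⊗ b) := by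
    have h' : a ◁ i ▷ b ≫ (α_ a X b).inv ≫ e ▷ b =
        (α_ a X' b).inv ≫ e' ▷ b ≫ (i ▷ a) ▷ b := by
      rw [← comp_whiskerRight, ← h]
      monoidal
    rw [MonoidalCategory.whiskerLeft_comp, Category.assoc, reassoc_of% h']
    monoidal
  -- A product of two objects of degree `1` has degree `1 * 1`, so the braidings for the two indices
  -- have to be compared.
  have congr {o : G} (ho : o = 1) {Z : C} (h : K.deg o Z) (h' : K.deg 1 Z) :
      (K.braid h' X).hom ≫ (A.one rfl).inv.app X ▷ Z =
        (K.braid h X).hom ≫ (A.one ho).inv.app X ▷ Z := by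
    subst ho
    rfl
  have h0 {o k : G} (e : o * o = k) (ho : o = 1) (hk : k = 1) :
      (A.mul e).hom.app X ≫ (A.one hk).inv.app X =
        (A.one ho).inv.app ((A.act o).obj X) ≫ (A.one ho).inv.app X := by
    subst hk ho
    refine congrArg (· ≫ _) ?_
    rw [← cancel_epi ((A.one rfl).hom.app ((A.act 1).obj X)), Iso.hom_inv_id_app]
    exact A.one_mul_left rfl e X
  have h1 := K.braid_tensor_left (E.deg_ι a) (E.deg_ι b) X
  have h2 := K.braid_natural_left (E.deg_ι (a ⊗ b)) (K.deg_of_iso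
    (Functor.Monoidal.μIso E.ι a b).symm (E.deg_ι (a ⊗ b))) X (δ E.ι a b)
  have h3 := E.exchange_natural_right a ((A.one (o := 1) rfl).inv.app X)
  have h4 := aux (K.braid (E.deg_ι b) X).hom _ _ _ h3
  have h5 : (E.exchange (a ⊗ b) X).hom ≫ X ◁ δ E.ι a b = δ E.ι a b ▷ X ≫
      (K.braid (K.deg_of_iso (Functor.Monoidal.μIso E.ι a b).symm (E.deg_ι (a ⊗ b))) X).hom ≫
        (A.one (o := 1) rfl).inv.app X ▷ (E.ι.obj a ⊗ E.ι.obj b) := by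
    rw [reassoc_of% h2]
    refine (Category.assoc _ _ _).trans (congrArg (_ ≫ ·) ?_)
    exact (whisker_exchange ((A.one rfl).inv.app X) (δ E.ι a b)).symm
  have h6 := congr (one_mul 1) (K.deg_tensor (E.deg_ι a) (E.deg_ι b)) (K.deg_of_iso
    (Functor.Monoidal.μIso E.ι a b).symm (E.deg_ι (a ⊗ b)))
  rw [h5, h6, h1]
  refine congrArg (_ ≫ ·) (h4.trans ?_)
  have h7 := congrArg (· ▷ (E.ι.obj a ⊗ E.ι.obj b)) (h0 (k := 1 * 1) rfl rfl (one_mul 1))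
  simp only [comp_whiskerRight] at h7
  simp only [Category.assoc, h7, exchange_hom, comp_whiskerRight]
  monoidal

theorem exchange_braiding (a b : B) :
    (E.exchange a (E.ι.obj b)).hom = μ E.ι a b ≫ E.ι.map (β_ a b).hom ≫ δ E.ι b a := by
  have h := E.braided a b
  rw [reassoc_of% h, Functor.Monoidal.μ_δ, Category.comp_id]
  rfl

/-- Up to unitors the exchange with the unit is an automorphism `s`. The tensor formula at `𝟙_ C ⊗
𝟙_ C` gives `s ≫ s = s`, so `s` is the identity. -/
theorem exchange_unit_right (b : B) :
    (E.exchange b (𝟙_ C)).hom = (ρ_ _).hom ≫ (λ_ _).inv := by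
  obtain ⟨s, hs⟩ : ∃ s : E.ι.obj b ≅ E.ι.obj b,
      s = (ρ_ _).symm ≪≫ E.exchange b (𝟙_ C) ≪≫ λ_ _ := ⟨_, rfl⟩
  have h1 : (E.exchange b (𝟙_ C)).hom = (ρ_ _).hom ≫ s.hom ≫ (λ_ _).inv := by simp [hs]
  have h2 := E.exchange_natural_right b (λ_ (𝟙_ C)).hom
  rw [exchange_tensor_right, h1] at h2
  have h3 : s.hom ≫ s.hom = s.hom := by
    rw [← cancel_mono (λ_ _).inv, ← cancel_epi (ρ_ _).hom,
        ← cancel_epi (E.ι.obj b ◁ (λ_ (𝟙_ C)).hom)]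
    rw [h2]
    monoidal
  have h4 : s.hom = 𝟙 _ := by rw [← cancel_epi s.hom, h3, Category.comp_id]
  rw [h1, h4, Category.id_comp]

/-- As for `exchange_unit_right`, now using the tensor formula in the variable from `B`: the
automorphism `s` measuring the deviation is idempotent. -/
theorem exchange_unit_left (X : C) :
    (E.exchange (𝟙_ B) X).hom ≫ X ◁ η E.ι ≫ (ρ_ X).hom = η E.ι ▷ X ≫ (λ_ X).hom := by
  obtain ⟨p, hp⟩ : ∃ p : E.ι.obj (𝟙_ B) ⊗ X ≅ X,
    p = whiskerRightIso (Functor.Monoidal.εIso E.ι).symm X ≪≫ λ_ X := ⟨_, rfl⟩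
  obtain ⟨q, hq⟩ : ∃ q : X ≅ X ⊗ E.ι.obj (𝟙_ B),
    q = (ρ_ X).symm ≪≫ whiskerLeftIso X (Functor.Monoidal.εIso E.ι) := ⟨_, rfl⟩
  obtain ⟨s, hs⟩ : ∃ s : X ≅ X, s = p.symm ≪≫ E.exchange (𝟙_ B) X ≪≫ q.symm := ⟨_, rfl⟩
  have h1 : (E.exchange (𝟙_ B) X).hom = p.hom ≫ s.hom ≫ q.hom := by simp [hs]
  have h2 := E.exchange_tensor_left (𝟙_ B) (𝟙_ B) X
  have h3 := E.exchange_natural_left (λ_ (𝟙_ B)).hom X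
  have hl : E.ι.map (λ_ (𝟙_ B)).hom = δ E.ι (𝟙_ B) (𝟙_ B) ≫ η E.ι ▷ _ ≫ (λ_ _).hom := by
    rw [Functor.Monoidal.map_leftUnitor]
  have hr : E.ι.map (λ_ (𝟙_ B)).hom = δ E.ι (𝟙_ B) (𝟙_ B) ≫ _ ◁ η E.ι ≫ (ρ_ _).hom := by
    rw [unitors_equal, Functor.Monoidal.map_rightUnitor]
  have p0 : p.hom = η E.ι ▷ X ≫ (λ_ X).hom := by simp [hp]
  have p1 : E.ι.obj (𝟙_ B) ◁ s.hom ≫ p.hom = p.hom ≫ s.hom := by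
    rw [p0, whisker_exchange_assoc, leftUnitor_naturality, Category.assoc]
  have p2 : E.ι.obj (𝟙_ B) ◁ q.hom ≫ (α_ _ _ _).inv ≫ p.hom ▷ _ = p.hom ≫ q.hom := by
    have : (α_ _ X (E.ι.obj (𝟙_ B))).inv ≫ p.hom ▷ _ = η E.ι ▷ _ ≫ (λ_ _).hom := by
      rw [p0]
      monoidal
    rw [this, p0, whisker_exchange_assoc, leftUnitor_naturality, Category.assoc]
  have p3 : δ E.ι (𝟙_ B) (𝟙_ B) ▷ X ≫ (α_ _ _ _).hom ≫ E.ι.obj (𝟙_ B) ◁ p.hom =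
      E.ι.map (λ_ (𝟙_ B)).hom ▷ X := by
    rw [p0, hr]
    monoidal
  have q1 : q.hom ≫ s.hom ▷ _ = s.hom ≫ q.hom := by
    simp [hq, whisker_exchange]
  have q2 : q.hom ▷ E.ι.obj (𝟙_ B) ≫ (α_ _ _ _).hom ≫ X ◁ (η E.ι ▷ _ ≫ (λ_ _).hom) = 𝟙 _ := by
    have : (α_ X (E.ι.obj (𝟙_ B)) (E.ι.obj (𝟙_ B))).hom ≫ X ◁ (η E.ι ▷ _ ≫ (λ_ _).hom) =
        (X ◁ η E.ι ≫ (ρ_ X).hom) ▷ _ := by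
      monoidal
    rw [this, ← comp_whiskerRight, hq]
    simp
  have h4 : s.hom ≫ s.hom = s.hom := by
    rw [hl, MonoidalCategory.whiskerLeft_comp, ← reassoc_of% h2, ← hl, h1] at h3
    simp only [MonoidalCategory.whiskerLeft_comp, comp_whiskerRight, Category.assoc] at h3 q2
    rw [q2, Category.comp_id, reassoc_of% p3, reassoc_of% p2, q1, reassoc_of% p1] at h3
    have : IsIso (E.ι.map (λ_ (𝟙_ B)).hom ▷ X) := inferInstance
    rw [← cancel_epi p.hom, ← cancel_epi (E.ι.map (λ_ (𝟙_ B)).hom ▷ X), ← cancel_mono q.hom]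
    simp only [Category.assoc]
    exact h3.symm
  have h5 : s.hom = 𝟙 _ := by rw [← cancel_epi s.hom, h4, Category.comp_id]
  rw [h1, h5, hp, hq]
  simp

end CrossedBraiding.Extension

end

/-! ### The components of an extension as module categories -/

section

variable {G : Type t} [Group G] {C : Type u₁} [Category.{v₁} C] [Preadditive C]
    [Linear ℂ C] [MonoidalCategory C] [DaggerCategory C] [UnitaryFusionCategory C]
    {A : UnitaryAction G C} {K : CrossedBraiding A}
    {B : Type u₂} [Category.{v₂} B] [Preadditive B] [Linear ℂ B] [MonoidalCategory B]
    [DaggerCategory B] [BraidedCategory B]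

namespace CrossedBraiding.Extension

variable (E : K.Extension B)

/-- The action of `B` on a component. -/
@[reducible]
def componentAction (g : G) : MonoidalLeftAction B (K.deg g).FullSubcategory where
  actionObj b x := ⟨E.ι.obj b ⊗ x.obj, by
    simpa only [one_mul] using K.deg_tensor (E.deg_ι b) x.property⟩
  actionHomLeft f x := ObjectProperty.homMk (E.ι.map f ▷ x.obj)
  actionHomRight b _ _ k := ObjectProperty.homMk (E.ι.obj b ◁ k.hom)
  actionHom f k := ObjectProperty.homMk (E.ι.map f ⊗ₘ k.hom)
  actionAssocIso a b x := (K.deg g).isoMk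
    (whiskerRightIso (Functor.Monoidal.μIso E.ι a b).symm x.obj ≪≫ α_ _ _ _)
  actionUnitIso x := (K.deg g).isoMk
    (whiskerRightIso (Functor.Monoidal.εIso E.ι).symm x.obj ≪≫ λ_ _)
  actionHom_def f k := by ext; exact MonoidalCategory.tensorHom_def _ _
  actionHomRight_id b x := by ext; exact MonoidalCategory.whiskerLeft_id _ _
  id_actionHomLeft b x := by
    ext
    change E.ι.map (𝟙 b) ▷ x.obj = 𝟙 _
    simp
  actionHom_comp f f' k k' := by
    ext
    change E.ι.map (f ≫ f') ⊗ₘ (k.hom ≫ k'.hom) = (E.ι.map f ⊗ₘ k.hom) ≫ (E.ι.map f' ⊗ₘ k'.hom)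
    rw [Functor.map_comp, tensorHom_comp_tensorHom]
  actionAssocIso_hom_naturality f f' k := by
    ext
    change (E.ι.map (f ⊗ₘ f') ⊗ₘ k.hom) ≫ δ E.ι _ _ ▷ _ ≫ (α_ _ _ _).hom =
      (δ E.ι _ _ ▷ _ ≫ (α_ _ _ _).hom) ≫ (E.ι.map f ⊗ₘ (E.ι.map f' ⊗ₘ k.hom))
    rw [Category.assoc, ← associator_naturality, ← tensorHom_id, ← tensorHom_id,
      tensorHom_comp_tensorHom_assoc, tensorHom_comp_tensorHom_assoc, δ_natural, Category.comp_id,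
      Category.id_comp]
  actionUnitIso_hom_naturality k := by
    ext
    change (η E.ι ▷ _ ≫ (λ_ _).hom) ≫ k.hom = E.ι.obj (𝟙_ B) ◁ k.hom ≫ η E.ι ▷ _ ≫ (λ_ _).hom
    rw [whisker_exchange_assoc, leftUnitor_naturality, Category.assoc]
  whiskerLeft_actionHomLeft b c c' f x := by
    ext
    change E.ι.map (b ◁ f) ▷ x.obj = (δ E.ι _ _ ▷ _ ≫ (α_ _ _ _).hom) ≫ _ ◁ (E.ι.map f ▷ x.obj) ≫
      (α_ _ _ _).inv ≫ μ E.ι _ _ ▷ _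
    rw [Functor.Monoidal.map_whiskerLeft]
    monoidal
  whiskerRight_actionHomLeft b f x := by
    ext
    change E.ι.map (f ▷ b) ▷ x.obj = (δ E.ι _ _ ▷ _ ≫ (α_ _ _ _).hom) ≫ E.ι.map f ▷ _ ≫
      (α_ _ _ _).inv ≫ μ E.ι _ _ ▷ _
    rw [Functor.Monoidal.map_whiskerRight]
    monoidal
  associator_actionHom a b c x := by
    ext
    change E.ι.map (α_ a b c).hom ▷ x.obj ≫ (δ E.ι _ _ ▷ _ ≫ (α_ _ _ _).hom) ≫
        _ ◁ (δ E.ι _ _ ▷ _ ≫ (α_ _ _ _).hom) =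
      (δ E.ι _ _ ▷ _ ≫ (α_ _ _ _).hom) ≫ δ E.ι _ _ ▷ _ ≫ (α_ _ _ _).hom
    have h := congrArg (· ▷ x.obj) (oplax_associativity E.ι a b c)
    refine Eq.trans ?_ ((congrArg (· ≫ (α_ _ _ x.obj).hom ≫
        _ ◁ (α_ _ _ x.obj).hom) h.symm).trans ?_)
      <;> monoidal
  leftUnitor_actionHom b x := by
    ext
    change E.ι.map (λ_ b).hom ▷ x.obj = (δ E.ι _ _ ▷ _ ≫ (α_ _ _ _).hom) ≫ η E.ι ▷ _ ≫ (λ_ _).hom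
    rw [Functor.Monoidal.map_leftUnitor]
    monoidal
  rightUnitor_actionHom b x := by
    ext
    change E.ι.map (ρ_ b).hom ▷ x.obj = (δ E.ι _ _ ▷ _ ≫ (α_ _ _ _).hom) ≫
      _ ◁ (η E.ι ▷ _ ≫ (λ_ _).hom)
    rw [Functor.Monoidal.map_rightUnitor]
    monoidal

/-- The component of degree `g` as a module category. -/
abbrev component (g : G) : UModCat.{u₁, v₁} B :=
  letI := E.componentAction g
  { carrier := (K.deg g).FullSubcategory
    cstar := (K.deg_isSummandClosed g).cStarCategory
    semisimple := (K.deg_isSummandClosed g).isFiniteSemisimple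
    action := E.componentAction g
    unitary :=
      { add_left f f' x := by
          ext
          change E.ι.map (f + f') ▷ x.obj = E.ι.map f ▷ x.obj + E.ι.map f' ▷ x.obj
          rw [E.unitary.map_add, MonoidalPreadditive.add_whiskerRight]
        smul_left c f x := by
          ext
          change E.ι.map (c • f) ▷ x.obj = c • E.ι.map f ▷ x.obj
          rw [E.unitary.map_smul, MonoidalLinear.smul_whiskerRight]
        add_right b _ _ k k' := by
          ext; exact MonoidalPreadditive.whiskerLeft_add _ _
        smul_right b _ _ c k := by
          ext; exact MonoidalLinear.whiskerLeft_smul _ _ _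
        dag_actionHom f k := by
          ext
          change dag (E.ι.map f ⊗ₘ k.hom) = E.ι.map (dag f) ⊗ₘ dag k.hom
          rw [UnitaryMonoidal.dag_tensorHom, E.unitary.map_dag]
        assoc_unitary a b x := (isUnitary_full _).2 (by
          change IsUnitary (δ E.ι a b ▷ x.obj ≫ (α_ _ _ _).hom)
          rw [← tensorHom_id]
          exact ((IsUnitary.inv (Functor.Monoidal.μIso E.ι a b) (E.unitary.μ_unitary a b)).tensor
            (IsUnitary.id _)).comp (UnitaryMonoidal.associator_unitary _ _ _))
        unit_unitary x := (isUnitary_full _).2 (by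
          change IsUnitary (η E.ι ▷ x.obj ≫ (λ_ _).hom)
          rw [← tensorHom_id]
          exact ((IsUnitary.inv (Functor.Monoidal.εIso E.ι) E.unitary.ε_unitary).tensor
            (IsUnitary.id _)).comp (UnitaryMonoidal.leftUnitor_unitary _)) } }

end CrossedBraiding.Extension

end

/-! ### The tensor product of components -/

section

variable {G : Type t} [Group G] {C : Type u₁} [Category.{v₁} C] [Preadditive C]
    [Linear ℂ C] [MonoidalCategory C] [DaggerCategory C] [UnitaryFusionCategory C]
    {A : UnitaryAction G C} {K : CrossedBraiding A}
    {B : Type u₂} [Category.{v₂} B] [Preadditive B] [Linear ℂ B] [MonoidalCategory B]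
    [DaggerCategory B] [BraidedCategory B]

namespace CrossedBraiding.Extension

variable (E : K.Extension B)

/-- The isomorphism `X ⊗ (b ⊗ Y) ≅ b ⊗ (X ⊗ Y)`. -/
@[simps!]
def rightIso (b : B) (X Y : C) : X ⊗ (E.ι.obj b ⊗ Y) ≅ E.ι.obj b ⊗ (X ⊗ Y) :=
  (α_ _ _ _).symm ≪≫ whiskerRightIso (E.exchange b X).symm Y ≪≫ α_ _ _ _

theorem rightIso_unitary (b : B) (X Y : C) : IsUnitary (E.rightIso b X Y).hom := by
  rw [rightIso_hom, ← tensorHom_id]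
  exact (IsUnitary.inv _ (UnitaryMonoidal.associator_unitary _ _ _)).comp
    (((IsUnitary.inv _ (E.exchange_unitary b X)).tensor (IsUnitary.id _)).comp
      (UnitaryMonoidal.associator_unitary _ _ _))

theorem exchange_natural_inv {b b' : B} {X X' : C} (f : b ⟶ b') (k : X ⟶ X') :
    (k ⊗ₘ E.ι.map f) ≫ (E.exchange b' X').inv = (E.exchange b X).inv ≫ (E.ι.map f ⊗ₘ k) := by
  rw [Iso.comp_inv_eq, Category.assoc, E.exchange_natural, Iso.inv_hom_id_assoc]

theorem rightIso_natural {b b' : B} {X X' Y Y' : C} (f : b ⟶ b') (k : X ⟶ X') (l : Y ⟶ Y') :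
    (k ⊗ₘ (E.ι.map f ⊗ₘ l)) ≫ (E.rightIso b' X' Y').hom =
      (E.rightIso b X Y).hom ≫ (E.ι.map f ⊗ₘ (k ⊗ₘ l)) := by
  have h := E.exchange_natural_inv f k
  rw [rightIso_hom, rightIso_hom, associator_inv_naturality_assoc, ← tensorHom_id, ← tensorHom_id,
    tensorHom_comp_tensorHom_assoc, h, Category.assoc, Category.assoc, ← associator_naturality,
    tensorHom_comp_tensorHom_assoc, Category.id_comp, Category.comp_id]

theorem rightIso_tensor (a b : B) (X Y : C) :
    (E.rightIso (a ⊗ b) X Y).hom ≫ δ E.ι a b ▷ (X ⊗ Y) ≫ (α_ _ _ _).hom =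
      X ◁ (δ E.ι a b ▷ Y ≫ (α_ _ _ _).hom) ≫ (E.rightIso a X _).hom ≫
        E.ι.obj a ◁ (E.rightIso b X Y).hom := by
  have h := E.exchange_tensor_left a b X
  have h' : (E.exchange (a ⊗ b) X).inv ≫ δ E.ι a b ▷ X =
      X ◁ δ E.ι a b ≫ (α_ X _ _).inv ≫ (E.exchange a X).inv ▷ E.ι.obj b ≫ (α_ _ X _).hom ≫
        E.ι.obj a ◁ (E.exchange b X).inv ≫ (α_ _ _ X).inv := by
    rw [Iso.inv_comp_eq, ← reassoc_of% h]
    simp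
  have h'' := congrArg (fun q => (α_ X (E.ι.obj (a ⊗ b)) Y).inv ≫ q ▷ Y ≫
    (α_ _ _ _).hom ▷ Y ≫ (α_ _ _ _).hom ≫ _ ◁ (α_ _ _ _).hom) h'
  simp only [rightIso_hom]
  refine Eq.trans ?_ (h''.trans ?_)
  · monoidal
  · monoidal

theorem rightIso_unit (X Y : C) :
    (E.rightIso (𝟙_ B) X Y).hom ≫ η E.ι ▷ (X ⊗ Y) ≫ (λ_ _).hom = X ◁ (η E.ι ▷ Y ≫ (λ_ _).hom) := by
  have h : (E.exchange (𝟙_ B) X).inv ≫ η E.ι ▷ X ≫ (λ_ X).hom = X ◁ η E.ι ≫ (ρ_ X).hom := by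
    rw [Iso.inv_comp_eq, E.exchange_unit_left]
  have h' := congrArg (fun q => (α_ X (E.ι.obj (𝟙_ B)) Y).inv ≫ q ▷ Y) h
  rw [rightIso_hom]
  refine Eq.trans ?_ (h'.trans ?_)
  · monoidal
  · monoidal

/-- Exchanging `b` past `a ⊗ X` exchanges it first past the image of `a`, which is the braiding of
`B` by `exchange_braiding`, and then past `X`. -/
theorem rightIso_hexagon (a b : B) (X Y : C) :
    (α_ _ _ _).hom ≫ E.ι.obj a ◁ (E.rightIso b X Y).hom =
      (E.rightIso b (E.ι.obj a ⊗ X) Y).hom ≫ E.ι.obj b ◁ (α_ _ _ _).hom ≫ (α_ _ _ _).inv ≫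
        μ E.ι b a ▷ _ ≫ E.ι.map (β_ b a).hom ▷ _ ≫ δ E.ι a b ▷ _ ≫ (α_ _ _ _).hom := by
  have h1 := E.exchange_tensor_right b (E.ι.obj a) X
  rw [exchange_braiding] at h1
  have h2 : (E.exchange b (E.ι.obj a ⊗ X)).inv ≫ (α_ _ _ _).inv ≫ μ E.ι b a ▷ X ≫
      E.ι.map (β_ b a).hom ▷ X ≫ δ E.ι a b ▷ X = (α_ _ _ _).hom ≫
        E.ι.obj a ◁ (E.exchange b X).inv ≫ (α_ _ _ _).inv := by
    rw [Iso.inv_comp_eq, h1]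
    simp
  have h3 := congrArg (fun q => (α_ (E.ι.obj a ⊗ X) (E.ι.obj b) Y).inv ≫ q ▷ Y ≫
    (α_ _ _ _).hom ≫ (α_ _ _ _).hom) h2
  simp only [rightIso_hom]
  refine Eq.trans ?_ (h3.symm.trans ?_)
  · monoidal
  · monoidal

/-- The tensor product of components as a bifunctor of module categories. -/
@[reducible]
def mulBifunctor {g h k : G} (e : g * h = k) :
    ModuleBifunctor (E.component g) (E.component h) (E.component k) where
  F :=
    { obj x :=
        { obj y := ⟨x.obj ⊗ y.obj, e ▸ K.deg_tensor x.property y.property⟩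
          map l := ObjectProperty.homMk (x.obj ◁ l.hom)
          map_id y := by ext; exact MonoidalCategory.whiskerLeft_id _ _
          map_comp l l' := by ext; exact MonoidalCategory.whiskerLeft_comp _ _ _ }
      map p :=
        { app y := ObjectProperty.homMk (p.hom ▷ y.obj)
          naturality y y' l := by ext; exact whisker_exchange _ _ }
      map_id x := by ext y; exact id_whiskerRight _ _
      map_comp p p' := by ext y; exact comp_whiskerRight _ _ _ }
  bilinear :=
    { add_left p p' y := by ext; exact MonoidalPreadditive.add_whiskerRight _ _
      smul_left c p y := by ext; exact MonoidalLinear.smul_whiskerRight _ _ _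
      add_right x _ _ l l' := by ext; exact MonoidalPreadditive.whiskerLeft_add _ _
      smul_right x _ _ c l := by ext; exact MonoidalLinear.whiskerLeft_smul _ _ _ }
  map_dag {x x' y y'} p l := by
    ext
    change dag (p.hom ▷ y.obj ≫ x'.obj ◁ l.hom) = dag p.hom ▷ y'.obj ≫ x.obj ◁ dag l.hom
    rw [← MonoidalCategory.tensorHom_def, ← MonoidalCategory.tensorHom_def,
      UnitaryMonoidal.dag_tensorHom]
  left b x y := (K.deg k).isoMk (α_ (E.ι.obj b) x.obj y.obj)
  right b x y := (K.deg k).isoMk (E.rightIso b x.obj y.obj)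
  left_unitary b x y := (isUnitary_full _).2 (UnitaryMonoidal.associator_unitary _ _ _)
  right_unitary b x y := (isUnitary_full _).2 (E.rightIso_unitary _ _ _)
  left_natural {b b' x x' y y'} f p l := by
    ext
    change ((E.ι.map f ⊗ₘ p.hom) ▷ y.obj ≫ (E.ι.obj b' ⊗ x'.obj) ◁ l.hom) ≫ (α_ _ _ _).hom =
      (α_ _ _ _).hom ≫ (E.ι.map f ⊗ₘ (p.hom ▷ y.obj ≫ x'.obj ◁ l.hom))
    rw [← MonoidalCategory.tensorHom_def, ← MonoidalCategory.tensorHom_def, associator_naturality]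
  right_natural {b b' x x' y y'} f p l := by
    ext
    change (p.hom ▷ (E.ι.obj b ⊗ y.obj) ≫ x'.obj ◁ (E.ι.map f ⊗ₘ l.hom)) ≫
      (E.rightIso b' x'.obj y'.obj).hom = (E.rightIso b x.obj y.obj).hom ≫
        (E.ι.map f ⊗ₘ (p.hom ▷ y.obj ≫ x'.obj ◁ l.hom))
    rw [← MonoidalCategory.tensorHom_def, ← MonoidalCategory.tensorHom_def, rightIso_natural]
  left_tensor a b x y := by
    ext
    change (α_ (E.ι.obj (a ⊗ b)) x.obj y.obj).hom ≫ δ E.ι a b ▷ _ ≫ (α_ _ _ _).hom =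
      (δ E.ι a b ▷ _ ≫ (α_ _ _ _).hom) ▷ y.obj ≫ (α_ _ _ _).hom ≫
        E.ι.obj a ◁ (α_ _ x.obj y.obj).hom
    monoidal
  right_tensor a b x y := by ext; exact E.rightIso_tensor a b x.obj y.obj
  left_unit x y := by
    ext
    change (α_ (E.ι.obj (𝟙_ B)) x.obj y.obj).hom ≫ η E.ι ▷ _ ≫ (λ_ _).hom =
      (η E.ι ▷ _ ≫ (λ_ _).hom) ▷ y.obj
    monoidal
  right_unit x y := by ext; exact E.rightIso_unit x.obj y.obj
  hexagon a b x y := by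
    ext
    refine (E.rightIso_hexagon a b x.obj y.obj).trans ?_
    change _ = (E.rightIso b (E.ι.obj a ⊗ x.obj) y.obj).hom ≫ E.ι.obj b ◁ (α_ _ _ _).hom ≫
      ((α_ _ _ _).inv ≫ μ E.ι b a ▷ _) ≫ E.ι.map (β_ b a).hom ▷ _ ≫ δ E.ι a b ▷ _ ≫ (α_ _ _ _).hom
    simp only [Category.assoc]

end CrossedBraiding.Extension

end

/-! ### The tensor product of components is a relative tensor product -/

section

variable {C : Type u₁} [Category.{v₁} C] [Preadditive C] [Linear ℂ C] [DaggerCategory C]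

/-- On the simple target, `dag f ≫ f` is a nonzero scalar; a multiple of `dag f` is a section. -/
theorem exists_section_of_simple [CStarCategory C] [IsFiniteSemisimple C] {X S : C} [Simple S]
    {f : X ⟶ S} (hf : f ≠ 0) : ∃ i : S ⟶ X, i ≫ f = 𝟙 S := by
  obtain ⟨c, hc⟩ := exists_smul_id_of_simple (dag f ≫ f)
  have hc0 : c ≠ 0 := by
    rintro rfl
    rw [zero_smul] at hc
    have h := CStarCategory.eq_zero_of_comp_dag (dag f) (by rwa [dag_dag])
    apply hf
    rw [← dag_dag f, h, ← zero_smul ℂ (0 : S ⟶ X), CStarCategory.dag_smul, map_zero, zero_smul]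
  exact ⟨c⁻¹ • dag f, by rw [Linear.smul_comp, hc, smul_smul, inv_mul_cancel₀ hc0, one_smul]⟩

end

section

variable {G : Type t} [Group G] {C : Type u₁} [Category.{v₁} C] [Preadditive C]
    [Linear ℂ C] [MonoidalCategory C] [DaggerCategory C] [UnitaryFusionCategory C]
    {A : UnitaryAction G C} {K : CrossedBraiding A}
    {B : Type u₂} [Category.{v₂} B] [Preadditive B] [Linear ℂ B] [MonoidalCategory B]
    [DaggerCategory B] [BraidedCategory B]

/-- If the evaluation were zero, a zigzag identity would force `Y = 0`. As its target, the unit, is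
simple, it has a section. -/
theorem exists_unit_retract {Y : C} (hY : ¬ Limits.IsZero Y) : ∃ (Y' : C) (_ : ExactPairing Y Y')
    (i : 𝟙_ C ⟶ Y' ⊗ Y) (p : Y' ⊗ Y ⟶ 𝟙_ C), i ≫ p = 𝟙 _ := by
  obtain ⟨-, ⟨d⟩⟩ := UnitaryFusionCategory.rigid Y
  have hs := UnitaryFusionCategory.simple_unit (C := C)
  obtain ⟨i, hi⟩ := exists_section_of_simple (f := d.exact.evaluation') (fun h => hY (by
    rw [Limits.IsZero.iff_id_eq_zero]
    have h1 := d.exact.coevaluation_evaluation'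
    have h2 := d.exact.evaluation_coevaluation'
    rw [h, MonoidalPreadditive.whiskerLeft_zero, Limits.comp_zero, Limits.comp_zero] at h2
    rw [← cancel_mono (ρ_ Y).inv, ← cancel_epi (λ_ Y).hom, Category.id_comp, ← h2]
    simp))
  exact ⟨_, d.exact, i, _, hi⟩

namespace CrossedBraiding.Extension

variable (E : K.Extension B)

theorem pair_mulBifunctor_hom {g h k : G} (e : g * h = k) {x x' : (K.deg g).FullSubcategory}
    {y y' : (K.deg h).FullSubcategory} {b : B} (u : x.obj ⟶ E.ι.obj b ⊗ x'.obj)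
    (v : E.ι.obj b ⊗ y.obj ⟶ y'.obj) :
    (K.deg k).ι.map ((E.mulBifunctor e).toBalanced.pair (x := x) (x' := x')
      (y := y) (y' := y') (b := b) (ObjectProperty.homMk u) (ObjectProperty.homMk v)) =
      u ▷ y.obj ≫ (E.exchange b x'.obj).hom ▷ y.obj ≫ (α_ _ _ _).hom ≫ x'.obj ◁ v := by
  change (u ▷ y.obj ≫ _ ◁ 𝟙 y.obj) ≫ ((α_ _ _ _).hom ≫ (E.rightIso b x'.obj y.obj).inv) ≫
    𝟙 x'.obj ▷ _ ≫ x'.obj ◁ v = _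
  rw [rightIso_inv]
  simp

/-- For `y, y'` of the same degree, `y' ⊗ y*` has degree `1` and so comes from some `b` in `B`; the
morphism adjoint to this identification is universal. Morphisms `x ⊗ y ⟶ x' ⊗ y'` correspond by
duality to morphisms `x ⟶ x' ⊗ (y' ⊗ y*)`, and the exchange isomorphism puts `b` on the left of
`x'`. For retracts, the unit is a retract of `y* ⊗ y` for any nonzero `y` of degree `h`, so `z` is a
retract of `(z ⊗ y*) ⊗ y`. -/
theorem mulBifunctor_isGenerating {g h k : G} (e : g * h = k) :
    (E.mulBifunctor e).toBalanced.IsGenerating where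
  exists_universal y y' := by
    obtain ⟨-, ⟨d⟩⟩ := UnitaryFusionCategory.rigid y.obj
    have := d.exact
    obtain ⟨b, ⟨φ⟩⟩ := (E.deg_one_iff (y'.obj ⊗ HasRightDual.rightDual y.obj)).1 (by
      simpa using K.deg_tensor y'.property (K.deg_dual d.exact y.property))
    have key (x x' : (K.deg g).FullSubcategory) (u : x.obj ⟶ E.ι.obj b ⊗ x'.obj) :
        u ▷ y.obj ≫ (E.exchange b x'.obj).hom ▷ y.obj ≫ (α_ _ _ _).hom ≫
            x'.obj ◁ (tensorRightHomEquiv _ y.obj (HasRightDual.rightDual y.obj) y'.obj).symm φ.hom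
            =
          (tensorRightHomEquiv _ y.obj (HasRightDual.rightDual y.obj) (x'.obj ⊗ y'.obj)).symm
            (u ≫ (E.exchange b x'.obj ≪≫ whiskerLeftIso x'.obj φ ≪≫ (α_ _ _ _).symm).hom) := by
      simp only [tensorRightHomEquiv, Equiv.coe_fn_symm_mk, Iso.trans_hom, whiskerLeftIso_hom,
        Iso.symm_hom]
      monoidal
    refine ⟨b, ObjectProperty.homMk ((tensorRightHomEquiv _ y.obj _ y'.obj).symm φ.hom),
      fun b' v => ?_, fun x x' => ⟨fun u u' huu => ?_, fun f => ?_⟩⟩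
    · obtain ⟨w, hw⟩ := E.full.map_surjective
        (tensorRightHomEquiv _ y.obj (HasRightDual.rightDual y.obj) y'.obj v.hom ≫ φ.inv)
      refine ⟨w, ?_⟩
      ext
      change v.hom = E.ι.map w ▷ y.obj ≫ (tensorRightHomEquiv _ y.obj _ y'.obj).symm φ.hom
      rw [← (tensorRightHomEquiv _ y.obj (HasRightDual.rightDual y.obj) y'.obj).symm_apply_apply
        v.hom, ← (Iso.eq_comp_inv _).1 hw]
      simp [tensorRightHomEquiv]
    · have h1 := congrArg (K.deg k).ι.map huu
      have h2 := (E.pair_mulBifunctor_hom e (x := x) (x' := x') (y := y) (y' := y')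
        u.hom _).symm.trans (h1.trans (E.pair_mulBifunctor_hom e u'.hom _))
      rw [key, key] at h2
      ext
      exact (cancel_mono _).1 ((tensorRightHomEquiv _ _ _ _).symm.injective h2)
    · let q := E.exchange b x'.obj ≪≫ whiskerLeftIso x'.obj φ ≪≫ (α_ _ _ _).symm
      refine ⟨ObjectProperty.homMk (tensorRightHomEquiv _ y.obj (HasRightDual.rightDual y.obj)
        (x'.obj ⊗ y'.obj) f.hom ≫ q.inv), ?_⟩
      ext
      refine (E.pair_mulBifunctor_hom e _ _).trans ((key _ _ _).trans ?_)
      rw [Category.assoc, Iso.inv_hom_id, Category.comp_id]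
      exact (tensorRightHomEquiv _ y.obj _ _).symm_apply_apply f.hom
  exists_retract z := by
    obtain ⟨y, hy, hy0⟩ := K.faithful h
    obtain ⟨y', d, i, p, hip⟩ := exists_unit_retract hy0
    refine ⟨⟨z.obj ⊗ y', ?_⟩, ⟨y, hy⟩,
      ObjectProperty.homMk ((ρ_ z.obj).inv ≫ z.obj ◁ i ≫ (α_ _ _ _).inv),
      ObjectProperty.homMk ((α_ _ _ _).hom ≫ z.obj ◁ p ≫ (ρ_ z.obj).hom), ?_⟩
    -- The object `z ⊗ y'` has degree `k * h⁻¹ = g`.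
    · exact eq_mul_inv_of_mul_eq e ▸ K.deg_tensor z.property (K.deg_dual d hy)
    · ext
      change ((ρ_ z.obj).inv ≫ z.obj ◁ i ≫ (α_ _ _ _).inv) ≫ (α_ _ _ _).hom ≫ z.obj ◁ p ≫
        (ρ_ z.obj).hom = 𝟙 _
      simp only [Category.assoc, Iso.inv_hom_id_assoc]
      rw [← MonoidalCategory.whiskerLeft_comp_assoc, hip]
      simp

end CrossedBraiding.Extension

end

/-! ### Module functors -/

section

variable {B : Type u₂} [Category.{v₂} B] [Preadditive B] [Linear ℂ B] [MonoidalCategory B]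
  [DaggerCategory B]

/-- Unitary functors of module categories. -/
structure ModuleFunctor (X : UModCat.{u₁, v₁} B) (Y : UModCat.{u₃, v₃} B) where
  F : X ⥤ Y
  isUnitary : IsUnitaryFunctor F
  act (b : B) (x : X) : F.obj (b ⊙ₗ x) ≅ b ⊙ₗ F.obj x
  act_unitary (b : B) (x : X) : IsUnitary (act b x).hom
  act_natural {b b' : B} {x x' : X} (f : b ⟶ b') (k : x ⟶ x') :
    F.map (f ⊙ₗₘ k) ≫ (act b' x').hom = (act b x).hom ≫ (f ⊙ₗₘ F.map k)
  act_tensor (a b : B) (x : X) :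
    (act (a ⊗ b) x).hom ≫ (αₗ a b _).hom =
      F.map (αₗ a b x).hom ≫ (act a (b ⊙ₗ x)).hom ≫ a ⊴ₗ (act b x).hom
  act_unit (x : X) : (act (𝟙_ B) x).hom ≫ (λₗ _).hom = F.map (λₗ x).hom

variable [BraidedCategory B] {X : UModCat.{u₁, v₁} B} {Y : UModCat.{u₃, v₃} B}
    {Z : UModCat.{w₁, w₂} B} {Z' : UModCat.{t, w₃} B} (Φ : ModuleBifunctor X Y Z)
    (T : ModuleFunctor Z Z')

namespace ModuleBifunctor

theorem map_biMap {x x' : X} {y y' : Y} (k : x ⟶ x') (l : y ⟶ y') :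
    biMap (Φ.F ⋙ (Functor.whiskeringRight _ _ _).obj T.F) k l = T.F.map (biMap Φ.F k l) :=
  (T.F.map_comp _ _).symm

/-- Composition with a module functor. -/
@[reducible]
def postcomp : ModuleBifunctor X Y Z' where
  F := Φ.F ⋙ (Functor.whiskeringRight _ _ _).obj T.F
  bilinear :=
    { add_left f f' y := (congrArg T.F.map (Φ.bilinear.add_left f f' y)).trans
        (T.isUnitary.map_add _ _)
      smul_left c f y := (congrArg T.F.map (Φ.bilinear.smul_left c f y)).trans
        (T.isUnitary.map_smul _ _)
      add_right x _ _ k k' := (congrArg T.F.map (Φ.bilinear.add_right x k k')).trans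
        (T.isUnitary.map_add _ _)
      smul_right x _ _ c k := (congrArg T.F.map (Φ.bilinear.smul_right x c k)).trans
        (T.isUnitary.map_smul _ _) }
  map_dag k l := by rw [map_biMap, map_biMap, ← T.isUnitary.map_dag, Φ.map_dag]
  left b x y := T.F.mapIso (Φ.left b x y) ≪≫ T.act b (Φ.on x y)
  right b x y := T.F.mapIso (Φ.right b x y) ≪≫ T.act b (Φ.on x y)
  left_unitary b x y := (T.isUnitary.map_unitary (Φ.left_unitary b x y)).comp (T.act_unitary _ _)
  right_unitary b x y := (T.isUnitary.map_unitary (Φ.right_unitary b x y)).comp (T.act_unitary _ _)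
  left_natural {b b' x x' y y'} f k l := by
    refine (congrArg (· ≫ _) (Φ.map_biMap T _ _)).trans ?_
    change T.F.map _ ≫ T.F.map (Φ.left b' x' y').hom ≫ (T.act b' (Φ.on x' y')).hom =
      (T.F.map (Φ.left b x y).hom ≫ (T.act b (Φ.on x y)).hom) ≫ _
    rw [← Functor.map_comp_assoc, Φ.left_natural, Functor.map_comp_assoc, T.act_natural,
      Category.assoc, ← map_biMap]
  right_natural {b b' x x' y y'} f k l := by
    refine (congrArg (· ≫ _) (Φ.map_biMap T _ _)).trans ?_
    change T.F.map _ ≫ T.F.map (Φ.right b' x' y').hom ≫ (T.act b' (Φ.on x' y')).hom =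
      (T.F.map (Φ.right b x y).hom ≫ (T.act b (Φ.on x y)).hom) ≫ _
    rw [← Functor.map_comp_assoc, Φ.right_natural, Functor.map_comp_assoc, T.act_natural,
      Category.assoc, ← map_biMap]
  left_tensor a b x y := by
    have h := congrArg T.F.map (Φ.left_tensor a b x y)
    have nat := T.act_natural (𝟙 a) (Φ.left b x y).hom
    simp only [Functor.map_comp, MonoidalLeftAction.id_actionHom] at h nat
    change (T.F.map (Φ.left (a ⊗ b) x y).hom ≫ (T.act _ (Φ.on x y)).hom) ≫
        (αₗ a b (T.F.obj (Φ.on x y))).hom =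
      T.F.map ((Φ.F.map (αₗ a b x).hom).app y) ≫
      (T.F.map (Φ.left a (b ⊙ₗ x) y).hom ≫ (T.act a (Φ.on (b ⊙ₗ x) y)).hom) ≫
        a ⊴ₗ (T.F.map (Φ.left b x y).hom ≫ (T.act b (Φ.on x y)).hom)
    rw [MonoidalLeftAction.actionHomRight_comp, Category.assoc, Category.assoc,
      ← reassoc_of% nat, ← reassoc_of% h, T.act_tensor]
  right_tensor a b x y := by
    have h := congrArg T.F.map (Φ.right_tensor a b x y)
    have nat := T.act_natural (𝟙 a) (Φ.right b x y).hom
    simp only [Functor.map_comp, MonoidalLeftAction.id_actionHom] at h nat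
    change (T.F.map (Φ.right (a ⊗ b) x y).hom ≫ (T.act _ (Φ.on x y)).hom) ≫
        (αₗ a b (T.F.obj (Φ.on x y))).hom =
      T.F.map ((Φ.F.obj x).map (αₗ a b y).hom) ≫
      (T.F.map (Φ.right a x (b ⊙ₗ y)).hom ≫ (T.act a (Φ.on x (b ⊙ₗ y))).hom) ≫
        a ⊴ₗ (T.F.map (Φ.right b x y).hom ≫ (T.act b (Φ.on x y)).hom)
    rw [MonoidalLeftAction.actionHomRight_comp, Category.assoc, Category.assoc,
      ← reassoc_of% nat, ← reassoc_of% h, T.act_tensor]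
  left_unit x y := (Category.assoc _ _ _).trans ((congrArg (_ ≫ ·) (T.act_unit _)).trans
    ((T.F.map_comp _ _).symm.trans (congrArg T.F.map (Φ.left_unit x y))))
  right_unit x y := (Category.assoc _ _ _).trans ((congrArg (_ ≫ ·) (T.act_unit _)).trans
    ((T.F.map_comp _ _).symm.trans (congrArg T.F.map (Φ.right_unit x y))))
  hexagon a b x y := by
    have h := congrArg T.F.map (Φ.hexagon a b x y)
    have nat := T.act_natural (𝟙 a) (Φ.right b x y).hom
    have nat' := T.act_natural (𝟙 b) (Φ.left a x y).hom
    have nat'' := T.act_natural (β_ b a).hom (𝟙 (Φ.on x y))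
    have h1 := T.act_tensor a b (Φ.on x y)
    have h2 := T.act_tensor b a (Φ.on x y)
    have h3 : T.F.map (αₗ b a (Φ.on x y)).inv ≫ (T.act (b ⊗ a) (Φ.on x y)).hom =
        (T.act b (a ⊙ₗ Φ.on x y)).hom ≫ b ⊴ₗ (T.act a (Φ.on x y)).hom ≫ (αₗ b a _).inv := by
      rw [← cancel_mono (αₗ b a _).hom, Category.assoc, h2, ← Functor.map_comp_assoc,
        Iso.inv_hom_id]
      simp
    simp only [Functor.map_comp, MonoidalLeftAction.id_actionHom, MonoidalLeftAction.actionHom_id,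
      CategoryTheory.Functor.map_id] at h nat nat' nat''
    change (T.F.map (Φ.left a x (b ⊙ₗ y)).hom ≫ (T.act a (Φ.on x (b ⊙ₗ y))).hom) ≫
        a ⊴ₗ (T.F.map (Φ.right b x y).hom ≫ (T.act b (Φ.on x y)).hom) =
      (T.F.map (Φ.right b (a ⊙ₗ x) y).hom ≫ (T.act b (Φ.on (a ⊙ₗ x) y)).hom) ≫
        b ⊴ₗ (T.F.map (Φ.left a x y).hom ≫ (T.act a (Φ.on x y)).hom) ≫
          (αₗ b a (T.F.obj (Φ.on x y))).inv ≫ (β_ b a).hom ⊵ₗ (T.F.obj (Φ.on x y)) ≫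
            (αₗ a b (T.F.obj (Φ.on x y))).hom
    rw [MonoidalLeftAction.actionHomRight_comp, MonoidalLeftAction.actionHomRight_comp]
    simp only [Category.assoc]
    rw [← reassoc_of% nat, reassoc_of% h, ← reassoc_of% nat', ← h1, reassoc_of% nat'',
      reassoc_of% h3]

theorem pair_postcomp {x x' : X} {y y' : Y} {b : B} (u : x ⟶ b ⊙ₗ x') (v : b ⊙ₗ y ⟶ y') :
    (Φ.postcomp T).toBalanced.pair u v = T.F.map (Φ.toBalanced.pair u v) := by
  have h : ((Φ.postcomp T).balance b x' y).hom = T.F.map (Φ.balance b x' y).hom := by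
    change (T.F.map (Φ.left b x' y).hom ≫ (T.act b _).hom) ≫ (T.act b _).inv ≫
      T.F.map (Φ.right b x' y).inv = T.F.map ((Φ.left b x' y).hom ≫ (Φ.right b x' y).inv)
    simp
  rw [BalancedFunctor.pair, BalancedFunctor.pair, Functor.map_comp, Functor.map_comp]
  exact congrArg₂ (· ≫ ·) (Φ.map_biMap T u (𝟙 y))
    (congrArg₂ (· ≫ ·) h (Φ.map_biMap T (𝟙 x') v))

theorem isGenerating_postcomp (h : Φ.toBalanced.IsGenerating) [T.F.IsEquivalence] :
    (Φ.postcomp T).toBalanced.IsGenerating where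
  exists_universal y y' := by
    obtain ⟨b, ev, h1, h2⟩ := h.exists_universal y y'
    refine ⟨b, ev, h1, fun x x' => ?_⟩
    have h3 : (fun u : x ⟶ b ⊙ₗ x' => (Φ.postcomp T).toBalanced.pair u ev) =
        T.F.map ∘ fun u => Φ.toBalanced.pair u ev :=
      funext fun u => Φ.pair_postcomp T u ev
    rw [h3]
    exact ⟨T.F.map_injective.comp (h2 x x').1, T.F.map_surjective.comp (h2 x x').2⟩
  exists_retract z := by
    obtain ⟨x, y, i, p, hip⟩ := h.exists_retract (T.F.objPreimage z)
    refine ⟨x, y, (T.F.objObjPreimageIso z).inv ≫ T.F.map i,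
      T.F.map p ≫ (T.F.objObjPreimageIso z).hom, ?_⟩
    have key {w : Z} (i : T.F.objPreimage z ⟶ w) (p : w ⟶ T.F.objPreimage z) (h : i ≫ p = 𝟙 _) :
        ((T.F.objObjPreimageIso z).inv ≫ T.F.map i) ≫ T.F.map p ≫ (T.F.objObjPreimageIso z).hom =
          𝟙 z := by
      rw [Category.assoc, ← Functor.map_comp_assoc, h]
      simp
    exact key i p hip

end ModuleBifunctor

end

/-! ### The trivial component as the regular module category -/

section

theorem IsUnitaryFunctor.of_map_unitary {C : Type u₁} [Category.{v₁} C] [Preadditive C]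
    [Linear ℂ C] [DaggerCategory C] {D : Type u₂} [Category.{v₂} D] [Preadditive D] [Linear ℂ D]
    [DaggerCategory D] {F : C ⥤ D} [F.Faithful] (hF : IsUnitaryFunctor F) {X Y : C} {f : X ⟶ Y}
    (hf : IsUnitary (F.map f)) : IsUnitary f := by
  constructor
  · apply F.map_injective
    rw [Functor.map_comp, hF.map_dag, hf.hom_dag, CategoryTheory.Functor.map_id]
  · apply F.map_injective
    rw [Functor.map_comp, hF.map_dag, hf.dag_hom, CategoryTheory.Functor.map_id]

variable {G : Type t} [Group G] {C : Type u₁} [Category.{v₁} C] [Preadditive C]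
    [Linear ℂ C] [MonoidalCategory C] [DaggerCategory C] [UnitaryFusionCategory C]
    {A : UnitaryAction G C} {K : CrossedBraiding A}
    {B : Type u₂} [Category.{v₂} B] [Preadditive B] [Linear ℂ B] [MonoidalCategory B]
    [DaggerCategory B] [BraidedCategory B]

namespace CrossedBraiding.Extension

variable (E : K.Extension B)

instance : E.ι.Full := E.full
instance : E.ι.Faithful := E.faithful

/-- The isomorphism is chosen unitary so that the quasi-inverse built from it is a `*`-functor with
unitary constraints. -/
theorem exists_preimage (x : (K.deg 1).FullSubcategory) :
    ∃ (b : B) (e : E.ι.obj b ≅ x.obj), IsUnitary e.hom := by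
  obtain ⟨b, ⟨e⟩⟩ := (E.deg_one_iff x.obj).1 x.property
  obtain ⟨u, hu⟩ := exists_unitary_of_iso e
  exact ⟨b, u, hu⟩

/-- The object of `B` corresponding to an object of the trivial component. -/
noncomputable def pre (x : (K.deg 1).FullSubcategory) : B := (E.exists_preimage x).choose

/-- The defining isomorphism of `pre`. -/
noncomputable def preIso (x : (K.deg 1).FullSubcategory) : E.ι.obj (E.pre x) ≅ x.obj :=
  (E.exists_preimage x).choose_spec.choose

theorem preIso_unitary (x : (K.deg 1).FullSubcategory) : IsUnitary (E.preIso x).hom :=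
  (E.exists_preimage x).choose_spec.choose_spec

/-- The value of `pre` on morphisms. -/
noncomputable def preMap {x y : (K.deg 1).FullSubcategory} (f : x ⟶ y) : E.pre x ⟶ E.pre y :=
  E.ι.preimage ((E.preIso x).hom ≫ f.hom ≫ (E.preIso y).inv)

theorem ι_preMap {x y : (K.deg 1).FullSubcategory} (f : x ⟶ y) :
    E.ι.map (E.preMap f) = (E.preIso x).hom ≫ f.hom ≫ (E.preIso y).inv :=
  Functor.map_preimage _ _

/-- A quasi-inverse of the embedding of `B`. -/
noncomputable def preFunctor : (K.deg 1).FullSubcategory ⥤ B where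
  obj := E.pre
  map := E.preMap
  map_id x := E.ι.map_injective (by
    rw [ι_preMap, ObjectProperty.FullSubcategory.id_hom]
    simp)
  map_comp f g := E.ι.map_injective (by
    rw [Functor.map_comp, ι_preMap, ι_preMap, ι_preMap, ObjectProperty.FullSubcategory.comp_hom]
    simp)

instance : E.preFunctor.IsEquivalence where
  faithful := ⟨fun {x y f g} h => by
    have h' := congrArg E.ι.map h
    change E.ι.map (E.preMap f) = E.ι.map (E.preMap g) at h'
    rw [ι_preMap, ι_preMap, cancel_epi, cancel_mono] at h'
    ext
    exact h'⟩
  full := ⟨fun {x y} f => by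
    obtain ⟨f', hf⟩ : ∃ f' : E.pre x ⟶ E.pre y, f' = f := ⟨f, rfl⟩
    refine ⟨ObjectProperty.homMk ((E.preIso x).inv ≫ E.ι.map f' ≫ (E.preIso y).hom),
      (E.ι.map_injective ?_ : E.preMap _ = f').trans hf⟩
    rw [ι_preMap]
    simp⟩
  essSurj := ⟨fun b => ⟨⟨E.ι.obj b, E.deg_ι b⟩, ⟨E.ι.preimageIso (E.preIso _)⟩⟩⟩

theorem isUnitaryFunctor_preFunctor : IsUnitaryFunctor E.preFunctor where
  map_add f g := by
    apply E.ι.map_injective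
    change E.ι.map (E.preMap (f + g)) = E.ι.map (E.preMap f + E.preMap g)
    rw [E.unitary.map_add, ι_preMap, ι_preMap, ι_preMap]
    change _ ≫ (f.hom + g.hom) ≫ _ = _
    simp
  map_smul c f := by
    apply E.ι.map_injective
    change E.ι.map (E.preMap (c • f)) = E.ι.map (c • E.preMap f)
    rw [E.unitary.map_smul, ι_preMap, ι_preMap]
    change _ ≫ (c • f.hom) ≫ _ = _
    simp
  map_dag {x y} f := by
    apply E.ι.map_injective
    change E.ι.map (E.preMap (dag f)) = E.ι.map (dag (E.preMap f))
    rw [E.unitary.map_dag, ι_preMap, ι_preMap, full_dag_hom, dag_comp, dag_comp,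
      IsUnitary.dag_eq_inv _ (E.preIso_unitary x), ← IsUnitary.dag_eq_inv _ (E.preIso_unitary y),
      dag_dag, Category.assoc]

/-- `pre` is a module functor. -/
noncomputable def preAct (b : B) (x : (K.deg 1).FullSubcategory) :
    E.pre ((E.componentAction 1).actionObj b x) ≅ b ⊗ E.pre x :=
  E.ι.preimageIso (E.preIso ((E.componentAction 1).actionObj b x) ≪≫
  whiskerLeftIso (E.ι.obj b) (E.preIso x).symm ≪≫
    Functor.Monoidal.μIso E.ι b (E.pre x))

theorem ι_preAct_hom (b : B) (x : (K.deg 1).FullSubcategory) :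
    E.ι.map (E.preAct b x).hom = (E.preIso ((E.componentAction 1).actionObj b x)).hom ≫
    E.ι.obj b ◁ (E.preIso x).inv ≫
      μ E.ι b (E.pre x) :=
  Functor.map_preimage _ _

theorem preAct_unitary (b : B) (x : (K.deg 1).FullSubcategory) : IsUnitary (E.preAct b x).hom := by
  refine E.unitary.of_map_unitary ?_
  rw [ι_preAct_hom, ← id_tensorHom]
  exact (E.preIso_unitary _).comp (((IsUnitary.id _).tensor
    (IsUnitary.inv _ (E.preIso_unitary _))).comp (E.unitary.μ_unitary _ _))

theorem preAct_natural {b b' : B} {x x' : (K.deg 1).FullSubcategory} (f : b ⟶ b') (k : x ⟶ x') :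
    E.preMap ((E.componentAction 1).actionHom f k) ≫ (E.preAct b' x').hom =
      (E.preAct b x).hom ≫ (f ⊗ₘ E.preMap k) := by
  apply E.ι.map_injective
  rw [Functor.map_comp, Functor.map_comp, ι_preMap, ι_preAct_hom, ι_preAct_hom,
    Category.assoc, Category.assoc, Category.assoc, Category.assoc, Iso.inv_hom_id_assoc,
    ← μ_natural, ι_preMap]
  refine congrArg (_ ≫ ·) ?_
  change (E.ι.map f ⊗ₘ k.hom) ≫ _ = _
  rw [← id_tensorHom, ← id_tensorHom, tensorHom_comp_tensorHom_assoc,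
    tensorHom_comp_tensorHom_assoc]
  simp

theorem preAct_tensor (a b : B) (x : (K.deg 1).FullSubcategory) :
    (E.preAct (a ⊗ b) x).hom ≫ (α_ a b _).hom =
      E.preMap ((E.componentAction 1).actionAssocIso a b x).hom ≫
      (E.preAct a ((E.componentAction 1).actionObj b x)).hom ≫ a ◁ (E.preAct b x).hom := by
  apply E.ι.map_injective
  simp only [Functor.map_comp]
  rw [ι_preMap, ι_preAct_hom, ι_preAct_hom, Category.assoc, Category.assoc, Category.assoc,
    Category.assoc, Category.assoc, Category.assoc, Iso.inv_hom_id_assoc, ← μ_natural_right,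
    ι_preAct_hom]
  refine congrArg (_ ≫ ·) ?_
  change _ = (δ E.ι a b ▷ x.obj ≫ (α_ _ _ _).hom) ≫ _
  rw [← cancel_epi (μ E.ι a b ▷ x.obj), ← whisker_exchange_assoc,
    Functor.LaxMonoidal.associativity]
  simp

theorem preAct_unit (x : (K.deg 1).FullSubcategory) :
    (E.preAct (𝟙_ B) x).hom ≫ (λ_ _).hom =
      E.preMap ((E.componentAction 1).actionUnitIso x).hom := by
  apply E.ι.map_injective
  rw [Functor.map_comp, ι_preMap, ι_preAct_hom, Category.assoc, Category.assoc]
  refine congrArg (_ ≫ ·) ?_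
  change _ = (η E.ι ▷ x.obj ≫ (λ_ _).hom) ≫ _
  rw [← cancel_epi (ε E.ι ▷ x.obj), ← whisker_exchange_assoc, ← Functor.LaxMonoidal.left_unitality]
  simp

/-- The trivial component is equivalent to the regular module category. -/
@[reducible]
noncomputable def preModuleFunctor [UnitaryFusionCategory B] :
    ModuleFunctor (E.component 1) (UModCat.self B) where
  F := E.preFunctor
  isUnitary := E.isUnitaryFunctor_preFunctor
  act := E.preAct
  act_unitary := E.preAct_unitary
  act_natural := E.preAct_natural
  act_tensor := E.preAct_tensor
  act_unit := E.preAct_unit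

/-- The inverse of the component of degree `g` is that of degree `g⁻¹`: their tensor product lands
in the trivial component, which is equivalent to `B` as a module category. -/
theorem component_isInvertible [UnitaryFusionCategory B] (g : G) :
    (E.component g).IsInvertible := by
  have : E.preModuleFunctor.F.IsEquivalence := inferInstanceAs E.preFunctor.IsEquivalence
  exact ⟨E.component g⁻¹, (E.mulBifunctor (mul_inv_cancel g)).postcomp E.preModuleFunctor,
    (E.mulBifunctor (inv_mul_cancel g)).postcomp E.preModuleFunctor,
    ModuleBifunctor.isRelativeTensorProduct _ (ModuleBifunctor.isGenerating_postcomp _ _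
      (E.mulBifunctor_isGenerating _)),
    ModuleBifunctor.isRelativeTensorProduct _ (ModuleBifunctor.isGenerating_postcomp _ _
      (E.mulBifunctor_isGenerating _))⟩

/-- The unit object as an object of the trivial component. -/
abbrev unitObj (K : CrossedBraiding A) {o : G} (e : o = 1) : (K.deg o).FullSubcategory :=
  ⟨𝟙_ C, e ▸ K.deg_unit⟩

/-- Acting on the unit object is the embedding of `B` up to the right unitor, and that embedding is
an equivalence onto the trivial component. -/
theorem unit_isEquivalence {o : G} (e : o = 1) :
    (letI := E.componentAction o;
      (MonoidalLeftAction.curriedAction B (K.deg o).FullSubcategory).flip.obj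
        (unitObj K e)).IsEquivalence := by
  have : ((K.deg o).lift E.ι (fun b => e ▸ E.deg_ι b)).IsEquivalence :=
    { faithful := inferInstance
      full := inferInstance
      essSurj := ⟨fun x => by
        obtain ⟨b, ⟨i⟩⟩ := (E.deg_one_iff x.obj).1 (e ▸ x.property)
        exact ⟨b, ⟨(K.deg o).isoMk i⟩⟩⟩ }
  refine Functor.isEquivalence_of_iso (F := (K.deg o).lift E.ι (fun b => e ▸ E.deg_ι b))
    (NatIso.ofComponents (fun b => (K.deg o).isoMk (ρ_ (E.ι.obj b)).symm) fun f => ?_)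
  ext
  exact (rightUnitor_inv_naturality (E.ι.map f))

end CrossedBraiding.Extension

end

/-! ### The tri-homomorphism of an extension -/

section

variable {G : Type t} [Group G] {C : Type u₁} [Category.{v₁} C] [Preadditive C]
    [Linear ℂ C] [MonoidalCategory C] [DaggerCategory C] [UnitaryFusionCategory C]
    {A : UnitaryAction G C} {K : CrossedBraiding A}
    {B : Type u₂} [Category.{v₂} B] [Preadditive B] [Linear ℂ B] [MonoidalCategory B]
    [DaggerCategory B] [BraidedCategory B] (E : K.Extension B)

namespace CrossedBraiding.Extension

/-- The exchange past `X ⊗ Y` is performed one factor at a time, by `exchange_tensor_right`. -/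
theorem rightIso_associator (b : B) (X Y Z : C) :
    (α_ X Y (E.ι.obj b ⊗ Z)).hom ≫ X ◁ (E.rightIso b Y Z).hom ≫ (E.rightIso b X (Y ⊗ Z)).hom =
      (E.rightIso b (X ⊗ Y) Z).hom ≫ E.ι.obj b ◁ (α_ X Y Z).hom := by
  have h1 : (E.exchange b (X ⊗ Y)).inv = (α_ _ _ _).hom ≫ X ◁ (E.exchange b Y).inv ≫
      (α_ _ _ _).inv ≫ (E.exchange b X).inv ▷ Y ≫ (α_ _ _ _).hom := by
    rw [← cancel_epi (E.exchange b (X ⊗ Y)).hom, Iso.hom_inv_id, exchange_tensor_right]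
    simp
  simp only [rightIso_hom, h1]
  monoidal

theorem rightIso_middle (b : B) (X Y Z : C) :
    (α_ X (E.ι.obj b ⊗ Y) Z).hom ≫ X ◁ (α_ _ Y Z).hom ≫ (E.rightIso b X (Y ⊗ Z)).hom =
      (E.rightIso b X Y).hom ▷ Z ≫ (α_ _ _ _).hom ≫ E.ι.obj b ◁ (α_ X Y Z).hom := by
  simp only [rightIso_hom]
  monoidal

theorem rightIso_leftUnitor (b : B) (X : C) :
    (λ_ (E.ι.obj b ⊗ X)).hom = (E.rightIso b (𝟙_ C) X).hom ≫ E.ι.obj b ◁ (λ_ X).hom := by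
  have h1 : (E.exchange b (𝟙_ C)).inv = (λ_ _).hom ≫ (ρ_ _).inv := by
    rw [← cancel_epi (E.exchange b (𝟙_ C)).hom, Iso.hom_inv_id, exchange_unit_right]
    simp
  rw [rightIso_hom, h1]
  monoidal

/-- The tri-homomorphism given by the components of an extension. -/
noncomputable def triHom [UnitaryFusionCategory B] : TriHom.{u₁, v₁} G B where
  obj := E.component
  invertible := E.component_isInvertible
  mul e := E.mulBifunctor e
  mul_equivalence e := ModuleBifunctor.isRelativeTensorProduct _ (E.mulBifunctor_isGenerating e)
  unit e := unitObj K e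
  unit_equivalence e := E.unit_isEquivalence e
  assoc {g h k gh hk ghk} e₁ e₂ e₃ e₄ x y z := (K.deg ghk).isoMk (α_ x.obj y.obj z.obj)
  leftUnit {o g} e e' x := (K.deg g).isoMk (λ_ x.obj)
  rightUnit {o g} e e' x := (K.deg g).isoMk (ρ_ x.obj)
  assoc_unitary e₁ e₂ e₃ e₄ x y z :=
    (isUnitary_full _).2 (UnitaryMonoidal.associator_unitary _ _ _)
  leftUnit_unitary e e' x := (isUnitary_full _).2 (UnitaryMonoidal.leftUnitor_unitary _)
  rightUnit_unitary e e' x := (isUnitary_full _).2 (UnitaryMonoidal.rightUnitor_unitary _)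
  assoc_natural e₁ e₂ e₃ e₄ x x' y y' z z' p q r := by
    ext
    change ((p.hom ▷ y.obj ≫ x'.obj ◁ q.hom) ▷ z.obj ≫ (x'.obj ⊗ y'.obj) ◁ r.hom) ≫
        (α_ _ _ _).hom = (α_ _ _ _).hom ≫ p.hom ▷ (y.obj ⊗ z.obj) ≫
          x'.obj ◁ (q.hom ▷ z.obj ≫ y'.obj ◁ r.hom)
    monoidal
  leftUnit_natural e e' x x' p := by
    ext
    change (𝟙 (𝟙_ C) ▷ x.obj ≫ 𝟙_ C ◁ p.hom) ≫ (λ_ x'.obj).hom = (λ_ x.obj).hom ≫ p.hom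
    simp
  rightUnit_natural e e' x x' p := by
    ext
    change (p.hom ▷ 𝟙_ C ≫ x'.obj ◁ 𝟙 (𝟙_ C)) ≫ (ρ_ x'.obj).hom = (ρ_ x.obj).hom ≫ p.hom
    simp
  assoc_left e₁ e₂ e₃ e₄ b x y z := by
    ext
    change (α_ (E.ι.obj b ⊗ x.obj) y.obj z.obj).hom ≫ (α_ _ _ _).hom =
      ((α_ _ _ _).hom ▷ z.obj ≫ _ ◁ 𝟙 z.obj) ≫ (α_ _ _ _).hom ≫ E.ι.obj b ◁ (α_ _ _ _).hom
    simp
  assoc_middle e₁ e₂ e₃ e₄ b x y z := by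
    ext
    change (α_ x.obj (E.ι.obj b ⊗ y.obj) z.obj).hom ≫ (𝟙 x.obj ▷ _ ≫ x.obj ◁ (α_ _ _ _).hom) ≫
      (E.rightIso b x.obj (y.obj ⊗ z.obj)).hom =
        ((E.rightIso b x.obj y.obj).hom ▷ z.obj ≫ _ ◁ 𝟙 z.obj) ≫ (α_ _ _ _).hom ≫
          E.ι.obj b ◁ (α_ _ _ _).hom
    rw [id_whiskerRight, Category.id_comp, MonoidalCategory.whiskerLeft_id, Category.comp_id,
      rightIso_middle]
  assoc_right e₁ e₂ e₃ e₄ b x y z := by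
    ext
    change (α_ x.obj y.obj (E.ι.obj b ⊗ z.obj)).hom ≫
      (𝟙 x.obj ▷ _ ≫ x.obj ◁ (E.rightIso b y.obj z.obj).hom) ≫
        (E.rightIso b x.obj (y.obj ⊗ z.obj)).hom =
          (E.rightIso b (x.obj ⊗ y.obj) z.obj).hom ≫ E.ι.obj b ◁ (α_ _ _ _).hom
    rw [id_whiskerRight, Category.id_comp, rightIso_associator]
  leftUnit_module e e' b x := by ext; exact E.rightIso_leftUnitor b x.obj
  rightUnit_module e e' b x := by
    ext
    change (ρ_ (E.ι.obj b ⊗ x.obj)).hom = (α_ _ _ _).hom ≫ E.ι.obj b ◁ (ρ_ x.obj).hom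
    simp
  pentagon e₁ e₂ e₃ e₄ e₅ e₆ e₇ e₈ e₉ e₁₀ x y z w := by
    ext
    change ((α_ x.obj y.obj z.obj).hom ▷ w.obj ≫ _ ◁ 𝟙 w.obj) ≫ (α_ _ _ _).hom ≫
      𝟙 x.obj ▷ _ ≫ x.obj ◁ (α_ _ _ _).hom = (α_ _ _ _).hom ≫ (α_ _ _ _).hom
    simp
  triangle e e₁ e₂ e₃ x y := by
    ext
    change (α_ x.obj (𝟙_ C) y.obj).hom ≫ 𝟙 x.obj ▷ _ ≫ x.obj ◁ (λ_ y.obj).hom =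
      (ρ_ x.obj).hom ▷ y.obj ≫ x.obj ◁ 𝟙 y.obj
    simp

/-- An extension corresponds to the tri-homomorphism given by its components. -/
noncomputable def triHomRealization [UnitaryFusionCategory B] : E.Realization E.triHom where
  J g := (K.deg g).ι
  unitary g :=
    { map_add _ _ := rfl
      map_smul _ _ := rfl
      map_dag _ := rfl }
  full g := inferInstanceAs (K.deg g).ι.Full
  faithful g := inferInstanceAs (K.deg g).ι.Faithful
  deg_iff g X := ⟨fun h => ⟨⟨X, h⟩, ⟨Iso.refl X⟩⟩, fun ⟨x, ⟨i⟩⟩ => K.deg_of_iso i x.property⟩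
  act {g} b x := Iso.refl (E.ι.obj b ⊗ (show (K.deg g).FullSubcategory from x).obj)
  mul {g h k} e x y := Iso.refl ((show (K.deg g).FullSubcategory from x).obj ⊗
    (show (K.deg h).FullSubcategory from y).obj)
  unit e := Iso.refl (𝟙_ C)
  act_unitary b x := IsUnitary.id _
  mul_unitary e x y := IsUnitary.id _
  unit_unitary e := IsUnitary.id _
  act_natural f p := (Category.comp_id _).trans (Category.id_comp _).symm
  act_tensor a b x := by
    refine (Category.id_comp _).trans (Eq.symm ((congrArg (_ ≫ ·) ((Category.id_comp _).trans
      (MonoidalCategory.whiskerLeft_id _ _))).trans (Category.comp_id _)))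
  act_unit x := Category.id_comp _
  mul_natural e x x' y y' p q := (Category.comp_id _).trans
    ((MonoidalCategory.tensorHom_def _ _).symm.trans (Category.id_comp _).symm)
  mul_left e b x y := by
    refine (congrArg (_ ≫ ·) ((Category.id_comp _).trans
      (MonoidalCategory.whiskerLeft_id _ _))).trans ((Category.comp_id _).trans (Eq.symm ?_))
    exact (Category.id_comp _).trans ((congrArg (· ≫ _) (id_whiskerRight _ _)).trans
      (Category.id_comp _))
  mul_right e b x y := by
    refine (congrArg (_ ≫ ·) ((Category.id_comp _).trans
      (MonoidalCategory.whiskerLeft_id _ _))).trans ((Category.comp_id _).trans (Eq.symm ?_))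
    exact (Category.id_comp _).trans ((congrArg (· ≫ _) (MonoidalCategory.whiskerLeft_id _ _)).trans
      (Category.id_comp _))
  mul_assoc e₁ e₂ e₃ e₄ x y z := by
    refine (congrArg (_ ≫ ·) ((Category.id_comp _).trans
      (MonoidalCategory.whiskerLeft_id _ _))).trans ((Category.comp_id _).trans (Eq.symm ?_))
    exact (Category.id_comp _).trans ((congrArg (· ≫ _) (id_whiskerRight _ _)).trans
      (Category.id_comp _))
  mul_unit_left e e' x := (Eq.symm ((Category.id_comp _).trans
    ((congrArg (· ≫ _) (id_whiskerRight _ _)).trans (Category.id_comp _))))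
  mul_unit_right e e' x := (Eq.symm ((Category.id_comp _).trans
    ((congrArg (· ≫ _) (MonoidalCategory.whiskerLeft_id _ _)).trans (Category.id_comp _))))

end CrossedBraiding.Extension

end

/-! ### Equivariantization in stages -/

section

variable {G : Type t} [Group G] {C : Type u₁} [Category.{v₁} C] [Preadditive C]
    [Linear ℂ C] [MonoidalCategory C] [DaggerCategory C] [UnitaryMonoidal C]
    {A : UnitaryAction G C}

open Equivariant

theorem UnitaryAction.mul_hom_naturality (A : UnitaryAction G C) {g h k : G} (e : g * h = k)
    {X Y : C} (f : X ⟶ Y) :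
    (A.act g).map ((A.act h).map f) ≫ (A.mul e).hom.app Y =
      (A.mul e).hom.app X ≫ (A.act k).map f :=
  (A.mul e).hom.naturality f

theorem UnitaryAction.swap_hom_naturality (A : UnitaryAction G C) {a b g : G}
    (e : a * g = g * b) {X Y : C} (f : X ⟶ Y) :
    (A.act a).map ((A.act g).map f) ≫ (A.swap e).hom.app Y =
      (A.swap e).hom.app X ≫ (A.act g).map ((A.act b).map f) :=
  (A.swap e).hom.naturality f

/-- The two ways to multiply `n (m (h (h' X)))` by moving `h` past `m h = h n'` agree. -/
theorem UnitaryAction.mul_swap_mul (A : UnitaryAction G C) {n m n' n'' h h' h'' g g' g'' : G}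
    (e : n * h = g) (e' : n' * h' = g') (e'' : n'' * h'' = g'') (hg : g * g' = g'')
    (hs : m * h = h * n') (hn : n * m = n'') (hh : h * h' = h'') (X : C) :
    (A.act n).map ((A.swap hs).hom.app ((A.act h').obj X)) ≫
        (A.mul e).hom.app ((A.act n').obj ((A.act h').obj X)) ≫
          (A.act g).map ((A.mul e').hom.app X) ≫ (A.mul hg).hom.app X =
      (A.act n).map ((A.act m).map ((A.mul hh).hom.app X)) ≫
        (A.mul hn).hom.app ((A.act h'').obj X) ≫ (A.mul e'').hom.app X := by
  have k₁ : n * (h * n') = g * n' := by rw [← mul_assoc, e]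
  have k₂ : g * n' * h' = g'' := by rw [mul_assoc, e', hg]
  have k₃ : n'' * h = g * n' := by rw [← hn, mul_assoc, hs, k₁]
  rw [A.mul_mul (gh := g * n') rfl e' k₂ hg, reassoc_of% (A.mul_hom_naturality hn),
    A.mul_mul k₃ hh k₂ e'', ← reassoc_of% (A.mul_mul e rfl rfl k₁), ← reassoc_of% Functor.map_comp,
    A.swap_comp hs hs rfl, reassoc_of% (A.mul_mul hn hs k₃ k₁)]
  rfl

namespace Equivariant

attribute [local instance] unitaryMonoidal

variable {N H : Subgroup G} [N.Normal]
  (Z : Equivariant ((residual A N).comp H.subtype))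

/-- The isomorphism `ψ_h : h(X) ⟶ X` of an object `((X, φ), ψ)`. -/
def strH (h : H) : (A.act (h : G)).obj Z.obj.obj ⟶ Z.obj.obj :=
  (Z.str h).hom

theorem strH_unitary (h : H) : IsUnitary (Z.strH h) :=
  isUnitary_iff.1 (Z.str_unitary h)

theorem strH_mul {h h' h'' : H} (e : (h : G) * h' = h'') :
    (A.mul e).hom.app Z.obj.obj ≫ Z.strH h'' = (A.act h).map (Z.strH h') ≫ Z.strH h :=
  congrArg (fun f => f.hom) (Z.str_mul (g := h) (h := h') (k := h'') (Subtype.ext e))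

/-- This is the `N`-equivariance of `ψ_h : h(X, φ) ⟶ (X, φ)`, the only relation between `φ` and `ψ`
and the analogue of `m h = h n` in the semidirect product. -/
theorem strN_strH {n m : N} {h : H} (e : (m : G) * h = h * n) :
    (A.act m).map (Z.strH h) ≫ Z.obj.strN m =
      (A.swap e).hom.app Z.obj.obj ≫ (A.act h).map (Z.obj.strN n) ≫ Z.strH h := by
  have := comm_strN (Z.str h) m
  exact this.trans ((congrArg (fun q => q ≫ Z.strH h)
    (Z.obj.strN_congr (conj_spec (h : G) m) e)).trans (Category.assoc _ _ _))

theorem comm_strH {Z W : Equivariant ((residual A N).comp H.subtype)} (f : Z ⟶ W) (h : H) :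
    (A.act h).map f.hom.hom ≫ W.strH h = Z.strH h ≫ f.hom.hom :=
  congrArg (fun f => f.hom) (f.comm h)

/-- The isomorphism `τ_{nh} = φ_n ∘ n(ψ_h)` of an object `((X, φ), ψ)`. -/
def strNH {n : N} {h : H} {g : G} (e : (n : G) * h = g) :
    (A.act g).obj Z.obj.obj ⟶ Z.obj.obj :=
  (A.mul e).inv.app Z.obj.obj ≫ (A.act n).map (Z.strH h) ≫ Z.obj.strN n

theorem mul_strNH {n : N} {h : H} {g : G} (e : (n : G) * h = g) :
    (A.mul e).hom.app Z.obj.obj ≫ Z.strNH e = (A.act n).map (Z.strH h) ≫ Z.obj.strN n := by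
  simp [strNH]

theorem strNH_unitary {n : N} {h : H} {g : G} (e : (n : G) * h = g) : IsUnitary (Z.strNH e) :=
  (IsUnitary.inv ((A.mul e).app _) (A.mul_unitary e _)).comp
    ((A.map_unitary _ (Z.strH_unitary h)).comp (Z.obj.str_unitary n))

/-- In `n(h(n'(h'(X))))` the factor `n'` is moved to the left of `h`, where it becomes `m = h * n' *
h⁻¹`. By `strN_strH` the structures follow this move, and then the cocycle laws of `φ` on `N` and of
`ψ` on `H` apply separately. -/
theorem strNH_mul {n n' n'' m : N} {h h' h'' : H} {g g' g'' : G} (e : (n : G) * h = g)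
    (e' : (n' : G) * h' = g') (e'' : (n'' : G) * h'' = g'') (hg : g * g' = g'')
    (hs : (m : G) * h = h * n') (hn : (n : G) * m = n'') (hh : (h : G) * h' = h'') :
    (A.mul hg).hom.app Z.obj.obj ≫ Z.strNH e'' = (A.act g).map (Z.strNH e') ≫ Z.strNH e := by
  rw [← cancel_epi ((A.act g).map ((A.mul e').hom.app Z.obj.obj)),
    ← cancel_epi ((A.mul e).hom.app ((A.act n').obj ((A.act h').obj Z.obj.obj))),
    ← cancel_epi ((A.act n).map ((A.swap hs).hom.app ((A.act h').obj Z.obj.obj))),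
    reassoc_of% (A.mul_swap_mul e e' e'' hg hs hn hh), Z.mul_strNH e'']
  rw [← Functor.map_comp_assoc (A.act g), Z.mul_strNH e', 
    ← reassoc_of% (A.mul_hom_naturality e), Z.mul_strNH e,
    ← reassoc_of% (A.mul_hom_naturality hn), Z.obj.strN_mul hn]
  simp only [← Functor.map_comp_assoc]
  rw [Z.strH_mul hh, Functor.map_comp (A.act (m : G)), Category.assoc, Z.strN_strH hs,
    Functor.map_comp (A.act (h : G)), Category.assoc, reassoc_of% (A.swap_hom_naturality hs)]

theorem strNH_eq_strN (n : N) {h : H} (hh : (h : G) = 1) (e : (n : G) * h = n) :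
    Z.strNH e = Z.obj.strN n := by
  have h1 : (A.one hh).hom.app Z.obj.obj ≫ Z.strH h = 𝟙 _ :=
    congrArg (fun f => f.hom) (Z.str_one (o := h) (Subtype.ext hh))
  refine (Category.id_comp _).symm.trans ((congrArg (fun q => q ≫ Z.strNH e)
    (A.mul_one_right hh e Z.obj.obj)).symm.trans ?_)
  rw [Category.assoc, Z.mul_strNH e, ← Functor.map_comp_assoc, h1]
  simp

theorem strNH_eq_strH {n : N} (h : H) (hn : (n : G) = 1) (e : (n : G) * h = h) :
    Z.strNH e = Z.strH h := by
  have h1 : (A.one hn).hom.app Z.obj.obj ≫ Z.obj.strN n = 𝟙 _ :=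
    Z.obj.str_one (o := n) (Subtype.ext hn)
  have nat := (A.one hn).hom.naturality (Z.strH h)
  simp only [Functor.id_map] at nat
  refine (Category.id_comp _).symm.trans ((congrArg (fun q => q ≫ Z.strNH e)
    (A.one_mul_left hn e Z.obj.obj)).symm.trans ?_)
  rw [Category.assoc, Z.mul_strNH e, ← reassoc_of% nat, h1]
  simp

theorem comm_strNH {Z W : Equivariant ((residual A N).comp H.subtype)} (f : Z ⟶ W) {n : N} {h : H}
    {g : G} (e : (n : G) * h = g) :
    (A.act g).map f.hom.hom ≫ W.strNH e = Z.strNH e ≫ f.hom.hom := by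
  rw [← cancel_epi ((A.mul e).hom.app Z.obj.obj), ← reassoc_of% (A.mul_hom_naturality e),
    W.mul_strNH e, reassoc_of% (Z.mul_strNH e), ← Functor.map_comp_assoc, comm_strH,
    Functor.map_comp, Category.assoc, comm_strN]

theorem tensor_strNH (Z W : Equivariant ((residual A N).comp H.subtype)) {n : N} {h : H}
    {g : G} (e : (n : G) * h = g) :
    (Z ⊗ W).strNH e = δ (A.act g) Z.obj.obj W.obj.obj ≫ (Z.strNH e ⊗ₘ W.strNH e) := by
  have h1 : (Z ⊗ W).strH h = δ (A.act (h : G)) Z.obj.obj W.obj.obj ≫ (Z.strH h ⊗ₘ W.strH h) := rfl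
  have h2 : (Z ⊗ W).obj.strN n =
    δ (A.act (n : G)) Z.obj.obj W.obj.obj ≫ (Z.obj.strN n ⊗ₘ W.obj.strN n) := rfl
  have h3 := (Z ⊗ W).mul_strNH e
  rw [h1, h2] at h3
  rw [← cancel_epi ((A.mul e).hom.app (Z.obj.obj ⊗ W.obj.obj))]
  refine h3.trans ?_
  rw [reassoc_of% (A.mul_tensor' e), tensorHom_comp_tensorHom, Z.mul_strNH e, W.mul_strNH e,
    ← tensorHom_comp_tensorHom, Functor.map_comp, Category.assoc, δ_natural_assoc]

theorem unit_strNH {n : N} {h : H} {g : G} (e : (n : G) * h = g) :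
    (𝟙_ (Equivariant ((residual A N).comp H.subtype))).strNH e = η (A.act g) := by
  have h3 := (𝟙_ (Equivariant ((residual A N).comp H.subtype))).mul_strNH e
  rw [← cancel_epi ((A.mul e).hom.app (𝟙_ C))]
  exact h3.trans (A.mul_unit' e).symm

section Complement

variable (hNH : N.IsComplement' H)

include hNH in
theorem exists_mul_eq (g : G) : ∃ (n : N) (h : H), (n : G) * h = g := by
  obtain ⟨⟨n, h⟩, e⟩ := hNH.2 g
  exact ⟨n, h, e⟩

include hNH in
theorem mul_eq_unique {n n' : N} {h h' : H} (e : (n : G) * h = n' * h') : n = n' ∧ h = h' :=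
  Prod.mk.inj (hNH.1 (a₁ := (n, h)) (a₂ := (n', h')) e)

/-- The equivariant structure `τ` on `X` for the whole group, for an object `((X, φ), ψ)`. -/
noncomputable def strG (g : G) : (A.act g).obj Z.obj.obj ⟶ Z.obj.obj :=
  Z.strNH (exists_mul_eq hNH g).choose_spec.choose_spec

theorem strG_eq {n : N} {h : H} {g : G} (e : (n : G) * h = g) : Z.strG hNH g = Z.strNH e := by
  have e' := (exists_mul_eq hNH g).choose_spec.choose_spec
  obtain ⟨h1, h2⟩ := mul_eq_unique hNH (e'.trans e.symm)
  unfold strG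
  congr!

/-- The functor `((X, φ), ψ) ↦ (X, τ)`, `τ_{nh} = φ_n ∘ n(ψ_h)`. -/
noncomputable def merge : Equivariant ((residual A N).comp H.subtype) ⥤ Equivariant A where
  obj Z :=
    { obj := Z.obj.obj
      str := Z.strG hNH
      str_unitary g := Z.strNH_unitary _
      str_mul {g g' g''} e := by
        obtain ⟨n, h, rfl⟩ := exists_mul_eq hNH g
        obtain ⟨n', h', rfl⟩ := exists_mul_eq hNH g'
        -- Multiplication in the semidirect product: `(n * h) * (n' * h') = (n * (h * n' * h⁻¹)) *
        -- (h * h')`.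
        have hm : (h : G) * n' * (h : G)⁻¹ ∈ N := Subgroup.Normal.conj_mem inferInstance _ n'.2 _
        rw [Z.strG_eq hNH (n := n * ⟨_, hm⟩) (h := h * h')
          (by rw [← e]; simp [mul_assoc]), Z.strG_eq hNH rfl, Z.strG_eq hNH rfl]
        exact Z.strNH_mul rfl rfl _ e (m := ⟨_, hm⟩) (by simp) rfl rfl }
  map f := ⟨f.hom.hom, fun g => comm_strNH f _⟩

@[simp] theorem merge_obj_obj : ((merge hNH).obj Z).obj = Z.obj.obj := rfl

theorem merge_obj_str {n : N} {h : H} {g : G} (e : (n : G) * h = g) :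
    ((merge hNH).obj Z).str g = Z.strNH e :=
  Z.strG_eq hNH e

theorem merge_str_hom {Z : Equivariant ((residual A N).comp H.subtype)} (n : N) :
    ((merge hNH).obj Z).str n = Z.obj.strN n :=
  (merge_obj_str Z hNH (h := 1) (mul_one _)).trans (Z.strNH_eq_strN n rfl _)

theorem merge_str_of_mem_right {Z : Equivariant ((residual A N).comp H.subtype)} (h : H) :
    ((merge hNH).obj Z).str h = Z.strH h :=
  (merge_obj_str Z hNH (n := 1) (one_mul _)).trans (Z.strNH_eq_strH h rfl _)

instance : (merge (A := A) hNH).Faithful where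
  map_injective h := hom_ext (hom_ext (congrArg (fun f => f.hom) h))

/-- A morphism commuting with `τ` commutes with its restrictions to `N` and to `H`, which are `φ`
and `ψ`. -/
instance : (merge (A := A) hNH).Full where
  map_surjective {Z W} f := by
    refine ⟨⟨⟨f.hom, fun n => ?_⟩, fun h => hom_ext ?_⟩, rfl⟩
    · have := f.comm n
      rw [merge_str_hom, merge_str_hom] at this
      exact this
    · have := f.comm h
      rw [merge_str_of_mem_right, merge_str_of_mem_right] at this
      exact this

/-- Restriction of the equivariant structure along a group homomorphism. -/
def comap {L : Type w₁} [Group L] (φ : L →* G) (X : Equivariant A) : Equivariant (A.comp φ) where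
  obj := X.obj
  str l := X.str (φ l)
  str_unitary _ := X.str_unitary _
  str_mul _ := X.str_mul _

variable (N H) in
/-- The object `((X, φ), ψ)` obtained from `(X, τ)` by restricting `τ` to `N` and to `H`. -/
def split (X : Equivariant A) : Equivariant ((residual A N).comp H.subtype) where
  obj := X.comap N.subtype
  -- `N`-equivariance of `τ_h`: by the cocycle law both composites come from `τ` at `n * h = h *
  -- (h⁻¹ * n * h)`.
  str h := ⟨X.str h, fun n => by
    change (A.act n).map (X.str h) ≫ X.str n =
      ((A.swap (conj_spec (h : G) n)).hom.app X.obj ≫ (A.act h).map (X.str (conj (h : G) n))) ≫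
        X.str h
    rw [Category.assoc, ← X.str_mul (conj_spec (h : G) n).symm,
      reassoc_of% (A.swap_comp (conj_spec (h : G) n) rfl _), ← X.str_mul rfl]⟩
  str_unitary h := isUnitary_iff.2 (X.str_unitary h)
  str_mul e := hom_ext (X.str_mul (congrArg Subtype.val e))

instance : (merge (A := A) hNH).EssSurj where
  mem_essImage X := ⟨split N H X, ⟨isoMk (X := (merge hNH).obj (split N H X)) (Y := X)
    (Iso.refl X.obj) fun g => by
      obtain ⟨n, h, e⟩ := exists_mul_eq hNH g
      refine (congrArg (fun q => q ≫ X.str g) ((A.act g).map_id _)).trans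
        ((Category.id_comp _).trans (Eq.trans ?_ (Category.comp_id _).symm))
      rw [merge_obj_str _ hNH e]
      exact (cancel_epi ((A.mul e).hom.app X.obj)).1
        ((X.str_mul e).trans ((split N H X).mul_strNH e).symm)⟩⟩

instance : (merge (A := A) hNH).IsEquivalence where

noncomputable instance : (merge (A := A) hNH).Monoidal :=
  Functor.CoreMonoidal.toMonoidal
    { εIso := isoMk (X := 𝟙_ (Equivariant A)) (Y := (merge hNH).obj (𝟙_ _)) (Iso.refl (𝟙_ C))
        fun g => by
          obtain ⟨n, h, e⟩ := exists_mul_eq hNH g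
          rw [merge_obj_str _ hNH e, unit_strNH]
          simp
      μIso Z W := isoMk (X := (merge hNH).obj Z ⊗ (merge hNH).obj W)
        (Y := (merge hNH).obj (Z ⊗ W)) (Iso.refl (Z.obj.obj ⊗ W.obj.obj)) fun g => by
          obtain ⟨n, h, e⟩ := exists_mul_eq hNH g
          rw [merge_obj_str _ hNH e, tensor_strNH, tensorObj_str, merge_obj_str _ hNH e,
            merge_obj_str _ hNH e]
          simp
      μIso_hom_natural_left f Z := hom_ext ((Category.comp_id _).trans (Category.id_comp _).symm)
      μIso_hom_natural_right Z f := hom_ext ((Category.comp_id _).trans (Category.id_comp _).symm)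
      associativity X Y Z := hom_ext (by
        change 𝟙 _ ▷ _ ≫ 𝟙 _ ≫ (α_ X.obj.obj Y.obj.obj Z.obj.obj).hom =
          (α_ X.obj.obj Y.obj.obj Z.obj.obj).hom ≫ _ ◁ 𝟙 _ ≫ 𝟙 _
        simp)
      left_unitality X := hom_ext (by
        change (λ_ X.obj.obj).hom = 𝟙 _ ▷ _ ≫ 𝟙 _ ≫ (λ_ X.obj.obj).hom
        simp)
      right_unitality X := hom_ext (by
        change (ρ_ X.obj.obj).hom = _ ◁ 𝟙 _ ≫ 𝟙 _ ≫ (ρ_ X.obj.obj).hom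
        simp) }

theorem isUnitaryTensorFunctor_merge : IsUnitaryTensorFunctor (merge (A := A) hNH) where
  map_add _ _ := rfl
  map_smul _ _ := rfl
  map_dag _ := rfl
  μ_unitary _ _ := isUnitary_iff.2 (IsUnitary.id _)
  ε_unitary := isUnitary_iff.2 (IsUnitary.id _)

/-- `merge` does not change the underlying objects and morphisms. -/
noncomputable def mergeForget : merge hNH ⋙ forget A ≅
    forget ((residual A N).comp H.subtype) ⋙ forget (A.comp N.subtype) :=
  NatIso.ofComponents (fun Z => Iso.refl Z.obj.obj)
    (fun _ => (Category.comp_id _).trans (Category.id_comp _).symm)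

theorem mergeForget_isMonoidal : NatTrans.IsMonoidal (mergeForget (A := A) hNH).hom where
  unit := by
    change (𝟙 (𝟙_ C) ≫ 𝟙 (𝟙_ C)) ≫ 𝟙 (𝟙_ C) = 𝟙 (𝟙_ C) ≫ 𝟙 (𝟙_ C)
    simp
  tensor X Y := by
    change (𝟙 (X.obj.obj ⊗ Y.obj.obj) ≫ 𝟙 (X.obj.obj ⊗ Y.obj.obj)) ≫ 𝟙 (X.obj.obj ⊗ Y.obj.obj) =
      (𝟙 X.obj.obj ⊗ₘ 𝟙 Y.obj.obj) ≫ 𝟙 (X.obj.obj ⊗ Y.obj.obj) ≫ 𝟙 (X.obj.obj ⊗ Y.obj.obj)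
    simp

theorem comp_whisker_comp_whisker {S V Z W W' W'' : C} (b : S ⊗ W ⟶ W'' ⊗ S) (r : W'' ⟶ W')
    (s : W' ⟶ W) (i : S ⟶ V) (j : V ⟶ Z) :
    (b ≫ r ▷ S ≫ W' ◁ i) ≫ s ▷ V ≫ W ◁ j = b ≫ (r ≫ s) ▷ S ≫ W ◁ (i ≫ j) := by
  simp only [Category.assoc, whisker_exchange_assoc, comp_whiskerRight,
    MonoidalCategory.whiskerLeft_comp]

/-- The residual braiding uses the factorization `h * n` rather than `n * h`. In this order the
cocycle law reads `τ_{hn} = ψ_h ∘ h(φ_n)`. -/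
theorem merge_str_mul_right {Z : Equivariant ((residual A N).comp H.subtype)} (h : H) (n : N) :
    ((merge hNH).obj Z).str (h * n) =
      ((A.mul rfl).inv.app Z.obj.obj ≫ (A.act h).map (Z.obj.strN n)) ≫ Z.strH h := by
  have := ((merge hNH).obj Z).str_mul (g := h) (h := n) rfl
  rw [merge_str_hom, merge_str_of_mem_right] at this
  exact (((A.mul rfl).app Z.obj.obj).eq_inv_comp.2 this).trans (Category.assoc _ _ _).symm

variable [MonoidalPreadditive C] {K : CrossedBraiding A}
    {L : CrossedBraiding ((residual A N).comp H.subtype)} (hL : CrossedBraiding.IsResidual K L)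
    [BraidedCategory (Equivariant ((residual A N).comp H.subtype))]
    [BraidedCategory (Equivariant A)]

include hL in
-- Testing first on a component of `H`-degree `h` and then on one of `G`-degree `h * n`, the left
-- side is the `G`-braiding followed by `h(φ_n)`, from the `H`-braiding, and then by `ψ_h`, from
-- gauging. By `merge_str_mul_right` this is the `G`-braiding followed by `τ_{hn}`.
theorem merge_braiding (hgL : L.IsGaugeBraiding) (hgK : K.IsGaugeBraiding)
    (Z W : Equivariant ((residual A N).comp H.subtype)) :
    (β_ Z W).hom.hom.hom = (β_ ((merge hNH).obj Z) ((merge hNH).obj W)).hom.hom := by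
  have hF : (forget (A.comp N.subtype) ⋙ tensorRight W.obj.obj).Additive :=
    ⟨fun {_ _ f f'} => MonoidalPreadditive.add_whiskerRight f.hom f'.hom⟩
  refine L.sector_hom_ext (L.sector_univ Z.obj) (forget (A.comp N.subtype) ⋙ tensorRight W.obj.obj)
    fun h _ V hV j => ?_
  refine K.sector_hom_ext ((hL.deg_iff h V).1 hV) (tensorRight W.obj.obj) fun g hg S hS i => ?_
  obtain ⟨n, rfl⟩ := hg
  have h1 : j.hom ▷ W.obj.obj ≫ (β_ Z W).hom.hom.hom = (L.braid hV W.obj).hom.hom ≫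
      W.strH h ▷ V.obj ≫ W.obj.obj ◁ j.hom := congrArg (fun f => f.hom) (hgL Z W hV j)
  have h2 := hL.braid_eq hV W.obj hS i
  have h3 : (i ≫ j.hom) ▷ W.obj.obj ≫ (β_ ((merge hNH).obj Z) ((merge hNH).obj W)).hom.hom =
    _ := hgK ((merge hNH).obj Z) ((merge hNH).obj W) hS (i ≫ j.hom)
  rw [merge_str_mul_right] at h3
  refine (congrArg (fun q => i ▷ W.obj.obj ≫ q) h1).trans (Eq.trans ?_
    (h3.symm.trans ((congrArg (fun q => q ≫ _) (comp_whiskerRight i j.hom W.obj.obj)).trans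
      (Category.assoc _ _ _))))
  refine (Category.assoc _ _ _).symm.trans ((congrArg (fun q => q ≫ _) h2).trans ?_)
  exact comp_whisker_comp_whisker _ _ (W.strH h) i j.hom

/-- The functor `merge` is braided. -/
@[reducible]
noncomputable def mergeBraided (hgL : L.IsGaugeBraiding) (hgK : K.IsGaugeBraiding) :
    (merge (A := A) hNH).Braided where
  braided Z W := hom_ext ((Category.id_comp _).trans
    ((merge_braiding hNH hL hgL hgK Z W).trans (Category.comp_id _).symm))

end Complement

end Equivariant

end

end SeqGauging

/-! ### Assembly of the theorem -/

theorem mainTheorem1 {G : Type t} [Group G] [Finite G] (N H : Subgroup G) [N.Normal]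
    (hNH : N.IsComplement' H)
    {B : Type u₂} [Category.{v₂} B] [Preadditive B] [Linear ℂ B] [MonoidalCategory B]
    [DaggerCategory B] [UnitaryFusionCategory B] [BraidedCategory B] [UnitaryBraided B]
    (ρ : TriHom.{w₁, w₂} G B)
    {C : Type u₁} [Category.{v₁} C] [Preadditive C] [Linear ℂ C] [MonoidalCategory C]
    [DaggerCategory C] [UnitaryFusionCategory C] (A : UnitaryAction G C)
    (K : CrossedBraiding A) (E : K.Extension B) (R : E.Realization ρ) :
    -- the `N`-crossed extension of `B` corresponding to the restriction of `ρ` to `N`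
    UnitaryFusionCategory (K.Sub N) ∧
    Nonempty ((E.restrict N).Realization (ρ.comp N.subtype)) ∧
    -- its equivariantization, the gauging of `B` by `N`
    ∃ (_ : UnitaryFusionCategory (Equivariant (K.subAction N)))
      (_ : BraidedCategory (Equivariant (K.subAction N))),
      UnitaryBraided (Equivariant (K.subAction N)) ∧ (K.restrict N).IsGaugeBraiding ∧
    -- the `N`-equivariantization of `C` is an `H`-crossed braided extension of the gauging by `N`
    ∃ (_ : UnitaryFusionCategory (Equivariant (A.comp N.subtype)))
      (L : CrossedBraiding ((Equivariant.residual A N).comp H.subtype))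
      (E₂ : L.Extension (Equivariant (K.subAction N)))
      (e₂ : E₂.ι ⋙ Equivariant.forget (A.comp N.subtype) ≅
        Equivariant.forget (K.subAction N) ⋙ (K.sector (N : Set G)).ι),
      CrossedBraiding.IsResidual K L ∧
      NatTrans.IsMonoidal e₂.hom ∧ (∀ X, IsUnitary (e₂.hom.app X)) ∧
      (∀ (X : Equivariant (K.subAction N)) (n : N),
        (A.act n).map (e₂.hom.app X) ≫ (X.str n).hom =
          (E₂.ι.obj X).strN n ≫ e₂.hom.app X) ∧
    -- it corresponds to a tri-homomorphism `ρ₂` from `H`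
    ∃ ρ₂ : TriHom.{max u₁ v₁ t, v₁} H (Equivariant (K.subAction N)),
      Nonempty (E₂.Realization ρ₂) ∧
    -- its equivariantization, the gauging by `H` along `ρ₂`, and the gauging of `B` by `G`
    ∃ (_ : UnitaryFusionCategory (Equivariant ((Equivariant.residual A N).comp H.subtype)))
      (_ : BraidedCategory (Equivariant ((Equivariant.residual A N).comp H.subtype)))
      (_ : UnitaryFusionCategory (Equivariant A)) (_ : BraidedCategory (Equivariant A)),
      UnitaryBraided (Equivariant ((Equivariant.residual A N).comp H.subtype)) ∧
      L.IsGaugeBraiding ∧ UnitaryBraided (Equivariant A) ∧ K.IsGaugeBraiding ∧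
    -- the equivalence `((X, φ), ψ) ↦ (X, τ)`, `τ_{nh} = φ_n ∘ n(ψ_h)`
    ∃ (F : Equivariant ((Equivariant.residual A N).comp H.subtype) ⥤ Equivariant A)
      (_ : F.Braided)
      (e : F ⋙ Equivariant.forget A ≅
        Equivariant.forget ((Equivariant.residual A N).comp H.subtype) ⋙
          Equivariant.forget (A.comp N.subtype)),
      F.IsEquivalence ∧ IsUnitaryTensorFunctor F ∧
      NatTrans.IsMonoidal e.hom ∧ (∀ Z, IsUnitary (e.hom.app Z)) ∧
      ∀ (Z : Equivariant ((Equivariant.residual A N).comp H.subtype)) (n : N) (h : H),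
        (A.act ((n : G) * h)).map (e.hom.app Z) ≫ (A.mul rfl).inv.app Z.obj.obj ≫
            (A.act n).map (Z.str h).hom ≫ Z.obj.strN n =
          (F.obj Z).str ((n : G) * h) ≫ e.hom.app Z := by
  classical
  have hN : UnitaryFusionCategory (K.Sub N) := K.sub_unitaryFusionCategory N
  let _ : BraidedCategory (Equivariant (K.subAction N)) := (K.restrict N).gaugeBraiding
  have hNN : UnitaryFusionCategory (Equivariant (K.subAction N)) :=
    Equivariant.unitaryFusionCategory
  have hCN : UnitaryFusionCategory (Equivariant (A.comp N.subtype)) :=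
    Equivariant.unitaryFusionCategory
  let L := K.residualCrossed hNH
  have hL : CrossedBraiding.IsResidual K L := K.residualCrossed_isResidual hNH
  let E₂ : L.Extension (Equivariant (K.subAction N)) := K.residualExtension hNH
  have hH : UnitaryFusionCategory (Equivariant ((Equivariant.residual A N).comp H.subtype)) :=
    Equivariant.unitaryFusionCategory
  have hG : UnitaryFusionCategory (Equivariant A) := Equivariant.unitaryFusionCategory
  let _ : BraidedCategory (Equivariant ((Equivariant.residual A N).comp H.subtype)) :=
    L.gaugeBraiding
  let _ : BraidedCategory (Equivariant A) := K.gaugeBraiding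
  have hgL : L.IsGaugeBraiding := L.isGaugeBraiding_gaugeBraiding
  have hgK : K.IsGaugeBraiding := K.isGaugeBraiding_gaugeBraiding
  have hbN : UnitaryBraided (Equivariant (K.subAction N)) :=
    (K.restrict N).gaugeBraiding_unitary
  refine ⟨hN, ⟨R.restrict N⟩, hNN, inferInstance, hbN,
    (K.restrict N).isGaugeBraiding_gaugeBraiding, hCN, L, E₂,
    CrossedBraiding.subEquivariantιForget K, hL,
    CrossedBraiding.subEquivariantιForget_isMonoidal K, fun X => IsUnitary.id _, fun X n => ?_,
    -- `ρ₂` is read off from the components of the `N`-equivariantization of `C`.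
    E₂.triHom, ⟨E₂.triHomRealization⟩, hH, inferInstance, hG, inferInstance,
    L.gaugeBraiding_unitary, hgL, K.gaugeBraiding_unitary, hgK, Equivariant.merge hNH,
    Equivariant.mergeBraided hNH hL hgL hgK, Equivariant.mergeForget hNH, inferInstance,
    Equivariant.isUnitaryTensorFunctor_merge hNH, Equivariant.mergeForget_isMonoidal hNH,
    fun Z => IsUnitary.id _, fun Z n h => ?_⟩
  · exact (congrArg (fun q => q ≫ (X.str n).hom) ((A.act n).map_id _)).trans
      ((Category.id_comp _).trans (Category.comp_id _).symm)
  · refine (congrArg (fun q => q ≫ Z.strNH rfl) ((A.act ((n : G) * h)).map_id _)).trans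
      ((Category.id_comp _).trans ?_)
    exact (Equivariant.merge_obj_str Z hNH rfl).symm.trans (Category.comp_id _).symm
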